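/- Let $G$ be a graph (finite, simple, undirected) with $n \ge 1$ vertices and let $r \ge 0$. A set $D$ of vertices is an $r$-dominating set of $G$ if every vertex of $G$ is within $r$ hops of some vertex of $D$. The minimum $r$-dominating set problem is to find an $r$-dominating set of minimum cardinality. There is an algorithm that, given $r$, the edge list of $G$, and a tree decomposition of $G$ of width $\mathrm{tw}$ with $N$ nodes (tree edges and bags as lists), finds a minimum $r$-dominating set of $G$ in time $$O\bigl((2r+1)^{\mathrm{tw}+1}\,(\mathrm{tw}+1)^2\, n + (\mathrm{tw}+1)\,N\bigr),$$ where the constant in $O(\cdot)$ is absolute. The second summand is the time to read the decomposition; for decompositions with $N=O(n)$ nodes the running time is $O((2r+1)^{\mathrm{tw}+1}(\mathrm{tw}+1)^2 n)$, in particular $O((2r+1)^{\mathrm{tw}+1} n)$ for every fixed $\mathrm{tw}$, with a constant that does not depend on $r$. The machine is a random access machine with unit-cost operations ($+$, truncated $-$, $\cdot$, integer division and remainder, comparison, indirect addressing) on words of $O(\log(n+N) + \mathrm{tw}\log(2r+1) + \log(2r+1))$ bits. -/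

import Mathlib

namespace RDom

/-! ### Graphs -/

/-- `S` is an `r`-dominating set of `G`: every vertex is within `r` hops of some vertex of `S`.
The extended distance is `⊤` between different connected components. -/
def IsDominating {V : Type*} (G : SimpleGraph V) (r : ℕ) (S : Finset V) : Prop :=
  ∀ v, ∃ u ∈ S, G.edist u v ≤ (r : ℕ∞)

/-- `S` is an `r`-dominating set of `G` of minimum cardinality. -/
def IsMinDominating {V : Type*} (G : SimpleGraph V) (r : ℕ) (S : Finset V) : Prop :=
  IsDominating G r S ∧ ∀ S' : Finset V, IsDominating G r S' → S.card ≤ S'.card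

/-- A tree decomposition of `G` whose tree has node set `ι`. -/
structure TreeDecomposition {V : Type*} (G : SimpleGraph V) (ι : Type*) where
  /-- the tree -/
  tree : SimpleGraph ι
  isTree : tree.IsTree
  /-- the bag of a node -/
  bag : ι → Finset V
  exists_mem_bag : ∀ v, ∃ i, v ∈ bag i
  exists_edge_bag : ∀ u v, G.Adj u v → ∃ i, u ∈ bag i ∧ v ∈ bag i
  subtree : ∀ v, (tree.induce {i | v ∈ bag i}).Connected

/-- The width: the maximum size of a bag, minus one. -/
def TreeDecomposition.width {V ι : Type*} [Fintype ι] {G : SimpleGraph V}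
    (T : TreeDecomposition G ι) : ℕ :=
  (Finset.univ.sup fun i => (T.bag i).card) - 1

/-! ### A random access machine with unit-cost instructions on bounded words

Programs are structured programs (assignment, sequence, branch, loop) over registers and
random access arrays of natural numbers. A program mentions finitely many registers and arrays.
All values computed during a run, addresses included, have to be below a word bound `B`. -/

/-- Binary machine operations; subtraction is truncated, comparisons return `1` or `0`. -/
inductive Op where
  | add | sub | mul | div | mod | lt | eq

/-- The value of an operation (division by `0` gives `0`, remainder modulo `0` is the dividend). -/
def Op.eval : Op → ℕ → ℕ → ℕ
  | .add, x, y => x + y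
  | .sub, x, y => x - y
  | .mul, x, y => x * y
  | .div, x, y => x / y
  | .mod, x, y => x % y
  | .lt, x, y => if x < y then 1 else 0
  | .eq, x, y => if x = y then 1 else 0

/-- A machine state: the contents of the registers and of the arrays. -/
structure State where
  /-- `reg x` is the content of register `x` -/
  reg : ℕ → ℕ
  /-- `arr a i` is the content of cell `i` of array `a` -/
  arr : ℕ → ℕ → ℕ

/-- Expressions: constants, registers, array cells, operations. -/
inductive Expr where
  | const (c : ℕ)
  | reg (x : ℕ)
  | arr (a : ℕ) (i : Expr)
  | op (o : Op) (e₁ e₂ : Expr)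

/-- The value of an expression. -/
def Expr.eval (s : State) : Expr → ℕ
  | .const c => c
  | .reg x => s.reg x
  | .arr a i => s.arr a (i.eval s)
  | .op o e₁ e₂ => o.eval (e₁.eval s) (e₂.eval s)

/-- The time to evaluate an expression: one step for every constant, register access, array
access and operation. -/
def Expr.cost : Expr → ℕ
  | .const _ => 1
  | .reg _ => 1
  | .arr _ i => i.cost + 1
  | .op _ e₁ e₂ => e₁.cost + e₂.cost + 1

/-- Every value that occurs in the evaluation of the expression is below the word bound `B`. -/
def Expr.Fits (B : ℕ) (s : State) : Expr → Prop
  | .const c => c < B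
  | .reg x => s.reg x < B
  | .arr a i => i.Fits B s ∧ s.arr a (i.eval s) < B
  | .op o e₁ e₂ => e₁.Fits B s ∧ e₂.Fits B s ∧ o.eval (e₁.eval s) (e₂.eval s) < B

/-- Programs. -/
inductive Prog where
  | skip
  | setReg (x : ℕ) (e : Expr)
  | setArr (a : ℕ) (i e : Expr)
  | seq (p q : Prog)
  | branch (e : Expr) (p q : Prog)
  | loop (e : Expr) (p : Prog)

/-- `Exec B p s t s'`: started in state `s`, the program `p` halts after exactly `t` steps in
state `s'`, and every value that it computes on the way is below `B`. -/
inductive Exec (B : ℕ) : Prog → State → ℕ → State → Prop where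
  | skip (s : State) : Exec B .skip s 1 s
  | setReg (s : State) (x : ℕ) (e : Expr) (he : e.Fits B s) :
      Exec B (.setReg x e) s (e.cost + 1)
        { s with reg := Function.update s.reg x (e.eval s) }
  | setArr (s : State) (a : ℕ) (i e : Expr) (hi : i.Fits B s) (he : e.Fits B s) :
      Exec B (.setArr a i e) s (i.cost + e.cost + 1)
        { s with arr :=
          Function.update s.arr a (Function.update (s.arr a) (i.eval s) (e.eval s)) }
  | seq {p q : Prog} {s s' s'' : State} {t t' : ℕ} (hp : Exec B p s t s')
      (hq : Exec B q s' t' s'') : Exec B (.seq p q) s (t + t') s''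
  | branch_true {e : Expr} {p q : Prog} {s s' : State} {t : ℕ} (he : e.Fits B s)
      (h : e.eval s ≠ 0) (hp : Exec B p s t s') :
      Exec B (.branch e p q) s (e.cost + 1 + t) s'
  | branch_false {e : Expr} {p q : Prog} {s s' : State} {t : ℕ} (he : e.Fits B s)
      (h : e.eval s = 0) (hq : Exec B q s t s') :
      Exec B (.branch e p q) s (e.cost + 1 + t) s'
  | loop_true {e : Expr} {p : Prog} {s s' s'' : State} {t t' : ℕ} (he : e.Fits B s)
      (h : e.eval s ≠ 0) (hp : Exec B p s t s') (hl : Exec B (.loop e p) s' t' s'') :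
      Exec B (.loop e p) s (e.cost + 1 + t + t') s''
  | loop_false {e : Expr} {p : Prog} {s : State} (he : e.Fits B s) (h : e.eval s = 0) :
      Exec B (.loop e p) s (e.cost + 1) s

/-! ### Input and output -/

/-- The list `l` contains every edge of `G` exactly once, in some order and orientation. -/
def ListsEdges {V : Type*} (G : SimpleGraph V) (l : List (V × V)) : Prop :=
  (l.map fun e => s(e.1, e.2)).Nodup ∧
    ∀ u v, G.Adj u v ↔ s(u, v) ∈ l.map fun e => s(e.1, e.2)

/-- The list `l` contains every element of `X` exactly once. -/
def ListsElements {V : Type*} (X : Finset V) (l : List V) : Prop :=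
  l.Nodup ∧ ∀ v, v ∈ l ↔ v ∈ X

/-- The initial machine state for the radius `r`, a graph on `Fin n` with edge list `E`, and a tree
decomposition with node set `Fin N`, tree edge list `F` and bag lists `L`. Registers `0, 1, 2, 3`
hold `r`, `n`, the number of edges and `N`; arrays `0, 1` hold the ends of the edges, arrays `2, 3`
the ends of the tree edges, array `4` the sizes of the bags and array `5` the concatenation of the
bags. Everything else is `0`. -/
def initState (r : ℕ) {n N : ℕ} (E : List (Fin n × Fin n)) (F : List (Fin N × Fin N))
    (L : Fin N → List (Fin n)) : State where
  reg
    | 0 => r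
    | 1 => n
    | 2 => E.length
    | 3 => N
    | _ => 0
  arr
    | 0, p => (E.map fun e => (e.1 : ℕ)).getD p 0
    | 1, p => (E.map fun e => (e.2 : ℕ)).getD p 0
    | 2, p => (F.map fun e => (e.1 : ℕ)).getD p 0
    | 3, p => (F.map fun e => (e.2 : ℕ)).getD p 0
    | 4, p => (List.ofFn fun i => (L i).length).getD p 0
    | 5, p => ((List.ofFn L).flatten.map fun v => (v : ℕ)).getD p 0
    | _, _ => 0

/-- The vertex set that a final state describes: array `6` holds its indicator function. -/
def outputSet (n : ℕ) (s : State) : Finset (Fin n) :=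
  Finset.univ.filter fun v => s.arr 6 v ≠ 0

end RDom

/-! A set `S` is `r`-dominating if and only if the vertices have labels in `0, …, r`, with label
`0` only in `S`, such that every vertex with a positive label has a neighbour with a smaller
label: the distances from a dominating set are such labels, and descending labels lead to a vertex
with label `0` within `r` steps (`IsLabelling.isDominating`, `IsDominating.exists_labelling`).
There is no condition on the difference of the labels of neighbours, only a demand for every
vertex: a minimum dominating set is the zero set of a labelling with the fewest zeros in which
every vertex with a positive label is satisfied by at least one edge.

The tree decomposition is used through the order in which the vertices first appear in the bags,
read from the root. If a vertex is eliminated after all later ones, its earlier neighbours `nb x`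
are contained in the first bag of `x`, and also in the first bag of the last of them, the parent
`par x` of `x` (`ElimOrder`, `BagSeq.elimOrder`, with the topmost nodes of subtrees as the key,
`mem_bag_top`). This turns a decomposition with `N` nodes into a tree on the `n` vertices with
`n - 1` joins. The vertices of a bag are stored in `k` slots, where `k` is the width plus one.

A partial solution is described by a code: a digit in base `2 r + 1` for every slot, which is a
label, flagged if it is positive and the vertex has to be satisfied by an edge of the part that is
already eliminated. For every vertex there is a table with the minimum number of zeros for each of
the `(2 r + 1) ^ k` codes (`ElimOrder.FeasC`, `ElimOrder.TabSpec`). To eliminate a vertex its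
label is minimised out (`ElimOrder.feasC_forget_iff`); then its table is joined to the table of
its parent, where the flags of a code may be distributed to the two tables in any way
(`ElimOrder.Separated.feasC_iff`).

The join is a covering product, and the running time depends on computing it in time
`O((2 r + 1) ^ k k ^ 2)` with a constant independent of the radius and of the values. A demand
that can be met is met by one additional vertex of the solution (`Feas.add_card_flags`); so every
entry exceeds the entry of the code without flags by at most the number `k` of slots. The tables
can therefore be written as `0`-`1` functions of a code and an excess in `0, …, k`, for which the
minimum becomes a polynomial multiplication in the excess. The zeta transform over the flags turns
the covering product into the product for every code (`zs_cov_succ`), and subtraction inverts it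
(`zs_sub_sh`). All numbers that occur stay below a fixed power of `(2 r + 1) ^ k (n + N)`.

For a solution of minimum size the joins are undone from the root to the leaves; the two codes
that explain an entry are found by enumerating the codes of one factor, since a disjoint
distribution of the flags suffices and determines the other code (`ElimOrder.IsTrace.step`,
`ElimOrder.IsTrace.end`).

Programs are verified with a total correctness calculus `WP` that bounds time and word size at the
same time: loop-free code is reduced to its verification condition (`WP.of_vc`), loops use
invariants (`WP.for`), and everything that a program does not write is unchanged (`WP.seq'`). -/

namespace RDom

/-! ### Codes: digits in base `2 r + 1` -/

/-- The digit of the code `σ` at slot `j`. A code is a number below `(2 r + 1) ^ k`; a digit `g ≤ r`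
is the label `g` without a flag, and `r + g` with `1 ≤ g ≤ r` is the label `g` with a flag. -/
def dg (r σ j : ℕ) : ℕ := σ / (2 * r + 1) ^ j % (2 * r + 1)

/-- The label that a code gives to slot `j`: the digits `g ≤ r` and `g + r` both stand for `g`. -/
def lb (r σ j : ℕ) : ℕ := if r < dg r σ j then dg r σ j - r else dg r σ j

/-- Slot `j` is flagged in the code `σ`. -/
def Flg (r σ j : ℕ) : Prop := r < dg r σ j

instance (r σ j : ℕ) : Decidable (Flg r σ j) := inferInstanceAs (Decidable (_ < _))

section codes

variable {r σ τ j i k t : ℕ}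

lemma dg_lt : dg r σ j < 2 * r + 1 := Nat.mod_lt _ (by omega)

lemma lb_le : lb r σ j ≤ r := by
  have := @dg_lt r σ j
  unfold lb; split_ifs <;> omega

lemma dg_eq_of_lb_eq (h : lb r σ j = lb r τ j) (h' : Flg r σ j ↔ Flg r τ j) :
    dg r σ j = dg r τ j := by
  unfold lb Flg at *
  split_ifs at h with h1 h2 h2
  all_goals simp_all
  omega

lemma lb_congr (h : dg r σ j = dg r τ j) : lb r σ j = lb r τ j := by simp [lb, h]

lemma Flg_congr (h : dg r σ j = dg r τ j) : Flg r σ j ↔ Flg r τ j := by simp [Flg, h]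

lemma dg_add (h : dg r σ j + t < 2 * r + 1) (i : ℕ) :
    dg r (σ + t * (2 * r + 1) ^ j) i = if i = j then dg r σ j + t else dg r σ i := by
  set b := 2 * r + 1 with hb
  have hb0 : 0 < b := by omega
  rcases lt_trichotomy i j with hij | rfl | hij
  · rw [if_neg hij.ne]
    obtain ⟨d, rfl⟩ := Nat.exists_eq_add_of_lt hij
    have : t * b ^ (i + d + 1) = (t * b ^ d * b) * b ^ i := by ring
    rw [dg, dg, ← hb, this, Nat.add_mul_div_right _ _ (by positivity), Nat.add_mul_mod_self_right]
  · rw [if_pos rfl, dg, ← hb, Nat.add_mul_div_right _ _ (by positivity), Nat.add_mod]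
    have ht : t % b = t := Nat.mod_eq_of_lt (by omega)
    rw [ht]
    exact Nat.mod_eq_of_lt h
  · rw [if_neg hij.ne']
    obtain ⟨d, rfl⟩ := Nat.exists_eq_add_of_lt hij
    have e : b ^ (j + d + 1) = b ^ j * b * b ^ d := by ring
    have key : (σ + t * b ^ j) / b ^ j / b = σ / b ^ j / b := by
      rw [Nat.add_mul_div_right _ _ (by positivity)]
      have h1 : σ / b ^ j % b + t < b := h
      have h2 := Nat.div_add_mod (σ / b ^ j) b
      rw [show σ / b ^ j + t = (σ / b ^ j % b + t) + b * (σ / b ^ j / b) by omega,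
        Nat.add_mul_div_left _ _ hb0, Nat.div_eq_of_lt h1, zero_add]
    rw [dg, dg, ← hb, e, ← Nat.div_div_eq_div_mul, ← Nat.div_div_eq_div_mul, key,
      ← Nat.div_div_eq_div_mul, ← Nat.div_div_eq_div_mul]

lemma mul_pow_le_of_le_dg (h : t ≤ dg r σ j) : t * (2 * r + 1) ^ j ≤ σ := by
  have h1 : t ≤ σ / (2 * r + 1) ^ j := h.trans (Nat.mod_le _ _)
  exact (Nat.mul_le_mul_right _ h1).trans (Nat.div_mul_le_self _ _)

lemma dg_sub (h : t ≤ dg r σ j) (i : ℕ) :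
    dg r (σ - t * (2 * r + 1) ^ j) i = if i = j then dg r σ j - t else dg r σ i := by
  have hle := mul_pow_le_of_le_dg h
  have hj : dg r (σ - t * (2 * r + 1) ^ j) j = dg r σ j - t := by
    unfold dg at h ⊢
    rw [mul_comm, Nat.sub_mul_div]
    have h2 := Nat.div_add_mod (σ / (2 * r + 1) ^ j) (2 * r + 1)
    have h3 := Nat.mod_lt (σ / (2 * r + 1) ^ j) (show 2 * r + 1 > 0 by omega)
    conv_lhs => rw [← h2]
    rw [Nat.add_sub_assoc h, Nat.mul_add_mod]
    exact Nat.mod_eq_of_lt (by omega)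
  have h3 := @dg_lt r σ j
  split_ifs with hij
  · rw [hij, hj]
  · have := dg_add (r := r) (σ := σ - t * (2 * r + 1) ^ j) (j := j) (t := t) (by omega) i
    rw [Nat.sub_add_cancel hle, if_neg hij] at this
    exact this.symm

lemma code_ext (hσ : σ < (2 * r + 1) ^ k) (hτ : τ < (2 * r + 1) ^ k)
    (h : ∀ j < k, dg r σ j = dg r τ j) : σ = τ := by
  induction k generalizing σ τ with
  | zero => simp at hσ hτ; omega
  | succ k ih =>
    have h0 := h 0 (by omega)
    simp only [dg, pow_zero, Nat.div_one] at h0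
    have h1 : σ / (2 * r + 1) = τ / (2 * r + 1) := by
      refine ih ?_ ?_ fun j hj => ?_
      · rw [Nat.div_lt_iff_lt_mul (by omega)]; rwa [pow_succ] at hσ
      · rw [Nat.div_lt_iff_lt_mul (by omega)]; rwa [pow_succ] at hτ
      · have := h (j + 1) (by omega)
        simpa only [dg, pow_succ', ← Nat.div_div_eq_div_mul] using this
    rw [← Nat.div_add_mod σ (2 * r + 1), ← Nat.div_add_mod τ (2 * r + 1), h0, h1]

lemma add_lt_of_dg (hj : j < k) (hσ : σ < (2 * r + 1) ^ k) (h : dg r σ j + t < 2 * r + 1) :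
    σ + t * (2 * r + 1) ^ j < (2 * r + 1) ^ k := by
  have h0 : (σ + t * (2 * r + 1) ^ j) / (2 * r + 1) ^ (j + 1) = σ / (2 * r + 1) ^ (j + 1) := by
    rw [pow_succ, ← Nat.div_div_eq_div_mul, ← Nat.div_div_eq_div_mul,
      Nat.add_mul_div_right _ _ (by positivity)]
    have h1 : σ / (2 * r + 1) ^ j % (2 * r + 1) + t < 2 * r + 1 := h
    have h2 := Nat.div_add_mod (σ / (2 * r + 1) ^ j) (2 * r + 1)
    rw [show σ / (2 * r + 1) ^ j + t = (σ / (2 * r + 1) ^ j % (2 * r + 1) + t)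
      + (2 * r + 1) * (σ / (2 * r + 1) ^ j / (2 * r + 1)) by omega,
      Nat.add_mul_div_left _ _ (by omega), Nat.div_eq_of_lt h1, zero_add]
  obtain ⟨d, rfl⟩ := Nat.exists_eq_add_of_lt hj
  have e : (2 * r + 1) ^ (j + d + 1) = (2 * r + 1) ^ d * (2 * r + 1) ^ (j + 1) := by ring
  rw [e] at hσ ⊢
  rw [← Nat.div_lt_iff_lt_mul (by positivity)] at hσ ⊢
  rwa [h0]

lemma dg_mul_add (hj : j < k) (a : ℕ) : dg r (a * (2 * r + 1) ^ k + σ) j = dg r σ j := by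
  obtain ⟨d, rfl⟩ := Nat.exists_eq_add_of_lt hj
  have : a * (2 * r + 1) ^ (j + d + 1) = (2 * r + 1) ^ j * ((2 * r + 1) * (a * (2 * r + 1) ^ d)) := by
    ring
  rw [dg, this, Nat.mul_add_div (by positivity), Nat.mul_add_mod, dg]

lemma dg_mod (hj : j < k) : dg r (σ % (2 * r + 1) ^ k) j = dg r σ j := by
  conv_rhs => rw [← Nat.div_add_mod σ ((2 * r + 1) ^ k), mul_comm, dg_mul_add hj]

/-- The codes `σ₁` and `σ₂` have the labels of `σ`, and a slot is flagged in `σ` if and only if it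
is flagged in `σ₁` or in `σ₂`. -/
def Cover (r k σ σ₁ σ₂ : ℕ) : Prop :=
  ∀ j < k, lb r σ₁ j = lb r σ j ∧ lb r σ₂ j = lb r σ j ∧ (Flg r σ j ↔ Flg r σ₁ j ∨ Flg r σ₂ j)

end codes

/-! ### The covering product and its transform -/

section cov

variable (r k : ℕ)

/-- The function that looks up the code with the flag at slot `j` removed, at the arguments where
this flag is present. -/
def sh (j : ℕ) (f : ℕ → ℕ) (y : ℕ) : ℕ :=
  if r < dg r y j then f (y - r * (2 * r + 1) ^ j) else 0

/-- The zeta transform in direction `j`. -/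
def zs (j : ℕ) (f : ℕ → ℕ) : ℕ → ℕ := f + sh r j f

/-- An argument `y` stands for the code `y % (2 r + 1) ^ k` and the degree `y / (2 r + 1) ^ k`;
the product of two functions is polynomial multiplication for every code. -/
def pr (f g : ℕ → ℕ) (y : ℕ) : ℕ :=
  ∑ a ∈ Finset.range (y / (2 * r + 1) ^ k + 1),
    f (a * (2 * r + 1) ^ k + y % (2 * r + 1) ^ k) *
      g ((y / (2 * r + 1) ^ k - a) * (2 * r + 1) ^ k + y % (2 * r + 1) ^ k)

/-- The product that is the covering product in the directions below `j` and pointwise in the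
other directions. -/
def cov : ℕ → (ℕ → ℕ) → (ℕ → ℕ) → ℕ → ℕ
  | 0, f, g => pr r k f g
  | j + 1, f, g => cov j f g + cov j f (sh r j g) + cov j (sh r j f) g

/-- The function after `s` steps of the zeta transform, done in the directions `k - 1, k - 2, …`. -/
def zt (f : ℕ → ℕ) : ℕ → ℕ → ℕ
  | 0 => f
  | s + 1 => zs r (k - 1 - s) (zt f s)

variable {r k} {f f' g g' : ℕ → ℕ} {i j : ℕ}

lemma sh_add : sh r j (f + f') = sh r j f + sh r j f' := by
  ext y; simp only [sh, Pi.add_apply]; split_ifs <;> rfl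

lemma sh_self : sh r j (sh r j f) = 0 := by
  ext y
  simp only [sh, Pi.zero_apply]
  split_ifs with h1 h2 <;> try rfl
  rw [dg_sub h1.le, if_pos rfl] at h2
  have := @dg_lt r y j
  omega

lemma sh_comm (h : i ≠ j) : sh r i (sh r j f) = sh r j (sh r i f) := by
  ext y
  simp only [sh]
  by_cases h1 : r < dg r y i <;> by_cases h2 : r < dg r y j
  · rw [if_pos h1, if_pos h2, dg_sub h1.le, dg_sub h2.le, if_neg h, if_neg h.symm, if_pos h1,
      if_pos h2, Nat.sub_right_comm]
  · rw [if_pos h1, if_neg h2, dg_sub h1.le, if_neg h.symm, if_neg h2]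
  · rw [if_neg h1, if_pos h2, dg_sub h2.le, if_neg h, if_neg h1]
  · rw [if_neg h1, if_neg h2]

lemma sh_zero : sh r j 0 = 0 := by ext y; simp [sh]

lemma sh_apply_mul_add {a σ : ℕ} (hj : j < k) :
    sh r j f (a * (2 * r + 1) ^ k + σ) =
      if r < dg r σ j then f (a * (2 * r + 1) ^ k + (σ - r * (2 * r + 1) ^ j)) else 0 := by
  rw [sh, dg_mul_add hj]
  split_ifs with h
  · rw [Nat.add_sub_assoc (mul_pow_le_of_le_dg h.le)]
  · rfl

lemma pr_add_left : pr r k (f + f') g = pr r k f g + pr r k f' g := by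
  ext y; simp [pr, add_mul, Finset.sum_add_distrib]

lemma pr_add_right : pr r k f (g + g') = pr r k f g + pr r k f g' := by
  ext y; simp [pr, mul_add, Finset.sum_add_distrib]

lemma pr_zero_left : pr r k 0 g = 0 := by ext y; simp [pr]

lemma pr_zero_right : pr r k f 0 = 0 := by ext y; simp [pr]

lemma sh_pr (hj : j < k) : sh r j (pr r k f g) = pr r k (sh r j f) (sh r j g) := by
  ext y
  have hM : 0 < (2 * r + 1) ^ k := by positivity
  simp only [pr, sh_apply_mul_add hj]
  rw [sh]
  have hd : dg r (y % (2 * r + 1) ^ k) j = dg r y j := dg_mod hj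
  rw [hd]
  split_ifs with h
  · have hle : r * (2 * r + 1) ^ j ≤ y % (2 * r + 1) ^ k :=
      mul_pow_le_of_le_dg (by rw [hd]; exact h.le)
    have e : y - r * (2 * r + 1) ^ j = (2 * r + 1) ^ k * (y / (2 * r + 1) ^ k)
        + (y % (2 * r + 1) ^ k - r * (2 * r + 1) ^ j) := by
      have := Nat.div_add_mod y ((2 * r + 1) ^ k)
      omega
    have hlt : y % (2 * r + 1) ^ k - r * (2 * r + 1) ^ j < (2 * r + 1) ^ k :=
      (Nat.sub_le _ _).trans_lt (Nat.mod_lt _ hM)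
    rw [pr, e, Nat.mul_add_div hM, Nat.mul_add_mod, Nat.div_eq_of_lt hlt, Nat.mod_eq_of_lt hlt]
    simp
  · simp

lemma cov_add_left : cov r k j (f + f') g = cov r k j f g + cov r k j f' g := by
  induction j generalizing f f' g with
  | zero => exact pr_add_left
  | succ j ih => simp only [cov, sh_add, ih]; ring

lemma cov_add_right : cov r k j f (g + g') = cov r k j f g + cov r k j f g' := by
  induction j generalizing f g g' with
  | zero => exact pr_add_right
  | succ j ih => simp only [cov, sh_add, ih]; ring

lemma cov_zero_left : cov r k j 0 g = 0 := by
  induction j generalizing g with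
  | zero => exact pr_zero_left
  | succ j ih => simp [cov, sh_zero, ih]

lemma cov_zero_right : cov r k j f 0 = 0 := by
  induction j generalizing f with
  | zero => exact pr_zero_right
  | succ j ih => simp [cov, sh_zero, ih]

/-- A shift in a direction that the covering product treats pointwise can be moved to both factors. -/
lemma sh_cov (hij : i ≤ j) (hj : j < k) :
    sh r j (cov r k i f g) = cov r k i (sh r j f) (sh r j g) := by
  induction i generalizing f g with
  | zero => exact sh_pr hj
  | succ i ih =>
    simp only [cov, sh_add, ih (by omega), sh_comm (show j ≠ i by omega)]

/-- The zeta transform turns the covering product in direction `j` into the pointwise product. -/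
lemma zs_cov_succ (hj : j < k) :
    zs r j (cov r k (j + 1) f g) = cov r k j (zs r j f) (zs r j g) := by
  simp only [zs, cov, sh_add, sh_cov le_rfl hj, sh_self, cov_add_left, cov_add_right,
    cov_zero_left, cov_zero_right]
  ring

/-- Subtraction inverts a step of the zeta transform. -/
lemma zs_sub_sh (y : ℕ) : zs r j f y - sh r j (zs r j f) y = f y := by
  simp only [zs, sh_add, sh_self]
  simp

lemma zs_le {X : ℕ} (h : ∀ y, f y ≤ X) (y : ℕ) : zs r j f y ≤ (2 * r + 1) * X := by
  simp only [zs, sh, Pi.add_apply]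
  split_ifs with h1
  · have : 0 < r := by
      by_contra h0
      obtain rfl : r = 0 := by omega
      simp [dg, Nat.mod_one] at h1
    have h2 := h y
    have h3 := h (y - r * (2 * r + 1) ^ j)
    nlinarith
  · have h2 := h y
    nlinarith

/-- A step of the transform adds two values and at most doubles the bound, and `2 ≤ 2 r + 1` unless
`r = 0`, where there are no flags. In this form the bound on the transforms is at most the number
of codes, which the word size allows. -/
lemma zt_le (h : ∀ y, f y ≤ 1) (s y : ℕ) : zt r k f s y ≤ (2 * r + 1) ^ s := by
  induction s generalizing y with
  | zero => simpa [zt] using h y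
  | succ s ih => rw [pow_succ']; exact zs_le ih y

/-- Codes cover in the slots below `j` and agree in the other slots. -/
def CoverBelow (r k j σ σ₁ σ₂ : ℕ) : Prop :=
  (∀ i < j, lb r σ₁ i = lb r σ i ∧ lb r σ₂ i = lb r σ i ∧ (Flg r σ i ↔ Flg r σ₁ i ∨ Flg r σ₂ i)) ∧
    ∀ i < k, j ≤ i → dg r σ₁ i = dg r σ i ∧ dg r σ₂ i = dg r σ i

lemma CoverBelow.symm {σ σ₁ σ₂ : ℕ} (h : CoverBelow r k j σ σ₁ σ₂) :
    CoverBelow r k j σ σ₂ σ₁ :=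
  ⟨fun i hi => ⟨(h.1 i hi).2.1, (h.1 i hi).1, (h.1 i hi).2.2.trans or_comm⟩,
    fun i hi hji => (h.2 i hi hji).symm⟩

lemma CoverBelow.succ {σ σ₁ σ₂ : ℕ} (hj : j < k) (h : CoverBelow r k j σ σ₁ σ₂) :
    CoverBelow r k (j + 1) σ σ₁ σ₂ := by
  refine ⟨fun i hi => ?_, fun i hi hji => h.2 i hi (by omega)⟩
  rcases Nat.lt_succ_iff_lt_or_eq.1 hi with hi | rfl
  · exact h.1 i hi
  · obtain ⟨h1, h2⟩ := h.2 i hj le_rfl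
    simp [lb, Flg, h1, h2]

lemma CoverBelow.sub {σ σ₁ σ₂ : ℕ} (hj : j < k) (h : CoverBelow r k j σ σ₁ σ₂)
    (hf : r < dg r σ₂ j) : CoverBelow r k (j + 1) σ σ₁ (σ₂ - r * (2 * r + 1) ^ j) := by
  have hlt := @dg_lt r σ₂ j
  refine ⟨fun i hi => ?_, fun i hi hji => ?_⟩
  · simp only [lb, Flg, dg_sub hf.le]
    rcases Nat.lt_succ_iff_lt_or_eq.1 hi with hi | rfl
    · rw [if_neg hi.ne]; exact h.1 i hi
    · obtain ⟨h1, h2⟩ := h.2 i hj le_rfl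
      rw [if_pos rfl, h1, ← h2, if_pos hf, if_neg (by omega)]
      simp [hf]
  · rw [dg_sub hf.le, if_neg (by omega)]
    exact h.2 i hi (by omega)

/-- If the first code has the digit of `σ` at slot `j`, then the second code has this digit as well, or
it arises from such a code by removing the flag. -/
lemma CoverBelow.cases {σ σ₁ σ₂ : ℕ} (hj : j < k) (h₂ : σ₂ < (2 * r + 1) ^ k)
    (h : CoverBelow r k (j + 1) σ σ₁ σ₂) (hf : Flg r σ j → Flg r σ₁ j) :
    CoverBelow r k j σ σ₁ σ₂ ∨ ∃ σ₂' < (2 * r + 1) ^ k, CoverBelow r k j σ σ₁ σ₂' ∧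
      r < dg r σ₂' j ∧ σ₂ = σ₂' - r * (2 * r + 1) ^ j := by
  obtain ⟨l1, l2, hfl⟩ := h.1 j (by omega)
  have e1 : dg r σ₁ j = dg r σ j := dg_eq_of_lb_eq l1 ⟨fun h => hfl.2 (.inl h), hf⟩
  by_cases hc : Flg r σ j ∧ ¬ Flg r σ₂ j
  · right
    have hlt := @dg_lt r σ j
    have e2 : dg r σ₂ j + r = dg r σ j := by
      obtain ⟨c1, c2⟩ := hc
      unfold Flg at c1 c2
      unfold lb at l2
      rw [if_pos c1, if_neg c2] at l2
      omega
    have hlt2 : dg r σ₂ j + r < 2 * r + 1 := by omega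
    refine ⟨σ₂ + r * (2 * r + 1) ^ j, add_lt_of_dg hj h₂ hlt2, ⟨fun i hi => ?_, fun i hi hji => ?_⟩,
      ?_, by simp⟩
    · simp only [lb, Flg, dg_add hlt2, if_neg hi.ne]
      exact h.1 i (by omega)
    · rw [dg_add hlt2]
      split_ifs with hij
      · subst hij; exact ⟨e1, e2⟩
      · exact h.2 i hi (by omega)
    · rw [dg_add hlt2, if_pos rfl, e2]; exact hc.1
  · left
    have e2 : dg r σ₂ j = dg r σ j := by
      refine dg_eq_of_lb_eq l2 ⟨fun h => hfl.2 (.inr h), fun h => ?_⟩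
      by_contra h'
      exact hc ⟨h, h'⟩
    refine ⟨fun i hi => h.1 i (by omega), fun i hi hji => ?_⟩
    rcases hji.eq_or_lt with rfl | hji
    · exact ⟨e1, e2⟩
    · exact h.2 i hi (by omega)

lemma cov_ne_zero_iff_coverBelow (hj : j ≤ k) {i σ : ℕ} (hσ : σ < (2 * r + 1) ^ k) :
    cov r k j f g (i * (2 * r + 1) ^ k + σ) ≠ 0 ↔
      ∃ σ₁ < (2 * r + 1) ^ k, ∃ σ₂ < (2 * r + 1) ^ k, CoverBelow r k j σ σ₁ σ₂ ∧ ∃ a ≤ i,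
        f (a * (2 * r + 1) ^ k + σ₁) ≠ 0 ∧ g ((i - a) * (2 * r + 1) ^ k + σ₂) ≠ 0 := by
  have hM : 0 < (2 * r + 1) ^ k := by positivity
  induction j generalizing f g with
  | zero =>
    have e1 : (i * (2 * r + 1) ^ k + σ) / (2 * r + 1) ^ k = i := by
      rw [mul_comm, Nat.mul_add_div hM, Nat.div_eq_of_lt hσ, add_zero]
    have e2 : (i * (2 * r + 1) ^ k + σ) % (2 * r + 1) ^ k = σ := by
      rw [mul_comm, Nat.mul_add_mod, Nat.mod_eq_of_lt hσ]
    simp only [cov, pr, e1, e2, ne_eq, Finset.sum_eq_zero_iff, mul_eq_zero, Finset.mem_range]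
    push Not
    constructor
    · rintro ⟨a, ha, h⟩
      exact ⟨σ, hσ, σ, hσ, ⟨by simp, by simp⟩, a, by omega, h⟩
    · rintro ⟨σ₁, h1, σ₂, h2, h, a, ha, h'⟩
      obtain rfl := code_ext h1 hσ fun j hj => (h.2 j hj (by omega)).1
      obtain rfl := code_ext h2 h1 fun j hj => (h.2 j hj (by omega)).2
      exact ⟨a, by omega, h'⟩
  | succ j ih =>
    have hjk : j < k := by omega
    have split : cov r k (j + 1) f g (i * (2 * r + 1) ^ k + σ) ≠ 0 ↔
        cov r k j f g (i * (2 * r + 1) ^ k + σ) ≠ 0 ∨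
        cov r k j f (sh r j g) (i * (2 * r + 1) ^ k + σ) ≠ 0 ∨
        cov r k j (sh r j f) g (i * (2 * r + 1) ^ k + σ) ≠ 0 := by
      simp only [cov, Pi.add_apply]; omega
    refine (split.trans (or_congr (ih hjk.le) (or_congr (ih hjk.le) (ih hjk.le)))).trans ?_
    simp only [sh_apply_mul_add hjk]
    constructor
    · rintro (⟨σ₁, h1, σ₂, h2, h, a, ha, h'⟩ | ⟨σ₁, h1, σ₂, h2, h, a, ha, h', h''⟩ |
        ⟨σ₁, h1, σ₂, h2, h, a, ha, h', h''⟩)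
      · exact ⟨σ₁, h1, σ₂, h2, h.succ hjk, a, ha, h'⟩
      · split_ifs at h'' with hf
        · exact ⟨σ₁, h1, _, (Nat.sub_le _ _).trans_lt h2, h.sub hjk hf, a, ha, h', h''⟩
        · exact (h'' rfl).elim
      · split_ifs at h' with hf
        · exact ⟨_, (Nat.sub_le _ _).trans_lt h1, σ₂, h2, (h.symm.sub hjk hf).symm, a, ha, h', h''⟩
        · exact (h' rfl).elim
    · rintro ⟨σ₁, h1, σ₂, h2, h, a, ha, h', h''⟩
      by_cases hf : Flg r σ j → Flg r σ₁ j
      · rcases h.cases hjk h2 hf with hc | ⟨σ₂', h2', hc, hf', rfl⟩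
        · exact .inl ⟨σ₁, h1, σ₂, h2, hc, a, ha, h', h''⟩
        · exact .inr (.inl ⟨σ₁, h1, σ₂', h2', hc, a, ha, h', by rwa [if_pos hf']⟩)
      · have hf2 : Flg r σ j → Flg r σ₂ j := fun h0 =>
          ((h.1 j (by omega)).2.2.1 h0).resolve_left fun h1 => hf fun _ => h1
        rcases h.symm.cases hjk h1 hf2 with hc | ⟨σ₁', h1', hc, hf', rfl⟩
        · exact .inl ⟨σ₁, h1, σ₂, h2, hc.symm, a, ha, h', h''⟩
        · exact .inr (.inr ⟨σ₁', h1', σ₂, h2, hc.symm, a, ha, by rwa [if_pos hf'], h''⟩)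

/-- The support of the covering product. -/
lemma cov_ne_zero_iff {i σ : ℕ} (hσ : σ < (2 * r + 1) ^ k) :
    cov r k k f g (i * (2 * r + 1) ^ k + σ) ≠ 0 ↔
      ∃ σ₁ < (2 * r + 1) ^ k, ∃ σ₂ < (2 * r + 1) ^ k, Cover r k σ σ₁ σ₂ ∧ ∃ a ≤ i,
        f (a * (2 * r + 1) ^ k + σ₁) ≠ 0 ∧ g ((i - a) * (2 * r + 1) ^ k + σ₂) ≠ 0 := by
  rw [cov_ne_zero_iff_coverBelow le_rfl hσ]
  have : ∀ σ₁ σ₂, CoverBelow r k k σ σ₁ σ₂ ↔ Cover r k σ σ₁ σ₂ := fun σ₁ σ₂ =>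
    ⟨fun h => h.1, fun h => ⟨h, fun i hi hki => by omega⟩⟩
  simp only [this]

end cov

/-! ### Partial solutions -/

section feas

variable (adj : ℕ → ℕ → Prop) (r k : ℕ) (c : ℕ → ℕ)

/-- The vertex `v` has a neighbour with a smaller label, along an edge whose larger end is in
`Y`. -/
def Sat (Y : Finset ℕ) (d : ℕ → ℕ) (v : ℕ) : Prop := ∃ u, adj u v ∧ d u < d v ∧ max u v ∈ Y

/-- There is a labelling `d` with labels in `0, …, r` and at most `m` labels `0` in `Y`, such that
every vertex of `Z` has label `0` or a neighbour with a smaller label along an edge of `Y` (an edge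
belongs to its larger end), the labels outside `Z` are prescribed by `ℓ`, depending on the
slot `c v` of the vertex `v`, and for every slot `j` with `fl j`, some vertex in this slot outside
`Z` has a neighbour with a smaller label along an edge of `Y`. -/
def Feas (Y Z : Finset ℕ) (ℓ : ℕ → ℕ) (fl : ℕ → Prop) (m : ℕ) : Prop :=
  ∃ d : ℕ → ℕ, (∀ v, d v ≤ r) ∧ (∀ v, v ∉ Z → d v = ℓ (c v)) ∧
    (∀ v ∈ Z, d v = 0 ∨ Sat adj Y d v) ∧
    (∀ j < k, fl j → ∃ v, v ∉ Z ∧ c v = j ∧ Sat adj Y d v) ∧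
    (Y.filter fun v => d v = 0).card ≤ m

variable {adj r k c} {Y Z Y₁ Y₂ Z₁ Z₂ : Finset ℕ} {ℓ ℓ' : ℕ → ℕ} {fl fl' : ℕ → Prop} {m m' : ℕ}

lemma Feas.mono (h : Feas adj r k c Y Z ℓ fl m) (hc : ∀ v, c v < k)
    (hℓ : ∀ j < k, ℓ' j = ℓ j) (hfl : ∀ j < k, fl' j → fl j) (hm : m ≤ m') :
    Feas adj r k c Y Z ℓ' fl' m' := by
  obtain ⟨d, h1, h2, h3, h4, h5⟩ := h
  exact ⟨d, h1, fun v hv => (h2 v hv).trans (hℓ _ (hc v)).symm, h3,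
    fun j hj hf => h4 j hj (hfl j hj hf), h5.trans hm⟩

/-- Without demands, label `0` everywhere is a solution. -/
lemma feas_of_no_flags (hℓ : ∀ j, ℓ j ≤ r) (hfl : ∀ j < k, ¬ fl j) :
    Feas adj r k c Y Z ℓ fl Y.card := by
  refine ⟨fun v => if v ∈ Z then 0 else ℓ (c v), fun v => ?_, fun v hv => by simp [hv],
    fun v hv => by simp [hv], fun j hj hf => (hfl j hj hf).elim, Finset.card_filter_le _ _⟩
  dsimp only
  split_ifs
  exacts [Nat.zero_le _, hℓ _]

/-- A demand that can be met at all is met by adding one vertex to the solution. -/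
lemma Feas.add_card_flags [DecidablePred fl] (h : Feas adj r k c Y Z ℓ fl m')
    (h0 : Feas adj r k c Y Z ℓ (fun _ => False) m) :
    Feas adj r k c Y Z ℓ fl (m + ((Finset.range k).filter fl).card) := by
  classical
  obtain ⟨d', a1, a2, a3, a4, a5⟩ := h
  obtain ⟨d, b1, b2, b3, b4, b5⟩ := h0
  have : ∀ j, ∃ v u, j < k → fl j → v ∉ Z ∧ c v = j ∧ adj u v ∧ d' u < d' v ∧ max u v ∈ Y := by
    intro j
    by_cases hj : j < k ∧ fl j
    · obtain ⟨v, hv, hc, u, hu⟩ := a4 j hj.1 hj.2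
      exact ⟨v, u, fun _ _ => ⟨hv, hc, hu⟩⟩
    · exact ⟨0, 0, fun h h' => (hj ⟨h, h'⟩).elim⟩
  choose v u huv using this
  set U := (((Finset.range k).filter fl).image u) ∩ Z with hU
  have hle : ∀ w, (if w ∈ U then 0 else d w) ≤ d w := fun w => by split_ifs <;> omega
  refine ⟨fun w => if w ∈ U then 0 else d w, fun w => (hle w).trans (b1 w), fun w hw => ?_,
    fun w hw => ?_, fun j hj hf => ?_, ?_⟩
  · have : w ∉ U := fun h => hw (Finset.mem_inter.1 h).2
    simp [this, b2 w hw]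
  · by_cases hwU : w ∈ U
    · simp [hwU]
    · rcases b3 w hw with h | ⟨u', h1, h2, h3⟩
      · simp [h]
      · right
        refine ⟨u', h1, ?_, h3⟩
        simp only [hwU, if_false]
        exact (hle u').trans_lt h2
  · obtain ⟨h1, h2, h3, h4, h5⟩ := huv j hj hf
    refine ⟨v j, h1, h2, u j, h3, ?_, h5⟩
    have hvU : v j ∉ U := fun h => h1 (Finset.mem_inter.1 h).2
    have ev : d (v j) = d' (v j) := by rw [b2 _ h1, a2 _ h1]
    simp only [hvU, if_false, ev]
    split_ifs with h
    · omega
    · have hz : u j ∉ Z := fun hz => h (Finset.mem_inter.2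
        ⟨Finset.mem_image_of_mem _ (Finset.mem_filter.2 ⟨Finset.mem_range.2 hj, hf⟩), hz⟩)
      rwa [b2 _ hz, ← a2 _ hz]
  · have hsub : (Y.filter fun w => (if w ∈ U then 0 else d w) = 0) ⊆
        (Y.filter fun w => d w = 0) ∪ U := by
      intro w
      simp only [Finset.mem_filter, Finset.mem_union]
      split_ifs <;> tauto
    refine (Finset.card_le_card hsub).trans ((Finset.card_union_le _ _).trans ?_)
    have h2 : U.card ≤ ((Finset.range k).filter fl).card :=
      (Finset.card_le_card Finset.inter_subset_left).trans Finset.card_image_le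
    omega

/-- Partial solutions on separated parts are combined independently; it suffices to distribute
the demands disjointly. -/
lemma Feas.exists_split (hadj : ∀ u v, adj u v → adj v u)
    (hZ₁ : Z₁ ⊆ Y₁) (hZ₂ : Z₂ ⊆ Y₂) (hY : Disjoint Y₁ Y₂)
    (h₁ : ∀ u v, adj u v → max u v ∈ Y₁ → u ∉ Z₂) (h₂ : ∀ u v, adj u v → max u v ∈ Y₂ → u ∉ Z₁)
    (hℓ : ∀ j, ℓ j ≤ r) (h : Feas adj r k c (Y₁ ∪ Y₂) (Z₁ ∪ Z₂) ℓ fl m) :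
    ∃ (fl₁ fl₂ : ℕ → Prop) (m₁ m₂ : ℕ), (∀ j < k, fl j ↔ fl₁ j ∨ fl₂ j) ∧
      (∀ j < k, fl₁ j → ¬ fl₂ j) ∧ m₁ + m₂ ≤ m ∧
      Feas adj r k c Y₁ Z₁ ℓ fl₁ m₁ ∧ Feas adj r k c Y₂ Z₂ ℓ fl₂ m₂ := by
  classical
  obtain ⟨d, b1, b2, b3, b4, b5⟩ := h
  set d₁ : ℕ → ℕ := fun v => if v ∈ Z₂ then ℓ (c v) else d v with hd₁
  set d₂ : ℕ → ℕ := fun v => if v ∈ Z₁ then ℓ (c v) else d v with hd₂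
  have s₁ : ∀ u v, adj u v → max u v ∈ Y₁ → d₁ u = d u ∧ d₁ v = d v := fun u v huv hm => by
    have e1 := h₁ u v huv hm
    have e2 := h₁ v u (hadj _ _ huv) (by rwa [max_comm])
    simp [hd₁, e1, e2]
  have s₂ : ∀ u v, adj u v → max u v ∈ Y₂ → d₂ u = d u ∧ d₂ v = d v := fun u v huv hm => by
    have e1 := h₂ u v huv hm
    have e2 := h₂ v u (hadj _ _ huv) (by rwa [max_comm])
    simp [hd₂, e1, e2]
  have sat : ∀ v, Sat adj (Y₁ ∪ Y₂) d v → Sat adj Y₁ d₁ v ∨ Sat adj Y₂ d₂ v := by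
    rintro v ⟨u, h1, h2, h3⟩
    rcases Finset.mem_union.1 h3 with h3 | h3
    · obtain ⟨e1, e2⟩ := s₁ u v h1 h3
      exact .inl ⟨u, h1, by rwa [e1, e2], h3⟩
    · obtain ⟨e1, e2⟩ := s₂ u v h1 h3
      exact .inr ⟨u, h1, by rwa [e1, e2], h3⟩
  have nsat₁ : ∀ v ∈ Z₁, ¬ Sat adj Y₂ d₂ v := fun v hv ⟨u, h1, _, h3⟩ =>
    h₂ v u (hadj _ _ h1) (by rwa [max_comm]) hv
  have nsat₂ : ∀ v ∈ Z₂, ¬ Sat adj Y₁ d₁ v := fun v hv ⟨u, h1, _, h3⟩ =>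
    h₁ v u (hadj _ _ h1) (by rwa [max_comm]) hv
  have dis₁ : ∀ v ∈ Z₁, v ∉ Z₂ := fun v hv hv' => Finset.disjoint_left.1 hY (hZ₁ hv) (hZ₂ hv')
  set fl₁ : ℕ → Prop := fun j => fl j ∧ ∃ v, v ∉ Z₁ ∧ c v = j ∧ Sat adj Y₁ d₁ v with hfl₁
  refine ⟨fl₁, fun j => fl j ∧ ¬ fl₁ j, (Y₁.filter fun v => d₁ v = 0).card,
    (Y₂.filter fun v => d₂ v = 0).card, fun j hj => ?_, fun j hj h1 h2 => h2.2 h1, ?_,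
    ⟨d₁, fun v => ?_, fun v hv => ?_, fun v hv => ?_, fun j hj hf => hf.2, le_rfl⟩,
    ⟨d₂, fun v => ?_, fun v hv => ?_, fun v hv => ?_, fun j hj hf => ?_, le_rfl⟩⟩
  · by_cases h : fl₁ j
    · simp [h, h.1]
    · simp [h]
  · rw [← Finset.card_union_of_disjoint (Finset.disjoint_filter_filter hY)]
    refine (Finset.card_le_card ?_).trans b5
    intro v hv
    simp only [Finset.mem_union, Finset.mem_filter] at hv ⊢
    rcases hv with ⟨hv, h0⟩ | ⟨hv, h0⟩
    · refine ⟨.inl hv, ?_⟩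
      have : v ∉ Z₂ := fun h => Finset.disjoint_left.1 hY hv (hZ₂ h)
      simpa [hd₁, this] using h0
    · refine ⟨.inr hv, ?_⟩
      have : v ∉ Z₁ := fun h => Finset.disjoint_left.1 hY (hZ₁ h) hv
      simpa [hd₂, this] using h0
  · simp only [hd₁]; split_ifs
    exacts [hℓ _, b1 v]
  · simp only [hd₁]; split_ifs with h
    exacts [rfl, b2 v (by simp [hv, h])]
  · have := dis₁ v hv
    rcases b3 v (by simp [hv]) with h | h
    · left; simpa [hd₁, this] using h
    · exact .inr ((sat v h).resolve_right (nsat₁ v hv))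
  · simp only [hd₂]; split_ifs
    exacts [hℓ _, b1 v]
  · simp only [hd₂]; split_ifs with h
    exacts [rfl, b2 v (by simp [hv, h])]
  · have : v ∉ Z₁ := fun h => dis₁ v h hv
    rcases b3 v (by simp [hv]) with h | h
    · left; simpa [hd₂, this] using h
    · exact .inr ((sat v h).resolve_left (nsat₂ v hv))
  · obtain ⟨v, hv, hc, hs⟩ := b4 j hj hf.1
    simp only [Finset.mem_union, not_or] at hv
    refine ⟨v, hv.2, hc, (sat v hs).resolve_left fun h => hf.2 ⟨hf.1, v, hv.1, hc, h⟩⟩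

/-- The converse of `Feas.exists_split`, where demands may be met on both sides. -/
lemma Feas.union (hadj : ∀ u v, adj u v → adj v u)
    (hZ₁ : Z₁ ⊆ Y₁) (hZ₂ : Z₂ ⊆ Y₂) (hY : Disjoint Y₁ Y₂)
    (h₁ : ∀ u v, adj u v → max u v ∈ Y₁ → u ∉ Z₂) (h₂ : ∀ u v, adj u v → max u v ∈ Y₂ → u ∉ Z₁)
    {fl₁ fl₂ : ℕ → Prop} {m₁ m₂ : ℕ} (hfl : ∀ j < k, fl j → fl₁ j ∨ fl₂ j)
    (f₁ : Feas adj r k c Y₁ Z₁ ℓ fl₁ m₁) (f₂ : Feas adj r k c Y₂ Z₂ ℓ fl₂ m₂) :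
    Feas adj r k c (Y₁ ∪ Y₂) (Z₁ ∪ Z₂) ℓ fl (m₁ + m₂) := by
  classical
  obtain ⟨d₁, a1, a2, a3, a4, a5⟩ := f₁
  obtain ⟨d₂, b1, b2, b3, b4, b5⟩ := f₂
  set d : ℕ → ℕ := fun v => if v ∈ Z₁ then d₁ v else d₂ v with hd
  have dis₁ : ∀ v ∈ Z₁, v ∉ Z₂ := fun v hv hv' => Finset.disjoint_left.1 hY (hZ₁ hv) (hZ₂ hv')
  have e₁ : ∀ v, v ∉ Z₂ → d v = d₁ v := fun v hv => by
    simp only [hd]; split_ifs with h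
    exacts [rfl, by rw [b2 v hv, a2 v h]]
  have e₂ : ∀ v, v ∉ Z₁ → d v = d₂ v := fun v hv => by simp [hd, hv]
  have sat₁ : ∀ v, Sat adj Y₁ d₁ v → v ∉ Z₂ ∧ Sat adj (Y₁ ∪ Y₂) d v := by
    rintro v ⟨u, h1, h2, h3⟩
    have k1 := h₁ u v h1 h3
    have k2 := h₁ v u (hadj _ _ h1) (by rwa [max_comm])
    exact ⟨k2, u, h1, by rwa [e₁ u k1, e₁ v k2], Finset.mem_union_left _ h3⟩
  have sat₂ : ∀ v, Sat adj Y₂ d₂ v → v ∉ Z₁ ∧ Sat adj (Y₁ ∪ Y₂) d v := by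
    rintro v ⟨u, h1, h2, h3⟩
    have k1 := h₂ u v h1 h3
    have k2 := h₂ v u (hadj _ _ h1) (by rwa [max_comm])
    exact ⟨k2, u, h1, by rwa [e₂ u k1, e₂ v k2], Finset.mem_union_right _ h3⟩
  refine ⟨d, fun v => ?_, fun v hv => ?_, fun v hv => ?_, fun j hj hf => ?_, ?_⟩
  · simp only [hd]; split_ifs
    exacts [a1 v, b1 v]
  · simp only [Finset.mem_union, not_or] at hv
    rw [e₁ v hv.2, a2 v hv.1]
  · rcases Finset.mem_union.1 hv with hv | hv
    · rw [e₁ v (dis₁ v hv)]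
      exact (a3 v hv).imp id fun h => (sat₁ v h).2
    · rw [e₂ v fun h => dis₁ v h hv]
      exact (b3 v hv).imp id fun h => (sat₂ v h).2
  · rcases hfl j hj hf with hf | hf
    · obtain ⟨v, hv, hc, hs⟩ := a4 j hj hf
      exact ⟨v, by simp [hv, (sat₁ v hs).1], hc, (sat₁ v hs).2⟩
    · obtain ⟨v, hv, hc, hs⟩ := b4 j hj hf
      exact ⟨v, by simp [hv, (sat₂ v hs).1], hc, (sat₂ v hs).2⟩
  · rw [Finset.filter_union]
    refine (Finset.card_union_le _ _).trans (add_le_add ?_ ?_)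
    · refine le_trans (le_of_eq ?_) a5
      congr 1
      refine Finset.filter_congr fun v hv => ?_
      rw [e₁ v fun h => Finset.disjoint_left.1 hY hv (hZ₂ h)]
    · refine le_trans (le_of_eq ?_) b5
      congr 1
      refine Finset.filter_congr fun v hv => ?_
      rw [e₂ v fun h => Finset.disjoint_left.1 hY (hZ₁ h) hv]

/-- Choosing the label of the vertex `x`: in the prescription for the smaller set, its slot holds
label `0` or is flagged. -/
lemma Feas.of_forget {x : ℕ} (hx : x ∈ Y) (hcx : c x < k)
    (hsep : ∀ u v, adj u v → max u v ∈ Y → u ∉ Y → c u ≠ c x)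
    (hadj : ∀ u v, adj u v → adj v u)
    (hℓ : ∀ j, j ≠ c x → ℓ' j = ℓ j)
    (hfl : ∀ j < k, j ≠ c x → fl j → fl' j) (hflx : ¬ fl (c x))
    (hx' : ℓ' (c x) = 0 ∨ fl' (c x)) (hℓr : ∀ j, ℓ j ≤ r)
    (h : Feas adj r k c Y (Y.erase x) ℓ' fl' m) : Feas adj r k c Y Y ℓ fl m := by
  classical
  obtain ⟨d, b1, b2, b3, b4, b5⟩ := h
  set d' : ℕ → ℕ := fun v => if v ∈ Y then d v else ℓ (c v) with hd'
  have touch : ∀ u v, adj u v → max u v ∈ Y → d' u = d u := by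
    intro u v huv hm
    simp only [hd']
    split_ifs with hu
    · rfl
    · rw [b2 u fun h => hu (Finset.mem_of_mem_erase h), hℓ _ (hsep u v huv hm hu)]
  have sat : ∀ v, Sat adj Y d v → Sat adj Y d' v := by
    rintro v ⟨u, h1, h2, h3⟩
    refine ⟨u, h1, ?_, h3⟩
    rwa [touch u v h1 h3, touch v u (hadj _ _ h1) (by rwa [max_comm])]
  refine ⟨d', fun v => ?_, fun v hv => by simp [hd', hv], fun v hv => ?_, fun j hj hf => ?_, ?_⟩
  · simp only [hd']; split_ifs
    exacts [b1 v, hℓr _]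
  · by_cases hvx : v = x
    · subst hvx
      rcases hx' with h0 | h0
      · left; simp [hd', hv, b2 v (by simp), h0]
      · right
        obtain ⟨w, hw, hcw, hs⟩ := b4 _ hcx h0
        have : w = v := by
          by_contra hne
          obtain ⟨u, h1, h2, h3⟩ := hs
          exact hsep w u (hadj _ _ h1) (by rwa [max_comm]) (fun h => hw (by simp [hne, h])) hcw
        subst this
        exact sat _ hs
    · refine (b3 v (by simp [hvx, hv])).imp (fun h => by simp [hd', hv, h]) (sat v)
  · have hjx : j ≠ c x := fun h => hflx (h ▸ hf)
    obtain ⟨w, hw, hcw, hs⟩ := b4 j hj (hfl j hj hjx hf)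
    refine ⟨w, fun h => hw (Finset.mem_erase.2 ⟨?_, h⟩), hcw, sat w hs⟩
    rintro rfl
    exact hjx hcw.symm
  · refine le_trans (le_of_eq ?_) b5
    congr 1
    exact Finset.filter_congr fun v hv => by simp [hd', hv]

/-- The label of `x` in a solution yields a prescription for the smaller set: a positive label has to
be flagged because `x` needs a neighbour with a smaller label. -/
lemma Feas.forget {x : ℕ} (hx : x ∈ Y) (hcx : c x < k)
    (hsep : ∀ u v, adj u v → max u v ∈ Y → u ∉ Y → c u ≠ c x)
    (hadj : ∀ u v, adj u v → adj v u) (hℓr : ∀ j, ℓ j ≤ r)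
    (h : Feas adj r k c Y Y ℓ fl m) :
    ¬ fl (c x) ∧ ∃ t ≤ r, Feas adj r k c Y (Y.erase x) (Function.update ℓ (c x) t)
      (fun j => if j = c x then 0 < t else fl j) m := by
  classical
  obtain ⟨d, b1, b2, b3, b4, b5⟩ := h
  have hsep' : ∀ v, v ∉ Y → Sat adj Y d v → c v ≠ c x := by
    rintro v hv ⟨u, h1, h2, h3⟩
    exact hsep v u (hadj _ _ h1) (by rwa [max_comm]) hv
  refine ⟨fun hf => ?_, d x, b1 x, ?_⟩
  · obtain ⟨v, hv, hc, hs⟩ := b4 _ hcx hf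
    exact hsep' v hv hs hc
  set ℓ' := Function.update ℓ (c x) (d x) with hℓ'
  set d' : ℕ → ℕ := fun v => if v ∈ Y then d v else ℓ' (c v) with hd'
  have touch : ∀ u v, adj u v → max u v ∈ Y → d' u = d u := by
    intro u v huv hm
    simp only [hd']
    split_ifs with hu
    · rfl
    · rw [b2 u hu, hℓ', Function.update_of_ne (hsep u v huv hm hu)]
  have sat : ∀ v, Sat adj Y d v → Sat adj Y d' v := by
    rintro v ⟨u, h1, h2, h3⟩
    refine ⟨u, h1, ?_, h3⟩
    rwa [touch u v h1 h3, touch v u (hadj _ _ h1) (by rwa [max_comm])]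
  refine ⟨d', fun v => ?_, fun v hv => ?_, fun v hv => ?_, fun j hj hf => ?_, ?_⟩
  · simp only [hd', hℓ', Function.update_apply]; split_ifs
    exacts [b1 v, b1 x, hℓr _]
  · by_cases hvx : v = x
    · subst hvx; simp [hd', hℓ', hx]
    · have : v ∉ Y := fun h => hv (by simp [hvx, h])
      simp [hd', this]
  · have hvY := Finset.mem_of_mem_erase hv
    exact (b3 v hvY).imp (fun h => by simp [hd', hvY, h]) (sat v)
  · by_cases hjx : j = c x
    · simp only [hjx, if_true] at hf
      exact ⟨x, by simp, hjx.symm, sat x ((b3 x hx).resolve_left (by omega))⟩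
    · simp only [hjx, if_false] at hf
      obtain ⟨v, hv, hc, hs⟩ := b4 j hj hf
      exact ⟨v, fun h => hv (Finset.mem_of_mem_erase h), hc, sat v hs⟩
  · refine le_trans (le_of_eq ?_) b5
    congr 1
    exact Finset.filter_congr fun v hv => by simp [hd', hv]

end feas

section codes

variable {r k : ℕ}

/-- Flags can be removed from a code. -/
lemma exists_code {σ : ℕ} (hσ : σ < (2 * r + 1) ^ k) (P : ℕ → Prop)
    (hP : ∀ j < k, P j → Flg r σ j) :
    ∃ τ < (2 * r + 1) ^ k, ∀ j < k, lb r τ j = lb r σ j ∧ (Flg r τ j ↔ P j) := by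
  classical
  suffices h : ∀ i ≤ k, ∃ τ < (2 * r + 1) ^ k,
      (∀ j < i, lb r τ j = lb r σ j ∧ (Flg r τ j ↔ P j)) ∧ ∀ j < k, i ≤ j → dg r τ j = dg r σ j by
    obtain ⟨τ, h1, h2, -⟩ := h k le_rfl
    exact ⟨τ, h1, h2⟩
  intro i
  induction i with
  | zero => exact fun _ => ⟨σ, hσ, by simp, by simp⟩
  | succ i ih =>
    intro hi
    obtain ⟨τ, h1, h2, h3⟩ := ih (by omega)
    have e := h3 i hi le_rfl
    by_cases hc : Flg r σ i ∧ ¬ P i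
    · have hf : r < dg r τ i := by rw [e]; exact hc.1
      have hlt := @dg_lt r τ i
      refine ⟨τ - r * (2 * r + 1) ^ i, (Nat.sub_le _ _).trans_lt h1, fun j hj => ?_,
        fun j hj hij => ?_⟩
      · rcases Nat.lt_succ_iff_lt_or_eq.1 hj with hj | rfl
        · simp only [lb, Flg, dg_sub hf.le, if_neg hj.ne]
          exact h2 j hj
        · simp only [lb, Flg, dg_sub hf.le, if_true, ← e, if_pos hf]
          exact ⟨if_neg (by omega), by simp only [hc.2, iff_false]; omega⟩
      · rw [dg_sub hf.le, if_neg (by omega), h3 j hj (by omega)]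
    · refine ⟨τ, h1, fun j hj => ?_, fun j hj hij => h3 j hj (by omega)⟩
      rcases Nat.lt_succ_iff_lt_or_eq.1 hj with hj | rfl
      · exact h2 j hj
      · refine ⟨lb_congr e, (Flg_congr e).trans ⟨fun h => ?_, hP j hi⟩⟩
        by_contra h'
        exact hc ⟨h, h'⟩

end codes

/-! ### Elimination orders and blocks -/

/-- An elimination order of width `k` of a graph on `0, …, n - 1`, where the vertices are removed
from `n - 1` down to `0`: `nb x` contains the smaller neighbours of `x`, is contained in
`insert (par x) (nb (par x))`, and the vertices of `insert x (nb x)` have different slots `col`. -/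
structure ElimOrder (n k : ℕ) where
  /-- adjacency -/
  adj : ℕ → ℕ → Prop
  /-- the slot of a vertex -/
  col : ℕ → ℕ
  /-- the parent in the elimination tree -/
  par : ℕ → ℕ
  /-- the vertices below `x` in the bag of `x` -/
  nb : ℕ → Finset ℕ
  symm : ∀ u v, adj u v → adj v u
  irrefl : ∀ u, ¬ adj u u
  lt_of_adj : ∀ u v, adj u v → u < n
  lt_of_mem_nb : ∀ x < n, ∀ y ∈ nb x, y < x
  mem_nb_of_adj : ∀ u v, adj u v → u < v → u ∈ nb v
  par_lt : ∀ x < n, 0 < x → par x < x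
  nb_subset : ∀ x < n, 0 < x → nb x ⊆ insert (par x) (nb (par x))
  col_lt : ∀ x, col x < k
  col_inj : ∀ x < n, ∀ u ∈ insert x (nb x), ∀ v ∈ insert x (nb x), col u = col v → u = v

/-- The first vertex below `s` on the way from `y` to the root. The condition `par y < y` holds except
at the root, and makes the recursion terminate for every function `par`. -/
def rep (par : ℕ → ℕ) (s : ℕ) (y : ℕ) : ℕ :=
  if _h : s ≤ y ∧ par y < y then rep par s (par y) else y
termination_by y

namespace ElimOrder

variable {n k : ℕ} (E : ElimOrder n k)

/-- The vertices that have been merged into `p` when the vertices from `s` on are eliminated. -/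
def blk (s p : ℕ) : Finset ℕ := (Finset.range n).filter fun y => rep E.par s y = p

lemma rep_of_lt {s y : ℕ} (h : y < s) : rep E.par s y = y := by
  rw [rep, dif_neg (by omega)]

lemma rep_le (s y : ℕ) : rep E.par s y ≤ y := by
  induction y using Nat.strong_induction_on with
  | _ y ih =>
    rw [rep]
    split_ifs with h
    · exact (ih _ h.2).trans h.2.le
    · exact le_rfl

/-- Eliminating `x` merges its block into the block of its parent. -/
lemma rep_succ {x : ℕ} (hx : x < n) (hx0 : 0 < x) (y : ℕ) :
    rep E.par x y = if rep E.par (x + 1) y = x then E.par x else rep E.par (x + 1) y := by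
  have hp := E.par_lt x hx hx0
  induction y using Nat.strong_induction_on with
  | _ y ih =>
    rcases lt_trichotomy y x with h | rfl | h
    · rw [E.rep_of_lt h, E.rep_of_lt (by omega), if_neg h.ne]
    · rw [E.rep_of_lt (show y < y + 1 by omega), if_pos rfl, rep, dif_pos ⟨le_rfl, hp⟩,
        E.rep_of_lt hp]
    · by_cases hy : E.par y < y
      · have e1 : rep E.par x y = rep E.par x (E.par y) := by rw [rep, dif_pos ⟨h.le, hy⟩]
        have e2 : rep E.par (x + 1) y = rep E.par (x + 1) (E.par y) := by
          rw [rep, dif_pos ⟨h, hy⟩]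
        rw [e1, e2, ih _ hy]
      · have e1 : rep E.par x y = y := by rw [rep, dif_neg (by tauto)]
        have e2 : rep E.par (x + 1) y = y := by rw [rep, dif_neg (by tauto)]
        rw [e1, e2, if_neg h.ne']

lemma blk_end {p : ℕ} (hp : p < n) : E.blk n p = {p} := by
  ext y
  simp only [blk, Finset.mem_filter, Finset.mem_range, Finset.mem_singleton]
  constructor
  · rintro ⟨h1, h2⟩; rwa [E.rep_of_lt h1] at h2
  · rintro rfl; exact ⟨hp, E.rep_of_lt hp⟩

lemma rep_one (y : ℕ) (hy : y < n) : rep E.par 1 y = 0 := by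
  induction y using Nat.strong_induction_on with
  | _ y ih =>
    rcases Nat.eq_zero_or_pos y with rfl | h
    · exact E.rep_of_lt (by omega)
    · have := E.par_lt y hy h
      rw [rep, dif_pos ⟨h, this⟩, ih _ this (by omega)]

lemma blk_one : E.blk 1 0 = Finset.range n := by
  ext y
  simp only [blk, Finset.mem_filter, Finset.mem_range, and_iff_left_iff_imp]
  exact E.rep_one y

lemma le_of_mem_blk {s p y : ℕ} (h : y ∈ E.blk s p) : p ≤ y :=
  (Finset.mem_filter.1 h).2 ▸ E.rep_le s y

lemma mem_blk_self {s p : ℕ} (hp : p < n) (hs : p < s) : p ∈ E.blk s p :=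
  Finset.mem_filter.2 ⟨Finset.mem_range.2 hp, E.rep_of_lt hs⟩

lemma disjoint_blk {s p q : ℕ} (h : p ≠ q) : Disjoint (E.blk s p) (E.blk s q) := by
  rw [Finset.disjoint_left]
  intro y h1 h2
  exact h ((Finset.mem_filter.1 h1).2.symm.trans (Finset.mem_filter.1 h2).2)

lemma card_blk_le (s p : ℕ) : (E.blk s p).card ≤ n :=
  (Finset.card_filter_le _ _).trans (by simp)

lemma blk_par {x : ℕ} (hx : x < n) (hx0 : 0 < x) :
    E.blk x (E.par x) = E.blk (x + 1) (E.par x) ∪ E.blk (x + 1) x := by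
  have hp := E.par_lt x hx hx0
  ext y
  simp only [blk, Finset.mem_filter, Finset.mem_union, E.rep_succ hx hx0 y]
  split_ifs with h
  · simp only [h, hp.ne', and_true, and_false, false_or]
  · simp [h]

lemma blk_of_ne {x p : ℕ} (hx : x < n) (hx0 : 0 < x) (hpx : p ≠ x) (hp : p ≠ E.par x) :
    E.blk x p = E.blk (x + 1) p := by
  ext y
  simp only [blk, Finset.mem_filter, E.rep_succ hx hx0 y]
  split_ifs with h
  · simp [h, hp.symm, hpx.symm]
  · simp

/-- The smaller vertices in the bag of a vertex of a block are in the block or in the bag of the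
vertex that represents the block. -/
lemma nb_blk {s p y u : ℕ} (hs : 0 < s) (hs' : s ≤ n) (hp : p < s) (hy : y ∈ E.blk s p)
    (hu : u ∈ E.nb y) : u ∈ E.blk s p ∨ u ∈ E.nb p := by
  obtain ⟨d, hd⟩ := Nat.exists_eq_add_of_le hs'
  induction d generalizing s p with
  | zero =>
    obtain rfl : n = s := by omega
    rw [E.blk_end hp, Finset.mem_singleton] at hy
    subst hy
    exact .inr hu
  | succ d ih =>
    have hsn : s < n := by omega
    by_cases hps : p = E.par s
    · subst hps
      have hpn := E.par_lt s hsn hs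
      rw [E.blk_par hsn hs] at hy ⊢
      rcases Finset.mem_union.1 hy with hy | hy
      · rcases ih (by omega) (by omega) (by omega) hy (by omega) with h | h
        · exact .inl (Finset.mem_union_left _ h)
        · exact .inr h
      · rcases ih (by omega) (by omega) (by omega) hy (by omega) with h | h
        · exact .inl (Finset.mem_union_right _ h)
        · rcases Finset.mem_insert.1 (E.nb_subset s hsn hs h) with rfl | h
          · exact .inl (Finset.mem_union_left _ (E.mem_blk_self (by omega) (by omega)))
          · exact .inr h
    · rw [E.blk_of_ne hsn hs hp.ne hps] at hy ⊢
      exact ih (by omega) (by omega) (by omega) hy (by omega)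

/-- The ends of the edges that belong to a block are in the block or in the bag of the vertex that
represents the block. -/
lemma edge_blk {s p u v : ℕ} (hs : 0 < s) (hs' : s ≤ n) (hp : p < s) (huv : E.adj u v)
    (h : max u v ∈ E.blk s p) : u ∈ E.blk s p ∨ u ∈ E.nb p := by
  rcases lt_trichotomy u v with huv' | rfl | huv'
  · rw [max_eq_right huv'.le] at h
    exact E.nb_blk hs hs' hp h (E.mem_nb_of_adj u v huv huv')
  · exact (E.irrefl _ huv).elim
  · rw [max_eq_left huv'.le] at h
    exact .inl h

/-- The partial solutions with prescriptions given by a code. -/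
def FeasC (r : ℕ) (Y Z : Finset ℕ) (σ m : ℕ) : Prop :=
  Feas E.adj r k E.col Y Z (lb r σ) (Flg r σ) m

/-- The values of `tab` up to `n` are the minimum sizes of partial solutions; larger values mean
that there is no partial solution. -/
def TabSpec (r : ℕ) (tab : ℕ → ℕ) (Y Z : Finset ℕ) : Prop :=
  ∀ σ < (2 * r + 1) ^ k, ∀ m ≤ n, tab σ ≤ m ↔ E.FeasC r Y Z σ m

/-- `bs` removes all flags from a code. -/
def IsBase (r k : ℕ) (bs : ℕ → ℕ) : Prop :=
  ∀ σ < (2 * r + 1) ^ k, bs σ < (2 * r + 1) ^ k ∧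
    ∀ j < k, lb r (bs σ) j = lb r σ j ∧ ¬ Flg r (bs σ) j

variable {E} {r : ℕ} {Y Z Y₁ Y₂ Z₁ Z₂ : Finset ℕ} {σ m : ℕ} {tab T₁ T₂ bs : ℕ → ℕ}

lemma TabSpec.congr {tab' : ℕ → ℕ} (h : E.TabSpec r tab Y Z)
    (h' : ∀ σ < (2 * r + 1) ^ k, tab' σ = tab σ) : E.TabSpec r tab' Y Z :=
  fun σ hσ m hm => by rw [h' σ hσ]; exact h σ hσ m hm

lemma TabSpec.base_le (h : E.TabSpec r tab Y Z) (hb : IsBase r k bs) (hY : Y.card ≤ n)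
    (hσ : σ < (2 * r + 1) ^ k) : tab (bs σ) ≤ Y.card :=
  (h _ (hb σ hσ).1 _ hY).2
    (feas_of_no_flags (fun _ => lb_le) fun j hj => ((hb σ hσ).2 j hj).2)

lemma TabSpec.base_le_self (h : E.TabSpec r tab Y Z) (hb : IsBase r k bs)
    (hσ : σ < (2 * r + 1) ^ k) (hn : tab σ ≤ n) : tab (bs σ) ≤ tab σ :=
  (h _ (hb σ hσ).1 _ hn).2 (((h _ hσ _ hn).1 le_rfl).mono E.col_lt
    (fun j hj => ((hb σ hσ).2 j hj).1) (fun j hj hf => (((hb σ hσ).2 j hj).2 hf).elim) le_rfl)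

/-- The excess of an entry over the entry without flags is at most the number of flags. -/
lemma TabSpec.le_base_add (h : E.TabSpec r tab Y Z) (hb : IsBase r k bs) (hY : Y.card ≤ n)
    (hσ : σ < (2 * r + 1) ^ k) (hn : tab σ ≤ n) :
    tab σ ≤ tab (bs σ) + ((Finset.range k).filter (Flg r σ)).card := by
  by_cases hc : tab (bs σ) + ((Finset.range k).filter (Flg r σ)).card ≤ n
  · refine (h _ hσ _ hc).2 (Feas.add_card_flags ((h _ hσ _ hn).1 le_rfl) ?_)
    exact ((h _ (hb σ hσ).1 _ ((h.base_le hb hY hσ).trans hY)).1 le_rfl).mono E.col_lt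
      (fun j hj => ((hb σ hσ).2 j hj).1.symm) (fun j hj hf => hf.elim) le_rfl
  · omega

lemma IsBase.eq_of_lb_eq (hb : IsBase r k bs) {τ : ℕ} (hσ : σ < (2 * r + 1) ^ k)
    (hτ : τ < (2 * r + 1) ^ k) (h : ∀ j < k, lb r τ j = lb r σ j) : bs τ = bs σ := by
  refine code_ext (hb τ hτ).1 (hb σ hσ).1 fun j hj => ?_
  have h1 := (hb τ hτ).2 j hj
  have h2 := (hb σ hσ).2 j hj
  exact dg_eq_of_lb_eq (by rw [h1.1, h2.1, h j hj]) ⟨fun h => (h1.2 h).elim, fun h => (h2.2 h).elim⟩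

/-- Two sets of vertices that are merged by a join. -/
structure Separated (E : ElimOrder n k) (Y₁ Z₁ Y₂ Z₂ : Finset ℕ) : Prop where
  sub₁ : Z₁ ⊆ Y₁
  sub₂ : Z₂ ⊆ Y₂
  disj : Disjoint Y₁ Y₂
  sep₁ : ∀ u v, E.adj u v → max u v ∈ Y₁ → u ∉ Z₂
  sep₂ : ∀ u v, E.adj u v → max u v ∈ Y₂ → u ∉ Z₁

lemma Separated.exists_cover (hS : E.Separated Y₁ Z₁ Y₂ Z₂) (hσ : σ < (2 * r + 1) ^ k)
    (h : E.FeasC r (Y₁ ∪ Y₂) (Z₁ ∪ Z₂) σ m) :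
    ∃ σ₁ < (2 * r + 1) ^ k, ∃ σ₂ < (2 * r + 1) ^ k, Cover r k σ σ₁ σ₂ ∧
      (∀ j < k, Flg r σ₁ j → ¬ Flg r σ₂ j) ∧ ∃ m₁ m₂, m₁ + m₂ ≤ m ∧
        E.FeasC r Y₁ Z₁ σ₁ m₁ ∧ E.FeasC r Y₂ Z₂ σ₂ m₂ := by
  obtain ⟨fl₁, fl₂, m₁, m₂, h1, h2, h3, h4, h5⟩ :=
    Feas.exists_split E.symm hS.sub₁ hS.sub₂ hS.disj hS.sep₁ hS.sep₂ (fun _ => lb_le) h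
  obtain ⟨σ₁, a1, a2⟩ := exists_code hσ fl₁ fun j hj hf => (h1 j hj).2 (.inl hf)
  obtain ⟨σ₂, b1, b2⟩ := exists_code hσ fl₂ fun j hj hf => (h1 j hj).2 (.inr hf)
  refine ⟨σ₁, a1, σ₂, b1, fun j hj => ⟨(a2 j hj).1, (b2 j hj).1, ?_⟩, fun j hj => ?_, m₁, m₂, h3,
    h4.mono E.col_lt (fun j hj => (a2 j hj).1) (fun j hj => (a2 j hj).2.1) le_rfl,
    h5.mono E.col_lt (fun j hj => (b2 j hj).1) (fun j hj => (b2 j hj).2.1) le_rfl⟩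
  · rw [(a2 j hj).2, (b2 j hj).2, h1 j hj]
  · rw [(a2 j hj).2, (b2 j hj).2]; exact h2 j hj

lemma Separated.feasC_union (hS : E.Separated Y₁ Z₁ Y₂ Z₂) {σ₁ σ₂ m₁ m₂ : ℕ}
    (hc : Cover r k σ σ₁ σ₂) (h₁ : E.FeasC r Y₁ Z₁ σ₁ m₁) (h₂ : E.FeasC r Y₂ Z₂ σ₂ m₂) :
    E.FeasC r (Y₁ ∪ Y₂) (Z₁ ∪ Z₂) σ (m₁ + m₂) :=
  Feas.union E.symm hS.sub₁ hS.sub₂ hS.disj hS.sep₁ hS.sep₂ (fun j hj => (hc j hj).2.2.1)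
    (h₁.mono E.col_lt (fun j hj => (hc j hj).1.symm) (fun _ _ => id) le_rfl)
    (h₂.mono E.col_lt (fun j hj => (hc j hj).2.1.symm) (fun _ _ => id) le_rfl)

/-- The values of a join, in terms of the excesses over the values without flags, which need not
add up to more than `k`. -/
lemma Separated.feasC_iff (hS : E.Separated Y₁ Z₁ Y₂ Z₂) (h₁ : E.TabSpec r T₁ Y₁ Z₁)
    (h₂ : E.TabSpec r T₂ Y₂ Z₂) (hb : IsBase r k bs) (hY₁ : Y₁.card ≤ n) (hY₂ : Y₂.card ≤ n)
    (hσ : σ < (2 * r + 1) ^ k) (hm : m ≤ n) :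
    E.FeasC r (Y₁ ∪ Y₂) (Z₁ ∪ Z₂) σ m ↔ ∃ i ≤ k, T₁ (bs σ) + T₂ (bs σ) + i ≤ m ∧
      ∃ σ₁ < (2 * r + 1) ^ k, ∃ σ₂ < (2 * r + 1) ^ k, Cover r k σ σ₁ σ₂ ∧ ∃ a ≤ i,
        T₁ σ₁ = T₁ (bs σ₁) + a ∧ T₂ σ₂ = T₂ (bs σ₂) + (i - a) := by
  constructor
  · intro h
    obtain ⟨σ₁, l1, σ₂, l2, hc, hd, m₁, m₂, hle, f1, f2⟩ := hS.exists_cover hσ h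
    have a1 := (h₁ σ₁ l1 m₁ (by omega)).2 f1
    have a2 := (h₂ σ₂ l2 m₂ (by omega)).2 f2
    have b1 := h₁.base_le_self hb l1 (by omega)
    have b2 := h₂.base_le_self hb l2 (by omega)
    have c1 := h₁.le_base_add hb hY₁ l1 (by omega)
    have c2 := h₂.le_base_add hb hY₂ l2 (by omega)
    have e1 := hb.eq_of_lb_eq hσ l1 fun j hj => (hc j hj).1
    have e2 := hb.eq_of_lb_eq hσ l2 fun j hj => (hc j hj).2.1
    have hcard : ((Finset.range k).filter (Flg r σ₁)).card
        + ((Finset.range k).filter (Flg r σ₂)).card ≤ k := by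
      rw [← Finset.card_union_of_disjoint]
      · refine (Finset.card_le_card (Finset.union_subset (Finset.filter_subset _ _)
          (Finset.filter_subset _ _))).trans (by simp)
      · rw [Finset.disjoint_left]
        intro j h1 h2
        simp only [Finset.mem_filter, Finset.mem_range] at h1 h2
        exact hd j h1.1 h1.2 h2.2
    rw [e1] at b1 c1
    rw [e2] at b2 c2
    refine ⟨(T₁ σ₁ - T₁ (bs σ)) + (T₂ σ₂ - T₂ (bs σ)), by omega, by omega, σ₁, l1, σ₂, l2, hc,
      T₁ σ₁ - T₁ (bs σ), by omega, ?_, ?_⟩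
    · rw [e1]; omega
    · rw [e2]; omega
  · rintro ⟨i, hi, hle, σ₁, l1, σ₂, l2, hc, a, ha, t1, t2⟩
    have e1 := hb.eq_of_lb_eq hσ l1 fun j hj => (hc j hj).1
    have e2 := hb.eq_of_lb_eq hσ l2 fun j hj => (hc j hj).2.1
    rw [e1] at t1
    rw [e2] at t2
    have := hS.feasC_union hc ((h₁ σ₁ l1 _ (by omega)).1 le_rfl) ((h₂ σ₂ l2 _ (by omega)).1 le_rfl)
    exact this.mono E.col_lt (fun _ _ => rfl) (fun _ _ => id) (by omega)

/-- The join of the table of `x` with the table of its parent. -/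
lemma separated_par {x : ℕ} (hx : x < n) (hx0 : 0 < x) :
    E.Separated (E.blk (x + 1) (E.par x)) ((E.blk (x + 1) (E.par x)).erase (E.par x))
      (E.blk (x + 1) x) (E.blk (x + 1) x) := by
  have hp := E.par_lt x hx hx0
  have hd : Disjoint (E.blk (x + 1) (E.par x)) (E.blk (x + 1) x) := E.disjoint_blk hp.ne
  refine ⟨Finset.erase_subset _ _, subset_rfl, hd, fun u v huv hm hu => ?_, fun u v huv hm hu => ?_⟩
  · rcases E.edge_blk (by omega) (by omega) (by omega) huv hm with h | h
    · exact Finset.disjoint_left.1 hd h hu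
    · have h1 := E.lt_of_mem_nb _ (by omega) u h
      have h2 := E.le_of_mem_blk hu
      omega
  · have hu' := Finset.mem_of_mem_erase hu
    rcases E.edge_blk (by omega) (by omega) (by omega) huv hm with h | h
    · exact Finset.disjoint_left.1 hd hu' h
    · have h2 := E.le_of_mem_blk hu'
      rcases Finset.mem_insert.1 (E.nb_subset x hx hx0 h) with h | h
      · exact Finset.ne_of_mem_erase hu h
      · have h1 := E.lt_of_mem_nb _ (by omega) u h
        omega

lemma blk_par_erase {x : ℕ} (hx : x < n) (hx0 : 0 < x) :
    (E.blk x (E.par x)).erase (E.par x) =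
      (E.blk (x + 1) (E.par x)).erase (E.par x) ∪ E.blk (x + 1) x := by
  have hp := E.par_lt x hx hx0
  rw [E.blk_par hx hx0, Finset.erase_union_distrib,
    Finset.erase_eq_of_notMem (s := E.blk (x + 1) x) fun h =>
      absurd (E.le_of_mem_blk h) (by omega)]

lemma col_ne_of_edge_blk {x : ℕ} (hx : x < n) (u v : ℕ) (huv : E.adj u v)
    (hm : max u v ∈ E.blk (x + 1) x) (hu : u ∉ E.blk (x + 1) x) : E.col u ≠ E.col x := by
  intro hc
  have h := (E.edge_blk (by omega) (by omega) (by omega) huv hm).resolve_left hu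
  have h1 := E.lt_of_mem_nb x hx u h
  have := E.col_inj x hx u (Finset.mem_insert_of_mem h) x (Finset.mem_insert_self _ _) hc
  omega

/-- The table without the vertex `x`, in terms of the table with the vertex `x`. -/
lemma feasC_forget_iff {x : ℕ} (hx : x < n) (hσ : σ < (2 * r + 1) ^ k) :
    E.FeasC r (E.blk (x + 1) x) (E.blk (x + 1) x) σ m ↔ ¬ Flg r σ (E.col x) ∧
      ∃ τ < (2 * r + 1) ^ k, (∀ j < k, j ≠ E.col x → dg r τ j = dg r σ j) ∧
        (dg r τ (E.col x) = 0 ∨ r < dg r τ (E.col x)) ∧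
        E.FeasC r (E.blk (x + 1) x) ((E.blk (x + 1) x).erase x) τ m := by
  have hmem := E.mem_blk_self hx (show x < x + 1 by omega)
  have hck := E.col_lt x
  constructor
  · intro h
    obtain ⟨h1, t, ht, h2⟩ := Feas.forget hmem (E.col_lt x) (col_ne_of_edge_blk hx) E.symm
      (fun _ => lb_le) h
    refine ⟨h1, ?_⟩
    have hd : dg r σ (E.col x) ≤ r := not_lt.1 h1
    -- the code with digit `0` at the slot of `x`, and the new digit
    have z1 := dg_sub (r := r) (le_refl (dg r σ (E.col x)))
    have hσ0 := (Nat.sub_le σ (dg r σ (E.col x) * (2 * r + 1) ^ E.col x)).trans_lt hσ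
    set σ₀ := σ - dg r σ (E.col x) * (2 * r + 1) ^ E.col x with hσ₀
    set g := if t = 0 then 0 else t + r with hg
    have hz : dg r σ₀ (E.col x) = 0 := by rw [z1, if_pos rfl]; omega
    have hgl : dg r σ₀ (E.col x) + g < 2 * r + 1 := by
      rw [hz, hg]; split_ifs <;> omega
    have z2 := dg_add hgl
    have e1 : ∀ j, j ≠ E.col x → dg r (σ₀ + g * (2 * r + 1) ^ E.col x) j = dg r σ j := by
      intro j hj; rw [z2, if_neg hj, z1, if_neg hj]
    have e2 : dg r (σ₀ + g * (2 * r + 1) ^ E.col x) (E.col x) = g := by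
      rw [z2, if_pos rfl, hz, zero_add]
    refine ⟨σ₀ + g * (2 * r + 1) ^ E.col x, add_lt_of_dg hck hσ0 hgl, fun j _ hj => e1 j hj, ?_, ?_⟩
    · rw [e2, hg]; split_ifs <;> omega
    · refine h2.mono E.col_lt (fun j hj => ?_) (fun j hj => ?_) le_rfl
      · by_cases hjx : j = E.col x
        · subst hjx
          rw [Function.update_self, lb, e2, hg]
          split_ifs <;> omega
        · rw [Function.update_of_ne hjx, lb_congr (e1 j hjx)]
      · by_cases hjx : j = E.col x
        · subst hjx
          simp only [Flg, if_true]
          rw [e2, hg]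
          split_ifs <;> omega
        · simp only [Flg, e1 j hjx, hjx, if_false, imp_self]
  · rintro ⟨h1, τ, hτ, h2, h3, h4⟩
    -- slots from `k` on have digit `0` in both codes
    have h2' : ∀ j, j ≠ E.col x → dg r τ j = dg r σ j := by
      intro j hj
      by_cases hjk : j < k
      · exact h2 j hjk hj
      · have hle : (2 * r + 1) ^ k ≤ (2 * r + 1) ^ j := Nat.pow_le_pow_right (by omega) (by omega)
        rw [dg, dg, Nat.div_eq_of_lt (hτ.trans_le hle), Nat.div_eq_of_lt (hσ.trans_le hle)]
    refine Feas.of_forget hmem hck (col_ne_of_edge_blk hx) E.symm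
      (fun j hj => lb_congr (h2' j hj)) (fun j _ hj => (Flg_congr (h2' j hj)).2) h1 ?_
      (fun _ => lb_le) h4
    rcases h3 with h3 | h3
    · left; simp [lb, h3]
    · exact .inr h3

/-- The initial table of a vertex, which knows only the edges to smaller vertices. -/
lemma feasC_singleton_iff {x : ℕ} (hx : x < n) :
    E.FeasC r {x} ∅ σ m ↔
      (∀ j < k, Flg r σ j →
        (j = E.col x ∧ ∃ i < k, (∃ u < x, E.adj u x ∧ E.col u = i) ∧
          lb r σ i < lb r σ (E.col x)) ∨
        ((∃ u < x, E.adj u x ∧ E.col u = j) ∧ lb r σ (E.col x) < lb r σ j)) ∧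
      (if lb r σ (E.col x) = 0 then 1 else 0) ≤ m := by
  have card : ∀ d : ℕ → ℕ, d x = lb r σ (E.col x) → ((({x} : Finset ℕ).filter
      fun v => d v = 0).card = if lb r σ (E.col x) = 0 then 1 else 0) := by
    intro d hd
    rw [Finset.filter_singleton, hd]
    split_ifs <;> rfl
  have max_eq : ∀ u v, E.adj u v → max u v = x → (v = x ∧ u < x) ∨ (u = x ∧ v < x) := by
    intro u v huv h
    have : u ≠ v := by rintro rfl; exact E.irrefl _ huv
    omega
  constructor
  · rintro ⟨d, b1, b2, b3, b4, b5⟩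
    have e : ∀ v, d v = lb r σ (E.col v) := fun v => b2 v (by simp)
    rw [card d (e x)] at b5
    refine ⟨fun j hj hf => ?_, b5⟩
    obtain ⟨v, -, hc, u, huv, hlt, hm⟩ := b4 j hj hf
    rw [e, e, hc] at hlt
    rcases max_eq u v huv (by simpa using hm) with ⟨rfl, h⟩ | ⟨rfl, h⟩
    · exact .inl ⟨hc.symm, E.col u, E.col_lt u, ⟨u, h, huv, rfl⟩, by rwa [hc]⟩
    · exact .inr ⟨⟨v, h, E.symm _ _ huv, hc⟩, hlt⟩
  · rintro ⟨h, h'⟩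
    refine ⟨fun v => lb r σ (E.col v), fun _ => lb_le, fun _ _ => rfl, by simp, fun j hj hf => ?_,
      by rwa [card _ rfl]⟩
    rcases h j hj hf with ⟨rfl, i, -, ⟨u, h1, h2, h3⟩, h4⟩ | ⟨⟨u, h1, h2, h3⟩, h4⟩
    · exact ⟨x, by simp, rfl, u, h2, by dsimp only; rwa [h3], by simp [h1.le]⟩
    · exact ⟨u, by simp, h3, x, E.symm _ _ h2, by dsimp only; rwa [h3], by simp [h1.le]⟩

end ElimOrder

namespace ElimOrder

variable {n k : ℕ} {E : ElimOrder n k} {r x opt : ℕ} {cur m : ℕ → ℕ}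

/-! ### Reconstructing a solution -/

/-- A partially reconstructed solution of size at most `opt`: the labels of the vertices below `x`
are chosen, and `cur p` is the code for which the table of `p` before the joins with the vertices
below `x` still has to be explained, with value `m p`. -/
structure IsTrace (E : ElimOrder n k) (r x opt : ℕ) (cur m : ℕ → ℕ) : Prop where
  lt : ∀ p < x, cur p < (2 * r + 1) ^ k
  feas : ∀ p < x, E.FeasC r (E.blk x p) ((E.blk x p).erase p) (cur p) (m p)
  sum_le : ∑ p ∈ Finset.range x, m p ≤ opt
  lab : ∀ p < x, ∀ v ∈ E.nb p, lb r (cur p) (E.col v) = lb r (cur v) (E.col v)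
  dem : ∀ v < x, lb r (cur v) (E.col v) = 0 ∨
    ∃ p < x, v ∈ insert p (E.nb p) ∧ Flg r (cur p) (E.col v)

lemma isTrace_one (hn : 0 < n) {τ : ℕ} (hτ : τ < (2 * r + 1) ^ k)
    (h0 : dg r τ (E.col 0) = 0 ∨ r < dg r τ (E.col 0))
    (hf : E.FeasC r (E.blk 1 0) ((E.blk 1 0).erase 0) τ opt) (hcur : cur 0 = τ) :
    E.IsTrace r 1 opt cur fun _ => opt := by
  subst hcur
  refine ⟨fun p hp => ?_, fun p hp => ?_, by simp, fun p hp v hv => ?_, fun v hv => ?_⟩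
  · obtain rfl : p = 0 := by omega
    exact hτ
  · obtain rfl : p = 0 := by omega
    exact hf
  · obtain rfl : p = 0 := by omega
    exact absurd (E.lt_of_mem_nb 0 hn v hv) (by omega)
  · obtain rfl : v = 0 := by omega
    rcases h0 with h0 | h0
    · left; simp [lb, h0]
    · exact .inr ⟨0, by omega, by simp, h0⟩

/-- Undo the join with the table of `x`: the code of the parent is covered by `σ₁` and `σ₂`, and `τ`
adds the label of `x` to the code `σ₂`. Demands that are passed to `σ₂` are from then on demands of
`x`. -/
lemma IsTrace.step (h : E.IsTrace r x opt cur m) (hx0 : 0 < x) (hx : x < n) {σ₁ σ₂ τ m₁ m₂ : ℕ}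
    (h₁ : σ₁ < (2 * r + 1) ^ k) (hτ : τ < (2 * r + 1) ^ k)
    (hc : Cover r k (cur (E.par x)) σ₁ σ₂)
    (f₁ : E.FeasC r (E.blk (x + 1) (E.par x)) ((E.blk (x + 1) (E.par x)).erase (E.par x)) σ₁ m₁)
    (f₂ : E.FeasC r (E.blk (x + 1) x) (E.blk (x + 1) x) σ₂ m₂)
    (hm : m₁ + m₂ ≤ m (E.par x))
    (hτσ : ∀ j < k, j ≠ E.col x → dg r τ j = dg r σ₂ j)
    (hτx : dg r τ (E.col x) = 0 ∨ r < dg r τ (E.col x))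
    (fτ : E.FeasC r (E.blk (x + 1) x) ((E.blk (x + 1) x).erase x) τ m₂) :
    E.IsTrace r (x + 1) opt (Function.update (Function.update cur (E.par x) σ₁) x τ)
      (Function.update (Function.update m (E.par x) m₁) x m₂) := by
  have hpx := E.par_lt x hx hx0
  set p := E.par x with hp
  have ex : ∀ {α : Type} (f : ℕ → α) a b, Function.update (Function.update f p a) x b x = b :=
    fun f a b => Function.update_self _ _ _
  have ep : ∀ {α : Type} (f : ℕ → α) a b, Function.update (Function.update f p a) x b p = a :=
    fun f a b => by rw [Function.update_of_ne hpx.ne, Function.update_self]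
  have eo : ∀ {α : Type} (f : ℕ → α) a b, ∀ q, q ≠ x → q ≠ p →
      Function.update (Function.update f p a) x b q = f q :=
    fun f a b q h1 h2 => by rw [Function.update_of_ne h1, Function.update_of_ne h2]
  set cur' := Function.update (Function.update cur p σ₁) x τ with hcur'
  have hlab : ∀ q < x, ∀ v, lb r (cur' q) (E.col v) = lb r (cur q) (E.col v) := by
    intro q hq v
    by_cases hqp : q = p
    · rw [hqp, hcur', ep, (hc _ (E.col_lt v)).1]
    · rw [hcur', eo _ _ _ q hq.ne hqp]
  have hnbx : ∀ v ∈ E.nb x, E.col v ≠ E.col x := by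
    intro v hv hcv
    have := E.col_inj x hx v (Finset.mem_insert_of_mem hv) x (Finset.mem_insert_self _ _) hcv
    exact absurd (E.lt_of_mem_nb x hx v hv) (by omega)
  refine ⟨fun q hq => ?_, fun q hq => ?_, ?_, fun q hq v hv => ?_, fun v hv => ?_⟩
  · by_cases hqx : q = x
    · rw [hqx, hcur', ex]; exact hτ
    · by_cases hqp : q = p
      · rw [hqp, hcur', ep]; exact h₁
      · rw [hcur', eo _ _ _ q hqx hqp]; exact h.lt q (by omega)
  · by_cases hqx : q = x
    · rw [hqx, hcur', ex, ex]; exact fτ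
    · by_cases hqp : q = p
      · rw [hqp, hcur', ep, ep]; exact f₁
      · rw [hcur', eo _ _ _ q hqx hqp, eo _ _ _ q hqx hqp, ← E.blk_of_ne hx hx0 hqx hqp]
        exact h.feas q (by omega)
  · refine le_trans ?_ h.sum_le
    have hpr : p ∈ Finset.range x := Finset.mem_range.2 hpx
    rw [Finset.sum_range_succ, ex, ← Finset.add_sum_erase _ _ hpr, ep,
      ← Finset.add_sum_erase _ m hpr]
    have : ∑ q ∈ (Finset.range x).erase p, Function.update (Function.update m p m₁) x m₂ q =
        ∑ q ∈ (Finset.range x).erase p, m q := by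
      refine Finset.sum_congr rfl fun q hq => ?_
      rw [Finset.mem_erase, Finset.mem_range] at hq
      exact eo _ _ _ q hq.2.ne hq.1
    omega
  · by_cases hqx : q = x
    · rw [hqx] at hv ⊢
      have hvx := E.lt_of_mem_nb x hx v hv
      rw [hlab v hvx, hcur', ex, lb_congr (hτσ _ (E.col_lt v) (hnbx v hv)), (hc _ (E.col_lt v)).2.1]
      rcases Finset.mem_insert.1 (E.nb_subset x hx hx0 hv) with rfl | hv'
      · rfl
      · exact h.lab p hpx v hv'
    · have hvq := E.lt_of_mem_nb q (by omega) v hv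
      rw [hlab v (by omega), hlab q (by omega)]
      exact h.lab q (by omega) v hv
  · by_cases hvx : v = x
    · rw [hvx, hcur', ex]
      rcases hτx with h0 | h0
      · left; simp [lb, h0]
      · exact .inr ⟨x, by omega, by simp, by rw [ex]; exact h0⟩
    · rw [hlab v (by omega)]
      refine (h.dem v (by omega)).imp id ?_
      rintro ⟨q, hq, hvq, hf⟩
      by_cases hqp : q = p
      · rw [hqp] at hvq hf
        rcases (hc _ (E.col_lt v)).2.2.1 hf with hf | hf
        · exact ⟨p, by omega, hvq, by rw [hcur', ep]; exact hf⟩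
        · -- the demand is handed over to `x`, whose bag contains the vertex
          obtain ⟨d, -, -, -, b4, -⟩ := f₂
          obtain ⟨w, hw, hcw, u, huw, -, hmax⟩ := b4 _ (E.col_lt v) hf
          have hw' := (E.edge_blk (by omega) (by omega) (by omega) (E.symm _ _ huw)
            (by rwa [max_comm])).resolve_left hw
          have hwp := E.nb_subset x hx hx0 hw'
          obtain rfl := E.col_inj p (by omega) w hwp v hvq hcw
          refine ⟨x, by omega, Finset.mem_insert_of_mem hw', ?_⟩
          rw [hcur', ex]
          exact (Flg_congr (hτσ _ (E.col_lt w) (hnbx w hw'))).2 hf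
      · exact ⟨q, by omega, hvq, by rw [hcur', eo _ _ _ q (by omega) hqp]; exact hf⟩

/-- When all labels are chosen, they are a solution. -/
lemma IsTrace.end (h : E.IsTrace r n opt cur m) :
    (∀ v < n, lb r (cur v) (E.col v) = 0 ∨
      ∃ u, E.adj u v ∧ lb r (cur u) (E.col u) < lb r (cur v) (E.col v)) ∧
    ((Finset.range n).filter fun v => lb r (cur v) (E.col v) = 0).card ≤ opt := by
  have hlab : ∀ p < n, ∀ v ∈ insert p (E.nb p), lb r (cur p) (E.col v) = lb r (cur v) (E.col v) := by
    intro p hp v hv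
    rcases Finset.mem_insert.1 hv with rfl | hv
    exacts [rfl, h.lab p hp v hv]
  constructor
  · intro v hv
    refine (h.dem v hv).imp id ?_
    rintro ⟨p, hp, hvp, hf⟩
    have hfe := h.feas p hp
    rw [E.blk_end hp, Finset.erase_singleton] at hfe
    obtain ⟨d, -, b2, -, b4, -⟩ := hfe
    obtain ⟨w, -, hcw, u, huw, hlt, hm⟩ := b4 _ (E.col_lt v) hf
    have bag : ∀ a b, E.adj a b → max a b ∈ ({p} : Finset ℕ) → a ∈ insert p (E.nb p) := by
      intro a b hab hmab
      rw [← E.blk_end hp] at hmab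
      rcases E.edge_blk (by omega) le_rfl hp hab hmab with h | h
      · rw [E.blk_end hp, Finset.mem_singleton] at h
        simp [h]
      · exact Finset.mem_insert_of_mem h
    have hw := bag w u (E.symm _ _ huw) (by rwa [max_comm])
    have hu := bag u w huw hm
    obtain rfl := E.col_inj p hp w hw v hvp hcw
    rw [b2 u (by simp), b2 w (by simp), hlab p hp u hu, hlab p hp w hw] at hlt
    exact ⟨u, huw, hlt⟩
  · refine le_trans ?_ h.sum_le
    rw [Finset.card_filter]
    refine Finset.sum_le_sum fun p hp => ?_
    rw [Finset.mem_range] at hp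
    have hfe := h.feas p hp
    rw [E.blk_end hp, Finset.erase_singleton] at hfe
    exact ((feasC_singleton_iff hp).1 hfe).2

end ElimOrder

/-! ### Labellings and dominating sets -/

/-- Every label of `d` is at most `r`, and every vertex has label `0` or a neighbour with a smaller
label. -/
def IsLabelling {V : Type*} (G : SimpleGraph V) (r : ℕ) (d : V → ℕ) : Prop :=
  ∀ v, d v ≤ r ∧ (d v = 0 ∨ ∃ u, G.Adj u v ∧ d u < d v)

section dominating

variable {V : Type*} [Fintype V] {G : SimpleGraph V} {r : ℕ}

/-- Following smaller labels leads to a vertex with label `0`. -/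
lemma IsLabelling.isDominating {d : V → ℕ} (h : IsLabelling G r d) :
    IsDominating G r (Finset.univ.filter fun v => d v = 0) := by
  have key : ∀ t v, d v ≤ t → ∃ u, d u = 0 ∧ G.edist u v ≤ (d v : ℕ∞) := by
    intro t
    induction t with
    | zero => exact fun v hv => ⟨v, by omega, by simp⟩
    | succ t ih =>
      intro v hv
      rcases (h v).2 with h0 | ⟨w, hwv, hlt⟩
      · exact ⟨v, h0, by simp⟩
      · obtain ⟨u, hu, hd⟩ := ih w (by omega)
        refine ⟨u, hu, (G.edist_triangle (v := w)).trans ?_⟩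
        rw [SimpleGraph.edist_eq_one_iff_adj.2 hwv]
        calc G.edist u w + 1 ≤ (d w : ℕ∞) + 1 := by gcongr
          _ ≤ (d v : ℕ∞) := by exact_mod_cast hlt
  intro v
  obtain ⟨u, hu, hd⟩ := key _ v le_rfl
  exact ⟨u, by simp [hu], hd.trans (by exact_mod_cast (h v).1)⟩

/-- The distances from a dominating set are a labelling. -/
lemma IsDominating.exists_labelling {S : Finset V} (h : IsDominating G r S) :
    ∃ d, IsLabelling G r d ∧ (Finset.univ.filter fun v => d v = 0) ⊆ S := by
  classical
  have ex : ∀ v, ∃ t : ℕ, ∃ u ∈ S, G.edist u v ≤ (t : ℕ∞) := fun v => ⟨r, h v⟩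
  refine ⟨fun v => Nat.find (ex v), fun v => ⟨Nat.find_min' _ (h v), ?_⟩, fun v hv => ?_⟩
  · rcases Nat.eq_zero_or_pos (Nat.find (ex v)) with h0 | hpos
    · exact .inl h0
    right
    obtain ⟨u, hu, hd⟩ := Nat.find_spec (ex v)
    have hne : G.edist u v ≠ ⊤ := fun ht => by simp [ht] at hd
    obtain ⟨p, hp⟩ := SimpleGraph.exists_walk_of_edist_ne_top hne
    rw [← hp] at hd
    have hd' : p.length ≤ Nat.find (ex v) := by exact_mod_cast hd
    have hnil : ¬ p.Nil := by
      intro hn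
      obtain rfl := hn.eq
      have : Nat.find (ex u) ≤ 0 := Nat.find_min' _ ⟨u, hu, by simp⟩
      omega
    refine ⟨p.penultimate, p.adj_penultimate hnil, ?_⟩
    have hl : p.dropLast.length + 1 = p.length := SimpleGraph.Walk.length_dropLast_add_one hnil
    have : Nat.find (ex p.penultimate) ≤ p.dropLast.length :=
      Nat.find_min' _ ⟨u, hu, p.dropLast.edist_le⟩
    dsimp only
    omega
  · simp only [Finset.mem_filter, Finset.mem_univ, true_and] at hv
    obtain ⟨u, hu, hd⟩ := Nat.find_spec (ex v)
    rw [hv] at hd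
    have : G.edist u v = 0 := by simpa using hd
    rw [SimpleGraph.edist_eq_zero_iff] at this
    exact this ▸ hu

end dominating

/-! ### Rooted trees -/

section tree

variable {ι : Type*} {T : SimpleGraph ι}

/-- A tree with a root has a parent function, which is strictly monotone for the depth. -/
lemma exists_parent (hT : T.IsTree) (root : ι) :
    ∃ (par : ι → ι) (dep : ι → ℕ), (∀ i, i ≠ root → T.Adj i (par i) ∧ dep i = dep (par i) + 1) ∧
      ∀ i j, T.Adj i j → (i ≠ root ∧ par i = j) ∨ (j ≠ root ∧ par j = i) := by
  classical
  choose p hp hlen using fun i => hT.connected.exists_path_of_dist root i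
  have uniq : ∀ i w, T.Adj w i → T.dist root i = T.dist root w + 1 →
      i ≠ root ∧ (p i).penultimate = w := by
    intro i w hwi hd
    refine ⟨by rintro rfl; simp at hd, ?_⟩
    have hi : i ∉ (p w).support := by
      intro hi
      have h1 := SimpleGraph.dist_le ((p w).takeUntil i hi)
      have h2 := (p w).length_takeUntil_le_length hi
      rw [hlen] at h2
      omega
    have hc : ((p w).concat hwi).IsPath := (hp w).concat hi hwi
    have : p i = (p w).concat hwi :=
      congrArg Subtype.val ((hT.isAcyclic.subsingleton_path root i).elim ⟨p i, hp i⟩ ⟨_, hc⟩)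
    rw [this, SimpleGraph.Walk.penultimate_concat]
  refine ⟨fun i => (p i).penultimate, fun i => T.dist root i, fun i hi => ?_, fun i j hij => ?_⟩
  · have hnil : ¬ (p i).Nil := fun h => hi h.eq.symm
    have hadj := (p i).adj_penultimate hnil
    refine ⟨hadj.symm, ?_⟩
    rcases hT.dist_eq_dist_add_one_of_adj root hadj with h | h
    · have h1 := SimpleGraph.dist_le (p i).dropLast
      have h2 := SimpleGraph.Walk.length_dropLast_add_one hnil
      rw [hlen] at h2
      omega
    · exact h
  · rcases hT.dist_eq_dist_add_one_of_adj root hij with h | h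
    · exact .inl (uniq i j hij.symm h)
    · exact .inr (uniq j i hij h)

variable {V : Type*} {par : ι → ι} {root : ι} {bag : ι → Finset V} {h : ι → ℕ}

/-- Below its topmost node, a subtree is closed under parents. -/
lemma mem_bag_parent
    (hadj : ∀ i j, T.Adj i j → (i ≠ root ∧ par i = j) ∨ (j ≠ root ∧ par j = i))
    (hh : ∀ i, i ≠ root → h (par i) < h i) {v : V}
    (hconn : (T.induce {i | v ∈ bag i}).Connected) {i j : ι} (hi : v ∈ bag i) (hj : v ∈ bag j)
    (hij : h j < h i) : i ≠ root ∧ v ∈ bag (par i) := by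
  have desc : ∀ (m : ℕ) a, (∀ m' < m, par^[m'] a ≠ root) → par^[m] a = i → h i ≤ h a := by
    intro m
    induction m with
    | zero => rintro a - rfl; exact le_rfl
    | succ m ih =>
      intro a ha hm
      refine (ih (par a) (fun m' hm' => ha (m' + 1) (by omega)) hm).trans (hh a ?_).le
      exact ha 0 (by omega)
  let C : Set {i | v ∈ bag i} := {a | ∃ m, (∀ m' < m, par^[m'] a.1 ≠ root) ∧ par^[m] a.1 = i}
  obtain ⟨w⟩ := hconn ⟨i, hi⟩ ⟨j, hj⟩
  obtain ⟨d, -, ⟨m, hm, hd⟩, hd2⟩ := w.exists_boundary_dart C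
    ⟨0, by simp, rfl⟩ fun ⟨m, hm, hm'⟩ => absurd (desc m j hm hm') (by omega)
  have hadj' : T.Adj d.fst.1 d.snd.1 := d.adj
  rcases hadj _ _ hadj' with ⟨h1, h2⟩ | ⟨h1, h2⟩
  · cases m with
    | zero =>
      simp only [Function.iterate_zero, id] at hd
      rw [hd] at h1 h2
      exact ⟨h1, h2 ▸ d.snd.2⟩
    | succ m =>
      refine (hd2 ⟨m, fun m' hm' => ?_, ?_⟩).elim
      · rw [← h2]; exact hm (m' + 1) (by omega)
      · rw [← h2]; exact hd
  · refine (hd2 ⟨m + 1, fun m' hm' => ?_, ?_⟩).elim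
    · cases m' with
      | zero => exact h1
      | succ m' => rw [Function.iterate_succ_apply, h2]; exact hm m' (by omega)
    · rw [Function.iterate_succ_apply, h2]; exact hd

/-- If `u` and `v` are in a common bag and the topmost node of `u` is not below the topmost node
`t` of `v`, then `u` is in the bag of `t`. -/
lemma mem_bag_top
    (hadj : ∀ i j, T.Adj i j → (i ≠ root ∧ par i = j) ∨ (j ≠ root ∧ par j = i))
    (hh : ∀ i, i ≠ root → h (par i) < h i) (hinj : Function.Injective h)
    (hconn : ∀ v, (T.induce {i | v ∈ bag i}).Connected) {u v : V} {t s : ι}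
    (ht : v ∈ bag t) (htop : ∀ j, v ∈ bag j → h t ≤ h j) (hs : u ∈ bag s) (hst : h s ≤ h t)
    (i : ι) (hu : u ∈ bag i) (hv : v ∈ bag i) : u ∈ bag t := by
  induction hm : h i using Nat.strong_induction_on generalizing i with
  | _ m ih =>
    rcases (htop i hv).eq_or_lt with he | hlt
    · rwa [hinj he]
    · obtain ⟨h1, h2⟩ := mem_bag_parent hadj hh (hconn v) hv ht hlt
      obtain ⟨-, h3⟩ := mem_bag_parent hadj hh (hconn u) hu hs (by omega)
      exact ih _ (hm ▸ hh i h1) (par i) h3 h2 rfl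

end tree

/-! ### From a sequence of bags to an elimination order -/

/-- The bags of a rooted tree decomposition, listed from the root downwards: `bag a v` says that
`v` is in bag number `a`. -/
structure BagSeq (n N : ℕ) (adj : ℕ → ℕ → Prop) (bag : ℕ → ℕ → Prop) : Prop where
  symm : ∀ u v, adj u v → adj v u
  irrefl : ∀ u, ¬ adj u u
  lt : ∀ a v, bag a v → v < n
  exists_bag : ∀ v < n, ∃ a < N, bag a v
  exists_edge : ∀ u v, adj u v → ∃ a < N, bag a u ∧ bag a v
  top : ∀ a < N, ∀ t < N, ∀ s ≤ t, ∀ u v, bag a u → bag a v → bag t v →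
    (∀ j < t, ¬ bag j v) → bag s u → bag t u

open Classical in
/-- The earlier vertices in the first bag `τ x` of vertex number `x`. -/
noncomputable def nbOf (bag : ℕ → ℕ → Prop) (ord τ : ℕ → ℕ) (x : ℕ) : Finset ℕ :=
  (Finset.range x).filter fun y => bag (τ x) (ord y)

lemma mem_nbOf {bag : ℕ → ℕ → Prop} {ord τ : ℕ → ℕ} {x y : ℕ} :
    y ∈ nbOf bag ord τ x ↔ y < x ∧ bag (τ x) (ord y) := by
  simp [nbOf]

/-- The vertices are numbered in the order `ord` of their first appearance in the sequence of bags,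
and `τ x` is the number of the first bag of vertex number `x`. -/
structure IsFirstOrder (n N : ℕ) (bag : ℕ → ℕ → Prop) (ord τ : ℕ → ℕ) : Prop where
  ord_lt : ∀ x < n, ord x < n
  ord_inj : ∀ x < n, ∀ y < n, ord x = ord y → x = y
  tau_lt : ∀ x < n, τ x < N
  bag_tau : ∀ x < n, bag (τ x) (ord x)
  not_bag : ∀ x < n, ∀ j < τ x, ¬ bag j (ord x)
  mono : ∀ x < n, ∀ y ≤ x, τ y ≤ τ x

/-- The elimination order of a tree decomposition, with greedily chosen slots. -/
noncomputable def BagSeq.elimOrder {n N k : ℕ} {adj bag : ℕ → ℕ → Prop} (hB : BagSeq n N adj bag)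
    {ord τ : ℕ → ℕ} (hO : IsFirstOrder n N bag ord τ) (col par : ℕ → ℕ)
    (hcol : ∀ x, col x < k)
    (hcol' : ∀ x < n, ∀ y ∈ nbOf bag ord τ x, col x ≠ col y)
    (hpar : ∀ x < n, (nbOf bag ord τ x = ∅ ∧ par x = 0) ∨
      (par x ∈ nbOf bag ord τ x ∧ ∀ y ∈ nbOf bag ord τ x, y ≤ par x)) : ElimOrder n k where
  adj x y := x < n ∧ y < n ∧ adj (ord x) (ord y)
  col := col
  par := par
  nb := nbOf bag ord τ
  symm := fun u v h => ⟨h.2.1, h.1, hB.symm _ _ h.2.2⟩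
  irrefl := fun u h => hB.irrefl _ h.2.2
  lt_of_adj := fun u v h => h.1
  lt_of_mem_nb := fun x _ y hy => (mem_nbOf.1 hy).1
  mem_nb_of_adj := by
    rintro u v ⟨hu, hv, huv⟩ hlt
    obtain ⟨a, ha, h1, h2⟩ := hB.exists_edge _ _ huv
    exact mem_nbOf.2 ⟨hlt, hB.top a ha (τ v) (hO.tau_lt v hv) (τ u) (hO.mono v hv u hlt.le) _ _
      h1 h2 (hO.bag_tau v hv) (hO.not_bag v hv) (hO.bag_tau u hu)⟩
  par_lt := by
    intro x hx hx0
    rcases hpar x hx with h | h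
    · omega
    · exact (mem_nbOf.1 h.1).1
  nb_subset := by
    intro x hx hx0 y hy
    rcases hpar x hx with ⟨h, -⟩ | ⟨h1, h2⟩
    · simp [h] at hy
    · rcases (h2 y hy).eq_or_lt with rfl | hlt
      · simp
      · refine Finset.mem_insert_of_mem (mem_nbOf.2 ⟨hlt, ?_⟩)
        have hpn : par x < n := (mem_nbOf.1 h1).1.trans hx
        exact hB.top (τ x) (hO.tau_lt x hx) _ (hO.tau_lt _ hpn) (τ y) (hO.mono _ hpn y hlt.le) _ _
          (mem_nbOf.1 hy).2 (mem_nbOf.1 h1).2 (hO.bag_tau _ hpn) (hO.not_bag _ hpn)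
          (hO.bag_tau y (by omega))
  col_lt := hcol
  col_inj := by
    intro x hx
    have key : ∀ u ∈ insert x (nbOf bag ord τ x), ∀ v ∈ insert x (nbOf bag ord τ x), u < v →
        col u ≠ col v := by
      intro u hu v hv huv hc
      have hvx : v ≤ x := by
        rcases Finset.mem_insert.1 hv with rfl | hv
        exacts [le_rfl, (mem_nbOf.1 hv).1.le]
      have hu' : u ∈ nbOf bag ord τ x := by
        rcases Finset.mem_insert.1 hu with rfl | hu
        exacts [absurd huv (by omega), hu]
      rcases Finset.mem_insert.1 hv with rfl | hv'
      · exact hcol' v hx u hu' hc.symm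
      · refine hcol' v (by omega) u (mem_nbOf.2 ⟨huv, ?_⟩) hc.symm
        exact hB.top (τ x) (hO.tau_lt x hx) _ (hO.tau_lt _ (by omega)) (τ u)
          (hO.mono _ (by omega) u huv.le) _ _ (mem_nbOf.1 hu').2 (mem_nbOf.1 hv').2
          (hO.bag_tau _ (by omega)) (hO.not_bag _ (by omega)) (hO.bag_tau u (by omega))
    intro u hu v hv hc
    rcases lt_trichotomy u v with h | h | h
    · exact (key u hu v hv h hc).elim
    · exact h
    · exact (key v hv u hu h hc.symm).elim

/-! ### Verifying machine programs -/

instance : Add Expr := ⟨.op .add⟩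
instance : Sub Expr := ⟨.op .sub⟩
instance : Mul Expr := ⟨.op .mul⟩
instance : Div Expr := ⟨.op .div⟩
instance : Mod Expr := ⟨.op .mod⟩
instance (c : ℕ) : OfNat Expr c := ⟨.const c⟩

/-- The comparison `e₁ < e₂` as an expression. -/
def Expr.lt (e₁ e₂ : Expr) : Expr := .op .lt e₁ e₂

/-- The comparison `e₁ = e₂` as an expression. -/
def Expr.eq (e₁ e₂ : Expr) : Expr := .op .eq e₁ e₂

infixr:60 " ;; " => Prog.seq

section eval

variable (s : State) (e₁ e₂ : Expr)

@[simp] lemma Expr.eval_add : (e₁ + e₂).eval s = e₁.eval s + e₂.eval s := rfl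
@[simp] lemma Expr.eval_sub : (e₁ - e₂).eval s = e₁.eval s - e₂.eval s := rfl
@[simp] lemma Expr.eval_mul : (e₁ * e₂).eval s = e₁.eval s * e₂.eval s := rfl
@[simp] lemma Expr.eval_div : (e₁ / e₂).eval s = e₁.eval s / e₂.eval s := rfl
@[simp] lemma Expr.eval_mod : (e₁ % e₂).eval s = e₁.eval s % e₂.eval s := rfl
@[simp] lemma Expr.eval_lt :
    (Expr.lt e₁ e₂).eval s = if e₁.eval s < e₂.eval s then 1 else 0 := rfl
@[simp] lemma Expr.eval_eq :
    (Expr.eq e₁ e₂).eval s = if e₁.eval s = e₂.eval s then 1 else 0 := rfl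
@[simp] lemma Expr.eval_ofNat (c : ℕ) : (no_index (OfNat.ofNat c) : Expr).eval s = OfNat.ofNat c := rfl
@[simp] lemma Expr.eval_reg (x : ℕ) : (Expr.reg x).eval s = s.reg x := rfl
@[simp] lemma Expr.eval_arr (a : ℕ) (i : Expr) : (Expr.arr a i).eval s = s.arr a (i.eval s) := rfl

end eval

/-- The state after writing `v` to register `x`. -/
def State.setR (s : State) (x v : ℕ) : State := { s with reg := Function.update s.reg x v }

/-- The state after writing `v` to cell `i` of array `a`. -/
def State.setA (s : State) (a i v : ℕ) : State :=
  { s with arr := Function.update s.arr a (Function.update (s.arr a) i v) }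

section state

variable (s : State) (x y a b i v : ℕ)

@[simp] lemma State.setR_reg : (s.setR x v).reg y = if y = x then v else s.reg y := by
  simp [State.setR, Function.update_apply]
@[simp] lemma State.setR_arr : (s.setR x v).arr = s.arr := rfl
@[simp] lemma State.setA_reg : (s.setA a i v).reg = s.reg := rfl
@[simp] lemma State.setA_arr :
    (s.setA a i v).arr b = if b = a then Function.update (s.arr a) i v else s.arr b := by
  simp [State.setA, Function.update_apply]

end state

/-- All registers and cells hold numbers at most `W`. -/
def Bdd (W : ℕ) (s : State) : Prop := (∀ x, s.reg x ≤ W) ∧ ∀ a i, s.arr a i ≤ W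

/-- Constants of the expression are at most `2`. -/
def Expr.constsLe : Expr → Bool
  | .const c => c ≤ 2
  | .reg _ => true
  | .arr _ i => i.constsLe
  | .op _ e₁ e₂ => e₁.constsLe && e₂.constsLe

/-- A syntactic condition under which all values that occur in the evaluation of the expression are
below `W ^ 64` in a state bounded by `W ≥ 2`. -/
def Expr.ok (e : Expr) : Bool := e.constsLe && decide (e.cost < 64)

/-- An operation yields at most twice the product of the bounds of its arguments, and the factor `2`
is paid by its own contribution to the cost. -/
lemma Expr.eval_le_pow {W : ℕ} (hW : 2 ≤ W) {s : State} (hs : Bdd W s) {e : Expr}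
    (he : e.constsLe) : e.eval s ≤ W ^ e.cost := by
  have h1 : ∀ m, 1 ≤ W ^ m := fun m => Nat.one_le_pow _ _ (by omega)
  induction e with
  | const c => simp [Expr.constsLe] at he; simp [Expr.eval, Expr.cost]; omega
  | reg x => simpa [Expr.eval, Expr.cost] using hs.1 x
  | arr a i ih =>
    refine (hs.2 a _).trans ?_
    exact Nat.le_self_pow (by simp [Expr.cost]) _
  | op o e₁ e₂ ih₁ ih₂ =>
    simp [Expr.constsLe] at he
    have a1 := ih₁ he.1
    have a2 := ih₂ he.2
    have b1 := h1 e₁.cost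
    have b2 := h1 e₂.cost
    have key : W ^ e₁.cost * W ^ e₂.cost * 2 ≤ W ^ (e₁.cost + e₂.cost + 1) := by
      rw [pow_succ, pow_add]; gcongr
    have hm : e₁.eval s * e₂.eval s ≤ W ^ e₁.cost * W ^ e₂.cost := Nat.mul_le_mul a1 a2
    have c1 : W ^ e₁.cost ≤ W ^ e₁.cost * W ^ e₂.cost := Nat.le_mul_of_pos_right _ b2
    have c2 : W ^ e₂.cost ≤ W ^ e₁.cost * W ^ e₂.cost := Nat.le_mul_of_pos_left _ b1
    have d1 := Nat.div_le_self (e₁.eval s) (e₂.eval s)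
    have d2 := Nat.mod_le (e₁.eval s) (e₂.eval s)
    simp only [Expr.eval, Expr.cost]
    cases o <;> simp only [Op.eval] <;> first | omega | (split_ifs <;> omega)

lemma Expr.fits_of_ok {W B : ℕ} (hW : 2 ≤ W) (hB : W ^ 64 ≤ B) {s : State} (hs : Bdd W s)
    {e : Expr} (he : e.ok) : e.Fits B s := by
  simp only [Expr.ok, Bool.and_eq_true, decide_eq_true_eq] at he
  obtain ⟨h1, h2⟩ := he
  have lt : ∀ m, m < 64 → W ^ m < B := fun m hm =>
    (Nat.pow_lt_pow_right (by omega) hm).trans_le hB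
  induction e with
  | const c => exact (Expr.eval_le_pow hW hs h1).trans_lt (lt _ h2)
  | reg x => exact (Expr.eval_le_pow hW hs h1).trans_lt (lt _ h2)
  | arr a i ih =>
    refine ⟨ih h1 (by simp only [Expr.cost] at h2; omega), ?_⟩
    exact (Expr.eval_le_pow hW hs (e := .arr a i) h1).trans_lt (lt _ h2)
  | op o e₁ e₂ ih₁ ih₂ =>
    have h1' := h1
    simp only [Expr.constsLe, Bool.and_eq_true] at h1'
    simp only [Expr.cost] at h2
    exact ⟨ih₁ h1'.1 (by omega), ih₂ h1'.2 (by omega),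
      (Expr.eval_le_pow hW hs (e := .op o e₁ e₂) h1).trans_lt (lt _ h2)⟩

/-- A sufficient condition for the value of the expression to be at most `W` in a state bounded
by `W`; only sums and products leave something to prove. -/
def Expr.Bd (W : ℕ) (s : State) : Expr → Prop
  | .const _ => True
  | .reg _ => True
  | .arr _ _ => True
  | .op .add e₁ e₂ => e₁.eval s + e₂.eval s ≤ W
  | .op .mul e₁ e₂ => e₁.eval s * e₂.eval s ≤ W
  | .op .sub e₁ _ => e₁.Bd W s
  | .op .div e₁ _ => e₁.Bd W s
  | .op .mod e₁ _ => e₁.Bd W s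
  | .op .lt _ _ => True
  | .op .eq _ _ => True

section Bd

variable {W : ℕ} {s : State} {e₁ e₂ : Expr}

@[simp] lemma Expr.Bd_add : (e₁ + e₂).Bd W s ↔ e₁.eval s + e₂.eval s ≤ W := Iff.rfl
@[simp] lemma Expr.Bd_mul : (e₁ * e₂).Bd W s ↔ e₁.eval s * e₂.eval s ≤ W := Iff.rfl
@[simp] lemma Expr.Bd_sub : (e₁ - e₂).Bd W s ↔ e₁.Bd W s := Iff.rfl
@[simp] lemma Expr.Bd_div : (e₁ / e₂).Bd W s ↔ e₁.Bd W s := Iff.rfl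
@[simp] lemma Expr.Bd_mod : (e₁ % e₂).Bd W s ↔ e₁.Bd W s := Iff.rfl
@[simp] lemma Expr.Bd_lt : (Expr.lt e₁ e₂).Bd W s := trivial
@[simp] lemma Expr.Bd_eq : (Expr.eq e₁ e₂).Bd W s := trivial
@[simp] lemma Expr.Bd_ofNat (c : ℕ) : (no_index (OfNat.ofNat c) : Expr).Bd W s := trivial
@[simp] lemma Expr.Bd_reg (x : ℕ) : (Expr.reg x).Bd W s := trivial
@[simp] lemma Expr.Bd_arr (a : ℕ) (i : Expr) : (Expr.arr a i).Bd W s := trivial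

end Bd

lemma Expr.eval_le_of_Bd {W : ℕ} (hW : 2 ≤ W) {s : State} (hs : Bdd W s) {e : Expr}
    (hc : e.constsLe) (he : e.Bd W s) : e.eval s ≤ W := by
  induction e with
  | const c => simp [Expr.constsLe] at hc; simp [Expr.eval]; omega
  | reg x => exact hs.1 x
  | arr a i => exact hs.2 _ _
  | op o e₁ e₂ ih₁ ih₂ =>
    simp only [Expr.constsLe, Bool.and_eq_true] at hc
    simp only [Expr.eval]
    cases o <;> simp only [Op.eval, Expr.Bd] at he ⊢
    · exact he
    · exact (Nat.sub_le _ _).trans (ih₁ hc.1 he)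
    · exact he
    · exact (Nat.div_le_self _ _).trans (ih₁ hc.1 he)
    · exact (Nat.mod_le _ _).trans (ih₁ hc.1 he)
    · split_ifs <;> omega
    · split_ifs <;> omega

lemma Bdd.setR {W : ℕ} {s : State} (hs : Bdd W s) {x v : ℕ} (hv : v ≤ W) : Bdd W (s.setR x v) := by
  refine ⟨fun y => ?_, hs.2⟩
  rw [State.setR_reg]
  split_ifs
  exacts [hv, hs.1 y]

lemma Bdd.setA {W : ℕ} {s : State} (hs : Bdd W s) {a i v : ℕ} (hv : v ≤ W) :
    Bdd W (s.setA a i v) := by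
  refine ⟨hs.1, fun b j => ?_⟩
  rw [State.setA_arr]
  split_ifs
  · rw [Function.update_apply]
    split_ifs
    exacts [hv, hs.2 a j]
  · exact hs.2 b j

/-- The registers that a program may change. -/
def Prog.modR : Prog → List ℕ
  | .skip => []
  | .setReg x _ => [x]
  | .setArr _ _ _ => []
  | .seq p q => p.modR ++ q.modR
  | .branch _ p q => p.modR ++ q.modR
  | .loop _ p => p.modR

/-- The arrays that a program may change. -/
def Prog.modA : Prog → List ℕ
  | .skip => []
  | .setReg _ _ => []
  | .setArr a _ _ => [a]
  | .seq p q => p.modA ++ q.modA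
  | .branch _ p q => p.modA ++ q.modA
  | .loop _ p => p.modA

/-- The states agree outside the registers in `X` and the arrays in `A`. -/
structure Frame (X A : List ℕ) (s s' : State) : Prop where
  reg : ∀ x, x ∉ X → s'.reg x = s.reg x
  arr : ∀ a, a ∉ A → s'.arr a = s.arr a

lemma Frame.refl (X A : List ℕ) (s : State) : Frame X A s s := ⟨fun _ _ => rfl, fun _ _ => rfl⟩

lemma Frame.trans {X A : List ℕ} {s s' s'' : State} (h : Frame X A s s') (h' : Frame X A s' s'') :
    Frame X A s s'' :=
  ⟨fun x hx => (h'.reg x hx).trans (h.reg x hx), fun x hx => (h'.arr x hx).trans (h.arr x hx)⟩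

lemma Frame.mono {X A X' A' : List ℕ} {s s' : State} (h : Frame X A s s') (hX : X ⊆ X')
    (hA : A ⊆ A') : Frame X' A' s s' :=
  ⟨fun x hx => h.reg x fun h' => hx (hX h'), fun x hx => h.arr x fun h' => hx (hA h')⟩

/-- A run changes only the registers and arrays that the program mentions as targets. -/
lemma Exec.frame {B : ℕ} {p : Prog} {s s' : State} {t : ℕ} (h : Exec B p s t s') :
    Frame p.modR p.modA s s' := by
  induction h with
  | skip s => exact Frame.refl _ _ _
  | setReg s x e he =>
    refine ⟨fun y hy => ?_, fun _ _ => rfl⟩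
    simp only [Prog.modR, List.mem_singleton] at hy
    simp [hy]
  | setArr s a i e hi he =>
    refine ⟨fun _ _ => rfl, fun y hy => ?_⟩
    simp only [Prog.modA, List.mem_singleton] at hy
    simp [hy]
  | seq _ _ ih₁ ih₂ =>
    exact (ih₁.mono (by simp [Prog.modR]) (by simp [Prog.modA])).trans
      (ih₂.mono (by simp [Prog.modR]) (by simp [Prog.modA]))
  | branch_true _ _ _ ih => exact ih.mono (by simp [Prog.modR]) (by simp [Prog.modA])
  | branch_false _ _ _ ih => exact ih.mono (by simp [Prog.modR]) (by simp [Prog.modA])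
  | loop_true _ _ _ _ ih₁ ih₂ => exact ih₁.trans ih₂
  | loop_false _ _ => exact Frame.refl _ _ _

/-- Total correctness with a time bound: started in `s`, if all contents are at most `W`, the
program `p` halts within `T` steps in a state that satisfies `Q` and whose contents are at most `W`,
and `W ^ 64` is a sufficient word bound. -/
def WP (W : ℕ) (p : Prog) (s : State) (T : ℕ) (Q : State → Prop) : Prop :=
  ∀ B, 2 ≤ W → W ^ 64 ≤ B → Bdd W s → ∃ t s', Exec B p s t s' ∧ t ≤ T ∧ Bdd W s' ∧ Q s'

section rules

variable {W T T₁ T₂ : ℕ} {p q : Prog} {s : State} {Q Q' : State → Prop}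

lemma WP.mono (h : WP W p s T Q) {T' : ℕ} (hT : T ≤ T') (hQ : ∀ s', Q s' → Q' s') :
    WP W p s T' Q' := by
  intro B hW hB hs
  obtain ⟨t, s', h1, h2, h3, h4⟩ := h B hW hB hs
  exact ⟨t, s', h1, h2.trans hT, h3, hQ _ h4⟩

lemma WP.frame (h : WP W p s T Q) : WP W p s T fun s' => Q s' ∧ Frame p.modR p.modA s s' := by
  intro B hW hB hs
  obtain ⟨t, s', h1, h2, h3, h4⟩ := h B hW hB hs
  exact ⟨t, s', h1, h2, h3, h4, h1.frame⟩

lemma WP.seq (hp : WP W p s T₁ fun s' => WP W q s' T₂ Q) : WP W (p ;; q) s (T₁ + T₂) Q := by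
  intro B hW hB hs
  obtain ⟨t, s', h1, h2, h3, h4⟩ := hp B hW hB hs
  obtain ⟨t', s'', h5, h6, h7, h8⟩ := h4 B hW hB h3
  exact ⟨t + t', s'', .seq h1 h5, by omega, h7, h8⟩

/-- Sequential composition, where the continuation may use that the first program changes only
its own registers and arrays. -/
lemma WP.seq' (hp : WP W p s T₁ Q')
    (hq : ∀ s', Q' s' → Frame p.modR p.modA s s' → WP W q s' T₂ Q) :
    WP W (p ;; q) s (T₁ + T₂) Q :=
  .seq (hp.frame.mono le_rfl fun s' h => hq s' h.1 h.2)

/-- The verification condition of a loop-free program. -/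
def Prog.vc (W : ℕ) : Prog → (State → Prop) → State → Prop
  | .skip, Q, s => Q s
  | .setReg x e, Q, s => e.Bd W s ∧ Q (s.setR x (e.eval s))
  | .setArr a i e, Q, s => e.Bd W s ∧ Q (s.setA a (i.eval s) (e.eval s))
  | .seq p q, Q, s => p.vc W (q.vc W Q) s
  | .branch e p q, Q, s => (e.eval s ≠ 0 → p.vc W Q s) ∧ (e.eval s = 0 → q.vc W Q s)
  | .loop _ _, _, _ => False

/-- The syntactic conditions on a loop-free program. -/
def Prog.ok : Prog → Bool
  | .skip => true
  | .setReg _ e => e.ok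
  | .setArr _ i e => i.ok && e.ok
  | .seq p q => p.ok && q.ok
  | .branch e p q => e.ok && p.ok && q.ok
  | .loop _ _ => false

/-- A bound for the running time of a loop-free program. -/
def Prog.time : Prog → ℕ
  | .skip => 1
  | .setReg _ e => e.cost + 1
  | .setArr _ i e => i.cost + e.cost + 1
  | .seq p q => p.time + q.time
  | .branch e p q => e.cost + 1 + (p.time + q.time)
  | .loop _ _ => 0

lemma WP.of_vc (hok : p.ok = true) (hT : Nat.ble p.time T = true) (h : p.vc W Q s) :
    WP W p s T Q := by
  replace hT := Nat.le_of_ble_eq_true hT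
  suffices h' : WP W p s p.time Q from h'.mono hT fun _ h => h
  clear hT
  induction p generalizing s Q with
  | skip => exact fun B _ _ hs => ⟨1, s, .skip s, le_rfl, hs, h⟩
  | setReg x e =>
    intro B hW hB hs
    refine ⟨_, _, .setReg s x e (Expr.fits_of_ok hW hB hs hok), le_rfl, ?_, h.2⟩
    simp only [Prog.ok, Expr.ok, Bool.and_eq_true] at hok
    exact hs.setR (Expr.eval_le_of_Bd hW hs hok.1 h.1)
  | setArr a i e =>
    intro B hW hB hs
    simp only [Prog.ok, Bool.and_eq_true] at hok
    refine ⟨_, _, .setArr s a i e (Expr.fits_of_ok hW hB hs hok.1)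
      (Expr.fits_of_ok hW hB hs hok.2), le_rfl, ?_, h.2⟩
    simp only [Expr.ok, Bool.and_eq_true] at hok
    exact hs.setA (Expr.eval_le_of_Bd hW hs hok.2.1 h.1)
  | seq p q ihp ihq =>
    simp only [Prog.ok, Bool.and_eq_true] at hok
    refine .seq ((ihp hok.1 h).mono le_rfl fun s' hs' => ihq hok.2 hs')
  | branch e p q ihp ihq =>
    simp only [Prog.ok, Bool.and_eq_true] at hok
    intro B hW hB hs
    have hf := Expr.fits_of_ok hW hB hs hok.1.1
    by_cases he : e.eval s = 0
    · obtain ⟨t, s', h1, h2, h3, h4⟩ := ihq hok.2 (h.2 he) B hW hB hs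
      exact ⟨_, s', .branch_false hf he h1, by simp only [Prog.time]; omega, h3, h4⟩
    · obtain ⟨t, s', h1, h2, h3, h4⟩ := ihp hok.1.2 (h.1 he) B hW hB hs
      exact ⟨_, s', .branch_true hf he h1, by simp only [Prog.time]; omega, h3, h4⟩
  | loop e p => simp [Prog.ok] at hok

lemma WP.branch {e : Expr} (hok : e.ok = true) (hp : e.eval s ≠ 0 → WP W p s T Q)
    (hq : e.eval s = 0 → WP W q s T Q) : WP W (.branch e p q) s (e.cost + 1 + T) Q := by
  intro B hW hB hs
  have hf := Expr.fits_of_ok hW hB hs hok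
  by_cases he : e.eval s = 0
  · obtain ⟨t, s', h1, h2, h3, h4⟩ := hq he B hW hB hs
    exact ⟨_, s', .branch_false hf he h1, by omega, h3, h4⟩
  · obtain ⟨t, s', h1, h2, h3, h4⟩ := hp he B hW hB hs
    exact ⟨_, s', .branch_true hf he h1, by omega, h3, h4⟩

/-- The program `for x = 0, …, e - 1 do p`; the bound `e` is evaluated anew in every round. -/
def Prog.for (x : ℕ) (e : Expr) (p : Prog) : Prog :=
  .setReg x 0 ;; .loop (.lt (.reg x) e) (p ;; .setReg x (.reg x + 1))

/-- The rule for `for`-loops. The invariant `I i` has to hold when round `i` starts, and the body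
may use that only its own registers and arrays have changed since the start of the loop. Every round
takes at most `12` steps for the comparison and the counter. -/
lemma WP.for {x : ℕ} {e : Expr} (m : ℕ) (I : ℕ → State → Prop)
    (hok : (e.constsLe && decide (e.cost ≤ 3) && decide (x ∉ p.modR)) = true) (hm : m ≤ W)
    (he : ∀ s', Frame (x :: p.modR) p.modA s s' → e.eval s' = m)
    (h0 : I 0 (s.setR x 0))
    (hstep : ∀ i s', i < m → s'.reg x = i → Frame (x :: p.modR) p.modA s s' → I i s' →
      WP W p s' T fun s'' => I (i + 1) (s''.setR x (i + 1)))
    (hQ : ∀ s', s'.reg x = m → Frame (x :: p.modR) p.modA s s' → I m s' → Q s') :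
    WP W (.for x e p) s ((m + 1) * (T + 12)) Q := by
  simp only [Bool.and_eq_true, decide_eq_true_eq] at hok
  obtain ⟨⟨hc, hcost⟩, hx⟩ := hok
  intro B hW hB hs
  have hok' : (Expr.lt (.reg x) e).ok = true := by
    simp only [Expr.ok, Expr.lt, Expr.constsLe, hc, Expr.cost, Bool.and_eq_true,
      decide_eq_true_eq, true_and]
    omega
  have hfr : ∀ (s' : State) v, Frame (x :: p.modR) p.modA s s' →
      Frame (x :: p.modR) p.modA s (s'.setR x v) := fun s' v hF =>
    ⟨fun y hy => by
      simp only [List.mem_cons, not_or] at hy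
      simp [hy.1, hF.reg y (by simp [hy])], hF.arr⟩
  have main : ∀ d i, d + i = m → ∀ s', Bdd W s' → s'.reg x = i →
      Frame (x :: p.modR) p.modA s s' → I i s' →
      ∃ t s'', Exec B (.loop (.lt (.reg x) e) (p ;; .setReg x (.reg x + 1))) s' t s'' ∧
        t ≤ d * (T + 12) + 6 ∧ Bdd W s'' ∧ Q s'' := by
    intro d
    induction d with
    | zero =>
      intro i hi s' hs' hx' hF hI
      obtain rfl : i = m := by omega
      refine ⟨_, s', .loop_false (Expr.fits_of_ok hW hB hs' hok') ?_, ?_, hs', hQ s' hx' hF hI⟩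
      · simp [he s' hF, hx']
      · simp only [Expr.lt, Expr.cost]; omega
    | succ d ih =>
      intro i hi s' hs' hx' hF hI
      obtain ⟨t, s₁, e1, t1, b1, q1⟩ := hstep i s' (by omega) hx' hF hI B hW hB hs'
      have hF1 : Frame (x :: p.modR) p.modA s s₁ :=
        hF.trans (e1.frame.mono (by simp) (by simp))
      have hx1 : s₁.reg x = i := (e1.frame.reg x hx).trans hx'
      have b2 : Bdd W (s₁.setR x (i + 1)) := b1.setR (by omega)
      obtain ⟨t', s₂, e2, t2, b3, q2⟩ :=
        ih (i + 1) (by omega) _ b2 (by simp) (hfr _ _ hF1) q1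
      have hset : Exec B (.setReg x (.reg x + 1)) s₁ 4 (s₁.setR x (i + 1)) := by
        have := Exec.setReg (B := B) s₁ x (.reg x + 1)
          (Expr.fits_of_ok hW hB b1 (by rfl))
        simpa [Expr.cost, hx1, State.setR] using this
      refine ⟨_, s₂, .loop_true (Expr.fits_of_ok hW hB hs' hok') ?_ (.seq e1 hset) e2, ?_, b3, q2⟩
      · simp only [Expr.eval_lt, Expr.eval_reg, hx', he s' hF]
        rw [if_pos (by omega)]; simp
      · simp only [Expr.lt, Expr.cost]
        rw [Nat.succ_mul]; omega
  have hset : Exec B (.setReg x 0) s 2 (s.setR x 0) :=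
    Exec.setReg (B := B) s x 0 (Expr.fits_of_ok hW hB hs (by rfl))
  obtain ⟨t, s', e1, t1, b1, q1⟩ := main m 0 (by omega) _ (hs.setR (by omega)) (by simp)
    (hfr _ _ (Frame.refl _ _ _)) h0
  exact ⟨_, s', .seq hset e1, by rw [Nat.succ_mul]; omega, b1, q1⟩

end rules

open _root_.RDom.Expr _root_.RDom.Prog

/-! ### Registers and arrays

The registers `0`–`3` and the arrays `0`–`5` hold the input. The other registers and arrays that
are written by one part of the program and read by another have the following names. -/

/-- the radius `r` -/
local notation "rR" => 0
/-- the number `n` of vertices -/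
local notation "rN" => 1
/-- the number `N` of nodes of the decomposition -/
local notation "rNN" => 3
/-- the number `k` of slots -/
local notation "rK" => 4
/-- the base `2 r + 1` of the codes -/
local notation "rB" => 5
/-- the number `M = (2 r + 1) ^ k` of codes -/
local notation "rM" => 6
/-- the size `(k + 1) M` of the auxiliary arrays of the covering product -/
local notation "rL" => 7
/-- the sizes of the bags -/
local notation "aSz" => 4
/-- the concatenation of the bags -/
local notation "aFl" => 5
/-- the indicator function of the solution -/
local notation "aOut" => 6
/-- the degrees of the nodes in the remaining tree -/
local notation "aDeg" => 7
/-- the sums of the neighbours of the nodes in the remaining tree -/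
local notation "aSum" => 8
/-- the queue of nodes, from the leaves to the root -/
local notation "aQ" => 9
/-- the offsets of the bags in `aFl` -/
local notation "aOff" => 10
/-- the numbers of the vertices, shifted by one -/
local notation "aId" => 11
/-- the vertices in the order of their numbers -/
local notation "aOrd" => 12
/-- the number of the first bag of a vertex -/
local notation "aTau" => 13
/-- for a slot, one more than the last vertex for which the slot was found in use -/
local notation "aUsed" => 14
/-- the slots of the vertices -/
local notation "aCol" => 15
/-- the parents in the elimination tree -/
local notation "aPar" => 16
/-- the earlier neighbours of the vertices, by slots -/
local notation "aAdj" => 17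
/-- the powers of the base -/
local notation "aPw" => 18
/-- the codes without flags -/
local notation "aBs" => 19
/-- the tables of the vertices -/
local notation "aT" => 20
/-- the tables after the elimination of the vertices -/
local notation "aF" => 21
/-- the tables of the parents before the joins -/
local notation "aP" => 22
/-- the transform of the first factor of a join -/
local notation "aZ" => 23
/-- the transform of the second factor of a join -/
local notation "aY" => 24
/-- the product of the transforms -/
local notation "aH" => 25
/-- the current codes in the reconstruction -/
local notation "aCur" => 26

/-! ### The join of two tables -/

/-- The arithmetic data that all table operations use: `r`, `n`, `k`, the base `2 r + 1`, the number
`(2 r + 1) ^ k` of codes, the length of the arrays for the covering product, the powers of the base,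
and the codes without flags. -/
structure Ctx (r n k : ℕ) (s : State) : Prop where
  r_eq : s.reg rR = r
  n_eq : s.reg rN = n
  k_eq : s.reg rK = k
  b_eq : s.reg rB = 2 * r + 1
  M_eq : s.reg rM = (2 * r + 1) ^ k
  L_eq : s.reg rL = (k + 1) * (2 * r + 1) ^ k
  pw_eq : ∀ j ≤ k, s.arr aPw j = (2 * r + 1) ^ j
  base : ElimOrder.IsBase r k (s.arr aBs)

lemma Ctx.of_frame {r n k : ℕ} {s s' : State} {X A : List ℕ} (h : Ctx r n k s)
    (hF : Frame X A s s') (hX : ([rR, rN, rK, rB, rM, rL].all fun x => decide (x ∉ X)) = true)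
    (hA : ([aPw, aBs].all fun x => decide (x ∉ A)) = true) : Ctx r n k s' := by
  simp only [List.all_cons, List.all_nil, Bool.and_true, Bool.and_eq_true, decide_eq_true_eq]
    at hX hA
  obtain ⟨h0, h1, h4, h5, h6, h7⟩ := hX
  exact ⟨(hF.reg _ h0).trans h.r_eq, (hF.reg _ h1).trans h.n_eq, (hF.reg _ h4).trans h.k_eq,
    (hF.reg _ h5).trans h.b_eq, (hF.reg _ h6).trans h.M_eq, (hF.reg _ h7).trans h.L_eq,
    fun j hj => (congrFun (hF.arr _ hA.1) j).trans (h.pw_eq j hj), (hF.arr _ hA.2) ▸ h.base⟩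

/-- One direction of a transform of array `a`: register `14` holds the power of the base, register
`15` holds `r` times this power. -/
def sweepDir (o : Op) (a : ℕ) : Prog :=
  .for 11 (reg rL) (branch (lt (reg rR) ((reg 11 / reg 14) % reg rB))
    (setArr a (reg 11) (.op o (arr a (reg 11)) (arr a (reg 11 - reg 15)))) skip)

lemma Expr.Bd_op_arr {W : ℕ} {s : State} {o : Op} {a : ℕ} {e e' : Expr}
    (h : o.eval (s.arr a (e.eval s)) (e'.eval s) ≤ W) : (Expr.op o (arr a e) e').Bd W s := by
  cases o <;> simp only [Op.eval] at h <;> first | exact h | trivial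

section sweep

variable {W r n k : ℕ} {s : State} {o : Op} {a j : ℕ} {f : ℕ → ℕ}

lemma sweepDir_spec (hs : Ctx r n k s) (hf : s.arr a = f) (h14 : s.reg 14 = (2 * r + 1) ^ j)
    (h15 : s.reg 15 = r * (2 * r + 1) ^ j) (hW : (k + 1) * (2 * r + 1) ^ k ≤ W)
    (ho : ∀ y < (k + 1) * (2 * r + 1) ^ k, r < dg r y j →
      o.eval (f y) (f (y - r * (2 * r + 1) ^ j)) ≤ W) :
    WP W (sweepDir o a) s (((k + 1) * (2 * r + 1) ^ k + 1) * (30 + 12)) fun s' =>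
      ∀ y, s'.arr a y = if y < (k + 1) * (2 * r + 1) ^ k ∧ r < dg r y j
        then o.eval (f y) (f (y - r * (2 * r + 1) ^ j)) else f y := by
  refine WP.for ((k + 1) * (2 * r + 1) ^ k) (fun i s' => ∀ y, s'.arr a y =
    if y < i ∧ r < dg r y j then o.eval (f y) (f (y - r * (2 * r + 1) ^ j)) else f y) rfl hW
    (fun s' hF => by simpa [hs.L_eq] using hF.reg 7 (by simp [modR])) (by simp [hf]) ?_
    (fun s' _ _ h => h)
  intro i s' hi hx hF hI
  have e0 := (hF.reg 0 (by simp [modR])).trans hs.r_eq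
  have e5 := (hF.reg 5 (by simp [modR])).trans hs.b_eq
  have e14 := (hF.reg 14 (by simp [modR])).trans h14
  have e15 := (hF.reg 15 (by simp [modR])).trans h15
  have hread : ∀ y, ¬ (y < i ∧ r < dg r y j) → s'.arr a y = f y := fun y hy => by
    rw [hI y, if_neg hy]
  have hi1 : s'.arr a i = f i := hread i (by omega)
  refine WP.of_vc rfl rfl ?_
  simp only [Prog.vc, eval_lt, eval_reg, eval_mod, eval_div, e0, hx, e14, e5]
  constructor
  · intro hlt
    have hlt' : r < dg r i j := by
      by_contra h
      exact hlt (if_neg h)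
    have hi2 : s'.arr a (i - r * (2 * r + 1) ^ j) = f (i - r * (2 * r + 1) ^ j) := by
      refine hread _ fun h => ?_
      rw [dg_sub hlt'.le, if_pos rfl] at h
      have := @dg_lt r i j
      omega
    refine ⟨Expr.Bd_op_arr ?_, fun y => ?_⟩
    · simp only [eval_arr, eval_reg, eval_sub, hx, e15, hi1, hi2]
      exact ho i hi hlt'
    · have hval : (Expr.op o (arr a (reg 11)) (arr a (reg 11 - reg 15))).eval s' =
          o.eval (f i) (f (i - r * (2 * r + 1) ^ j)) := by
        simp [Expr.eval, hx, e15, hi1, hi2]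
      rw [hval]
      simp only [State.setR_arr, State.setA_arr, if_true, Function.update_apply]
      split_ifs with h1 h2 h2
      · rw [h1]
      · subst h1; exact absurd ⟨by omega, hlt'⟩ h2
      · rw [hI y, if_pos ⟨by omega, h2.2⟩]
      · refine hread y fun h => h2 ⟨by omega, h.2⟩
  · intro hlt y
    have hlt' : ¬ r < dg r i j := fun h => by simp [dg] at h; simp [h] at hlt
    simp only [State.setR_arr]
    rw [hI y]
    by_cases hy : y = i
    · subst hy; simp [hlt']
    · have : y < i + 1 ↔ y < i := by omega
      simp only [this]

/-- A transform of array `a` in all directions, where `e` is the direction in round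
`reg 12`. -/
def sweep (o : Op) (a : ℕ) (e : Expr) : Prog :=
  .for 12 (reg rK)
    ((setReg 14 (arr aPw e) ;; setReg 15 (reg rR * reg 14)) ;; sweepDir o a)

lemma sweep_spec {e : Expr} {J : ℕ → ℕ} {g : ℕ → ℕ → ℕ} (hs : Ctx r n k s)
    (ha : decide (a ∉ [aPw, aBs]) = true)
    (hok : Prog.ok (setReg 14 (arr aPw e) ;; setReg 15 (reg rR * reg 14)) = true)
    (hcost : Nat.ble (Prog.time (setReg 14 (arr aPw e) ;; setReg 15 (reg rR * reg 14))) 20 = true)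
    (heval : ∀ i < k, ∀ s' : State, s'.reg rK = k → s'.reg 12 = i → e.eval s' = J i)
    (hJ : ∀ i < k, J i < k) (hW : (k + 1) * (2 * r + 1) ^ k ≤ W) 
    (hg : ∀ i ≤ k, ∀ y < (k + 1) * (2 * r + 1) ^ k, g i y ≤ W)
    (h0 : ∀ y < (k + 1) * (2 * r + 1) ^ k, s.arr a y = g 0 y)
    (hstep : ∀ i < k, ∀ y, g (i + 1) y =
      if r < dg r y (J i) then o.eval (g i y) (g i (y - r * (2 * r + 1) ^ J i)) else g i y) :
    WP W (sweep o a e) s ((k + 1) * (20 + ((k + 1) * (2 * r + 1) ^ k + 1) * (30 + 12) + 12))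
      fun s' => ∀ y < (k + 1) * (2 * r + 1) ^ k, s'.arr a y = g k y := by
  have hM : 0 < (2 * r + 1) ^ k := by positivity
  rw [decide_eq_true_eq] at ha
  simp only [List.mem_cons, List.not_mem_nil, or_false, not_or] at ha
  refine WP.for k (fun i s' => ∀ y < (k + 1) * (2 * r + 1) ^ k, s'.arr a y = g i y) rfl
    (le_trans (by nlinarith) hW) (fun s' hF => by
      simpa [hs.k_eq] using hF.reg 4 (by simp [sweepDir, Prog.for, modR]))
    (by simpa using h0) ?_ (fun s' _ _ h => h)
  intro i s₁ hi hx hF hI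
  have hc : Ctx r n k s₁ := hs.of_frame hF rfl
    (by simp [sweepDir, Prog.for, modA, Ne.symm ha.1, Ne.symm ha.2])
  have hev := heval i hi s₁ hc.k_eq hx
  have hpw := hc.pw_eq (J i) (hJ i hi).le
  have hrb : r * (2 * r + 1) ^ J i ≤ W := by
    have h1 : (2 * r + 1) ^ (J i + 1) ≤ (2 * r + 1) ^ k := Nat.pow_le_pow_right (by omega) (hJ i hi)
    rw [pow_succ] at h1
    have h2 : r * (2 * r + 1) ^ J i ≤ (2 * r + 1) ^ J i * (2 * r + 1) := by nlinarith
    have h3 : (2 * r + 1) ^ k ≤ (k + 1) * (2 * r + 1) ^ k := Nat.le_mul_of_pos_left _ (by omega)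
    omega
  have hmid : WP W (setReg 14 (arr aPw e) ;; setReg 15 (reg rR * reg 14)) s₁ 20 fun s' =>
      s'.reg 14 = (2 * r + 1) ^ J i ∧ s'.reg 15 = r * (2 * r + 1) ^ J i := by
    refine .of_vc hok hcost ⟨trivial, ?_, ?_⟩
    · simpa [hev, hpw, hc.r_eq] using hrb
    · simp [hev, hpw, hc.r_eq]
  refine .seq ((hmid.frame).mono le_rfl ?_)
  rintro s₂ ⟨⟨h14, h15⟩, hF2⟩
  have hc2 : Ctx r n k s₂ := hc.of_frame hF2 rfl rfl
  have ha2 : s₂.arr a = s₁.arr a := hF2.arr a (by simp [modA])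
  refine (sweepDir_spec hc2 ha2 h14 h15 hW fun y hy hf => ?_).mono le_rfl fun s₃ h y hy => ?_
  · rw [hI y hy, hI _ ((Nat.sub_le _ _).trans_lt hy)]
    have := hg (i + 1) (by omega) y hy
    rwa [hstep i hi, if_pos hf] at this
  · simp only [State.setR_arr]
    rw [h y, hI y hy, hI _ ((Nat.sub_le _ _).trans_lt hy), hstep i hi]
    simp [hy]

end sweep

/-- The array `A'` differs from `A` only in the cells `off, …, off + i - 1`, which satisfy `R`. -/
def Filled (A A' : ℕ → ℕ) (off i : ℕ) (R : ℕ → ℕ → Prop) : Prop :=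
  (∀ σ < i, R σ (A' (off + σ))) ∧ ∀ y, y < off ∨ off + i ≤ y → A' y = A y

lemma Filled.zero (A : ℕ → ℕ) (off : ℕ) (R : ℕ → ℕ → Prop) : Filled A A off 0 R :=
  ⟨by simp, fun _ _ => rfl⟩

lemma Filled.step {A A' : ℕ → ℕ} {off i v : ℕ} {R : ℕ → ℕ → Prop} (h : Filled A A' off i R)
    (hv : R i v) : Filled A (Function.update A' (off + i) v) off (i + 1) R := by
  refine ⟨fun σ hσ => ?_, fun y hy => ?_⟩
  · rcases Nat.lt_succ_iff_lt_or_eq.1 hσ with hσ | rfl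
    · rw [Function.update_of_ne (by omega)]; exact h.1 σ hσ
    · rw [Function.update_self]; exact hv
  · rw [Function.update_of_ne (by omega)]; exact h.2 y (by omega)

section join

variable {W r n k : ℕ} {s : State}

/-- The indicator function of the pairs of a code and its excess over the code without flags. -/
def excess (r k : ℕ) (bs T : ℕ → ℕ) (y : ℕ) : ℕ :=
  if T (y % (2 * r + 1) ^ k) = T (bs (y % (2 * r + 1) ^ k)) + y / (2 * r + 1) ^ k then 1 else 0

/-- Write the excess function of a table to array `a`; the table starts at cell `reg 18` of
array `src`. -/
def fillExcess (a src : ℕ) : Prog :=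
  .for 11 (reg rL) (setArr a (reg 11) (eq (arr src (reg 18 + reg 11 % reg rM))
    (arr src (reg 18 + arr aBs (reg 11 % reg rM)) + reg 11 / reg rM)))

lemma fillExcess_spec {a src : ℕ} (hs : Ctx r n k s)
    (ha : decide (aBs ≠ a) = true) (hsrc : src ≠ a) (hW : (k + 1) * (2 * r + 1) ^ k ≤ W) :
    WP W (fillExcess a src) s (((k + 1) * (2 * r + 1) ^ k + 1) * (30 + 12)) fun s' =>
      ∀ y < (k + 1) * (2 * r + 1) ^ k,
        s'.arr a y = excess r k (s.arr aBs) (fun σ => s.arr src (s.reg 18 + σ)) y := by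
  rw [decide_eq_true_eq] at ha
  refine WP.for ((k + 1) * (2 * r + 1) ^ k) (fun i s' => ∀ y < i,
    s'.arr a y = excess r k (s.arr aBs) (fun σ => s.arr src (s.reg 18 + σ)) y) rfl hW
    (fun s' hF => by simpa [hs.L_eq] using hF.reg 7 (by simp [modR])) (by simp) ?_
    (fun s' _ _ h => h)
  intro i s' hi hx hF hI
  have e6 := (hF.reg 6 (by simp [modR])).trans hs.M_eq
  have e18 := hF.reg 18 (by simp [modR])
  have esrc := hF.arr src (by simpa [modA] using hsrc)
  have ebs := hF.arr 19 (by simpa [modA] using ha)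
  refine WP.of_vc rfl rfl ?_
  simp only [Prog.vc]
  refine ⟨trivial, fun y hy => ?_⟩
  simp only [State.setR_arr, State.setA_arr, if_true, Function.update_apply, eval_reg, hx]
  split_ifs with h
  · subst h
    simp [excess, esrc, ebs, e6, e18, hx]
  · exact hI y (by omega)

/-- The product of the arrays `aZ` and `aY`, written to `aH`. -/
def product : Prog :=
  .for 11 (reg rL) (setReg 16 0 ;; setReg 17 (reg 11 / reg rM + 1) ;;
    .for 13 (reg 17) (setReg 16 (reg 16 + arr aZ (reg 13 * reg rM + reg 11 % reg rM) *
      arr aY ((reg 11 / reg rM - reg 13) * reg rM + reg 11 % reg rM))) ;;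
    setArr aH (reg 11) (reg 16))

lemma product_spec {f g : ℕ → ℕ} (hs : Ctx r n k s)
    (hf : ∀ y < (k + 1) * (2 * r + 1) ^ k, s.arr aZ y = f y)
    (hg : ∀ y < (k + 1) * (2 * r + 1) ^ k, s.arr aY y = g y)
    (hfM : ∀ y, f y ≤ (2 * r + 1) ^ k) (hgM : ∀ y, g y ≤ (2 * r + 1) ^ k)
    (hW : (k + 1) * ((2 * r + 1) ^ k * (2 * r + 1) ^ k) ≤ W) :
    WP W product s (((k + 1) * (2 * r + 1) ^ k + 1) *
      (2 + (6 + ((k + 1 + 1) * (30 + 12) + 10)) + 12)) fun s' =>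
      ∀ y < (k + 1) * (2 * r + 1) ^ k, s'.arr aH y = pr r k f g y := by
  have hM : 0 < (2 * r + 1) ^ k := by positivity
  have hW1 : (k + 1) * (2 * r + 1) ^ k ≤ W := le_trans (Nat.mul_le_mul_left _ (Nat.le_mul_of_pos_left _ hM)) hW
  have hW2 : k + 1 ≤ W := le_trans (Nat.le_mul_of_pos_right _ hM) hW1
  refine WP.for ((k + 1) * (2 * r + 1) ^ k) (fun i s' => ∀ y < i, s'.arr aH y = pr r k f g y)
    rfl hW1 (fun s' hF => by simpa [hs.L_eq] using hF.reg 7 (by decide)) (by simp) ?_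
    (fun s' _ _ h => h)
  intro y s₁ hy hx hF hI
  have e6 := (hF.reg 6 (by decide)).trans hs.M_eq
  have eZ := hF.arr aZ (by decide)
  have eY := hF.arr aY (by decide)
  have hdiv : y / (2 * r + 1) ^ k < k + 1 := by
    rwa [Nat.div_lt_iff_lt_mul hM]
  have hdm := Nat.div_add_mod y ((2 * r + 1) ^ k)
  refine .seq (.of_vc rfl (rfl : Nat.ble _ 2 = true) ⟨trivial, ?_⟩)
  refine .seq (.of_vc rfl (rfl : Nat.ble _ 6 = true) ⟨?_, ?_⟩)
  · simp [e6, hx]; omega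
  set S : ℕ → ℕ := fun i => ∑ a ∈ Finset.range i,
    f (a * (2 * r + 1) ^ k + y % (2 * r + 1) ^ k) *
      g ((y / (2 * r + 1) ^ k - a) * (2 * r + 1) ^ k + y % (2 * r + 1) ^ k) with hS
  have hSle : ∀ i ≤ k + 1, S i ≤ W := fun i hi => by
    refine le_trans ((Finset.sum_le_card_nsmul _ _ ((2 * r + 1) ^ k * (2 * r + 1) ^ k)
      fun a _ => Nat.mul_le_mul (hfM _) (hgM _)).trans ?_) hW
    rw [Finset.card_range, smul_eq_mul]
    exact Nat.mul_le_mul_right _ hi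
  refine .seq' (WP.mono (WP.for (T := 30) (y / (2 * r + 1) ^ k + 1) (fun i s' => s'.reg 16 = S i)
    rfl (by omega) (fun s' hF => ?_) ?_ ?_ (fun s' _ _ h => h)) (by gcongr; omega) fun _ h => h) ?_
  · have := hF.reg 17 (by decide)
    simpa [e6, hx] using this
  · simp [S]
  · intro i s₂ hi hx2 hF2 hI2
    have g6 : s₂.reg 6 = (2 * r + 1) ^ k := by simpa [e6] using hF2.reg 6 (by decide)
    have g11 : s₂.reg 11 = y := by simpa [hx] using hF2.reg 11 (by decide)
    have gZ : s₂.arr aZ = s.arr aZ := by simpa [eZ] using hF2.arr aZ (by decide)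
    have gY : s₂.arr aY = s.arr aY := by simpa [eY] using hF2.arr aY (by decide)
    have i1 : i * (2 * r + 1) ^ k + y % (2 * r + 1) ^ k < (k + 1) * (2 * r + 1) ^ k := by
      have : i * (2 * r + 1) ^ k ≤ y / (2 * r + 1) ^ k * (2 * r + 1) ^ k :=
        Nat.mul_le_mul_right _ (by omega)
      rw [mul_comm] at hdm; omega
    have i2 : (y / (2 * r + 1) ^ k - i) * (2 * r + 1) ^ k + y % (2 * r + 1) ^ k <
        (k + 1) * (2 * r + 1) ^ k := by
      have : (y / (2 * r + 1) ^ k - i) * (2 * r + 1) ^ k ≤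
          y / (2 * r + 1) ^ k * (2 * r + 1) ^ k := Nat.mul_le_mul_right _ (by omega)
      rw [mul_comm] at hdm; omega
    have hval : S i + s.arr aZ (i * (2 * r + 1) ^ k + y % (2 * r + 1) ^ k) *
        s.arr aY ((y / (2 * r + 1) ^ k - i) * (2 * r + 1) ^ k + y % (2 * r + 1) ^ k) =
        S (i + 1) := by
      rw [hf _ i1, hg _ i2, hS]; simp only; rw [Finset.sum_range_succ]
    refine .of_vc rfl rfl ⟨?_, ?_⟩
    · simp only [Bd_add, eval_reg, eval_mul, eval_arr, eval_add, eval_mod, eval_div, eval_sub, hI2,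
        hx2, g6, g11, gZ, gY, hval]
      exact hSle _ (by omega)
    · simp only [eval_reg, eval_mul, eval_arr, eval_add, eval_mod, eval_div, eval_sub, hI2,
        hx2, g6, g11, gZ, gY, hval, State.setR_reg]
      simp
  · intro s₂ h2 hF2
    have g11 : s₂.reg 11 = y := by simpa [hx] using hF2.reg 11 (by decide)
    have gH : s₂.arr aH = s₁.arr aH := by simpa using hF2.arr aH (by decide)
    refine .of_vc rfl rfl ⟨trivial, fun y' hy' => ?_⟩
    simp only [State.setR_arr, State.setA_arr, if_true, Function.update_apply, eval_reg, h2, g11, gH]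
    split_ifs with h
    · subst h; rfl
    · exact hI y' (by omega)

/-- Write the table of the join to array `aT`: the least excess with a nonzero entry in `aH`, added
to the values of the codes without flags. -/
def extract : Prog :=
  .for 11 (reg rM) (setReg 16 (reg rN + 1) ;;
    .for 13 (reg rK + 1) (branch (arr aH ((reg rK - reg 13) * reg rM + reg 11))
      (setReg 16 (reg rK - reg 13)) skip) ;;
    setArr aT (reg 19 + reg 11) (arr aP (reg 18 + arr aBs (reg 11)) +
      arr aF (reg 18 + arr aBs (reg 11)) + reg 16))

/-- The loop runs through the excesses in decreasing order, so that the least one is kept; if there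
is none, the entry is larger than `n`. -/
lemma extract_spec {h : ℕ → ℕ} (hs : Ctx r n k s)
    (hh : ∀ y < (k + 1) * (2 * r + 1) ^ k, s.arr aH y = h y)
    (h1 : ∀ σ < (2 * r + 1) ^ k, s.arr aP (s.reg 18 + s.arr aBs σ) ≤ n)
    (h2 : ∀ σ < (2 * r + 1) ^ k, s.arr aF (s.reg 18 + s.arr aBs σ) ≤ n)
    (hW : (k + 1) * (2 * r + 1) ^ k ≤ W) (hW' : 3 * n + k + 1 ≤ W) :
    WP W extract s (((2 * r + 1) ^ k + 1) * (4 + ((k + 1 + 1) * (30 + 12) + 20) + 12)) fun s' =>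
      Filled (s.arr aT) (s'.arr aT) (s.reg 19) ((2 * r + 1) ^ k) fun σ v => ∀ m ≤ n, v ≤ m ↔
        ∃ i ≤ k, s.arr aP (s.reg 18 + s.arr aBs σ) + s.arr aF (s.reg 18 + s.arr aBs σ) + i ≤ m ∧
          h (i * (2 * r + 1) ^ k + σ) ≠ 0 := by
  have hM : 0 < (2 * r + 1) ^ k := by positivity
  refine WP.for ((2 * r + 1) ^ k) (fun i s' => Filled (s.arr aT) (s'.arr aT) (s.reg 19) i
    fun σ v => ∀ m ≤ n, v ≤ m ↔
      ∃ i ≤ k, s.arr aP (s.reg 18 + s.arr aBs σ) + s.arr aF (s.reg 18 + s.arr aBs σ) + i ≤ m ∧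
        h (i * (2 * r + 1) ^ k + σ) ≠ 0) rfl (le_trans (Nat.le_mul_of_pos_left _ (by omega)) hW)
    (fun s' hF => by simpa [hs.M_eq] using hF.reg 6 (by decide)) (Filled.zero _ _ _) ?_
    (fun s' _ _ h => h)
  intro σ s₁ hσ hx hF hI
  have hc : Ctx r n k s₁ := hs.of_frame hF rfl rfl
  have e18 := hF.reg 18 (by decide)
  have e19 := hF.reg 19 (by decide)
  have eH := hF.arr aH (by decide)
  have eP := hF.arr aP (by decide)
  have eF := hF.arr aF (by decide)
  have eB := hF.arr aBs (by decide)
  refine .seq (.of_vc rfl (rfl : Nat.ble _ 4 = true) ⟨?_, ?_⟩)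
  · simp [hc.n_eq]; omega
  refine .seq' (WP.for (T := 30) (k + 1) (fun i s' => s'.reg 16 ≤ n + k + 1 ∧ ∀ m ≤ n,
    s'.reg 16 ≤ m ↔ ∃ t ≤ k, k < t + i ∧ h (t * (2 * r + 1) ^ k + σ) ≠ 0 ∧ t ≤ m)
    rfl (by omega) (fun s' hF2 => ?_) ?_ ?_ (fun s' _ _ h => h)) ?_
  · have := hF2.reg 4 (by decide)
    simpa [hc.k_eq] using this
  · simp only [State.setR_reg, eval_add, eval_reg, hc.n_eq, eval_ofNat]
    refine ⟨by simp, fun m hm => ⟨fun h => ?_, fun ⟨t, h1, h2, _⟩ => by omega⟩⟩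
    simp at h; omega
  · intro i s₂ hi hx2 hF2 hI2
    have g4 : s₂.reg 4 = k := by simpa [hc.k_eq] using hF2.reg 4 (by decide)
    have g6 : s₂.reg 6 = (2 * r + 1) ^ k := by simpa [hc.M_eq] using hF2.reg 6 (by decide)
    have g11 : s₂.reg 11 = σ := by simpa [hx] using hF2.reg 11 (by decide)
    have gH : s₂.arr aH = s.arr aH := by simpa [eH] using hF2.arr aH (by decide)
    have hlt : (k - i) * (2 * r + 1) ^ k + σ < (k + 1) * (2 * r + 1) ^ k := by
      have : (k - i) * (2 * r + 1) ^ k ≤ k * (2 * r + 1) ^ k := Nat.mul_le_mul_right _ (by omega)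
      rw [Nat.add_mul]; omega
    have hread := hh _ hlt
    refine .of_vc rfl rfl ⟨fun hne => ⟨trivial, ?_⟩, fun h0 => ?_⟩
    · simp only [eval_arr, eval_add, eval_mul, eval_sub, eval_reg, g4, g6, g11, gH, hx2, hread]
        at hne
      simp only [State.setR_reg, eval_sub, eval_reg, g4, hx2]
      refine ⟨by simp; omega, fun m hm => ?_⟩
      simp only [Nat.reduceEqDiff, if_false, if_true]
      constructor
      · exact fun h => ⟨k - i, by omega, by omega, hne, h⟩
      · rintro ⟨t, _, _, _, _⟩; omega
    · simp only [eval_arr, eval_add, eval_mul, eval_sub, eval_reg, g4, g6, g11, gH, hx2, hread]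
        at h0
      simp only [vc, State.setR_reg]
      refine ⟨by simpa using hI2.1, fun m hm => ?_⟩
      simp only [Nat.reduceEqDiff, if_false]
      rw [hI2.2 m hm]
      constructor
      · rintro ⟨t, a1, a2, a3, a4⟩; exact ⟨t, a1, by omega, a3, a4⟩
      · rintro ⟨t, a1, a2, a3, a4⟩
        refine ⟨t, a1, ?_, a3, a4⟩
        by_contra hlt'
        obtain rfl : t = k - i := by omega
        exact a3 h0
  · rintro s₂ ⟨h3, h4⟩ hF2
    have g11 : s₂.reg 11 = σ := by simpa [hx] using hF2.reg 11 (by decide)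
    have g18 : s₂.reg 18 = s.reg 18 := by simpa [e18] using hF2.reg 18 (by decide)
    have g19 : s₂.reg 19 = s.reg 19 := by simpa [e19] using hF2.reg 19 (by decide)
    have gP : s₂.arr aP = s.arr aP := by simpa [eP] using hF2.arr aP (by decide)
    have gF : s₂.arr aF = s.arr aF := by simpa [eF] using hF2.arr aF (by decide)
    have gB : s₂.arr aBs = s.arr aBs := by simpa [eB] using hF2.arr aBs (by decide)
    have gT : s₂.arr aT = s₁.arr aT := by simpa using hF2.arr aT (by decide)
    have b1 := h1 σ hσ
    have b2 := h2 σ hσ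
    refine .of_vc rfl rfl ⟨?_, ?_⟩
    · simp [g11, g18, gP, gF, gB]; omega
    · simp only [State.setR_arr, State.setA_arr, if_true, eval_add, eval_reg, eval_arr, g11, g18,
        g19, gP, gF, gB, gT]
      refine hI.step fun m hm => ?_
      constructor
      · intro hle
        obtain ⟨t, a1, -, a3, a4⟩ := (h4 (m - (s.arr aP (s.reg 18 + s.arr aBs σ) +
          s.arr aF (s.reg 18 + s.arr aBs σ))) (by omega)).1 (by omega)
        exact ⟨t, a1, by omega, a3⟩
      · rintro ⟨t, a1, a2, a3⟩
        have := (h4 t (by omega)).2 ⟨t, a1, by omega, a3, le_rfl⟩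
        omega

/-- Copy a table from array `aT` to array `aP`. -/
def copyTable : Prog :=
  .for 11 (reg rM) (setArr aP (reg 18 + reg 11) (arr aT (reg 19 + reg 11)))

lemma copyTable_spec (hs : Ctx r n k s) (hW : (2 * r + 1) ^ k ≤ W) :
    WP W copyTable s (((2 * r + 1) ^ k + 1) * (30 + 12)) fun s' =>
      Filled (s.arr aP) (s'.arr aP) (s.reg 18) ((2 * r + 1) ^ k) fun σ v =>
        v = s.arr aT (s.reg 19 + σ) := by
  refine WP.for ((2 * r + 1) ^ k) (fun i s' => Filled (s.arr aP) (s'.arr aP) (s.reg 18) i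
    fun σ v => v = s.arr aT (s.reg 19 + σ)) rfl hW
    (fun s' hF => by simpa [hs.M_eq] using hF.reg 6 (by decide)) (Filled.zero _ _ _) ?_
    (fun s' _ _ h => h)
  intro σ s₁ hσ hx hF hI
  have e18 := hF.reg 18 (by decide)
  have e19 := hF.reg 19 (by decide)
  have eT := hF.arr aT (by decide)
  refine .of_vc rfl rfl ⟨trivial, ?_⟩
  simp only [State.setR_arr, State.setA_arr, if_true, eval_add, eval_reg, eval_arr, e18, e19, eT, hx]
  exact hI.step rfl

/-- Replace the table of the parent by its join with the table in `aF`; register `18` holds the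
start of the tables of the current vertex, register `19` the start of the tables of its parent. -/
def join : Prog :=
  copyTable ;; fillExcess aZ aP ;; fillExcess aY aF ;;
    sweep .add aZ (reg rK - 1 - reg 12) ;; sweep .add aY (reg rK - 1 - reg 12) ;; product ;;
    sweep .sub aH (reg 12) ;; extract

lemma excess_le_one (bs T : ℕ → ℕ) (y : ℕ) : excess r k bs T y ≤ 1 := by
  unfold excess; split_ifs <;> omega

lemma excess_ne_zero {bs T : ℕ → ℕ} {a σ : ℕ} (hσ : σ < (2 * r + 1) ^ k) :
    excess r k bs T (a * (2 * r + 1) ^ k + σ) ≠ 0 ↔ T σ = T (bs σ) + a := by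
  have hM : 0 < (2 * r + 1) ^ k := by positivity
  have e1 : (a * (2 * r + 1) ^ k + σ) / (2 * r + 1) ^ k = a := by
    rw [mul_comm, Nat.mul_add_div hM, Nat.div_eq_of_lt hσ, add_zero]
  have e2 : (a * (2 * r + 1) ^ k + σ) % (2 * r + 1) ^ k = σ := by
    rw [mul_comm, Nat.mul_add_mod, Nat.mod_eq_of_lt hσ]
  rw [excess, e1, e2]
  simp

/-- The intermediate results of the inverse transform are not larger than the product of the
transforms. -/
lemma cov_le_pr {i : ℕ} (f g : ℕ → ℕ) (hi : i ≤ k) (y : ℕ) :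
    cov r k i (zt r k f (k - i)) (zt r k g (k - i)) y ≤ pr r k (zt r k f k) (zt r k g k) y := by
  induction i with
  | zero => exact le_rfl
  | succ i ih =>
    refine le_trans ?_ (ih (by omega))
    have e : k - i = (k - (i + 1)) + 1 := by omega
    rw [e]
    simp only [zt]
    have e' : k - 1 - (k - (i + 1)) = i := by omega
    rw [e', ← zs_cov_succ (show i < k by omega)]
    exact Nat.le_add_right _ _

lemma pr_le {f g : ℕ → ℕ} (hf : ∀ y, f y ≤ (2 * r + 1) ^ k) (hg : ∀ y, g y ≤ (2 * r + 1) ^ k)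
    (y : ℕ) : pr r k f g y ≤ (y / (2 * r + 1) ^ k + 1) * ((2 * r + 1) ^ k * (2 * r + 1) ^ k) := by
  refine (Finset.sum_le_card_nsmul _ _ ((2 * r + 1) ^ k * (2 * r + 1) ^ k)
      fun a _ => Nat.mul_le_mul (hf _) (hg _)).trans ?_
  simp

/-- The time of a join. -/
def joinTime (r k : ℕ) : ℕ :=
  ((2 * r + 1) ^ k + 1) * (30 + 12) + (2 * (((k + 1) * (2 * r + 1) ^ k + 1) * (30 + 12)) +
    (3 * ((k + 1) * (20 + ((k + 1) * (2 * r + 1) ^ k + 1) * (30 + 12) + 12)) +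
    (((k + 1) * (2 * r + 1) ^ k + 1) * (2 + (6 + ((k + 1 + 1) * (30 + 12) + 10)) + 12) +
    ((2 * r + 1) ^ k + 1) * (4 + ((k + 1 + 1) * (30 + 12) + 20) + 12))))

/-- The hypotheses on `T₁` and `T₂` say that the codes without flags have solutions. -/
lemma join_spec {bs T₁ T₂ : ℕ → ℕ} (hs : Ctx r n k s) (hbs : s.arr aBs = bs)
    (hT₁ : ∀ σ < (2 * r + 1) ^ k, s.arr aT (s.reg 19 + σ) = T₁ σ)
    (hT₂ : ∀ σ < (2 * r + 1) ^ k, s.arr aF (s.reg 18 + σ) = T₂ σ)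
    (h1 : ∀ σ < (2 * r + 1) ^ k, T₁ (bs σ) ≤ n) (h2 : ∀ σ < (2 * r + 1) ^ k, T₂ (bs σ) ≤ n)
    (hW : (k + 1) * ((2 * r + 1) ^ k * (2 * r + 1) ^ k) ≤ W) (hW' : 3 * n + k + 1 ≤ W) :
    WP W join s (joinTime r k) fun s' =>
      Filled (s.arr aT) (s'.arr aT) (s.reg 19) ((2 * r + 1) ^ k) (fun σ v => ∀ m ≤ n, v ≤ m ↔
        ∃ i ≤ k, T₁ (bs σ) + T₂ (bs σ) + i ≤ m ∧
          ∃ σ₁ < (2 * r + 1) ^ k, ∃ σ₂ < (2 * r + 1) ^ k, Cover r k σ σ₁ σ₂ ∧ ∃ a ≤ i,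
            T₁ σ₁ = T₁ (bs σ₁) + a ∧ T₂ σ₂ = T₂ (bs σ₂) + (i - a)) ∧
      Filled (s.arr aP) (s'.arr aP) (s.reg 18) ((2 * r + 1) ^ k) (fun σ v => v = T₁ σ) := by
  have hM : 0 < (2 * r + 1) ^ k := by positivity
  have hW1 : (k + 1) * (2 * r + 1) ^ k ≤ W :=
    le_trans (Nat.mul_le_mul_left _ (Nat.le_mul_of_pos_left _ hM)) hW
  have hW2 : (2 * r + 1) ^ k ≤ W := le_trans (Nat.le_mul_of_pos_left _ (by omega)) hW1
  have hbase := hs.base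
  rw [hbs] at hbase
  have exc_congr : ∀ (T T' : ℕ → ℕ), (∀ σ < (2 * r + 1) ^ k, T σ = T' σ) → ∀ y,
      excess r k bs T y = excess r k bs T' y := by
    intro T T' h y
    have hy := Nat.mod_lt y hM
    rw [excess, excess, h _ hy, h _ (hbase _ hy).1]
  have hzt : ∀ (T : ℕ → ℕ), ∀ i ≤ k, ∀ y, zt r k (excess r k bs T) i y ≤ (2 * r + 1) ^ k :=
    fun T i hi y => (zt_le (excess_le_one bs T) i y).trans (Nat.pow_le_pow_right (by omega) hi)
  have hz : ∀ {a : ℕ} {T : ℕ → ℕ} (s' : State), Ctx r n k s' →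
      decide (a ∉ [aPw, aBs]) = true →
      (∀ y < (k + 1) * (2 * r + 1) ^ k, s'.arr a y = excess r k bs T y) →
      WP W (sweep .add a (reg rK - 1 - reg 12)) s'
        ((k + 1) * (20 + ((k + 1) * (2 * r + 1) ^ k + 1) * (30 + 12) + 12)) fun s'' =>
        ∀ y < (k + 1) * (2 * r + 1) ^ k, s''.arr a y = zt r k (excess r k bs T) k y := by
    intro a T s' hc ha h
    refine sweep_spec (J := fun i => k - 1 - i) (g := fun i => zt r k (excess r k bs T) i) hc ha
      rfl rfl (fun i hi s'' e1 e2 => by simp [e1, e2]) (fun i hi => by omega) hW1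
      (fun i hi y _ => (hzt T i hi y).trans hW2) h fun i hi y => ?_
    simp only [zt, zs, Pi.add_apply, sh, Op.eval]
    split_ifs <;> rfl
  have T1 : joinTime r k = ((2 * r + 1) ^ k + 1) * (30 + 12) +
    (((k + 1) * (2 * r + 1) ^ k + 1) * (30 + 12) + (((k + 1) * (2 * r + 1) ^ k + 1) * (30 + 12) +
    ((k + 1) * (20 + ((k + 1) * (2 * r + 1) ^ k + 1) * (30 + 12) + 12) +
    ((k + 1) * (20 + ((k + 1) * (2 * r + 1) ^ k + 1) * (30 + 12) + 12) +
    (((k + 1) * (2 * r + 1) ^ k + 1) * (2 + (6 + ((k + 1 + 1) * (30 + 12) + 10)) + 12) +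
    ((k + 1) * (20 + ((k + 1) * (2 * r + 1) ^ k + 1) * (30 + 12) + 12) +
    ((2 * r + 1) ^ k + 1) * (4 + ((k + 1 + 1) * (30 + 12) + 20) + 12))))))) := by
    rw [joinTime]; ring
  rw [T1, join]
  refine .seq' (copyTable_spec hs hW2) fun s₁ h₁ F₁ => ?_
  have c₁ : Ctx r n k s₁ := hs.of_frame F₁ rfl rfl
  have r18₁ := F₁.reg 18 (by decide)
  have r19₁ := F₁.reg 19 (by decide)
  have b₁ := (F₁.arr aBs (by decide)).trans hbs
  have p₁ : ∀ σ < (2 * r + 1) ^ k, s₁.arr aP (s.reg 18 + σ) = T₁ σ := fun σ hσ => by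
    rw [h₁.1 σ hσ, hT₁ σ hσ]
  have f₁ : ∀ σ < (2 * r + 1) ^ k, s₁.arr aF (s.reg 18 + σ) = T₂ σ := fun σ hσ => by
    rw [F₁.arr aF (by decide), hT₂ σ hσ]
  refine .seq' (fillExcess_spec c₁ rfl (by decide) hW1) fun s₂ h₂ F₂ => ?_
  have c₂ : Ctx r n k s₂ := c₁.of_frame F₂ rfl rfl
  refine .seq' (fillExcess_spec c₂ rfl (by decide) hW1) fun s₃ h₃ F₃ => ?_
  have c₃ : Ctx r n k s₃ := c₂.of_frame F₃ rfl rfl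
  have z₃ : ∀ y < (k + 1) * (2 * r + 1) ^ k, s₃.arr aZ y = excess r k bs T₁ y := fun y hy => by
    rw [F₃.arr aZ (by decide), h₂ y hy, b₁, r18₁]
    exact exc_congr _ _ p₁ y
  have y₃ : ∀ y < (k + 1) * (2 * r + 1) ^ k, s₃.arr aY y = excess r k bs T₂ y := fun y hy => by
    rw [h₃ y hy, F₂.arr aBs (by decide), b₁, F₂.reg 18 (by decide), r18₁, F₂.arr aF (by decide)]
    exact exc_congr _ _ f₁ y
  refine .seq' (hz s₃ c₃ rfl z₃) fun s₄ h₄ F₄ => ?_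
  have c₄ : Ctx r n k s₄ := c₃.of_frame F₄ rfl rfl
  refine .seq' (hz (T := T₂) s₄ c₄ rfl fun y hy => by rw [F₄.arr aY (by decide), y₃ y hy])
    fun s₅ h₅ F₅ => ?_
  have c₅ : Ctx r n k s₅ := c₄.of_frame F₅ rfl rfl
  refine .seq' (product_spec c₅ (fun y hy => by rw [F₅.arr aZ (by decide), h₄ y hy]) h₅
    (hzt T₁ k le_rfl) (hzt T₂ k le_rfl) hW) fun s₆ h₆ F₆ => ?_
  have c₆ : Ctx r n k s₆ := c₅.of_frame F₆ rfl rfl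
  refine .seq' (sweep_spec (J := fun i => i)
      (g := fun i => cov r k i (zt r k (excess r k bs T₁) (k - i))
        (zt r k (excess r k bs T₂) (k - i))) c₆
      rfl rfl rfl (fun i hi s'' e1 e2 => by simp [e2]) (fun i hi => hi) hW1 (fun i hi y hy => ?_) ?_
      fun i hi y => ?_) fun s₇ h₇ F₇ => ?_
  · refine (cov_le_pr _ _ hi y).trans ((pr_le (hzt T₁ k le_rfl) (hzt T₂ k le_rfl) y).trans ?_)
    refine (Nat.mul_le_mul_right _ ?_).trans hW
    rw [← Nat.div_lt_iff_lt_mul hM] at hy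
    omega
  · exact h₆
  · have e : k - i = (k - (i + 1)) + 1 := by omega
    have e' : k - 1 - (k - (i + 1)) = i := by omega
    simp only [e, zt, e']
    rw [← zs_cov_succ hi]
    have := zs_sub_sh (r := r) (j := i) (f := cov r k (i + 1) (zt r k (excess r k bs T₁)
      (k - (i + 1))) (zt r k (excess r k bs T₂) (k - (i + 1)))) y
    rw [sh] at this
    simp only [Op.eval]
    split_ifs at this ⊢ <;> omega
  have c₇ : Ctx r n k s₇ := c₆.of_frame F₇ rfl rfl
  have r18₇ : s₇.reg 18 = s.reg 18 := by
    rw [F₇.reg 18 (by decide), F₆.reg 18 (by decide), F₅.reg 18 (by decide), F₄.reg 18 (by decide),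
      F₃.reg 18 (by decide), F₂.reg 18 (by decide), r18₁]
  have r19₇ : s₇.reg 19 = s.reg 19 := by
    rw [F₇.reg 19 (by decide), F₆.reg 19 (by decide), F₅.reg 19 (by decide), F₄.reg 19 (by decide),
      F₃.reg 19 (by decide), F₂.reg 19 (by decide), r19₁]
  have keep : ∀ a, a ∉ [aZ, aY, aH] → s₇.arr a = s₁.arr a := fun a ha => by
    simp only [List.mem_cons, List.not_mem_nil, or_false, not_or] at ha
    obtain ⟨a1, a2, a3⟩ := ha
    rw [F₇.arr a (by simpa [sweep, sweepDir, Prog.for, modA] using a3),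
      F₆.arr a (by simpa [product, Prog.for, modA] using a3),
      F₅.arr a (by simpa [sweep, sweepDir, Prog.for, modA] using a2),
      F₄.arr a (by simpa [sweep, sweepDir, Prog.for, modA] using a1),
      F₃.arr a (by simpa [fillExcess, Prog.for, modA] using a2),
      F₂.arr a (by simpa [fillExcess, Prog.for, modA] using a1)]
  have b₇ := (keep aBs (by decide)).trans b₁
  have p₇ := keep aP (by decide)
  have f₇ := keep aF (by decide)
  have t₇ := (keep aT (by decide)).trans (F₁.arr aT (by decide))
  refine ((extract_spec c₇ h₇ (fun σ hσ => ?_) (fun σ hσ => ?_) hW1 hW').frame).mono le_rfl ?_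
  · rw [p₇, b₇, r18₇, p₁ _ (hbase σ hσ).1]; exact h1 σ hσ
  · rw [f₇, b₇, r18₇, f₁ _ (hbase σ hσ).1]; exact h2 σ hσ
  rintro s₈ ⟨h₈, F₈⟩
  rw [t₇, r19₇] at h₈
  refine ⟨⟨fun σ hσ m hm => ?_, h₈.2⟩, ⟨fun σ hσ => ?_, fun y hy => ?_⟩⟩
  · rw [h₈.1 σ hσ m hm, p₇, b₇, r18₇, f₇, p₁ _ (hbase σ hσ).1, f₁ _ (hbase σ hσ).1]
    refine exists_congr fun i => and_congr_right fun hi => and_congr_right fun _ => ?_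
    simp only [Nat.sub_self, zt]
    rw [cov_ne_zero_iff hσ]
    refine exists_congr fun σ₁ => and_congr_right fun l1 => exists_congr fun σ₂ =>
      and_congr_right fun l2 => and_congr_right fun _ => exists_congr fun a =>
      and_congr_right fun _ => ?_
    rw [excess_ne_zero l1, excess_ne_zero l2]
  · rw [F₈.arr aP (by decide), p₇, p₁ σ hσ]
  · rw [F₈.arr aP (by decide), p₇, h₁.2 y hy]

end join

/-- Filling the block of `x` does not change the other blocks. -/
lemma Filled.of_ne {A A' : ℕ → ℕ} {M x y σ : ℕ} {R : ℕ → ℕ → Prop} (h : Filled A A' (x * M) M R)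
    (hyx : y ≠ x) (hσ : σ < M) : A' (y * M + σ) = A (y * M + σ) := by
  refine h.2 _ ?_
  rcases Nat.lt_or_gt_of_ne hyx with hlt | hlt
  · left
    calc y * M + σ < (y + 1) * M := by rw [Nat.succ_mul]; omega
      _ ≤ x * M := Nat.mul_le_mul_right _ hlt
  · right
    calc x * M + M = (x + 1) * M := (Nat.succ_mul _ _).symm
      _ ≤ y * M := Nat.mul_le_mul_right _ hlt
      _ ≤ y * M + σ := Nat.le_add_right _ _

/-! ### The elimination of a vertex -/

section forget

variable {W r n k : ℕ} {s : State}

/-- For the codes with digit `0` at the slot with power `reg 14`, the minimum of the values with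
digit `0` or a flag there. -/
def forgetMin : Prog :=
  .for 11 (reg rM) (setReg 15 ((reg 11 / reg 14) % reg rB) ;;
    branch (lt (reg rR) (reg 15))
      (branch (lt (arr aT (reg 18 + reg 11)) (arr aF (reg 18 + (reg 11 - reg 15 * reg 14))))
        (setArr aF (reg 18 + (reg 11 - reg 15 * reg 14)) (arr aT (reg 18 + reg 11))) skip)
      (branch (reg 15) skip (setArr aF (reg 18 + reg 11) (arr aT (reg 18 + reg 11)))))

lemma forgetMin_spec {j : ℕ} (hs : Ctx r n k s) (h14 : s.reg 14 = (2 * r + 1) ^ j)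
    (hW : (2 * r + 1) ^ k ≤ W) :
    WP W forgetMin s (((2 * r + 1) ^ k + 1) * (60 + 12)) fun s' =>
      (∀ σ < (2 * r + 1) ^ k, dg r σ j = 0 → ∀ m, s'.arr aF (s.reg 18 + σ) ≤ m ↔
        ∃ τ < (2 * r + 1) ^ k, τ - dg r τ j * (2 * r + 1) ^ j = σ ∧
          (dg r τ j = 0 ∨ r < dg r τ j) ∧ s.arr aT (s.reg 18 + τ) ≤ m) ∧
      ∀ y, y < s.reg 18 ∨ s.reg 18 + (2 * r + 1) ^ k ≤ y → s'.arr aF y = s.arr aF y := by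
  refine WP.for ((2 * r + 1) ^ k) (fun i s' =>
      (∀ σ < i, dg r σ j = 0 → ∀ m, s'.arr aF (s.reg 18 + σ) ≤ m ↔
        ∃ τ < i, τ - dg r τ j * (2 * r + 1) ^ j = σ ∧
          (dg r τ j = 0 ∨ r < dg r τ j) ∧ s.arr aT (s.reg 18 + τ) ≤ m) ∧
      ∀ y, y < s.reg 18 ∨ s.reg 18 + (2 * r + 1) ^ k ≤ y → s'.arr aF y = s.arr aF y) rfl hW
    (fun s' hF => by simpa [hs.M_eq] using hF.reg 6 (by decide)) (by simp) ?_ (fun s' _ _ h => h)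
  intro i s₁ hi hx hF ⟨hI, hO⟩
  have hc : Ctx r n k s₁ := hs.of_frame hF rfl rfl
  have e14 := (hF.reg 14 (by decide)).trans h14
  have e18 := hF.reg 18 (by decide)
  have eT := hF.arr aT (by decide)
  have hdg : i / (2 * r + 1) ^ j % (2 * r + 1) = dg r i j := rfl
  set g := dg r i j with hg
  have hle : i - g * (2 * r + 1) ^ j ≤ i := Nat.sub_le _ _
  have hpos : 0 < (2 * r + 1) ^ j := by positivity
  have hmul := mul_pow_le_of_le_dg hg.le
  have hz : dg r (i - g * (2 * r + 1) ^ j) j = 0 := by rw [dg_sub hg.le, if_pos rfl]; omega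
  -- the codes below `i + 1` contribute to another code than `i` does
  have other : ∀ σ m, σ ≠ i - g * (2 * r + 1) ^ j ∨ ¬ (g = 0 ∨ r < g) →
      ((∃ τ < i + 1, τ - dg r τ j * (2 * r + 1) ^ j = σ ∧
        (dg r τ j = 0 ∨ r < dg r τ j) ∧ s.arr aT (s.reg 18 + τ) ≤ m) ↔
      ∃ τ < i, τ - dg r τ j * (2 * r + 1) ^ j = σ ∧
        (dg r τ j = 0 ∨ r < dg r τ j) ∧ s.arr aT (s.reg 18 + τ) ≤ m) := by
    intro σ m h
    constructor
    · rintro ⟨τ, h1, h2, h3, h4⟩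
      refine ⟨τ, ?_, h2, h3, h4⟩
      by_contra hlt
      obtain rfl : τ = i := by omega
      rcases h with h | h
      · exact h h2.symm
      · exact h h3
    · rintro ⟨τ, h1, h2⟩
      exact ⟨τ, by omega, h2⟩
  refine .of_vc rfl rfl ⟨trivial, ?_⟩
  simp only [vc, eval_lt, eval_reg, eval_arr, eval_add, eval_sub, eval_mul, eval_div, eval_mod,
    State.setR_reg, State.setR_arr, State.setA_arr, hx, e14, e18, eT, hc.b_eq, hc.r_eq, hdg,
    Nat.reduceEqDiff, if_true, if_false, OfNat.zero_ne_ofNat,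
    Bd_arr, true_and]
  refine ⟨fun hlt => ?_, fun hlt => ⟨fun h0 => ?_, fun h0 => ?_⟩⟩
  · have hlt : r < g := by by_contra h; exact hlt (if_neg h)
    have hlt' : i - g * (2 * r + 1) ^ j < i := by
      have : 0 < g * (2 * r + 1) ^ j := Nat.mul_pos (by omega) hpos
      omega
    have hmin : ∀ m, (s₁.arr aF (s.reg 18 + (i - g * (2 * r + 1) ^ j)) ≤ m ∨
        s.arr aT (s.reg 18 + i) ≤ m) ↔
        ∃ τ < i + 1, τ - dg r τ j * (2 * r + 1) ^ j = i - g * (2 * r + 1) ^ j ∧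
        (dg r τ j = 0 ∨ r < dg r τ j) ∧ s.arr aT (s.reg 18 + τ) ≤ m := by
      intro m
      rw [hI _ hlt' hz m]
      constructor
      · rintro (⟨τ, h1, h2⟩ | h)
        · exact ⟨τ, by omega, h2⟩
        · exact ⟨i, by omega, rfl, .inr hlt, h⟩
      · rintro ⟨τ, h1, h2, h3, h4⟩
        rcases Nat.lt_succ_iff_lt_or_eq.1 h1 with h1 | rfl
        · exact .inl ⟨τ, h1, h2, h3, h4⟩
        · exact .inr h4
    refine ⟨fun hT => ⟨fun σ hσ h0 m => ?_, fun y hy => ?_⟩, fun hT => ⟨fun σ hσ h0 m => ?_, hO⟩⟩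
    · have hT : s.arr aT (s.reg 18 + i) < s₁.arr aF (s.reg 18 + (i - g * (2 * r + 1) ^ j)) := by
        by_contra h; exact hT (if_neg h)
      by_cases hσi : σ = i - g * (2 * r + 1) ^ j
      · subst hσi
        rw [Function.update_self, ← hmin m]
        omega
      · have hσi' : σ < i := by
          rcases Nat.lt_succ_iff_lt_or_eq.1 hσ with h | rfl
          · exact h
          · omega
        rw [Function.update_of_ne (by omega), other σ m (.inl hσi), hI σ hσi' h0]
    · rw [Function.update_of_ne (by omega)]; exact hO y hy
    · have hT : ¬ s.arr aT (s.reg 18 + i) < s₁.arr aF (s.reg 18 + (i - g * (2 * r + 1) ^ j)) :=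
        fun h => by simp [h] at hT
      by_cases hσi : σ = i - g * (2 * r + 1) ^ j
      · subst hσi
        rw [← hmin m]
        omega
      · have hσi' : σ < i := by
          rcases Nat.lt_succ_iff_lt_or_eq.1 hσ with h | rfl
          · exact h
          · omega
        rw [other σ m (.inl hσi), hI σ hσi' h0]
  · have hlt : ¬ r < g := fun h => by simp [h] at hlt
    refine ⟨fun σ hσ hσ0 m => ?_, hO⟩
    have hσi' : σ < i := by
      rcases Nat.lt_succ_iff_lt_or_eq.1 hσ with h | rfl
      · exact h
      · omega
    rw [other σ m (.inr (by omega)), hI σ hσi' hσ0]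
  · simp only [h0, Nat.zero_mul, Nat.sub_zero] at other
    refine ⟨fun σ hσ hσ0 m => ?_, fun y hy => ?_⟩
    · by_cases hσi : σ = i
      · subst hσi
        rw [Function.update_self]
        constructor
        · exact fun h => ⟨σ, by omega, by rw [← hg, h0]; simp, .inl hσ0, h⟩
        · rintro ⟨τ, h1, h2, h3, h4⟩
          obtain rfl : τ = σ := by omega
          exact h4
      · rw [Function.update_of_ne (by omega), other σ m (.inl hσi), hI σ (by omega) hσ0]
    · rw [Function.update_of_ne (by omega)]; exact hO y hy

/-- Extend the minima to the codes with other digits at the slot with power `reg 14`. -/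
def forgetFill : Prog :=
  .for 11 (reg rM) (setReg 15 ((reg 11 / reg 14) % reg rB) ;;
    branch (lt (reg rR) (reg 15)) (setArr aF (reg 18 + reg 11) (reg rN + 1))
      (setArr aF (reg 18 + reg 11) (arr aF (reg 18 + (reg 11 - reg 15 * reg 14)))))

lemma forgetFill_spec {j : ℕ} (hs : Ctx r n k s) (h14 : s.reg 14 = (2 * r + 1) ^ j)
    (hW : (2 * r + 1) ^ k ≤ W) (hW' : n + 1 ≤ W) :
    WP W forgetFill s (((2 * r + 1) ^ k + 1) * (60 + 12)) fun s' =>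
      Filled (s.arr aF) (s'.arr aF) (s.reg 18) ((2 * r + 1) ^ k) fun σ v =>
        v = if r < dg r σ j then n + 1
          else s.arr aF (s.reg 18 + (σ - dg r σ j * (2 * r + 1) ^ j)) := by
  refine WP.for ((2 * r + 1) ^ k) (fun i s' => Filled (s.arr aF) (s'.arr aF) (s.reg 18) i
    fun σ v => v = if r < dg r σ j then n + 1
      else s.arr aF (s.reg 18 + (σ - dg r σ j * (2 * r + 1) ^ j))) rfl hW
    (fun s' hF => by simpa [hs.M_eq] using hF.reg 6 (by decide)) (Filled.zero _ _ _) ?_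
    (fun s' _ _ h => h)
  intro i s₁ hi hx hF hI
  have hc : Ctx r n k s₁ := hs.of_frame hF rfl rfl
  have e14 := (hF.reg 14 (by decide)).trans h14
  have e18 := hF.reg 18 (by decide)
  have hdg : i / (2 * r + 1) ^ j % (2 * r + 1) = dg r i j := rfl
  refine .of_vc rfl rfl ⟨trivial, ?_⟩
  simp only [vc, eval_lt, eval_reg, eval_arr, eval_add, eval_sub, eval_mul, eval_div, eval_mod,
    State.setR_reg, State.setR_arr, State.setA_arr, hx, e14, e18, hc.b_eq, hc.r_eq, hdg,
    Nat.reduceEqDiff, if_true, if_false, OfNat.zero_ne_ofNat, hc.n_eq,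
    OfNat.one_ne_ofNat, Bd_arr, Bd_add, true_and, eval_ofNat]
  refine ⟨fun hlt => ⟨hW', hI.step ?_⟩, fun hlt => hI.step ?_⟩
  · rw [if_pos]; by_contra h; exact hlt (if_neg h)
  · have hlt : ¬ r < dg r i j := fun h => by simp [h] at hlt
    rw [if_neg hlt]
    rcases Nat.eq_zero_or_pos (dg r i j) with h0 | h0
    · rw [h0]; simp only [Nat.zero_mul, Nat.sub_zero]
      exact hI.2 _ (.inr le_rfl)
    · have hpos : 0 < dg r i j * (2 * r + 1) ^ j := by positivity
      have hmul := mul_pow_le_of_le_dg (le_refl (dg r i j))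
      rw [hI.1 (i - dg r i j * (2 * r + 1) ^ j) (by omega)]
      have hz : dg r (i - dg r i j * (2 * r + 1) ^ j) j = 0 := by
        rw [dg_sub le_rfl, if_pos rfl]; omega
      rw [hz, if_neg (by omega), Nat.zero_mul, Nat.sub_zero]

/-- Compute the table in `aF` from the table in `aT` by eliminating the vertex `reg 10`. -/
def forget : Prog := setReg 14 (arr aPw (arr aCol (reg 10))) ;; forgetMin ;; forgetFill

lemma sub_dg_eq_iff {σ τ j : ℕ} (hσ : σ < (2 * r + 1) ^ k) (hτ : τ < (2 * r + 1) ^ k) :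
    τ - dg r τ j * (2 * r + 1) ^ j = σ - dg r σ j * (2 * r + 1) ^ j ↔
      ∀ i < k, i ≠ j → dg r τ i = dg r σ i := by
  constructor
  · intro h i hi hij
    have h1 := dg_sub (le_refl (dg r τ j)) i
    have h2 := dg_sub (le_refl (dg r σ j)) i
    rw [if_neg hij] at h1 h2
    rw [← h1, ← h2, h]
  · intro h
    refine code_ext ((Nat.sub_le _ _).trans_lt hτ) ((Nat.sub_le _ _).trans_lt hσ) fun i hi => ?_
    rw [dg_sub le_rfl, dg_sub le_rfl]
    split_ifs with hij
    · omega
    · exact h i hi hij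

lemma forget_spec {x : ℕ} (hs : Ctx r n k s) (h10 : s.reg 10 = x) (hj : s.arr aCol x < k)
    (hW : (2 * r + 1) ^ k ≤ W) (hW' : n + 1 ≤ W) :
    WP W forget s (4 + (((2 * r + 1) ^ k + 1) * (60 + 12) + ((2 * r + 1) ^ k + 1) * (60 + 12)))
      fun s' => Filled (s.arr aF) (s'.arr aF) (s.reg 18) ((2 * r + 1) ^ k) fun σ v =>
        ∀ m ≤ n, v ≤ m ↔ ¬ r < dg r σ (s.arr aCol x) ∧ ∃ τ < (2 * r + 1) ^ k,
          (∀ i < k, i ≠ s.arr aCol x → dg r τ i = dg r σ i) ∧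
          (dg r τ (s.arr aCol x) = 0 ∨ r < dg r τ (s.arr aCol x)) ∧
          s.arr aT (s.reg 18 + τ) ≤ m := by
  set j := s.arr aCol x with hjdef
  refine .seq (.of_vc rfl rfl ⟨trivial, ?_⟩)
  set s₁ := s.setR 14 ((arr aPw (arr aCol (reg 10))).eval s) with hs₁
  have c₁ : Ctx r n k s₁ := ⟨by simp [hs₁, hs.r_eq], by simp [hs₁, hs.n_eq], by simp [hs₁, hs.k_eq],
    by simp [hs₁, hs.b_eq], by simp [hs₁, hs.M_eq], by simp [hs₁, hs.L_eq], hs.pw_eq, hs.base⟩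
  have h14 : s₁.reg 14 = (2 * r + 1) ^ j := by simp [hs₁, h10, ← hjdef, hs.pw_eq _ hj.le]
  have h18 : s₁.reg 18 = s.reg 18 := by simp [hs₁]
  have hT : s₁.arr aT = s.arr aT := rfl
  have hF : s₁.arr aF = s.arr aF := rfl
  refine .seq' (forgetMin_spec c₁ h14 hW) fun s₂ h₂ F₂ => ?_
  have c₂ : Ctx r n k s₂ := c₁.of_frame F₂ rfl rfl
  have h14₂ := (F₂.reg 14 (by decide)).trans h14
  have h18₂ := (F₂.reg 18 (by decide)).trans h18
  rw [h18, hT] at h₂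
  refine (forgetFill_spec c₂ h14₂ hW hW').mono le_rfl fun s₃ h₃ => ?_
  rw [h18₂] at h₃
  refine ⟨fun σ hσ m hm => ?_, fun y hy => by rw [h₃.2 y hy, h₂.2 y hy, hF]⟩
  rw [h₃.1 σ hσ]
  split_ifs with h
  · simp [h]; omega
  · rw [h₂.1 _ ((Nat.sub_le _ _).trans_lt hσ) (by rw [dg_sub le_rfl, if_pos rfl]; omega)]
    simp only [h, not_false_iff, true_and]
    refine exists_congr fun τ => and_congr_right fun hτ => ?_
    rw [sub_dg_eq_iff hσ hτ]

end forget

/-! ### The initial tables -/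

section init

variable {W r n k : ℕ} {s : State}

/-- Collect the conditions on the initial table: register `16` reports an unsatisfied flag of a
smaller vertex, register `17` a neighbour with a smaller label than the vertex `reg 10`. -/
def initScan : Prog :=
  .for 12 (reg rK) (setReg 14 ((reg 11 / arr aPw (reg 12)) % reg rB) ;;
    setReg 15 (reg 14 - reg rR * lt (reg rR) (reg 14)) ;;
    branch (arr aAdj (reg 20 + reg 12)) (branch (lt (reg 15) (reg 22)) (setReg 17 1) skip) skip ;;
    branch (lt (reg rR) (reg 14)) (branch (eq (reg 12) (arr aCol (reg 10))) skip
      (branch (arr aAdj (reg 20 + reg 12))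
        (branch (lt (reg 22) (reg 15)) skip (setReg 16 1)) (setReg 16 1))) skip)

lemma initScan_spec {σ c : ℕ} (hs : Ctx r n k s) (h11 : s.reg 11 = σ)
    (hc : s.arr aCol (s.reg 10) = c) (h16 : s.reg 16 = 0) (h17 : s.reg 17 = 0) (hk : k ≤ W) :
    WP W initScan s ((k + 1) * (80 + 12)) fun s' =>
      (s'.reg 16 ≠ 0 ↔ ∃ j < k, r < dg r σ j ∧ j ≠ c ∧
        ¬ (s.arr aAdj (s.reg 20 + j) ≠ 0 ∧ s.reg 22 < lb r σ j)) ∧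
      (s'.reg 17 ≠ 0 ↔ ∃ j < k, s.arr aAdj (s.reg 20 + j) ≠ 0 ∧ lb r σ j < s.reg 22) := by
  refine WP.for k (fun i s' =>
      (s'.reg 16 ≠ 0 ↔ ∃ j < i, r < dg r σ j ∧ j ≠ c ∧
        ¬ (s.arr aAdj (s.reg 20 + j) ≠ 0 ∧ s.reg 22 < lb r σ j)) ∧
      (s'.reg 17 ≠ 0 ↔ ∃ j < i, s.arr aAdj (s.reg 20 + j) ≠ 0 ∧ lb r σ j < s.reg 22)) rfl hk
    (fun s' hF => by simpa [hs.k_eq] using hF.reg 4 (by decide)) (by simp [h16, h17]) ?_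
    (fun s' _ _ h => h)
  intro i s₁ hi hx hF ⟨hI1, hI2⟩
  have hc₁ : Ctx r n k s₁ := hs.of_frame hF rfl rfl
  have e11 := (hF.reg 11 (by decide)).trans h11
  have e10 := hF.reg 10 (by decide)
  have e20 := hF.reg 20 (by decide)
  have e22 := hF.reg 22 (by decide)
  have eA := hF.arr aAdj (by decide)
  have eC := hF.arr aCol (by decide)
  have hdg : σ / (2 * r + 1) ^ i % (2 * r + 1) = dg r σ i := rfl
  have hlb : dg r σ i - r * (if r < dg r σ i then 1 else 0) = lb r σ i := by
    rw [lb]; split_ifs <;> simp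
  have step : ∀ (P : ℕ → Prop), (∃ j < i + 1, P j) ↔ (∃ j < i, P j) ∨ P i := by
    intro P
    constructor
    · rintro ⟨j, hj, h⟩
      rcases Nat.lt_succ_iff_lt_or_eq.1 hj with hj | rfl
      exacts [.inl ⟨j, hj, h⟩, .inr h]
    · rintro (⟨j, hj, h⟩ | h)
      exacts [⟨j, by omega, h⟩, ⟨i, by omega, h⟩]
  refine .of_vc rfl rfl ?_
  simp only [vc, eval_lt, eval_eq, eval_reg, eval_arr, eval_add, eval_sub, eval_mul, eval_div,
    eval_mod, State.setR_reg, State.setR_arr, hx, e11, e10, e20, e22, eA, eC, hc₁.b_eq, hc₁.r_eq,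
    hc₁.pw_eq i hi.le, hdg, hlb, hc, Nat.reduceEqDiff, if_true, if_false,
    OfNat.zero_ne_ofNat, Bd_mod, Bd_div, Bd_sub, Bd_reg, Bd_ofNat, true_and, eval_ofNat,
    step (fun j => r < dg r σ j ∧ j ≠ c ∧ ¬ (s.arr aAdj (s.reg 20 + j) ≠ 0 ∧ s.reg 22 < lb r σ j)),
    step (fun j => s.arr aAdj (s.reg 20 + j) ≠ 0 ∧ lb r σ j < s.reg 22)]
  simp only [← hI1, ← hI2]
  clear step
  by_cases h4 : i = c
  · subst h4
    by_cases hA : s.arr aAdj (s.reg 20 + i) = 0 <;> by_cases h1 : lb r σ i < s.reg 22 <;>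
      by_cases h3 : r < dg r σ i <;> simp [hA, h1, h3]
  · by_cases hA : s.arr aAdj (s.reg 20 + i) = 0 <;> by_cases h1 : lb r σ i < s.reg 22 <;>
      by_cases h2 : s.reg 22 < lb r σ i <;> by_cases h3 : r < dg r σ i <;>
      simp [hA, h1, h2, h3, h4]

/-- The initial table of the vertex `reg 10`. -/
def initTable : Prog :=
  .for 11 (reg rM)
    ((setReg 21 ((reg 11 / arr aPw (arr aCol (reg 10))) % reg rB) ;;
      setReg 22 (reg 21 - reg rR * lt (reg rR) (reg 21)) ;; setReg 16 0 ;; setReg 17 0) ;;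
    initScan ;;
    branch (lt (reg rR) (reg 21)) (branch (reg 17) skip (setReg 16 1)) skip ;;
    branch (reg 16) (setArr aT (reg 18 + reg 11) (reg rN + 1))
      (setArr aT (reg 18 + reg 11) (eq (reg 22) 0)))

lemma initTable_spec {c : ℕ} (hs : Ctx r n k s) (hc : s.arr aCol (s.reg 10) = c) (hck : c < k)
    (hk : k ≤ W) (hW : (2 * r + 1) ^ k ≤ W) (hW' : n + 1 ≤ W) :
    WP W initTable s (((2 * r + 1) ^ k + 1) * (30 + ((k + 1) * (80 + 12) + 50) + 12)) fun s' =>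
      Filled (s.arr aT) (s'.arr aT) (s.reg 18) ((2 * r + 1) ^ k) fun σ v => ∀ m ≤ n, v ≤ m ↔
        (∀ j < k, Flg r σ j → (j = c ∧ ∃ i < k, s.arr aAdj (s.reg 20 + i) ≠ 0 ∧ lb r σ i < lb r σ c) ∨
          (s.arr aAdj (s.reg 20 + j) ≠ 0 ∧ lb r σ c < lb r σ j)) ∧
        (if lb r σ c = 0 then 1 else 0) ≤ m := by
  refine WP.for ((2 * r + 1) ^ k) (fun i s' => Filled (s.arr aT) (s'.arr aT) (s.reg 18) i
    fun σ v => ∀ m ≤ n, v ≤ m ↔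
        (∀ j < k, Flg r σ j → (j = c ∧ ∃ i < k, s.arr aAdj (s.reg 20 + i) ≠ 0 ∧ lb r σ i < lb r σ c) ∨
          (s.arr aAdj (s.reg 20 + j) ≠ 0 ∧ lb r σ c < lb r σ j)) ∧
        (if lb r σ c = 0 then 1 else 0) ≤ m) rfl hW
    (fun s' hF => by simpa [hs.M_eq] using hF.reg 6 (by decide)) (Filled.zero _ _ _) ?_
    (fun s' _ _ h => h)
  intro i s₁ hi hx hF hI
  have c₁ : Ctx r n k s₁ := hs.of_frame hF rfl rfl
  have e10 := hF.reg 10 (by decide)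
  have e18 := hF.reg 18 (by decide)
  have e20 := hF.reg 20 (by decide)
  have eA := hF.arr aAdj (by decide)
  have eC := hF.arr aCol (by decide)
  have hdg : i / (2 * r + 1) ^ c % (2 * r + 1) = dg r i c := rfl
  have hlb : dg r i c - r * (if r < dg r i c then 1 else 0) = lb r i c := by
    rw [lb]; split_ifs <;> simp
  refine .mono (T := 30 + ((k + 1) * (80 + 12) + 50)) ?_ le_rfl fun _ h => h
  refine .seq' (Q' := fun s' => s'.reg 21 = dg r i c ∧ s'.reg 22 = lb r i c ∧ s'.reg 16 = 0 ∧
    s'.reg 17 = 0) (.of_vc rfl rfl ?_) fun s₂ ⟨h21, h22, h16, h17⟩ F₂ => ?_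
  · rw [mul_ite, mul_one, mul_zero] at hlb
    simp [vc, e10, eC, hc, hx, c₁.pw_eq c hck.le, c₁.b_eq, c₁.r_eq, hdg, hlb]
  have c₂ : Ctx r n k s₂ := c₁.of_frame F₂ rfl rfl
  have e10₂ := (F₂.reg 10 (by decide)).trans e10
  have e11₂ := (F₂.reg 11 (by decide)).trans hx
  have e18₂ := (F₂.reg 18 (by decide)).trans e18
  have e20₂ := (F₂.reg 20 (by decide)).trans e20
  have eA₂ := (F₂.arr aAdj (by decide)).trans eA
  have eC₂ := (F₂.arr aCol (by decide)).trans eC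
  refine .seq' (initScan_spec (c := c) c₂ e11₂ (by rw [e10₂, eC₂, hc]) h16 h17 hk)
    fun s₃ ⟨h16', h17'⟩ F₃ => ?_
  have c₃ : Ctx r n k s₃ := c₂.of_frame F₃ rfl rfl
  have e11₃ := (F₃.reg 11 (by decide)).trans e11₂
  have e18₃ := (F₃.reg 18 (by decide)).trans e18₂
  have e21₃ := (F₃.reg 21 (by decide)).trans h21
  have e22₃ := (F₃.reg 22 (by decide)).trans h22
  have eT : s₃.arr aT = s₁.arr aT := (F₃.arr aT (by decide)).trans (F₂.arr aT (by decide))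
  rw [e20₂, eA₂, h22] at h16' h17'
  -- the condition on the flags fails
  have bad : ((r < dg r i c ∧ s₃.reg 17 = 0) ∨ s₃.reg 16 ≠ 0) ↔ ¬ ∀ j < k, Flg r i j →
      (j = c ∧ ∃ i' < k, s.arr aAdj (s.reg 20 + i') ≠ 0 ∧ lb r i i' < lb r i c) ∨
          (s.arr aAdj (s.reg 20 + j) ≠ 0 ∧ lb r i c < lb r i j) := by
    rw [← h17', h16']
    simp only [Flg]
    push Not
    constructor
    · rintro (⟨h1, h2⟩ | ⟨j, h1, h2, h3, h4⟩)
      · exact ⟨c, hck, h1, fun _ => h2, fun _ => le_rfl⟩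
      · exact ⟨j, h1, h2, fun h => (h3 h).elim, h4⟩
    · rintro ⟨j, h1, h2, h3, h4⟩
      by_cases hj : j = c
      · exact .inl ⟨hj ▸ h2, h3 hj⟩
      · exact .inr ⟨j, h1, h2, hj, h4⟩
  have full : s₃.arr aT = s₁.arr aT → ∀ (v : ℕ), (¬ ((r < dg r i c ∧ s₃.reg 17 = 0) ∨ s₃.reg 16 ≠ 0) →
      v = if lb r i c = 0 then 1 else 0) →
      (((r < dg r i c ∧ s₃.reg 17 = 0) ∨ s₃.reg 16 ≠ 0) → v = n + 1) →
      Filled (s.arr aT) (Function.update (s₁.arr aT) (s.reg 18 + i) v) (s.reg 18) (i + 1)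
        fun σ v => ∀ m ≤ n, v ≤ m ↔
        (∀ j < k, Flg r σ j → (j = c ∧ ∃ i < k, s.arr aAdj (s.reg 20 + i) ≠ 0 ∧ lb r σ i < lb r σ c) ∨
          (s.arr aAdj (s.reg 20 + j) ≠ 0 ∧ lb r σ c < lb r σ j)) ∧
        (if lb r σ c = 0 then 1 else 0) ≤ m := by
    intro _ v h1 h2
    refine hI.step fun m hm => ?_
    by_cases hb : (r < dg r i c ∧ s₃.reg 17 = 0) ∨ s₃.reg 16 ≠ 0
    · rw [h2 hb]
      constructor
      · intro h; omega
      · intro h; exact (bad.1 hb h.1).elim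
    · rw [h1 hb]
      exact ⟨fun h => ⟨by_contra fun h' => hb (bad.2 h'), h⟩, fun h => h.2⟩
  refine .of_vc rfl rfl ?_
  by_cases hf : r < dg r i c <;> by_cases h1 : s₃.reg 17 = 0 <;> by_cases h2 : s₃.reg 16 = 0 <;>
    simp [vc, e21₃, c₃.r_eq, hf, h1, h2, c₃.n_eq, e11₃, e18₃, eT, e22₃, hW'] <;>
    refine full eT _ ?_ ?_ <;> simp [hf, h1, h2]

/-- The initial tables of all vertices. -/
def initAll : Prog :=
  .for 10 (reg rN) ((setReg 18 (reg 10 * reg rM) ;; setReg 20 (reg 10 * reg rK)) ;; initTable)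

lemma initAll_spec {E : ElimOrder n k} (hs : Ctx r n k s) (hc : ∀ x < n, s.arr aCol x = E.col x)
    (hA : ∀ x < n, ∀ j < k, s.arr aAdj (x * k + j) ≠ 0 ↔ ∃ u < x, E.adj u x ∧ E.col u = j)
    (hW : n * (2 * r + 1) ^ k ≤ W) (hWk : n * k ≤ W) (hW' : n + 1 ≤ W) (hn : 0 < n) :
    WP W initAll s ((n + 1) * ((10 +
      ((2 * r + 1) ^ k + 1) * (30 + ((k + 1) * (80 + 12) + 50) + 12)) + 12)) fun s' =>
      ∀ x < n, E.TabSpec r (fun σ => s'.arr aT (x * (2 * r + 1) ^ k + σ)) {x} ∅ := by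
  refine WP.for n (fun i s' => ∀ x < i, E.TabSpec r
      (fun σ => s'.arr aT (x * (2 * r + 1) ^ k + σ)) {x} ∅) rfl (by omega)
    (fun s' hF => by simpa [hs.n_eq] using hF.reg 1 (by decide)) (by simp) ?_ (fun s' _ _ h => h)
  intro i s₁ hi hx hF hI
  have c₁ : Ctx r n k s₁ := hs.of_frame hF rfl rfl
  have eA := hF.arr aAdj (by decide)
  have eC := hF.arr aCol (by decide)
  have hM : i * (2 * r + 1) ^ k ≤ W := (Nat.mul_le_mul_right _ hi.le).trans hW
  have hK : i * k ≤ W := (Nat.mul_le_mul_right _ hi.le).trans hWk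
  refine .seq' (Q' := fun s' => s'.reg 18 = i * (2 * r + 1) ^ k ∧ s'.reg 20 = i * k)
    (.of_vc rfl rfl ?_) fun s₂ ⟨h18, h20⟩ F₂ => ?_
  · simp [vc, hx, c₁.M_eq, c₁.k_eq, hM, hK]
  have c₂ : Ctx r n k s₂ := c₁.of_frame F₂ rfl rfl
  have e10₂ := (F₂.reg 10 (by decide)).trans hx
  have eA₂ := (F₂.arr aAdj (by decide)).trans eA
  have eC₂ := (F₂.arr aCol (by decide)).trans eC
  have eT₂ := F₂.arr aT (by decide)
  refine (initTable_spec (c := E.col i) c₂ (by rw [e10₂, eC₂, hc i hi]) (E.col_lt i) 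
    ((Nat.le_mul_of_pos_left _ hn).trans hWk) ((Nat.le_mul_of_pos_left _ hn).trans hW) hW').mono
    le_rfl fun s₃ h₃ => ?_
  rw [h18, h20, eA₂, eT₂] at h₃
  intro x hx'
  simp only [State.setR_arr]
  rcases Nat.lt_succ_iff_lt_or_eq.1 hx' with hx' | rfl
  · refine (hI x hx').congr fun σ hσ => ?_
    exact h₃.of_ne hx'.ne hσ
  · intro σ hσ m hm
    rw [h₃.1 σ hσ m hm, ElimOrder.feasC_singleton_iff hi]
    refine and_congr (forall_congr' fun j => forall_congr' fun hj => imp_congr Iff.rfl ?_) Iff.rfl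
    rw [hA x hi j hj]
    refine or_congr (and_congr Iff.rfl ?_) Iff.rfl
    exact exists_congr fun a => and_congr_right fun ha => by rw [hA x hi a ha]

end init

/-! ### The elimination of all vertices -/

section eliminate

variable {W r n k : ℕ} {s : State}

/-- Eliminate the vertices from `n - 1` down to `0`. -/
def eliminate : Prog :=
  .for 9 (reg rN) ((setReg 10 (reg rN - 1 - reg 9) ;; setReg 18 (reg 10 * reg rM)) ;; forget ;;
    branch (reg 10) (setReg 19 (arr aPar (reg 10) * reg rM) ;; join) skip)

/-- The tables when the vertices from `z` on are eliminated: `aT` holds the tables of the blocks of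
the remaining vertices, and for every eliminated vertex `aT` and `aF` hold the tables before and
after its elimination, and `aP` the table of its parent before the join. -/
structure Tables (E : ElimOrder n k) (r z : ℕ) (s : State) : Prop where
  rest : ∀ p < z, E.TabSpec r (fun σ => s.arr aT (p * (2 * r + 1) ^ k + σ)) (E.blk z p)
    ((E.blk z p).erase p)
  full : ∀ x < n, z ≤ x → E.TabSpec r (fun σ => s.arr aT (x * (2 * r + 1) ^ k + σ))
    (E.blk (x + 1) x) ((E.blk (x + 1) x).erase x)
  forg : ∀ x < n, z ≤ x → E.TabSpec r (fun σ => s.arr aF (x * (2 * r + 1) ^ k + σ))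
    (E.blk (x + 1) x) (E.blk (x + 1) x)
  prev : ∀ x < n, z ≤ x → 0 < x → E.TabSpec r (fun σ => s.arr aP (x * (2 * r + 1) ^ k + σ))
    (E.blk (x + 1) (E.par x)) ((E.blk (x + 1) (E.par x)).erase (E.par x))

/-- The time of the elimination of a vertex. -/
def elimTime (r k : ℕ) : ℕ :=
  20 + ((4 + (((2 * r + 1) ^ k + 1) * (60 + 12) + ((2 * r + 1) ^ k + 1) * (60 + 12))) +
    (2 + (10 + joinTime r k)))

lemma eliminate_spec {E : ElimOrder n k} (hs : Ctx r n k s) (hc : ∀ x < n, s.arr aCol x = E.col x)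
    (hp : ∀ x < n, s.arr aPar x = E.par x)
    (hT : ∀ x < n, E.TabSpec r (fun σ => s.arr aT (x * (2 * r + 1) ^ k + σ)) {x} ∅)
    (hW : n * (2 * r + 1) ^ k ≤ W) (hW2 : (k + 1) * ((2 * r + 1) ^ k * (2 * r + 1) ^ k) ≤ W)
    (hW' : 3 * n + k + 1 ≤ W) (hn : 0 < n) :
    WP W eliminate s ((n + 1) * (elimTime r k + 12)) (Tables E r 0) := by
  refine WP.for n (fun i s' => Tables E r (n - i) s') rfl (by omega)
    (fun s' hF => by simpa [hs.n_eq] using hF.reg 1 (by decide)) ?_ ?_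
    (fun s' _ _ h => by simpa using h)
  · refine ⟨fun p hp => ?_, fun x hx h => absurd hx (by omega), fun x hx h => absurd hx (by omega),
      fun x hx h => absurd hx (by omega)⟩
    rw [Nat.sub_zero] at hp ⊢
    rw [E.blk_end hp, Finset.erase_singleton]
    exact hT p hp
  intro i s₁ hi hx hF hI
  have c₁ : Ctx r n k s₁ := hs.of_frame hF rfl rfl
  have eC := hF.arr aCol (by decide)
  have eP := hF.arr aPar (by decide)
  obtain ⟨x, hxe⟩ : ∃ x, n - i = x + 1 := ⟨n - i - 1, by omega⟩
  have hxn : x < n := by omega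
  rw [hxe] at hI
  have hxi : n - (i + 1) = x := by omega
  rw [hxi]
  have hM : x * (2 * r + 1) ^ k ≤ W := (Nat.mul_le_mul_right _ hxn.le).trans hW
  have hM1 : (2 * r + 1) ^ k ≤ W := (Nat.le_mul_of_pos_left _ hn).trans hW
  refine .seq' (Q' := fun s' => s'.reg 10 = x ∧ s'.reg 18 = x * (2 * r + 1) ^ k)
    (.of_vc rfl rfl ?_) fun s₂ ⟨h10, h18⟩ F₂ => ?_
  · have : n - 1 - i = x := by omega
    simp [vc, hx, c₁.M_eq, c₁.n_eq, this, hM]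
  have c₂ : Ctx r n k s₂ := c₁.of_frame F₂ rfl rfl
  have eC₂ := (F₂.arr aCol (by decide)).trans eC
  have eP₂ := (F₂.arr aPar (by decide)).trans eP
  refine .seq' (forget_spec c₂ h10 (by rw [eC₂, hc x hxn]; exact E.col_lt x) hM1 (by omega))
    fun s₃ h₃ F₃ => ?_
  rw [h18, eC₂, hc x hxn] at h₃
  have c₃ : Ctx r n k s₃ := c₂.of_frame F₃ rfl rfl
  have h10₃ := (F₃.reg 10 (by decide)).trans h10
  have h18₃ := (F₃.reg 18 (by decide)).trans h18
  have eP₃ := (F₃.arr aPar (by decide)).trans eP₂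
  have eT₃ : s₃.arr aT = s₁.arr aT := (F₃.arr aT (by decide)).trans (F₂.arr aT (by decide))
  have eQ₃ : s₃.arr aP = s₁.arr aP := (F₃.arr aP (by decide)).trans (F₂.arr aP (by decide))
  have eT₂ : s₂.arr aT = s₁.arr aT := F₂.arr aT (by decide)
  have eF₂ : s₂.arr aF = s₁.arr aF := F₂.arr aF (by decide)
  rw [eT₂, eF₂] at h₃
  have forgx : E.TabSpec r (fun σ => s₃.arr aF (x * (2 * r + 1) ^ k + σ))
      (E.blk (x + 1) x) (E.blk (x + 1) x) := by
    intro σ hσ m hm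
    rw [h₃.1 σ hσ m hm, ElimOrder.feasC_forget_iff hxn hσ]
    refine and_congr Iff.rfl (exists_congr fun τ => and_congr_right fun hτ =>
      and_congr_right fun _ => and_congr_right fun _ => ?_)
    exact hI.rest x (by omega) τ hτ m hm
  have forg : ∀ y < n, x ≤ y → E.TabSpec r (fun σ => s₃.arr aF (y * (2 * r + 1) ^ k + σ))
      (E.blk (y + 1) y) (E.blk (y + 1) y) := by
    intro y hy hxy
    rcases hxy.eq_or_lt with rfl | hxy
    · exact forgx
    · exact (hI.forg y hy hxy).congr fun σ hσ => h₃.of_ne hxy.ne' hσ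
  refine WP.branch rfl (fun h0 => ?_) fun h0 => ?_
  · simp only [eval_reg, h10₃] at h0
    have hx0 : 0 < x := by omega
    have hpx := E.par_lt x hxn hx0
    have hMp : E.par x * (2 * r + 1) ^ k ≤ W := (Nat.mul_le_mul_right _ hpx.le).trans hM
    refine .seq' (Q' := fun s' => s'.reg 19 = E.par x * (2 * r + 1) ^ k)
      (.of_vc rfl rfl ?_) fun s₄ h19 F₄ => ?_
    · simp [vc, h10₃, c₃.M_eq, eP₃, hp x hxn, hMp]
    have c₄ : Ctx r n k s₄ := c₃.of_frame F₄ rfl rfl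
    have h18₄ := (F₄.reg 18 (by decide)).trans h18₃
    have eF₄ : s₄.arr aF = s₃.arr aF := F₄.arr aF (by decide)
    have eT₄ : s₄.arr aT = s₁.arr aT := (F₄.arr aT (by decide)).trans eT₃
    have eQ₄ : s₄.arr aP = s₁.arr aP := (F₄.arr aP (by decide)).trans eQ₃
    have tp := hI.rest (E.par x) (by omega)
    refine ((join_spec (T₁ := fun σ => s₁.arr aT (E.par x * (2 * r + 1) ^ k + σ))
      (T₂ := fun σ => s₃.arr aF (x * (2 * r + 1) ^ k + σ)) c₄ rfl
      (fun σ hσ => by rw [eT₄, h19]) (fun σ hσ => by rw [eF₄, h18₄])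
      (fun σ hσ => (tp.base_le c₄.base (E.card_blk_le _ _) hσ).trans (E.card_blk_le _ _))
      (fun σ hσ => (forgx.base_le c₄.base (E.card_blk_le _ _) hσ).trans (E.card_blk_le _ _))
      hW2 hW').frame).mono le_rfl fun s₅ ⟨⟨h₅, h₅'⟩, F₅⟩ => ?_
    rw [h19, eT₄] at h₅
    rw [h18₄, eQ₄] at h₅'
    have eF₅ : s₅.arr aF = s₃.arr aF := (F₅.arr aF (by decide)).trans eF₄
    refine ⟨fun p hp => ?_, fun y hy hxy => ?_, fun y hy hxy => ?_, fun y hy hxy hy0 => ?_⟩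
    · by_cases hpp : p = E.par x
      · subst hpp
        intro σ hσ m hm
        simp only [State.setR_arr]
        rw [h₅.1 σ hσ m hm, E.blk_par_erase hxn hx0, E.blk_par hxn hx0]
        exact ((E.separated_par hxn hx0).feasC_iff tp forgx c₄.base (E.card_blk_le _ _)
          (E.card_blk_le _ _) hσ hm).symm
      · rw [E.blk_of_ne hxn hx0 hp.ne hpp]
        exact (hI.rest p (by omega)).congr fun σ hσ => h₅.of_ne hpp hσ
    · rcases hxy.eq_or_lt with rfl | hxy
      · exact (hI.rest x (by omega)).congr fun σ hσ => h₅.of_ne hpx.ne' hσ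
      · exact (hI.full y hy hxy).congr fun σ hσ => h₅.of_ne (by omega) hσ
    · simp only [State.setR_arr, eF₅]
      exact forg y hy hxy
    · rcases hxy.eq_or_lt with rfl | hxy
      · exact tp.congr fun σ hσ => h₅'.1 σ hσ
      · exact (hI.prev y hy hxy hy0).congr fun σ hσ => h₅'.of_ne hxy.ne' hσ
  · simp only [eval_reg, h10₃] at h0
    refine .of_vc rfl (by rfl) ?_
    subst h0
    refine ⟨fun p hp => absurd hp (by omega), fun y hy hxy => ?_, fun y hy hxy => ?_,
      fun y hy hxy hy0 => ?_⟩
    · simp only [State.setR_arr, eT₃]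
      rcases hxy.eq_or_lt with rfl | hxy
      · exact hI.rest 0 (by omega)
      · exact hI.full y hy hxy
    · simp only [State.setR_arr]
      exact forg y hy hxy
    · simp only [State.setR_arr, eQ₃]
      exact hI.prev y hy hy0 hy0

end eliminate

/-! ### The reconstruction of a solution -/

section backtrack

variable {W r n k : ℕ} {s : State}

/-- The digit of the second code, if the digits of the first code and of the covered code are `g₁`
and `g`, and the two codes have no common flag. -/
def otherDigit (r g g₁ : ℕ) : ℕ := if g₁ = g then (if r < g then g - r else g) else g

/-- `g₁` is a digit of a first code for the digit `g` of a covered code. -/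
def FitsDigit (r g g₁ : ℕ) : Prop := g₁ = g ∨ (r < g ∧ g₁ + r = g)

/-- If the first code fits, then it covers together with the complementary code. -/
lemma cover_of_digits {σ σ₁ σ₂ : ℕ} (h : ∀ j < k, FitsDigit r (dg r σ j) (dg r σ₁ j))
    (h₂ : ∀ j < k, dg r σ₂ j = otherDigit r (dg r σ j) (dg r σ₁ j)) : Cover r k σ σ₁ σ₂ := by
  intro j hj
  have a := h j hj
  have b := h₂ j hj
  have := @dg_lt r σ j
  simp only [lb, Flg, FitsDigit, otherDigit] at *
  split_ifs at * <;> omega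

lemma digits_of_cover {σ σ₁ σ₂ : ℕ} (h : Cover r k σ σ₁ σ₂)
    (hd : ∀ j < k, Flg r σ₁ j → ¬ Flg r σ₂ j) : ∀ j < k, FitsDigit r (dg r σ j) (dg r σ₁ j) ∧
      dg r σ₂ j = otherDigit r (dg r σ j) (dg r σ₁ j) := by
  intro j hj
  obtain ⟨a, b, c⟩ := h j hj
  have d := hd j hj
  have := @dg_lt r σ j
  simp only [lb, Flg, FitsDigit, otherDigit] at *
  split_ifs at * <;> omega

/-- Compute in register `20` the second code for the covered code `reg 30` and the first code
`reg 11`; register `17` reports whether there is one. -/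
def complement : Prog :=
  setReg 17 1 ;; setReg 20 0 ;;
  .for 12 (reg rK) (setReg 13 (arr aPw (reg 12)) ;; setReg 14 ((reg 30 / reg 13) % reg rB) ;;
    setReg 15 ((reg 11 / reg 13) % reg rB) ;;
    branch (eq (reg 15) (reg 14))
      (branch (lt (reg rR) (reg 14)) (setReg 20 (reg 20 + (reg 14 - reg rR) * reg 13))
        (setReg 20 (reg 20 + reg 14 * reg 13)))
      (setReg 20 (reg 20 + reg 14 * reg 13) ;;
        branch (lt (reg rR) (reg 14)) (branch (eq (reg 15 + reg rR) (reg 14)) skip (setReg 17 0))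
          (setReg 17 0)))

lemma complement_spec {σ σ₁ : ℕ} (hs : Ctx r n k s) (h30 : s.reg 30 = σ) (h11 : s.reg 11 = σ₁)
    (hk : k ≤ W) (hW : (2 * r + 1) ^ k ≤ W) :
    WP W complement s (2 + (2 + (k + 1) * (80 + 12))) fun s' =>
      (s'.reg 17 ≠ 0 ↔ ∀ j < k, FitsDigit r (dg r σ j) (dg r σ₁ j)) ∧
      s'.reg 20 < (2 * r + 1) ^ k ∧
      ∀ j < k, dg r (s'.reg 20) j = otherDigit r (dg r σ j) (dg r σ₁ j) := by
  refine .seq (.of_vc rfl rfl ⟨trivial, .seq (.of_vc rfl rfl ⟨trivial, ?_⟩)⟩)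
  set s₀ := (s.setR 17 (eval s 1)).setR 20 (eval (s.setR 17 (eval s 1)) 0) with hs₀
  have e30 : s₀.reg 30 = σ := by simp [hs₀, h30]
  have e11 : s₀.reg 11 = σ₁ := by simp [hs₀, h11]
  have c₀ : Ctx r n k s₀ := ⟨by simp [hs₀, hs.r_eq], by simp [hs₀, hs.n_eq], by simp [hs₀, hs.k_eq],
    by simp [hs₀, hs.b_eq], by simp [hs₀, hs.M_eq], by simp [hs₀, hs.L_eq], hs.pw_eq, hs.base⟩
  refine WP.for k (fun i s' =>
      (s'.reg 17 ≠ 0 ↔ ∀ j < i, FitsDigit r (dg r σ j) (dg r σ₁ j)) ∧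
      s'.reg 20 < (2 * r + 1) ^ i ∧
      ∀ j < i, dg r (s'.reg 20) j = otherDigit r (dg r σ j) (dg r σ₁ j)) rfl hk
    (fun s' hF => by simpa [c₀.k_eq] using hF.reg 4 (by decide)) (by simp [hs₀]) ?_
    (fun s' _ _ h => h)
  intro i s₁ hi hx hF ⟨hI1, hI2, hI3⟩
  have c₁ : Ctx r n k s₁ := c₀.of_frame hF rfl rfl
  have f30 := (hF.reg 30 (by decide)).trans e30
  have f11 := (hF.reg 11 (by decide)).trans e11
  have d1 : σ / (2 * r + 1) ^ i % (2 * r + 1) = dg r σ i := rfl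
  have d2 : σ₁ / (2 * r + 1) ^ i % (2 * r + 1) = dg r σ₁ i := rfl
  have hlt := @dg_lt r σ i
  have hlt1 := @dg_lt r σ₁ i
  -- adding a digit
  have add : ∀ g < 2 * r + 1, s₁.reg 20 + g * (2 * r + 1) ^ i < (2 * r + 1) ^ (i + 1) := by
    intro g hg
    calc s₁.reg 20 + g * (2 * r + 1) ^ i < (g + 1) * (2 * r + 1) ^ i := by rw [Nat.succ_mul g]; omega
      _ ≤ (2 * r + 1) * (2 * r + 1) ^ i := Nat.mul_le_mul_right _ hg
      _ = _ := by rw [pow_succ, mul_comm]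
  have bd : ∀ g < 2 * r + 1, s₁.reg 20 + g * (2 * r + 1) ^ i ≤ W := fun g hg =>
    ((add g hg).le.trans (Nat.pow_le_pow_right (by omega) hi)).trans hW
  have digit : ∀ g < 2 * r + 1, g = otherDigit r (dg r σ i) (dg r σ₁ i) → ∀ j < i + 1,
      dg r (s₁.reg 20 + g * (2 * r + 1) ^ i) j = otherDigit r (dg r σ j) (dg r σ₁ j) := by
    intro g hg hgo j hj
    rw [add_comm]
    rcases Nat.lt_succ_iff_lt_or_eq.1 hj with hj | rfl
    · rw [dg_mul_add hj, hI3 j hj]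
    · rw [← hgo, dg, mul_comm, Nat.mul_add_div (by positivity), Nat.div_eq_of_lt hI2, add_zero,
        Nat.mod_eq_of_lt hg]
  have all : (∀ j < i + 1, FitsDigit r (dg r σ j) (dg r σ₁ j)) ↔
      s₁.reg 17 ≠ 0 ∧ FitsDigit r (dg r σ i) (dg r σ₁ i) := by
    rw [hI1]
    constructor
    · exact fun h => ⟨fun j hj => h j (by omega), h i (by omega)⟩
    · rintro ⟨h, h'⟩ j hj
      rcases Nat.lt_succ_iff_lt_or_eq.1 hj with hj | rfl
      exacts [h j hj, h']
  have key : ∀ v g, g < 2 * r + 1 → g = otherDigit r (dg r σ i) (dg r σ₁ i) →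
      (v ≠ 0 ↔ s₁.reg 17 ≠ 0 ∧ FitsDigit r (dg r σ i) (dg r σ₁ i)) →
      (v ≠ 0 ↔ ∀ j < i + 1, FitsDigit r (dg r σ j) (dg r σ₁ j)) ∧
      s₁.reg 20 + g * (2 * r + 1) ^ i < (2 * r + 1) ^ (i + 1) ∧
      ∀ j < i + 1, dg r (s₁.reg 20 + g * (2 * r + 1) ^ i) j =
        otherDigit r (dg r σ j) (dg r σ₁ j) :=
    fun v g h1 h2 h3 => ⟨h3.trans all.symm, add g h1, digit g h1 h2⟩
  refine .of_vc rfl rfl ?_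
  simp only [vc, eval_lt, eval_eq, eval_reg, eval_arr, eval_add, eval_sub, eval_mul, eval_div,
    eval_mod, State.setR_reg, hx, f30, f11, c₁.b_eq, c₁.r_eq,
    c₁.pw_eq i hi.le, d1, d2, Nat.reduceEqDiff, if_true, if_false,
    OfNat.zero_ne_ofNat, Bd_mod, Bd_div, Bd_arr, Bd_reg, Bd_add, Bd_ofNat, true_and, eval_ofNat]
  have b1 := bd (dg r σ i) hlt
  have b2 := bd (dg r σ i - r) (by omega)
  have pos : ∀ {p : Prop} [Decidable p], (if p then 1 else 0) ≠ 0 → p := by intro p _; simp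
  have neg : ∀ {p : Prop} [Decidable p], (if p then 1 else 0) = 0 → ¬ p := by intro p _; simp
  refine ⟨fun h => ⟨fun h' => ⟨b2, key _ _ (by omega) ?_ ?_⟩, fun h' => ⟨b1, key _ _ hlt ?_ ?_⟩⟩,
    fun h => ⟨b1, fun h' => ⟨fun h'' => key _ _ hlt ?_ ?_, fun h'' => key _ _ hlt ?_ ?_⟩,
      fun h' => key _ _ hlt ?_ ?_⟩⟩
  · rw [otherDigit, if_pos (pos h), if_pos (pos h')]
  · simp [FitsDigit, pos h]
  · rw [otherDigit, if_pos (pos h), if_neg (neg h')]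
  · simp [FitsDigit, pos h]
  · rw [otherDigit, if_neg (neg h)]
  · simp [FitsDigit, pos h', pos h'']
  · rw [otherDigit, if_neg (neg h)]
  · simp [FitsDigit, neg h, neg h'']
  · rw [otherDigit, if_neg (neg h)]
  · simp [FitsDigit, neg h, neg h']

/-- Cover the code of the parent of `reg 10` at minimum cost, by `reg 31` for the parent and by
`reg 27` for `reg 10`. -/
def pickCover : Prog :=
  (setReg 30 (arr aCur (arr aPar (reg 10))) ;; setReg 16 (reg rN + 1)) ;;
  .for 11 (reg rM) (complement ;;
    branch (reg 17) (branch (lt (arr aP (reg 18 + reg 11) + arr aF (reg 18 + reg 20)) (reg 16))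
      (setReg 16 (arr aP (reg 18 + reg 11) + arr aF (reg 18 + reg 20)) ;;
        setReg 31 (reg 11) ;; setReg 27 (reg 20)) skip) skip)

lemma pickCover_spec {σ m : ℕ} {A B : ℕ → ℕ} (hs : Ctx r n k s)
    (hσ : s.arr aCur (s.arr aPar (s.reg 10)) = σ)
    (hA : ∀ τ < (2 * r + 1) ^ k, s.arr aP (s.reg 18 + τ) = A τ)
    (hB : ∀ τ < (2 * r + 1) ^ k, s.arr aF (s.reg 18 + τ) = B τ)
    (hk : k ≤ W) (hW : (2 * r + 1) ^ k ≤ W) (hW' : n + 1 ≤ W) (hm : m ≤ n)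
    (hex : ∃ σ₁ < (2 * r + 1) ^ k, ∃ σ₂ < (2 * r + 1) ^ k, Cover r k σ σ₁ σ₂ ∧
      (∀ j < k, Flg r σ₁ j → ¬ Flg r σ₂ j) ∧ A σ₁ + B σ₂ ≤ m) :
    WP W pickCover s (20 + ((2 * r + 1) ^ k + 1) * ((2 + (2 + (k + 1) * (80 + 12))) + 50 + 12))
      fun s' => s'.reg 31 < (2 * r + 1) ^ k ∧ s'.reg 27 < (2 * r + 1) ^ k ∧
        Cover r k σ (s'.reg 31) (s'.reg 27) ∧ A (s'.reg 31) + B (s'.reg 27) ≤ m := by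
  refine .seq' (Q' := fun s' => s'.reg 30 = σ ∧ s'.reg 16 = n + 1)
    (.of_vc rfl rfl ?_) fun s₀ ⟨h30, h16⟩ F₀ => ?_
  · simp [vc, hσ, hs.n_eq, hW']
  have c₀ : Ctx r n k s₀ := hs.of_frame F₀ rfl rfl
  have h18₀ := F₀.reg 18 (by decide)
  have hA₀ : ∀ τ < (2 * r + 1) ^ k, s₀.arr aP (s.reg 18 + τ) = A τ := fun τ hτ => by
    rw [F₀.arr aP (by decide), hA τ hτ]
  have hB₀ : ∀ τ < (2 * r + 1) ^ k, s₀.arr aF (s.reg 18 + τ) = B τ := fun τ hτ => by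
    rw [F₀.arr aF (by decide), hB τ hτ]
  refine WP.for ((2 * r + 1) ^ k) (fun i s' => s'.reg 16 ≤ n + 1 ∧
      (s'.reg 16 ≤ n → s'.reg 31 < (2 * r + 1) ^ k ∧ s'.reg 27 < (2 * r + 1) ^ k ∧
        Cover r k σ (s'.reg 31) (s'.reg 27) ∧ A (s'.reg 31) + B (s'.reg 27) ≤ s'.reg 16) ∧
      ∀ σ₁ < i, ∀ σ₂ < (2 * r + 1) ^ k, Cover r k σ σ₁ σ₂ →
        (∀ j < k, Flg r σ₁ j → ¬ Flg r σ₂ j) → A σ₁ + B σ₂ ≤ n → s'.reg 16 ≤ A σ₁ + B σ₂) rfl hW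
    (fun s' hF => by simpa [c₀.M_eq] using hF.reg 6 (by decide)) (by simp [h16]) ?_ ?_
  · intro i s₁ hi hx hF ⟨hI1, hI2, hI3⟩
    have c₁ : Ctx r n k s₁ := c₀.of_frame hF rfl rfl
    refine .seq' (complement_spec c₁ ((hF.reg 30 (by decide)).trans h30) hx hk hW)
      fun s₂ ⟨h17, h20, hd⟩ F₂ => ?_
    have c₂ : Ctx r n k s₂ := c₁.of_frame F₂ rfl rfl
    have h11 := (F₂.reg 11 (by decide)).trans hx
    have e16 := F₂.reg 16 (by decide)
    have e31 := F₂.reg 31 (by decide)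
    have e27 := F₂.reg 27 (by decide)
    have h18 := (F₂.reg 18 (by decide)).trans ((hF.reg 18 (by decide)).trans h18₀)
    have hA₂ : s₂.arr aP (s.reg 18 + i) = A i := by
      rw [F₂.arr aP (by decide), hF.arr aP (by decide), hA₀ i hi]
    have hB₂ : s₂.arr aF (s.reg 18 + s₂.reg 20) = B (s₂.reg 20) := by
      rw [F₂.arr aF (by decide), hF.arr aF (by decide), hB₀ _ h20]
    have uniq : ∀ σ₂ < (2 * r + 1) ^ k, Cover r k σ i σ₂ →
        (∀ j < k, Flg r i j → ¬ Flg r σ₂ j) → s₂.reg 17 ≠ 0 ∧ s₂.reg 20 = σ₂ := by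
      intro σ₂ hσ₂ hc hf
      have h := digits_of_cover hc hf
      exact ⟨h17.2 fun j hj => (h j hj).1, code_ext h20 hσ₂ fun j hj => by
        rw [hd j hj, (h j hj).2]⟩
    have split : ∀ (P : ℕ → Prop), (∀ j < i + 1, P j) ↔ (∀ j < i, P j) ∧ P i := by
      intro P
      constructor
      · exact fun h => ⟨fun j hj => h j (by omega), h i (by omega)⟩
      · rintro ⟨h, h'⟩ j hj
        rcases Nat.lt_succ_iff_lt_or_eq.1 hj with hj | rfl
        exacts [h j hj, h']
    refine .of_vc rfl rfl ?_
    simp only [vc, eval_lt, eval_reg, eval_arr, eval_add, State.setR_reg, h11, h18,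
      hA₂, hB₂, Nat.reduceEqDiff, if_true, if_false, Bd_reg, Bd_add, true_and, e16, e31, e27, split]
    refine ⟨fun h => ⟨fun hlt => ?_, fun hlt => ⟨hI1, hI2, hI3, fun σ₂ h1 h2 h3 h4 => ?_⟩⟩,
      fun h => ⟨hI1, hI2, hI3, fun σ₂ h1 h2 h3 h4 => ?_⟩⟩
    · have hlt : A i + B (s₂.reg 20) < s₁.reg 16 := by by_contra h; exact hlt (if_neg h)
      refine ⟨by omega, by omega, fun _ => ⟨hi, h20, cover_of_digits (h17.1 h) hd, le_rfl⟩,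
        fun σ₁ l1 σ₂ l2 a b c => ?_, fun σ₂ h1 h2 h3 h4 => ?_⟩
      · exact hlt.le.trans (hI3 σ₁ l1 σ₂ l2 a b c)
      · rw [(uniq σ₂ h1 h2 h3).2]
    · have hlt : ¬ A i + B (s₂.reg 20) < s₁.reg 16 := fun h => by simp [h] at hlt
      rw [← (uniq σ₂ h1 h2 h3).2]
      omega
    · exact ((uniq σ₂ h1 h2 h3).1 h).elim
  · rintro s' - - ⟨-, h2, h3⟩
    obtain ⟨σ₁, l1, σ₂, l2, a, b, c⟩ := hex
    have := h3 σ₁ l1 σ₂ l2 a b (c.trans hm)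
    obtain ⟨d1, d2, d3, d4⟩ := h2 (by omega)
    exact ⟨d1, d2, d3, by omega⟩

/-- Choose the best label of `reg 10`, for the code `reg 27`. -/
def pickLabel : Prog :=
  (setReg 14 (arr aPw (arr aCol (reg 10))) ;;
    setReg 28 (reg 27 - ((reg 27 / reg 14) % reg rB) * reg 14) ;;
    setReg 29 (reg 28) ;; setReg 16 (arr aT (reg 18 + reg 28))) ;;
  .for 11 (reg rR) (setReg 13 (reg 28 + (reg rR + 1 + reg 11) * reg 14) ;;
    branch (lt (arr aT (reg 18 + reg 13)) (reg 16))
      (setReg 16 (arr aT (reg 18 + reg 13)) ;; setReg 29 (reg 13)) skip)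

lemma pickLabel_spec {c m : ℕ} {A : ℕ → ℕ} (hs : Ctx r n k s) (hc : s.arr aCol (s.reg 10) = c)
    (hck : c < k) (h27 : s.reg 27 < (2 * r + 1) ^ k)
    (hA : ∀ τ < (2 * r + 1) ^ k, s.arr aT (s.reg 18 + τ) = A τ)
    (hW : (2 * r + 1) ^ k ≤ W)
    (hex : ∃ τ < (2 * r + 1) ^ k, (∀ i < k, i ≠ c → dg r τ i = dg r (s.reg 27) i) ∧
          (dg r τ c = 0 ∨ r < dg r τ c) ∧ A τ ≤ m) :
    WP W pickLabel s (40 + (r + 1) * (30 + 12)) fun s' =>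
      s'.reg 29 < (2 * r + 1) ^ k ∧ (∀ i < k, i ≠ c → dg r (s'.reg 29) i = dg r (s.reg 27) i) ∧
      (dg r (s'.reg 29) c = 0 ∨ r < dg r (s'.reg 29) c) ∧ A (s'.reg 29) ≤ m ∧
      (s'.reg 29 = s'.reg 28 ↔ dg r (s'.reg 29) c = 0) := by
  set ρ := s.reg 27 with hρ
  have z := dg_sub (r := r) (le_refl (dg r ρ c))
  set σ := ρ - dg r ρ c * (2 * r + 1) ^ c with hσdef
  have hσ : σ < (2 * r + 1) ^ k := (Nat.sub_le _ _).trans_lt h27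
  have hz : dg r σ c = 0 := by rw [z, if_pos rfl]; omega
  have hzo : ∀ i, i ≠ c → dg r σ i = dg r ρ i := fun i hi => by rw [z, if_neg hi]
  have hpos : 0 < (2 * r + 1) ^ c := by positivity
  refine .seq' (Q' := fun s' => s'.reg 14 = (2 * r + 1) ^ c ∧ s'.reg 28 = σ ∧ s'.reg 29 = σ ∧
    s'.reg 16 = A σ) (.of_vc rfl rfl ?_) fun s₀ ⟨h14, h28, h29, h16⟩ F₀ => ?_
  · have hdg : ρ / (2 * r + 1) ^ c % (2 * r + 1) = dg r ρ c := rfl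
    simp [vc, hc, hs.pw_eq c hck.le, hs.b_eq, ← hρ, hdg, ← hσdef, hA σ hσ]
  have c₀ : Ctx r n k s₀ := hs.of_frame F₀ rfl rfl
  have h18₀ := F₀.reg 18 (by decide)
  have hA₀ : ∀ τ < (2 * r + 1) ^ k, s₀.arr aT (s.reg 18 + τ) = A τ := fun τ hτ => by
    rw [F₀.arr aT (by decide), hA τ hτ]
  have hg : ∀ t < r, dg r σ c + (r + 1 + t) < 2 * r + 1 := fun t ht => by rw [hz]; omega
  have hrW : r ≤ W := by
    have : (2 * r + 1) ^ 1 ≤ (2 * r + 1) ^ k := Nat.pow_le_pow_right (by omega) (by omega)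
    rw [pow_one] at this
    omega
  refine WP.for r (fun i s' => s'.reg 16 = A (s'.reg 29) ∧ s'.reg 16 ≤ A σ ∧
      (s'.reg 29 = σ ∨ ∃ t < i, s'.reg 29 = σ + (r + 1 + t) * (2 * r + 1) ^ c) ∧
      ∀ t < i, s'.reg 16 ≤ A (σ + (r + 1 + t) * (2 * r + 1) ^ c)) rfl hrW
    (fun s' hF => by simpa [c₀.r_eq] using hF.reg 0 (by decide)) (by simp [h16, h29]) ?_ ?_
  · intro i s₁ hi hx hF ⟨hI1, hI2, hI3, hI4⟩
    have c₁ : Ctx r n k s₁ := c₀.of_frame hF rfl rfl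
    have f14 := (hF.reg 14 (by decide)).trans h14
    have f28 := (hF.reg 28 (by decide)).trans h28
    have f18 := (hF.reg 18 (by decide)).trans h18₀
    have hlt := add_lt_of_dg hck hσ (hg i hi)
    have hA₁ : s₁.arr aT (s.reg 18 + (σ + (r + 1 + i) * (2 * r + 1) ^ c)) =
        A (σ + (r + 1 + i) * (2 * r + 1) ^ c) := by
      rw [hF.arr aT (by decide), hA₀ _ hlt]
    refine .of_vc rfl rfl ?_
    simp only [vc, eval_lt, eval_reg, eval_arr, eval_add, eval_mul, State.setR_reg, State.setR_arr,
      hx, f14, f28, f18, c₁.r_eq, hA₁, Nat.reduceEqDiff, if_true, if_false, Bd_reg, Bd_add, Bd_arr,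
      true_and, eval_ofNat]
    simp only [ne_eq, ite_eq_right_iff, one_ne_zero, imp_false, not_not]
    refine ⟨hlt.le.trans hW, fun h => ⟨h.le.trans hI2, .inr ⟨i, by omega, rfl⟩, fun t ht => ?_⟩,
      fun h => ⟨hI1, hI2, hI3.imp id fun ⟨t, ht, h⟩ => ⟨t, by omega, h⟩, fun t ht => ?_⟩⟩
    · rcases Nat.lt_succ_iff_lt_or_eq.1 ht with ht | rfl
      · exact h.le.trans (hI4 t ht)
      · exact le_rfl
    · rcases Nat.lt_succ_iff_lt_or_eq.1 ht with ht | rfl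
      · exact hI4 t ht
      · omega
  · rintro s' - hF ⟨h1, h2, h3, h4⟩
    have e28 := (hF.reg 28 (by decide)).trans h28
    have hle : A (s'.reg 29) ≤ m := by
      obtain ⟨τ, l, a, b, d⟩ := hex
      rw [← h1]
      rcases b with b | b
      · have : τ = σ := code_ext l hσ fun i hi => by
          by_cases hic : i = c
          · rw [hic, b, hz]
          · rw [a i hi hic, hzo i hic]
        rw [this] at d
        exact h2.trans d
      · have hτ := @dg_lt r τ c
        have hg' := hg (dg r τ c - (r + 1)) (by omega)
        have : τ = σ + (r + 1 + (dg r τ c - (r + 1))) * (2 * r + 1) ^ c :=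
          code_ext l (add_lt_of_dg hck hσ hg') fun i hi => by
            rw [dg_add hg']
            split_ifs with hic
            · rw [hic, hz]; omega
            · rw [a i hi hic, hzo i hic]
        rw [this] at d
        exact (h4 _ (by omega)).trans d
    rcases h3 with h3 | ⟨t, ht, h3⟩
    · rw [e28]
      refine ⟨h3 ▸ hσ, fun i _ hic => by rw [h3, hzo i hic], .inl (by rw [h3, hz]), hle, ?_⟩
      simp [h3, hz]
    · have d := dg_add (hg t ht)
      refine ⟨h3 ▸ add_lt_of_dg hck hσ (hg t ht), fun i _ hic => by rw [h3, d, if_neg hic, hzo i hic],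
        .inr (by rw [h3, d, if_pos rfl, hz]; omega), hle, ?_⟩
      rw [e28]
      have : 0 < (r + 1 + t) * (2 * r + 1) ^ c := by positivity
      constructor
      · intro h; omega
      · intro h; rw [h3, d, if_pos rfl, hz] at h; omega

/-- Choose the labels of the vertices from `0` up to `n - 1`. -/
def backtrack : Prog :=
  .for 10 (reg rN) (setReg 18 (reg 10 * reg rM) ;; .branch (reg 10) pickCover (setReg 27 0) ;;
    pickLabel ;;
    branch (reg 10) (setArr aCur (arr aPar (reg 10)) (reg 31)) skip ;;
    setArr aCur (reg 10) (reg 29) ;;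
    setArr aOut (arr aOrd (reg 10)) (eq (reg 29) (reg 28)))

/-- The time of the choice of a label. -/
def backTime (r k : ℕ) : ℕ :=
  4 + ((2 + (20 + ((2 * r + 1) ^ k + 1) * ((2 + (2 + (k + 1) * (80 + 12))) + 50 + 12))) +
    ((40 + (r + 1) * (30 + 12)) + 30))

lemma backtrack_spec {E : ElimOrder n k} {ord : ℕ → ℕ} (hs : Ctx r n k s)
    (hc : ∀ x < n, s.arr aCol x = E.col x) (hp : ∀ x < n, s.arr aPar x = E.par x)
    (ho : ∀ x < n, s.arr aOrd x = ord x) (hinj : ∀ x < n, ∀ y < n, ord x = ord y → x = y)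
    (hT : Tables E r 0 s) (hW : n * (2 * r + 1) ^ k ≤ W)
    (hW' : n + 1 ≤ W) (hk : k ≤ W) (hn : 0 < n) :
    WP W backtrack s ((n + 1) * (backTime r k + 12)) fun s' => ∃ (opt : ℕ) (cur m : ℕ → ℕ),
      (∀ t ≤ n, opt ≤ t ↔ E.FeasC r (Finset.range n) (Finset.range n) 0 t) ∧
      E.IsTrace r n opt cur m ∧ ∀ x < n, s'.arr aOut (ord x) ≠ 0 ↔ lb r (cur x) (E.col x) = 0 := by
  have hM1 : (2 * r + 1) ^ k ≤ W := (Nat.le_mul_of_pos_left _ hn).trans hW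
  have hM0 : 0 < (2 * r + 1) ^ k := by positivity
  have tab0 := hT.forg 0 hn le_rfl
  rw [zero_add, E.blk_one] at tab0
  set opt := s.arr aF (0 * (2 * r + 1) ^ k + 0) with hopt
  have hoptn : opt ≤ n := by
    refine (tab0 0 hM0 n le_rfl).2 ?_
    have := feas_of_no_flags (adj := E.adj) (c := E.col) (Y := Finset.range n)
      (Z := Finset.range n) (k := k) (fun j => lb_le (r := r) (σ := 0) (j := j))
      (fl := Flg r 0) fun j _ => by simp [Flg, dg]
    rwa [Finset.card_range] at this
  refine WP.for n (fun i s' => 0 < i → ∃ m, E.IsTrace r i opt (s'.arr aCur) m ∧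
      ∀ x < i, s'.arr aOut (ord x) ≠ 0 ↔ lb r (s'.arr aCur x) (E.col x) = 0) rfl
    (by omega) (fun s' hF => by simpa [hs.n_eq] using hF.reg 1 (by decide)) (by simp) ?_
    (fun s' _ _ h => ?_)
  swap
  · obtain ⟨m, h1, h2⟩ := h hn
    exact ⟨opt, s'.arr aCur, m, tab0 0 hM0, h1, h2⟩
  intro x s₁ hx hx10 hF hI
  have c₁ : Ctx r n k s₁ := hs.of_frame hF rfl rfl
  have hM : x * (2 * r + 1) ^ k ≤ W := (Nat.mul_le_mul_right _ hx.le).trans hW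
  have aC₁ := hF.arr aCol (by decide)
  have aP₁ := hF.arr aPar (by decide)
  have aO₁ := hF.arr aOrd (by decide)
  have aT₁ := hF.arr aT (by decide)
  have aF₁ := hF.arr aF (by decide)
  have aQ₁ := hF.arr aP (by decide)
  -- the two codes that cover the code of the parent
  refine .seq' (Q' := fun s' => s'.reg 18 = x * (2 * r + 1) ^ k) (.of_vc rfl rfl ?_)
    fun s₂ h18 F₂ => ?_
  · simp [vc, hx10, c₁.M_eq, hM]
  have c₂ : Ctx r n k s₂ := c₁.of_frame F₂ rfl rfl
  have h10₂ := (F₂.reg 10 (by decide)).trans hx10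
  have aC₂ := (F₂.arr aCol (by decide)).trans aC₁
  have aP₂ := (F₂.arr aPar (by decide)).trans aP₁
  have aO₂ := (F₂.arr aOrd (by decide)).trans aO₁
  have aT₂ := (F₂.arr aT (by decide)).trans aT₁
  have aF₂ := (F₂.arr aF (by decide)).trans aF₁
  have aQ₂ := (F₂.arr aP (by decide)).trans aQ₁
  have aU₂ := F₂.arr aCur (by decide)
  have aV₂ := F₂.arr aOut (by decide)
  refine .seq' (T₁ := 2 + (20 + ((2 * r + 1) ^ k + 1) * ((2 + (2 + (k + 1) * (80 + 12))) + 50 + 12)))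
    (Q' := fun s' => s'.reg 27 < (2 * r + 1) ^ k ∧ s.arr aF (x * (2 * r + 1) ^ k + s'.reg 27) ≤ n ∧
      (x = 0 → s'.reg 27 = 0) ∧ (0 < x → s'.reg 31 < (2 * r + 1) ^ k ∧ ∃ m,
        E.IsTrace r x opt (s₁.arr aCur) m ∧
        Cover r k (s₁.arr aCur (E.par x)) (s'.reg 31) (s'.reg 27) ∧
        s.arr aP (x * (2 * r + 1) ^ k + s'.reg 31) + s.arr aF (x * (2 * r + 1) ^ k + s'.reg 27)
          ≤ m (E.par x) ∧ m (E.par x) ≤ n)) (.branch rfl (fun h => ?_) fun h => ?_)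
      fun s₃ ⟨h27, hFn, h0, hpos⟩ F₃ => ?_
  · simp only [eval_reg, h10₂] at h
    have hx0 : 0 < x := by omega
    have hpx := E.par_lt x hx hx0
    obtain ⟨m, hm, -⟩ := hI hx0
    have hmn : m (E.par x) ≤ n := by
      refine le_trans ?_ (hm.sum_le.trans hoptn)
      exact Finset.single_le_sum (f := m) (fun _ _ => Nat.zero_le _) (Finset.mem_range.2 hpx)
    have hf := hm.feas _ hpx
    rw [E.blk_par_erase hx hx0, E.blk_par hx hx0] at hf
    obtain ⟨σ₁, l1, σ₂, l2, a, b, m₁, m₂, hle, f1, f2⟩ :=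
      (E.separated_par hx hx0).exists_cover (hm.lt _ hpx) hf
    refine (pickCover_spec (σ := s₁.arr aCur (E.par x)) (m := m (E.par x))
      (A := fun σ => s.arr aP (x * (2 * r + 1) ^ k + σ))
      (B := fun σ => s.arr aF (x * (2 * r + 1) ^ k + σ)) c₂
      (by rw [h10₂, aU₂, aP₂, hp x hx]) (fun τ _ => by rw [aQ₂, h18]) (fun τ _ => by rw [aF₂, h18])
      hk hM1 hW' hmn ⟨σ₁, l1, σ₂, l2, a, b, ?_⟩).mono le_rfl
      fun s' ⟨a1, a2, a3, a4⟩ => ⟨a2, by omega, by omega, fun _ => ⟨a1, m, hm, a3, a4, hmn⟩⟩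
    exact (Nat.add_le_add ((hT.prev x hx (Nat.zero_le _) hx0 _ l1 m₁ (by omega)).2 f1)
      ((hT.forg x hx (Nat.zero_le _) _ l2 m₂ (by omega)).2 f2)).trans hle
  · simp only [eval_reg, h10₂] at h
    subst h
    refine .of_vc rfl (Nat.ble_eq_true_of_le (show 2 ≤ _ by omega)) ⟨trivial, ?_⟩
    simpa [hM0, hopt] using hoptn
  have c₃ : Ctx r n k s₃ := c₂.of_frame F₃ rfl rfl
  have h10₃ := (F₃.reg 10 (by decide)).trans h10₂
  have h18₃ := (F₃.reg 18 (by decide)).trans h18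
  have aC₃ := (F₃.arr aCol (by decide)).trans aC₂
  have aP₃ := (F₃.arr aPar (by decide)).trans aP₂
  have aO₃ := (F₃.arr aOrd (by decide)).trans aO₂
  have aT₃ := (F₃.arr aT (by decide)).trans aT₂
  have aU₃ := (F₃.arr aCur (by decide)).trans aU₂
  have aV₃ := (F₃.arr aOut (by decide)).trans aV₂
  -- the label of `x`
  have f2 := (hT.forg x hx (Nat.zero_le _) _ h27 _ hFn).1 le_rfl
  obtain ⟨-, τ, hτ, b1, b2, b3⟩ := (ElimOrder.feasC_forget_iff hx h27).1 f2
  refine .seq' (pickLabel_spec (c := E.col x) (m := s.arr aF (x * (2 * r + 1) ^ k + s₃.reg 27))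
    (A := fun σ => s.arr aT (x * (2 * r + 1) ^ k + σ)) c₃ (by rw [h10₃, aC₃, hc x hx])
    (E.col_lt x) h27 (fun τ _ => by rw [aT₃, h18₃]) hM1
    ⟨τ, hτ, b1, b2, (hT.full x hx (Nat.zero_le _) τ hτ _ hFn).2 b3⟩)
    fun s₄ ⟨d1, d2, d3, d4, d5⟩ F₄ => ?_
  have fτ := (hT.full x hx (Nat.zero_le _) _ d1 _ hFn).1 d4
  have h10₄ := (F₄.reg 10 (by decide)).trans h10₃
  have h31₄ := F₄.reg 31 (by decide)
  have aP₄ := (F₄.arr aPar (by decide)).trans aP₃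
  have aO₄ := (F₄.arr aOrd (by decide)).trans aO₃
  have aU₄ := (F₄.arr aCur (by decide)).trans aU₃
  have aV₄ := (F₄.arr aOut (by decide)).trans aV₃
  have hlb : lb r (s₄.reg 29) (E.col x) = 0 ↔ s₄.reg 29 = s₄.reg 28 := by
    rw [d5, lb]
    split_ifs <;> omega
  refine .of_vc rfl rfl ?_
  simp only [vc, eval_eq, eval_reg, eval_arr, State.setA_reg, State.setA_arr, h10₄, h31₄, aP₄, aO₄,
    aU₄, aV₄, hp x hx, ho x hx, Nat.reduceEqDiff, if_true, if_false, Bd_reg, true_and, Bd_eq,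
    State.setR_arr]
  refine ⟨fun h _ => ?_, fun h _ => ?_⟩
  · have hx0 : 0 < x := by omega
    have hpx := E.par_lt x hx hx0
    obtain ⟨l1, m, hm, hcov, hle, hmn⟩ := hpos hx0
    have f1 := (hT.prev x hx (Nat.zero_le _) hx0 _ l1 _
      ((Nat.le_add_right _ _).trans (hle.trans hmn))).1 le_rfl
    refine ⟨_, hm.step hx0 hx l1 d1 hcov f1 f2 hle d2 d3 fτ, fun y hy => ?_⟩
    rcases Nat.lt_succ_iff_lt_or_eq.1 hy with hy | rfl
    · have hne : ord y ≠ ord x := fun h => by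
        have := hinj y (by omega) x hx h
        omega
      obtain ⟨-, -, hout⟩ := hI hx0
      rw [Function.update_of_ne hne, Function.update_of_ne hy.ne, hout y hy]
      by_cases hyp : y = E.par x
      · rw [hyp, Function.update_self, (hcov _ (E.col_lt _)).1]
      · rw [Function.update_of_ne hyp]
    · rw [Function.update_self, Function.update_self, hlb]
      split_ifs with h' <;> simp [h']
  · subst h
    have h00 := h0 rfl
    rw [h00] at fτ d2
    rw [zero_add] at fτ
    refine ⟨_, ElimOrder.isTrace_one hn d1 d3 fτ (Function.update_self _ _ _), fun y hy => ?_⟩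
    obtain rfl : y = 0 := by omega
    rw [Function.update_self, Function.update_self, hlb]
    split_ifs with h' <;> simp [h']

end backtrack

/-! ### Ordering the nodes of the tree -/

section tree

variable {N : ℕ}

/-- The edges of a rooted tree correspond to the nodes other than the root. -/
lemma sum_edges {T : SimpleGraph (Fin N)} {F : List (Fin N × Fin N)} (hF : ListsEdges T F)
    {root : Fin N} {par : Fin N → Fin N} {dep : Fin N → ℕ}
    (hpar : ∀ i, i ≠ root → T.Adj i (par i) ∧ dep i = dep (par i) + 1)
    (hadj : ∀ i j, T.Adj i j → (i ≠ root ∧ par i = j) ∨ (j ≠ root ∧ par j = i))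
    (f : Sym2 (Fin N) → ℕ) :
    (F.map fun e => f s(e.1, e.2)).sum = ∑ j ∈ Finset.univ.erase root, f s(j, par j) := by
  have h1 : (F.map fun e => f s(e.1, e.2)).sum =
      ∑ x ∈ (F.map fun e => s(e.1, e.2)).toFinset, f x := by
    rw [List.sum_toFinset _ hF.1, List.map_map]
    rfl
  rw [h1]
  symm
  refine Finset.sum_bij (fun j _ => s(j, par j)) (fun j hj => ?_) (fun i hi j hj h => ?_)
    (fun e he => ?_) fun _ _ => rfl
  · rw [List.mem_toFinset, ← hF.2]
    exact (hpar j (Finset.ne_of_mem_erase hj)).1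
  · rcases Sym2.eq_iff.1 h with h | ⟨h2, h3⟩
    · exact h.1
    · have a := (hpar i (Finset.ne_of_mem_erase hi)).2
      have b := (hpar j (Finset.ne_of_mem_erase hj)).2
      rw [h3] at a
      rw [← h2] at b
      omega
  · induction e with
    | _ u v =>
      rw [List.mem_toFinset, ← hF.2] at he
      rcases hadj u v he with ⟨h2, rfl⟩ | ⟨h2, rfl⟩
      · exact ⟨u, by simp [h2], rfl⟩
      · exact ⟨v, by simp [h2], Sym2.eq_swap⟩

lemma sum_range_getD {α : Type*} (F : List (α × α)) (v : α → ℕ) (g : ℕ → ℕ → ℕ) :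
    ∑ p ∈ Finset.range F.length,
      g ((F.map fun e => v e.1).getD p 0) ((F.map fun e => v e.2).getD p 0) =
      (F.map fun e => g (v e.1) (v e.2)).sum := by
  induction F with
  | nil => simp
  | cons e F ih =>
    simp [Finset.sum_range_succ', ← ih, add_comm]

variable {W : ℕ} {s : State}

/-- Compute the degree of every node and the sum of its neighbours. -/
def countEdges : Prog :=
  .for 9 (reg rNN - 1) (
    setArr aDeg (arr 2 (reg 9)) (arr aDeg (arr 2 (reg 9)) + 1) ;;
    setArr aDeg (arr 3 (reg 9)) (arr aDeg (arr 3 (reg 9)) + 1) ;;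
    setArr aSum (arr 2 (reg 9)) (arr aSum (arr 2 (reg 9)) + arr 3 (reg 9)) ;;
    setArr aSum (arr 3 (reg 9)) (arr aSum (arr 3 (reg 9)) + arr 2 (reg 9)))

lemma countEdges_spec {A B : ℕ → ℕ} (hN : s.reg rNN = N) (hA : s.arr 2 = A) (hB : s.arr 3 = B)
    (h7 : s.arr aDeg = 0) (h8 : s.arr aSum = 0) (hA' : ∀ p, A p ≤ N) (hB' : ∀ p, B p ≤ N)
    (hW : 2 * (N * N) ≤ W) :
    WP W countEdges s ((N - 1 + 1) * (40 + 12)) fun s' =>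
      (∀ i, s'.arr aDeg i = ∑ p ∈ Finset.range (N - 1),
        ((if A p = i then 1 else 0) + if B p = i then 1 else 0)) ∧
      ∀ i, s'.arr aSum i = ∑ p ∈ Finset.range (N - 1),
        ((if A p = i then B p else 0) + if B p = i then A p else 0) := by
  have hNN : N ≤ N * N := Nat.le_mul_self N
  refine WP.for (N - 1) (fun e s' => (∀ i, s'.arr aDeg i = ∑ p ∈ Finset.range e,
        ((if A p = i then 1 else 0) + if B p = i then 1 else 0)) ∧
      ∀ i, s'.arr aSum i = ∑ p ∈ Finset.range e,
        ((if A p = i then B p else 0) + if B p = i then A p else 0)) rfl (by omega)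
    (fun s' hF => by simp [hF.reg 3 (by decide), hN]) (by simp [h7, h8]) ?_ (fun s' _ _ h => h)
  intro e s₁ he hx hF ⟨hI1, hI2⟩
  have eA := (hF.arr 2 (by decide)).trans hA
  have eB := (hF.arr 3 (by decide)).trans hB
  have b1 : ∀ i, s₁.arr aDeg i ≤ 2 * e := by
    intro i
    rw [hI1 i]
    refine (Finset.sum_le_card_nsmul _ _ 2 fun p _ => ?_).trans (by simp; omega)
    split_ifs <;> omega
  have b2 : ∀ i, s₁.arr aSum i ≤ 2 * (e * N) := by
    intro i
    rw [hI2 i]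
    refine (Finset.sum_le_card_nsmul _ _ (2 * N) fun p _ => ?_).trans (by simp; ring_nf; rfl)
    have := hA' p
    have := hB' p
    split_ifs <;> omega
  have b3 : e * N + N ≤ N * N := by
    calc e * N + N = (e + 1) * N := (Nat.succ_mul e N).symm
      _ ≤ N * N := Nat.mul_le_mul_right _ (by omega)
  have hAe := hA' e
  have hBe := hB' e
  have c1 := b1 (A e)
  have c2 := b1 (B e)
  have c3 := b2 (A e)
  have c4 := b2 (B e)
  refine .of_vc rfl rfl ?_
  simp only [vc, eval_reg, eval_arr, eval_add, State.setR_arr, State.setA_arr, State.setA_reg, hx,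
    eA, eB, Nat.reduceEqDiff, if_true, if_false, Bd_add, eval_ofNat, Finset.sum_range_succ]
  refine ⟨by omega, ?_, by omega, ?_, fun i => ?_, fun i => ?_⟩
  · rw [Function.update_apply]; split_ifs <;> omega
  · rw [Function.update_apply]; split_ifs <;> omega
  · have h1 := hI1 i
    simp only [Function.update_apply, @eq_comm _ i]
    split_ifs <;> simp_all
  · have h1 := hI2 i
    simp only [Function.update_apply, @eq_comm _ i]
    split_ifs <;> (simp_all; try omega)

/-- The children of `i` that are not among the first `h` entries of the queue `q`. -/
def kids (N : ℕ) (par q : ℕ → ℕ) (h i : ℕ) : Finset ℕ :=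
  (Finset.range N).filter fun j => j ≠ 0 ∧ par j = i ∧ ∀ a < h, q a ≠ j

/-- The state of the stripping of leaves: the first `h` nodes of the queue `q` of length `t` are
removed, and the queue contains the nodes other than the root all of whose children are removed. -/
structure Strip (N : ℕ) (par : ℕ → ℕ) (h t : ℕ) (q : ℕ → ℕ) : Prop where
  lt : ∀ a < t, q a < N ∧ q a ≠ 0
  inj : ∀ a < t, ∀ b < t, q a = q b → a = b
  mem : ∀ i < N, i ≠ 0 → kids N par q h i = ∅ → ∃ a < t, q a = i
  child : ∀ a < t, ∀ j < N, j ≠ 0 → par j = q a → ∃ b < a, b < h ∧ q b = j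
  le : h ≤ t

lemma Strip.le_pred {par q : ℕ → ℕ} {h t : ℕ} (hS : Strip N par h t q) : t ≤ N - 1 := by
  have h1 : (Finset.range t).card ≤ ((Finset.range N).erase 0).card := by
    refine Finset.card_le_card_of_injOn q (fun a ha => ?_) fun a ha b hb hab => ?_
    · have := hS.lt a (by simpa using ha)
      simpa using this
    · exact hS.inj a (by simpa using ha) b (by simpa using hb) hab
  rw [Finset.card_range] at h1
  rcases Nat.eq_zero_or_pos N with rfl | hN
  · simpa using h1
  · rwa [Finset.card_erase_of_mem (by simpa using hN), Finset.card_range] at h1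

lemma Strip.kids_queue {par q : ℕ → ℕ} {h t a : ℕ} (hS : Strip N par h t q) (ha : a < t) :
    kids N par q h (q a) = ∅ := by
  rw [kids, Finset.filter_eq_empty_iff]
  rintro j hj ⟨h1, h2, h3⟩
  obtain ⟨b, -, hb, hb'⟩ := hS.child a ha j (Finset.mem_range.1 hj) h1 h2
  exact h3 b hb hb'

/-- As long as not all nodes are removed, the deepest remaining node is in the queue. -/
lemma Strip.lt_of_lt {par q dep : ℕ → ℕ} {h t : ℕ} (hS : Strip N par h t q)
    (hdep : ∀ i < N, i ≠ 0 → dep i = dep (par i) + 1) (hh : h < N - 1) : h < t := by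
  have hex : (((Finset.range N).erase 0) \ ((Finset.range h).image q)).Nonempty := by
    rw [← Finset.card_pos]
    have h1 := Finset.le_card_sdiff ((Finset.range h).image q) ((Finset.range N).erase 0)
    have h2 : ((Finset.range h).image q).card ≤ h := Finset.card_image_le.trans (by simp)
    rw [Finset.card_erase_of_mem (by simp; omega), Finset.card_range] at h1
    omega
  obtain ⟨i, hi, hmax⟩ := Finset.exists_max_image _ dep hex
  simp only [Finset.mem_sdiff, Finset.mem_erase, Finset.mem_range, Finset.mem_image, not_exists,
    not_and] at hi hmax
  obtain ⟨⟨hi0, hiN⟩, hiq⟩ := hi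
  have hk : kids N par q h i = ∅ := by
    rw [kids, Finset.filter_eq_empty_iff]
    rintro j hj ⟨h1, h2, h3⟩
    have := hmax j ⟨⟨h1, Finset.mem_range.1 hj⟩, h3⟩
    have := hdep j (Finset.mem_range.1 hj) h1
    rw [h2] at this
    omega
  obtain ⟨a, ha, rfl⟩ := hS.mem i hiN hi0 hk
  by_contra hlt
  exact hiq a (by omega) rfl

lemma Strip.kids_succ {par q : ℕ → ℕ} {h t : ℕ} (hS : Strip N par h t q) (hh : h < t) (i : ℕ) :
    kids N par q (h + 1) i = (kids N par q h i).erase (q h) := by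
  ext j
  simp only [kids, Finset.mem_filter, Finset.mem_erase, Finset.mem_range]
  constructor
  · rintro ⟨h1, h2, h3, h4⟩
    exact ⟨(h4 h (by omega)).symm, h1, h2, h3, fun a ha => h4 a (by omega)⟩
  · rintro ⟨h0, h1, h2, h3, h4⟩
    refine ⟨h1, h2, h3, fun a ha => ?_⟩
    rcases Nat.lt_succ_iff_lt_or_eq.1 ha with ha | rfl
    exacts [h4 a ha, h0.symm]

lemma Strip.mem_kids {par q : ℕ → ℕ} {h t : ℕ} (hS : Strip N par h t q) (hh : h < t) :
    q h ∈ kids N par q h (par (q h)) := by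
  have := hS.lt h hh
  refine Finset.mem_filter.2 ⟨Finset.mem_range.2 this.1, this.2, rfl, fun a ha hq => ?_⟩
  have := hS.inj a (by omega) h hh hq
  omega

lemma kids_congr {par q q' : ℕ → ℕ} {h : ℕ} (hq : ∀ a < h, q' a = q a) (i : ℕ) :
    kids N par q' h i = kids N par q h i := by
  ext j
  simp only [kids, Finset.mem_filter]
  refine and_congr_right fun _ => and_congr_right fun _ => and_congr_right fun _ => ?_
  exact forall_congr' fun a => imp_congr_right fun ha => by rw [hq a ha]

/-- Removing a node when its parent keeps other children. -/
lemma Strip.step_skip {par q : ℕ → ℕ} {h t : ℕ} (hS : Strip N par h t q) (hh : h < t)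
    (hp : par (q h) = 0 ∨ kids N par q (h + 1) (par (q h)) ≠ ∅) : Strip N par (h + 1) t q := by
  refine ⟨hS.lt, hS.inj, fun i hi hi0 hk => ?_, fun a ha j hj hj0 hpj => ?_, hh⟩
  · refine hS.mem i hi hi0 ?_
    rw [hS.kids_succ hh] at hk
    rwa [Finset.erase_eq_of_notMem] at hk
    intro hmem
    have : par (q h) = i := (Finset.mem_filter.1 hmem).2.2.1
    subst this
    rcases hp with hp | hp
    · exact hi0 hp
    · rw [hS.kids_succ hh] at hp
      exact hp hk
  · obtain ⟨b, h1, h2, h3⟩ := hS.child a ha j hj hj0 hpj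
    exact ⟨b, h1, by omega, h3⟩

/-- Removing the last child of a node. -/
lemma Strip.step_push {par q : ℕ → ℕ} {h t : ℕ} (hS : Strip N par h t q) (hh : h < t)
    (hp0 : par (q h) ≠ 0) (hpN : par (q h) < N) (hp : kids N par q (h + 1) (par (q h)) = ∅) :
    Strip N par (h + 1) (t + 1) (Function.update q t (par (q h))) := by
  have hq : ∀ a < t, Function.update q t (par (q h)) a = q a := fun a ha =>
    Function.update_of_ne ha.ne _ _
  have hk : ∀ i, kids N par (Function.update q t (par (q h))) (h + 1) i = kids N par q (h + 1) i :=
    kids_congr fun a ha => hq a (by omega)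
  -- the parent is new in the queue
  have hnew : ∀ a < t, q a ≠ par (q h) := by
    intro a ha he
    have h1 := hS.kids_queue ha
    have h2 := hS.mem_kids hh
    rw [← he, h1] at h2
    simp at h2
  refine ⟨fun a ha => ?_, fun a ha b hb hab => ?_, fun i hi hi0 hki => ?_,
    fun a ha j hj hj0 hpj => ?_, by omega⟩
  · rcases Nat.lt_succ_iff_lt_or_eq.1 ha with ha | rfl
    · rw [hq a ha]; exact hS.lt a ha
    · rw [Function.update_self]; exact ⟨hpN, hp0⟩
  · rcases Nat.lt_succ_iff_lt_or_eq.1 ha with ha | rfl <;>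
      rcases Nat.lt_succ_iff_lt_or_eq.1 hb with hb | rfl
    · rw [hq a ha, hq b hb] at hab; exact hS.inj a ha b hb hab
    · rw [hq a ha, Function.update_self] at hab; exact (hnew a ha hab).elim
    · rw [hq b hb, Function.update_self] at hab; exact (hnew b hb hab.symm).elim
    · rfl
  · by_cases hip : i = par (q h)
    · exact ⟨t, by omega, by rw [Function.update_self, hip]⟩
    · rw [hk, hS.kids_succ hh, Finset.erase_eq_of_notMem] at hki
      · obtain ⟨a, ha, hqa⟩ := hS.mem i hi hi0 hki
        exact ⟨a, by omega, by rw [hq a ha, hqa]⟩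
      · exact fun hmem => hip (Finset.mem_filter.1 hmem).2.2.1.symm
  · rcases Nat.lt_succ_iff_lt_or_eq.1 ha with ha | rfl
    · rw [hq a ha] at hpj
      obtain ⟨b, h1, h2, h3⟩ := hS.child a ha j hj hj0 hpj
      exact ⟨b, h1, by omega, by rw [hq b (by omega), h3]⟩
    · rw [Function.update_self] at hpj
      by_contra hne
      have : j ∈ kids N par q (h + 1) (par (q h)) :=
        Finset.mem_filter.2 ⟨Finset.mem_range.2 hj, hj0, hpj, fun b hb hqb =>
          hne ⟨b, by omega, by omega, by rw [hq b (by omega), hqb]⟩⟩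
      rw [hp] at this
      simp at this

/-- Put the leaves into the queue. -/
def queueLeaves : Prog :=
  setReg 8 0 ;; .for 9 (reg rNN) (branch (reg 9) (branch (eq (arr aDeg (reg 9)) 1)
    (setArr aQ (reg 8) (reg 9) ;; setReg 8 (reg 8 + 1)) skip) skip)

lemma queueLeaves_spec {par : ℕ → ℕ} (hN : s.reg rNN = N)
    (hdeg : ∀ i < N, s.arr aDeg i = (if i ≠ 0 then 1 else 0) + (kids N par (s.arr aQ) 0 i).card)
    (hW : N ≤ W) :
    WP W queueLeaves s (2 + (N + 1) * (30 + 12)) fun s' =>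
      Strip N par 0 (s'.reg 8) (s'.arr aQ) := by
  refine .seq (.of_vc rfl rfl ⟨trivial, ?_⟩)
  set s₀ := s.setR 8 (eval s 0) with hs₀
  have hN₀ : s₀.reg rNN = N := by simp [hs₀, hN]
  have h8₀ : s₀.reg 8 = 0 := by simp [hs₀]
  have hdeg₀ : s₀.arr aDeg = s.arr aDeg := rfl
  clear_value s₀
  refine WP.for N (fun m s' => s'.reg 8 ≤ m ∧ (∀ a < s'.reg 8, s'.arr aQ a < m ∧ s'.arr aQ a ≠ 0 ∧
      kids N par (s.arr aQ) 0 (s'.arr aQ a) = ∅) ∧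
      (∀ a < s'.reg 8, ∀ b < s'.reg 8, s'.arr aQ a = s'.arr aQ b → a = b) ∧
      ∀ i < m, i ≠ 0 → kids N par (s.arr aQ) 0 i = ∅ → ∃ a < s'.reg 8, s'.arr aQ a = i) rfl hW
    (fun s' hF => by simp [hF.reg 3 (by decide), hN₀]) (by simp [h8₀]) ?_ ?_
  · intro m s₁ hm hx hF ⟨h0, h1, h2, h3⟩
    have eD : s₁.arr aDeg m = _ := (congrFun ((hF.arr aDeg (by decide)).trans hdeg₀) m).trans
      (hdeg m hm)
    refine .of_vc rfl rfl ?_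
    simp only [vc, eval_reg, eval_arr, eval_add, eval_eq, State.setR_arr, State.setR_reg,
      State.setA_arr, State.setA_reg, hx, eD, Nat.reduceEqDiff, if_true, if_false, Bd_add, Bd_reg,
      eval_ofNat, true_and]
    -- nothing is pushed
    have skip : ¬ (m ≠ 0 ∧ kids N par (s.arr aQ) 0 m = ∅) →
        s₁.reg 8 ≤ m + 1 ∧ (∀ a < s₁.reg 8, s₁.arr aQ a < m + 1 ∧ s₁.arr aQ a ≠ 0 ∧
        kids N par (s.arr aQ) 0 (s₁.arr aQ a) = ∅) ∧
        (∀ a < s₁.reg 8, ∀ b < s₁.reg 8, s₁.arr aQ a = s₁.arr aQ b → a = b) ∧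
        ∀ i < m + 1, i ≠ 0 → kids N par (s.arr aQ) 0 i = ∅ → ∃ a < s₁.reg 8, s₁.arr aQ a = i := by
      intro hm'
      refine ⟨by omega, fun a ha => ⟨by have := (h1 a ha).1; omega, (h1 a ha).2⟩, h2,
        fun i hi hi0 hk => ?_⟩
      rcases Nat.lt_succ_iff_lt_or_eq.1 hi with hi | rfl
      · exact h3 i hi hi0 hk
      · exact (hm' ⟨hi0, hk⟩).elim
    refine ⟨fun hm0 => ⟨fun hd => ⟨by omega, ?_⟩, fun hd => skip fun hk => ?_⟩,
      fun hm0 => skip fun hk => hk.1 hm0⟩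
    · rw [if_pos hm0] at hd
      have hk : kids N par (s.arr aQ) 0 m = ∅ := by
        rw [← Finset.card_eq_zero]
        by_contra h
        exact hd (if_neg (by omega))
      refine ⟨by omega, fun a ha => ?_, fun a ha b hb hab => ?_, fun i hi hi0 hki => ?_⟩
      · rcases Nat.lt_succ_iff_lt_or_eq.1 ha with ha | rfl
        · rw [Function.update_of_ne ha.ne]
          exact ⟨by have := (h1 a ha).1; omega, (h1 a ha).2⟩
        · rw [Function.update_self]; exact ⟨by omega, hm0, hk⟩
      · rcases Nat.lt_succ_iff_lt_or_eq.1 ha with ha | rfl <;>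
          rcases Nat.lt_succ_iff_lt_or_eq.1 hb with hb | rfl
        · rw [Function.update_of_ne ha.ne, Function.update_of_ne hb.ne] at hab
          exact h2 a ha b hb hab
        · rw [Function.update_of_ne ha.ne, Function.update_self] at hab
          have := (h1 a ha).1; omega
        · rw [Function.update_of_ne hb.ne, Function.update_self] at hab
          have := (h1 b hb).1; omega
        · rfl
      · rcases Nat.lt_succ_iff_lt_or_eq.1 hi with hi | rfl
        · obtain ⟨a, ha, hqa⟩ := h3 i hi hi0 hki
          exact ⟨a, by omega, by rw [Function.update_of_ne ha.ne, hqa]⟩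
        · exact ⟨s₁.reg 8, by omega, Function.update_self _ _ _⟩
    · rw [hk.2] at hd
      simp [hm0] at hd
  · rintro s' - - ⟨-, h1, h2, h3⟩
    have hk : ∀ i, kids N par (s'.arr aQ) 0 i = kids N par (s.arr aQ) 0 i :=
      kids_congr fun a ha => absurd ha (by omega)
    refine ⟨fun a ha => ⟨(h1 a ha).1, (h1 a ha).2.1⟩, h2, fun i hi hi0 hki => h3 i hi hi0 (hk i ▸ hki),
      fun a ha j hj hj0 hpj => ?_, Nat.zero_le _⟩
    have := (h1 a ha).2.2
    rw [kids, Finset.filter_eq_empty_iff] at this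
    exact (this (Finset.mem_range.2 hj) ⟨hj0, hpj, fun a ha => absurd ha (by omega)⟩).elim

/-- Remove the nodes other than the root one after the other; `aSum` contains the parent of a node
without children. -/
def stripLeaves : Prog :=
  .for 9 (reg rNN - 1) (setReg 10 (arr aQ (reg 9)) ;; setReg 11 (arr aSum (reg 10)) ;;
    setArr aDeg (reg 11) (arr aDeg (reg 11) - 1) ;;
    setArr aSum (reg 11) (arr aSum (reg 11) - reg 10) ;;
    branch (reg 11) (branch (eq (arr aDeg (reg 11)) 1)
      (setArr aQ (reg 8) (reg 11) ;; setReg 8 (reg 8 + 1)) skip) skip)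

lemma stripLeaves_spec {par dep : ℕ → ℕ} (hN : s.reg rNN = N)
    (hpar : ∀ i < N, i ≠ 0 → par i < N ∧ dep i = dep (par i) + 1)
    (hdeg : ∀ i < N, s.arr aDeg i = (if i ≠ 0 then 1 else 0) + (kids N par (s.arr aQ) 0 i).card)
    (hsum : ∀ i < N, s.arr aSum i =
      (if i ≠ 0 then par i else 0) + ∑ j ∈ kids N par (s.arr aQ) 0 i, j)
    (hS : Strip N par 0 (s.reg 8) (s.arr aQ)) (hW : N ≤ W) :
    WP W stripLeaves s ((N - 1 + 1) * (60 + 12)) fun s' =>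
      Strip N par (N - 1) (N - 1) (s'.arr aQ) := by
  refine WP.for (N - 1) (fun h s' => Strip N par h (s'.reg 8) (s'.arr aQ) ∧
      (∀ i < N, s'.arr aDeg i = (if i ≠ 0 then 1 else 0) + (kids N par (s'.arr aQ) h i).card) ∧
      ∀ i < N, s'.arr aSum i = (if i ≠ 0 then par i else 0) + ∑ j ∈ kids N par (s'.arr aQ) h i, j)
    rfl (by omega) (fun s' hF => by simp [hF.reg 3 (by decide), hN]) ⟨hS, hdeg, hsum⟩ ?_ ?_
  · intro h s₁ hh hx hF ⟨hS, h1, h2⟩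
    have hht := hS.lt_of_lt (dep := dep) (fun i hi hi0 => (hpar i hi hi0).2) hh
    have htN := hS.le_pred
    obtain ⟨hqN, hq0⟩ := hS.lt h hht
    set q := s₁.arr aQ with hq
    set i := q h with hi
    obtain ⟨hpN, -⟩ := hpar i hqN hq0
    have hsi : s₁.arr aSum i = par i := by
      rw [h2 i hqN, if_pos hq0, hi, hS.kids_queue hht]
      simp
    have hmem := hS.mem_kids hht
    have hks := hS.kids_succ hht
    rw [← hi] at hmem hks
    have hother : ∀ j, j ≠ par i → kids N par q (h + 1) j = kids N par q h j := fun j hj => by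
      rw [hks, Finset.erase_eq_of_notMem fun hm => hj (Finset.mem_filter.1 hm).2.2.1.symm]
    have hd : s₁.arr aDeg (par i) - 1 =
        (if par i ≠ 0 then 1 else 0) + (kids N par q (h + 1) (par i)).card := by
      rw [h1 _ hpN, hks, Finset.card_erase_of_mem hmem]
      have := Finset.card_pos.2 ⟨_, hmem⟩
      omega
    have hsm : s₁.arr aSum (par i) - i =
        (if par i ≠ 0 then par (par i) else 0) + ∑ j ∈ kids N par q (h + 1) (par i), j := by
      rw [h2 _ hpN, hks, ← Finset.add_sum_erase _ (fun j => j) hmem]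
      omega
    have hdeg' : ∀ j < N, Function.update (s₁.arr aDeg) (par i) (s₁.arr aDeg (par i) - 1) j =
        (if j ≠ 0 then 1 else 0) + (kids N par q (h + 1) j).card := by
      intro j hj
      rw [Function.update_apply]
      split_ifs with hjp hj0 hj0
      · rw [hd, hjp, if_pos (hjp ▸ hj0)]
      · rw [hd, hjp, if_neg (hjp ▸ hj0)]
      · rw [h1 j hj, hother j hjp, if_pos hj0]
      · rw [h1 j hj, hother j hjp, if_neg hj0]
    have hsum' : ∀ j < N, Function.update (s₁.arr aSum) (par i) (s₁.arr aSum (par i) - i) j =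
        (if j ≠ 0 then par j else 0) + ∑ u ∈ kids N par q (h + 1) j, u := by
      intro j hj
      rw [Function.update_apply]
      split_ifs with hjp hj0 hj0
      · rw [hsm, hjp, if_pos (hjp ▸ hj0)]
      · rw [hsm, hjp, if_neg (hjp ▸ hj0)]
      · rw [h2 j hj, hother j hjp, if_pos hj0]
      · rw [h2 j hj, hother j hjp, if_neg hj0]
    refine .of_vc rfl rfl ?_
    simp only [vc, eval_reg, eval_arr, eval_add, eval_sub, eval_eq, State.setR_arr, State.setR_reg,
      State.setA_arr, State.setA_reg, hx, Nat.reduceEqDiff, if_true, if_false, Bd_add, Bd_sub,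
      Bd_reg, Bd_arr, eval_ofNat, true_and, ← hq, ← hi, hsi, Function.update_self]
    refine ⟨fun hp0 => ⟨fun hdp => ⟨by omega, ?_⟩, fun hdp => ?_⟩, fun hp0 => ?_⟩
    · have hk : kids N par q (h + 1) (par i) = ∅ := by
        rw [← Finset.card_eq_zero]
        by_contra hc
        refine hdp (if_neg ?_)
        rw [hd, if_pos hp0]
        omega
      have hkc : ∀ j, kids N par (Function.update q (s₁.reg 8) (par i)) (h + 1) j =
          kids N par q (h + 1) j :=
        kids_congr fun a ha => Function.update_of_ne (by omega) _ _
      refine ⟨hS.step_push hht hp0 hpN hk, fun j hj => ?_, fun j hj => ?_⟩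
      · rw [hkc]; exact hdeg' j hj
      · rw [hkc]; exact hsum' j hj
    · refine ⟨hS.step_skip hht (.inr fun hk => ?_), hdeg', hsum'⟩
      rw [← hi] at hk
      rw [hd, if_pos hp0, hk] at hdp
      simp at hdp
    · exact ⟨hS.step_skip hht (.inl hp0), hdeg', hsum'⟩
  · rintro s' - - ⟨hS, -, -⟩
    have h1 := hS.le
    have h2 := hS.le_pred
    have : s'.reg 8 = N - 1 := by omega
    rwa [this] at hS

/-- Order the nodes of the tree such that children precede their parents. -/
def orderNodes : Prog :=
  countEdges ;; queueLeaves ;; stripLeaves ;; setArr aQ (reg rNN - 1) 0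

/-- The node in cell `N - 1 - a` of the queue is the node of height `a`, and the heights increase
from a node to its children. -/
structure NodeOrder {N : ℕ} (T : SimpleGraph (Fin N)) (q : ℕ → ℕ) (root : Fin N)
    (par : Fin N → Fin N) (h : Fin N → ℕ) : Prop where
  adj : ∀ i j, T.Adj i j → (i ≠ root ∧ par i = j) ∨ (j ≠ root ∧ par j = i)
  par_lt : ∀ i, i ≠ root → h (par i) < h i
  inj : Function.Injective h
  lt : ∀ i, h i < N
  queue : ∀ i, q (N - 1 - h i) = i

lemma ListsEdges.length {T : SimpleGraph (Fin N)} (hT : T.IsTree) {F : List (Fin N × Fin N)}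
    (hF : ListsEdges T F) : F.length = N - 1 := by
  obtain ⟨root⟩ := hT.connected.nonempty
  obtain ⟨par, dep, hpar, hadj⟩ := exists_parent hT root
  have := sum_edges hF hpar hadj fun _ => 1
  simpa using this

/-- Stripping leaves needs only the degrees and the sums of the neighbours: the sum of the remaining
neighbours of a leaf is its parent. -/
lemma orderNodes_spec {T : SimpleGraph (Fin N)} (hT : T.IsTree) {F : List (Fin N × Fin N)}
    (hF : ListsEdges T F) (hN : s.reg rNN = N)
    (hA : s.arr 2 = fun p => (F.map fun e => (e.1 : ℕ)).getD p 0)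
    (hB : s.arr 3 = fun p => (F.map fun e => (e.2 : ℕ)).getD p 0)
    (h7 : s.arr aDeg = 0) (h8 : s.arr aSum = 0) (hW : 2 * (N * N) ≤ W) :
    WP W orderNodes s ((N - 1 + 1) * (40 + 12) + ((2 + (N + 1) * (30 + 12)) +
      ((N - 1 + 1) * (60 + 12) + 10))) fun s' =>
      ∃ root par h, NodeOrder T (s'.arr aQ) root par h := by
  obtain ⟨root₀⟩ := hT.connected.nonempty
  have hN0 : 0 < N := by have := root₀.2; omega
  have hNW : N ≤ W := by have := Nat.le_mul_self N; omega
  set root : Fin N := ⟨0, hN0⟩ with hroot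
  obtain ⟨par, dep, hpar, hadj⟩ := exists_parent hT root
  have hlen := hF.length hT
  let P : ℕ → ℕ := fun i => if h : i < N then par ⟨i, h⟩ else 0
  let D : ℕ → ℕ := fun i => if h : i < N then dep ⟨i, h⟩ else 0
  have hP : ∀ i : Fin N, P i = par i := fun i => by simp [P]
  have hD : ∀ i : Fin N, D i = dep i := fun i => by simp [D]
  have hne : ∀ i : Fin N, i ≠ root ↔ (i : ℕ) ≠ 0 := fun i => by simp [hroot, Fin.ext_iff]
  have hPD : ∀ i < N, i ≠ 0 → P i < N ∧ D i = D (P i) + 1 := by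
    intro i hi hi0
    have h1 := (hpar ⟨i, hi⟩ ((hne _).2 hi0)).2
    have h2 := hP ⟨i, hi⟩
    have h3 := hD ⟨i, hi⟩
    simp only at h2 h3
    rw [h2, hD, h3]
    exact ⟨(par ⟨i, hi⟩).2, h1⟩
  -- a sum over the neighbours of a node
  have nbr : ∀ (q : ℕ → ℕ) (φ : ℕ → ℕ) (i : Fin N), (F.map fun e =>
      (if (e.1 : ℕ) = i then φ e.2 else 0) + if (e.2 : ℕ) = i then φ e.1 else 0).sum =
      (if (i : ℕ) ≠ 0 then φ (P i) else 0) + ∑ j ∈ kids N P q 0 i, φ j := by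
    intro q φ i
    have h1 := sum_edges hF hpar hadj (Sym2.lift ⟨fun a b =>
      (if (a : ℕ) = i then φ b else 0) + if (b : ℕ) = i then φ a else 0,
      fun a b => add_comm _ _⟩)
    simp only [Sym2.lift_mk] at h1
    rw [h1, Finset.sum_add_distrib]
    congr 1
    · simp only [← Fin.ext_iff]
      rw [Finset.sum_ite_eq']
      simp only [Finset.mem_erase, Finset.mem_univ, and_true, hne, hP]
    · rw [← Finset.sum_filter]
      refine Finset.sum_bij (fun j _ => (j : ℕ)) (fun j hj => ?_) (fun a _ b _ h => Fin.ext h)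
        (fun j hj => ?_) fun _ _ => rfl
      · simp only [Finset.mem_filter, Finset.mem_erase, Finset.mem_univ, and_true, hne] at hj
        exact Finset.mem_filter.2 ⟨Finset.mem_range.2 j.2, hj.1, by rw [hP, hj.2],
          fun a ha => absurd ha (by omega)⟩
      · obtain ⟨h1, h2, h3, -⟩ := Finset.mem_filter.1 hj
        refine ⟨⟨j, Finset.mem_range.1 h1⟩, ?_, rfl⟩
        simp only [Finset.mem_filter, Finset.mem_erase, Finset.mem_univ, and_true, hne]
        exact ⟨h2, by rw [← hP]; exact h3⟩
  have hle : ∀ (g : Fin N × Fin N → Fin N) (p : ℕ), (F.map fun e => (g e : ℕ)).getD p 0 ≤ N := by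
    intro g p
    rw [List.getD_eq_getElem?_getD, List.getElem?_map]
    cases F[p]? <;> simp
  refine .seq' (countEdges_spec hN hA hB h7 h8 (hle _) (hle _) hW) fun s₁ ⟨h₁, h₁'⟩ F₁ => ?_
  have hN₁ := (F₁.reg 3 (by decide)).trans hN
  have hdeg : ∀ i < N, s₁.arr aDeg i =
      (if i ≠ 0 then 1 else 0) + (kids N P (s₁.arr aQ) 0 i).card := by
    intro i hi
    rw [h₁ i, ← hlen, sum_range_getD F (fun v => (v : ℕ))
      fun a b => (if a = i then 1 else 0) + if b = i then 1 else 0]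
    rw [nbr (s₁.arr aQ) (fun _ => 1) ⟨i, hi⟩]
    simp
  have hsum : ∀ i < N, s₁.arr aSum i =
      (if i ≠ 0 then P i else 0) + ∑ j ∈ kids N P (s₁.arr aQ) 0 i, j := by
    intro i hi
    rw [h₁' i, ← hlen, sum_range_getD F (fun v => (v : ℕ))
      fun a b => (if a = i then b else 0) + if b = i then a else 0]
    exact nbr (s₁.arr aQ) (fun j => j) ⟨i, hi⟩
  refine .seq' (queueLeaves_spec hN₁ hdeg hNW) fun s₂ h₂ F₂ => ?_
  have hN₂ := (F₂.reg 3 (by decide)).trans hN₁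
  have hk₂ : ∀ i, kids N P (s₂.arr aQ) 0 i = kids N P (s₁.arr aQ) 0 i :=
    kids_congr fun a ha => absurd ha (by omega)
  refine .seq' (stripLeaves_spec (dep := D) hN₂ hPD (fun i hi => ?_) (fun i hi => ?_) h₂ hNW)
    fun s₃ h₃ F₃ => ?_
  · rw [hk₂, F₂.arr aDeg (by decide)]; exact hdeg i hi
  · rw [hk₂, F₂.arr aSum (by decide)]; exact hsum i hi
  have hN₃ := (F₃.reg 3 (by decide)).trans hN₂
  refine .of_vc rfl rfl ⟨trivial, ?_⟩
  simp only [State.setA_arr, if_true, eval_sub, eval_reg, hN₃, eval_ofNat]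
  set q := s₃.arr aQ with hq
  -- every node is in the queue
  have surj : ∀ i : Fin N, ∃ a < N, Function.update q (N - 1) 0 a = i ∧
      ((i : ℕ) ≠ 0 → a < N - 1 ∧ q a = i) := by
    intro i
    by_cases hi0 : (i : ℕ) = 0
    · exact ⟨N - 1, by omega, by simp [hi0], fun h => (h hi0).elim⟩
    · obtain ⟨a, ha, hqa⟩ : ∃ a < N - 1, q a = i := by
        have himg : (Finset.range (N - 1)).image q = (Finset.range N).erase 0 := by
          refine Finset.eq_of_subset_of_card_le (fun j hj => ?_) ?_
          · obtain ⟨a, ha, rfl⟩ := Finset.mem_image.1 hj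
            have := h₃.lt a (Finset.mem_range.1 ha)
            simpa using ⟨this.2, this.1⟩
          · rw [Finset.card_erase_of_mem (by simpa using hN0), Finset.card_range,
              Finset.card_image_of_injOn, Finset.card_range]
            intro a ha b hb hab
            exact h₃.inj a (by simpa using ha) b (by simpa using hb) hab
        have : (i : ℕ) ∈ (Finset.range (N - 1)).image q := by
          rw [himg]; simpa using hi0
        obtain ⟨a, ha, hqa⟩ := Finset.mem_image.1 this
        exact ⟨a, Finset.mem_range.1 ha, hqa⟩
      exact ⟨a, by omega, by rw [Function.update_of_ne ha.ne, hqa], fun _ => ⟨ha, hqa⟩⟩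
  choose pos hpos hqpos hqpos' using surj
  refine ⟨root, par, fun i => N - 1 - pos i, hadj, fun i hi => ?_, fun i j hij => ?_, fun i => by omega,
    fun i => ?_⟩
  · have hi0 := (hne i).1 hi
    obtain ⟨hlt, hqi⟩ := hqpos' i hi0
    suffices h : pos i < pos (par i) by have := hpos (par i); omega
    by_cases hp0 : (par i : ℕ) = 0
    · have h1 := hqpos (par i)
      by_contra hle
      rw [Function.update_of_ne (by omega), hp0] at h1
      exact (h₃.lt _ (by omega)).2 h1
    · obtain ⟨hltp, hqp⟩ := hqpos' (par i) hp0
      obtain ⟨b, h1, h2, h3⟩ := h₃.child _ hltp i i.2 hi0 (by rw [hP, hqp])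
      have := h₃.inj b h2 (pos i) hlt (by rw [h3, hqi])
      omega
  · have h1 := hpos i
    have h2 := hpos j
    have h3 : pos i = pos j := by omega
    have h4 := hqpos i
    rw [h3, hqpos j] at h4
    exact Fin.ext h4.symm
  · have h1 := hpos i
    have : N - 1 - (N - 1 - pos i) = pos i := by omega
    rw [this, hqpos]

end tree

/-! ### Ordering the vertices -/

section order

variable {W n N : ℕ} {s : State}

lemma getD_flatten (l : List (List ℕ)) (i j : ℕ) (hj : j < (l.getD i []).length) :
    l.flatten.getD (∑ a ∈ Finset.range i, (l.map List.length).getD a 0 + j) 0 =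
      (l.getD i []).getD j 0 := by
  induction l generalizing i with
  | nil => simp at hj
  | cons x l ih =>
    cases i with
    | zero =>
      simp only [List.getD_cons_zero] at hj ⊢
      rw [List.flatten_cons, Finset.sum_range_zero, zero_add, List.getD_append _ _ _ _ hj]
    | succ i =>
      rw [List.getD_cons_succ] at hj ⊢
      rw [← ih i hj, Finset.sum_range_succ', List.flatten_cons, List.getD_append_right]
      · simp only [List.map_cons, List.getD_cons_succ, List.getD_cons_zero]
        congr 1
        omega
      · simp only [List.map_cons, List.getD_cons_zero]
        omega

/-- Compute the offsets of the bags and the maximum size of a bag. -/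
def prefixSums : Prog :=
  (setReg 16 0 ;; setReg rK 0) ;; .for 9 (reg rNN) (setArr aOff (reg 9) (reg 16) ;;
    setReg 16 (reg 16 + arr aSz (reg 9)) ;;
    branch (lt (reg rK) (arr aSz (reg 9))) (setReg rK (arr aSz (reg 9))) skip)

lemma prefixSums_spec {sz : ℕ → ℕ} (hN : s.reg rNN = N) (hsz : s.arr aSz = sz)
    (hle : ∀ i < N, sz i ≤ n) (hW : N * n ≤ W) (hW' : N ≤ W) :
    WP W prefixSums s (10 + (N + 1) * (30 + 12)) fun s' =>
      (∀ i < N, s'.arr aOff i = ∑ a ∈ Finset.range i, sz a) ∧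
      s'.reg rK = (Finset.range N).sup sz := by
  refine .seq' (Q' := fun s' => s'.reg 16 = 0 ∧ s'.reg rK = 0) (.of_vc rfl rfl (by simp [vc]))
    fun s₀ ⟨h16, h4⟩ F₀ => ?_
  have hN₀ := (F₀.reg 3 (by decide)).trans hN
  have hsz₀ := (F₀.arr aSz (by decide)).trans hsz
  refine WP.for N (fun m s' => (∀ i < m, s'.arr aOff i = ∑ a ∈ Finset.range i, sz a) ∧
      s'.reg 16 = ∑ a ∈ Finset.range m, sz a ∧ s'.reg rK = (Finset.range m).sup sz) rfl hW'
    (fun s' hF => by simp [hF.reg 3 (by decide), hN₀]) (by simp [h16, h4]) ?_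
    (fun s' _ _ h => ⟨h.1, h.2.2⟩)
  intro m s₁ hm hx hF ⟨h1, h2, h3⟩
  have hsz₁ := (hF.arr aSz (by decide)).trans hsz₀
  have hsum : ∑ a ∈ Finset.range m, sz a + sz m ≤ W := by
    rw [← Finset.sum_range_succ]
    refine (Finset.sum_le_card_nsmul _ _ n fun a ha => hle a ?_).trans ?_
    · rw [Finset.mem_range] at ha; omega
    · rw [Finset.card_range, smul_eq_mul]
      exact (Nat.mul_le_mul_right _ hm).trans hW
  have hsup : (Finset.range (m + 1)).sup sz = max (sz m) ((Finset.range m).sup sz) := by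
    rw [Finset.range_add_one, Finset.sup_insert]
  have hoff : ∀ i < m + 1, Function.update (s₁.arr aOff) m (s₁.reg 16) i =
      ∑ a ∈ Finset.range i, sz a := by
    intro i hi
    rcases Nat.lt_succ_iff_lt_or_eq.1 hi with hi | rfl
    · rw [Function.update_of_ne hi.ne, h1 i hi]
    · rw [Function.update_self, h2]
  refine .of_vc rfl rfl ?_
  simp only [vc, eval_reg, eval_arr, eval_add, eval_lt, State.setR_arr, State.setR_reg,
    State.setA_arr, State.setA_reg, hx, hsz₁, Nat.reduceEqDiff, if_true, if_false, Bd_add, Bd_reg,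
    Bd_arr, true_and, hsup, Finset.sum_range_succ, ← h2, ← h3]
  rw [← h2] at hsum
  refine ⟨hsum, fun hlt => ⟨hoff, ?_⟩, fun hlt => ⟨hoff, ?_⟩⟩
  · rw [ite_ne_right_iff] at hlt; omega
  · rw [ite_eq_right_iff] at hlt; omega

/-- `bag` number `a` consists of the vertices that are listed for the node in cell `N - 1 - a` of
the queue. -/
def BagAt (N : ℕ) (q off sz fl : ℕ → ℕ) (a v : ℕ) : Prop :=
  ∃ j < sz (q (N - 1 - a)), fl (off (q (N - 1 - a)) + j) = v

/-- The first `cnt` vertices are numbered by `ord`, with inverse `id` (shifted by one) and numbers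
`τ` of the first bags, which are at most `h`; these are the vertices in `seen`. -/
structure PartOrder (n : ℕ) (bag : ℕ → ℕ → Prop) (seen : ℕ → Prop) (h cnt : ℕ) (ord τ id : ℕ → ℕ) :
    Prop where
  id_ord : ∀ x < cnt, id (ord x) = x + 1
  ord_id : ∀ v, id v ≠ 0 → id v - 1 < cnt ∧ ord (id v - 1) = v
  seen_iff : ∀ v, id v ≠ 0 ↔ seen v
  lt : ∀ x < cnt, ord x < n
  tau_le : ∀ x < cnt, τ x ≤ h
  bag_tau : ∀ x < cnt, bag (τ x) (ord x)
  not_bag : ∀ x < cnt, ∀ j < τ x, ¬ bag j (ord x)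
  mono : ∀ x < cnt, ∀ y ≤ x, τ y ≤ τ x

variable {bag : ℕ → ℕ → Prop} {seen : ℕ → Prop} {h cnt : ℕ} {ord τ id : ℕ → ℕ}

lemma PartOrder.inj (hP : PartOrder n bag seen h cnt ord τ id) :
    ∀ x < cnt, ∀ y < cnt, ord x = ord y → x = y := by
  intro x hx y hy hxy
  have h1 := hP.id_ord x hx
  rw [hxy, hP.id_ord y hy] at h1
  omega

lemma PartOrder.card_le (hP : PartOrder n bag seen h cnt ord τ id) : cnt ≤ n := by
  have := Finset.card_le_card_of_injOn (s := Finset.range cnt) (t := Finset.range n) ord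
    (fun x hx => by simpa using hP.lt x (by simpa using hx))
    fun x hx y hy hxy => hP.inj x (by simpa using hx) y (by simpa using hy) hxy
  simpa using this

lemma PartOrder.congr {seen' : ℕ → Prop} {h' : ℕ} (hP : PartOrder n bag seen h cnt ord τ id)
    (hs : ∀ v, seen v ↔ seen' v) (hh : h ≤ h') : PartOrder n bag seen' h' cnt ord τ id :=
  ⟨hP.id_ord, hP.ord_id, fun v => (hP.seen_iff v).trans (hs v), hP.lt,
    fun x hx => (hP.tau_le x hx).trans hh, hP.bag_tau, hP.not_bag, hP.mono⟩

/-- Number the next vertex `v`, which is new in bag `h`. -/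
lemma PartOrder.step (hP : PartOrder n bag seen h cnt ord τ id) {v : ℕ} (hv : v < n)
    (hid : id v = 0) (hbag : bag h v) (hseen : ∀ a < h, bag a v → seen v) :
    PartOrder n bag (fun u => seen u ∨ v = u) h (cnt + 1) (Function.update ord cnt v)
      (Function.update τ cnt h) (Function.update id v (cnt + 1)) := by
  have hne : ∀ x < cnt, ord x ≠ v := by
    rintro x hx rfl
    have := hP.id_ord x hx
    omega
  have ho : ∀ x < cnt, Function.update ord cnt v x = ord x := fun x hx =>
    Function.update_of_ne hx.ne _ _
  have ht : ∀ x < cnt, Function.update τ cnt h x = τ x := fun x hx =>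
    Function.update_of_ne hx.ne _ _
  refine ⟨fun x hx => ?_, fun u hu => ?_, fun u => ?_, fun x hx => ?_, fun x hx => ?_,
    fun x hx => ?_, fun x hx j hj => ?_, fun x hx y hy => ?_⟩
  · rcases Nat.lt_succ_iff_lt_or_eq.1 hx with hx | rfl
    · rw [ho x hx, Function.update_of_ne (hne x hx), hP.id_ord x hx]
    · rw [Function.update_self, Function.update_self]
  · by_cases huv : u = v
    · subst huv
      rw [Function.update_self, Nat.add_sub_cancel, Function.update_self]
      exact ⟨by omega, rfl⟩
    · rw [Function.update_of_ne huv] at hu ⊢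
      obtain ⟨h1, h2⟩ := hP.ord_id u hu
      exact ⟨by omega, by rw [ho _ h1, h2]⟩
  · by_cases huv : u = v
    · subst huv
      simp
    · rw [Function.update_of_ne huv, hP.seen_iff]
      simp [Ne.symm huv]
  · rcases Nat.lt_succ_iff_lt_or_eq.1 hx with hx | rfl
    · rw [ho x hx]; exact hP.lt x hx
    · rwa [Function.update_self]
  · rcases Nat.lt_succ_iff_lt_or_eq.1 hx with hx | rfl
    · rw [ht x hx]; exact hP.tau_le x hx
    · rw [Function.update_self]
  · rcases Nat.lt_succ_iff_lt_or_eq.1 hx with hx | rfl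
    · rw [ht x hx, ho x hx]; exact hP.bag_tau x hx
    · rwa [Function.update_self, Function.update_self]
  · rcases Nat.lt_succ_iff_lt_or_eq.1 hx with hx | rfl
    · rw [ht x hx] at hj
      rw [ho x hx]; exact hP.not_bag x hx j hj
    · rw [Function.update_self] at hj
      rw [Function.update_self]
      exact fun hb => (hP.seen_iff v).2 (hseen j hj hb) hid
  · rcases Nat.lt_succ_iff_lt_or_eq.1 hx with hx | rfl
    · rw [ht x hx, ht y (by omega)]; exact hP.mono x hx y hy
    · rw [Function.update_self]
      rcases hy.lt_or_eq with hy | rfl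
      · rw [ht y hy]; exact hP.tau_le y hy
      · rw [Function.update_self]

/-- Number the vertices in the order of their first appearance in the bags. -/
def firstOrder : Prog :=
  setReg 8 0 ;; .for 9 (reg rNN) (setReg 10 (arr aQ (reg rNN - 1 - reg 9)) ;;
    .for 11 (arr aSz (reg 10)) (setReg 12 (arr aFl (arr aOff (reg 10) + reg 11)) ;;
      branch (arr aId (reg 12)) skip (setArr aOrd (reg 8) (reg 12) ;; setArr aTau (reg 8) (reg 9) ;;
        setReg 8 (reg 8 + 1) ;; setArr aId (reg 12) (reg 8))))

lemma firstOrder_spec {k : ℕ} {q off sz fl : ℕ → ℕ} (hN : s.reg rNN = N) (hq : s.arr aQ = q)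
    (hoff : s.arr aOff = off) (hsz : s.arr aSz = sz) (hfl : s.arr aFl = fl) (hid : s.arr aId = 0)
    (hlt : ∀ a < N, ∀ v, BagAt N q off sz fl a v → v < n)
    (hex : ∀ v < n, ∃ a < N, BagAt N q off sz fl a v) (hk : ∀ a < N, sz (q a) ≤ k)
    (hW : N ≤ W) (hWk : k ≤ W) (hWn : n ≤ W) :
    WP W firstOrder s (2 + (N + 1) * (10 + (k + 1) * (40 + 12) + 12)) fun s' =>
      IsFirstOrder n N (BagAt N q off sz fl) (s'.arr aOrd) (s'.arr aTau) ∧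
      ∀ x < n, s'.arr aId (s'.arr aOrd x) = x + 1 := by
  refine .seq (.of_vc rfl rfl ⟨trivial, ?_⟩)
  set s₀ := s.setR 8 (eval s 0) with hs₀
  have hN₀ : s₀.reg rNN = N := by simp [hs₀, hN]
  have h8₀ : s₀.reg 8 = 0 := by simp [hs₀]
  have hq₀ : s₀.arr aQ = q := hq
  have hoff₀ : s₀.arr aOff = off := hoff
  have hsz₀ : s₀.arr aSz = sz := hsz
  have hfl₀ : s₀.arr aFl = fl := hfl
  have hid₀ : s₀.arr aId = 0 := hid
  clear_value s₀
  refine WP.for N (fun a s' => PartOrder n (BagAt N q off sz fl)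
      (fun v => ∃ b < a, BagAt N q off sz fl b v) a (s'.reg 8) (s'.arr aOrd) (s'.arr aTau)
      (s'.arr aId)) rfl hW
    (fun s' hF => by simp [hF.reg 3 (by decide), hN₀]) ?_ ?_ ?_
  · simp only [State.setR_reg, State.setR_arr, h8₀, hid₀]
    exact ⟨by simp, by simp, by simp, by simp, by simp, by simp, by simp, by simp⟩
  · intro a s₁ ha hx hF hI
    have hN₁ := (hF.reg 3 (by decide)).trans hN₀
    have hq₁ := (hF.arr aQ (by decide)).trans hq₀
    have hoff₁ := (hF.arr aOff (by decide)).trans hoff₀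
    have hsz₁ := (hF.arr aSz (by decide)).trans hsz₀
    have hfl₁ := (hF.arr aFl (by decide)).trans hfl₀
    set i := q (N - 1 - a) with hi
    have hki := hk (N - 1 - a) (by omega)
    rw [← hi] at hki
    refine .mono (T := 10 + (k + 1) * (40 + 12)) ?_ le_rfl fun _ h => h
    refine .seq' (Q' := fun s' => s'.reg 10 = i) (.of_vc rfl rfl (by simp [vc, hx, hN₁, hq₁, hi]))
      fun s₂ h10 F₂ => ?_
    have h9₂ := (F₂.reg 9 (by decide)).trans hx
    have hoff₂ := (F₂.arr aOff (by decide)).trans hoff₁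
    have hsz₂ := (F₂.arr aSz (by decide)).trans hsz₁
    have hfl₂ := (F₂.arr aFl (by decide)).trans hfl₁
    refine .mono (T := (sz i + 1) * (40 + 12)) (WP.for (sz i) (fun j s' =>
      PartOrder n (BagAt N q off sz fl) (fun v => (∃ b < a, BagAt N q off sz fl b v) ∨
        ∃ j' < j, fl (off i + j') = v) a (s'.reg 8) (s'.arr aOrd) (s'.arr aTau) (s'.arr aId))
      rfl (by omega) (fun s' hF => by
        simp [hF.reg 10 (by decide), h10, hF.arr aSz (by decide), hsz₂]) ?_ ?_ ?_)
      (Nat.mul_le_mul_right _ (by omega)) fun _ h => h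
    · simp only [State.setR_reg, State.setR_arr, Nat.reduceEqDiff, if_false,
        F₂.reg 8 (by decide), F₂.arr aOrd (by decide), F₂.arr aTau (by decide),
        F₂.arr aId (by decide)]
      exact hI.congr (by simp) le_rfl
    · intro j s₃ hj hx3 hF3 hI3
      have h9₃ := (hF3.reg 9 (by decide)).trans h9₂
      have h10₃ := (hF3.reg 10 (by decide)).trans h10
      have hoff₃ := (hF3.arr aOff (by decide)).trans hoff₂
      have hfl₃ := (hF3.arr aFl (by decide)).trans hfl₂
      have hcnt := hI3.card_le
      have hbag : BagAt N q off sz fl a (fl (off i + j)) := ⟨j, hj, rfl⟩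
      have hvn := hlt a ha _ hbag
      have hseen : ∀ v, (((∃ b < a, BagAt N q off sz fl b v) ∨ ∃ j' < j, fl (off i + j') = v) ∨
          fl (off i + j) = v) ↔ (∃ b < a, BagAt N q off sz fl b v) ∨
          ∃ j' < j + 1, fl (off i + j') = v := by
        intro v
        rw [or_assoc]
        refine or_congr_right ⟨?_, ?_⟩
        · rintro (⟨j', h1, h2⟩ | h)
          exacts [⟨j', by omega, h2⟩, ⟨j, by omega, h⟩]
        · rintro ⟨j', h1, h2⟩
          rcases Nat.lt_succ_iff_lt_or_eq.1 h1 with h1 | rfl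
          exacts [.inl ⟨j', h1, h2⟩, .inr h2]
      refine .of_vc rfl rfl ?_
      simp only [vc, eval_reg, eval_arr, eval_add, State.setR_arr, State.setR_reg,
        State.setA_arr, State.setA_reg, hx3, h9₃, h10₃, hoff₃, hfl₃, Nat.reduceEqDiff, if_true,
        if_false, Bd_add, Bd_reg, Bd_arr, true_and, eval_ofNat]
      refine ⟨fun h0 => ?_, fun h0 => ?_⟩
      · refine hI3.congr (fun v => ?_) le_rfl
        rw [← hseen v]
        constructor
        · exact .inl
        · rintro (h | rfl)
          exacts [h, (hI3.seen_iff _).1 h0]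
      · have hstep := hI3.step hvn h0 hbag fun b hb hbv => .inl ⟨b, hb, hbv⟩
        have hcnt' := hstep.card_le
        exact ⟨by omega, hstep.congr hseen le_rfl⟩
    · intro s₃ _ _ hI3
      simp only [State.setR_reg, State.setR_arr, Nat.reduceEqDiff, if_false]
      refine hI3.congr (fun v => ?_) (by omega)
      constructor
      · rintro (⟨b, h1, h2⟩ | ⟨j, h1, h2⟩)
        exacts [⟨b, by omega, h2⟩, ⟨a, by omega, j, h1, h2⟩]
      · rintro ⟨b, h1, h2⟩
        rcases Nat.lt_succ_iff_lt_or_eq.1 h1 with h1 | rfl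
        exacts [.inl ⟨b, h1, h2⟩, .inr h2]
  · intro s' _ _ hI
    have hcnt : s'.reg 8 = n := by
      refine le_antisymm hI.card_le ?_
      have := Finset.card_le_card_of_injOn (s := Finset.range n) (t := Finset.range (s'.reg 8))
        (fun v => s'.arr aId v - 1) (fun v hv => ?_) fun u hu v hv huv => ?_
      · simpa using this
      · have hv' := hI.ord_id v ((hI.seen_iff v).2 (hex v (by simpa using hv)))
        simpa using hv'.1
      · have hu' := hI.ord_id u ((hI.seen_iff u).2 (hex u (by simpa using hu)))
        have hv' := hI.ord_id v ((hI.seen_iff v).2 (hex v (by simpa using hv)))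
        simp only at huv
        rw [← hu'.2, ← hv'.2, huv]
    rw [hcnt] at hI
    refine ⟨⟨hI.lt, hI.inj, fun x hx => ?_, hI.bag_tau, hI.not_bag, hI.mono⟩, hI.id_ord⟩
    by_contra hτ
    obtain ⟨b, hb, hb'⟩ := (hI.seen_iff _).1 (show s'.arr aId (s'.arr aOrd x) ≠ 0 by
      rw [hI.id_ord x hx]; omega)
    exact hI.not_bag x hx b (by omega) hb'

end order

/-! ### Slots, parents and adjacency -/

section slots

variable {W n N k : ℕ} {s : State}

lemma IsFirstOrder.exists_ord {bag : ℕ → ℕ → Prop} {ord τ : ℕ → ℕ}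
    (hO : IsFirstOrder n N bag ord τ) {v : ℕ} (hv : v < n) : ∃ x < n, ord x = v := by
  have : (Finset.range n).image ord = Finset.range n := by
    refine Finset.eq_of_subset_of_card_le (fun j hj => ?_) ?_
    · obtain ⟨a, ha, rfl⟩ := Finset.mem_image.1 hj
      simpa using hO.ord_lt a (by simpa using ha)
    · rw [Finset.card_image_of_injOn]
      intro a ha b hb hab
      exact hO.ord_inj a (by simpa using ha) b (by simpa using hb) hab
  have hv' : v ∈ (Finset.range n).image ord := by simpa [this] using hv
  obtain ⟨x, hx, h⟩ := Finset.mem_image.1 hv'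
  exact ⟨x, by simpa using hx, h⟩

/-- Scan the first bag of the vertex `reg 10`, whose node is `reg 13`: mark the slots of the earlier
vertices in array `aUsed`, and compute the largest of these vertices in register `14`. -/
def scanBag : Prog :=
  .for 11 (arr aSz (reg 13)) (setReg 15 (arr aId (arr aFl (arr aOff (reg 13) + reg 11))) ;;
    branch (lt (reg 15) (reg 10 + 1))
      (setArr aUsed (arr aCol (reg 15 - 1)) (reg 10 + 1) ;;
        branch (lt (reg 14) (reg 15 - 1)) (setReg 14 (reg 15 - 1)) skip) skip)

lemma scanBag_spec {u : ℕ → ℕ} {x m : ℕ} (hx : s.reg 10 = x) (hxn : x < n) (h14 : s.reg 14 = 0)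
    (hsz : s.arr aSz (s.reg 13) = m)
    (hu : ∀ j < m, u j < n ∧ s.arr aId (s.arr aFl (s.arr aOff (s.reg 13) + j)) = u j + 1)
    (hused : ∀ c, s.arr aUsed c ≤ x) (hmk : m ≤ k) (hW : n + 1 ≤ W) (hWk : k ≤ W) :
    WP W scanBag s ((k + 1) * (50 + 12)) fun s' =>
      (∀ j < m, u j < x → u j ≤ s'.reg 14) ∧
      (s'.reg 14 = 0 ∨ ∃ j < m, u j < x ∧ s'.reg 14 = u j) ∧
      (∀ c, s'.arr aUsed c ≤ x + 1) ∧
      ∀ c, s'.arr aUsed c = x + 1 ↔ ∃ j < m, u j < x ∧ s.arr aCol (u j) = c := by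
  refine .mono (T := (m + 1) * (50 + 12)) (WP.for m (fun i s' =>
      (∀ j < i, u j < x → u j ≤ s'.reg 14) ∧
      (s'.reg 14 = 0 ∨ ∃ j < i, u j < x ∧ s'.reg 14 = u j) ∧
      (∀ c, s'.arr aUsed c ≤ x + 1) ∧
      ∀ c, s'.arr aUsed c = x + 1 ↔ ∃ j < i, u j < x ∧ s.arr aCol (u j) = c) rfl (by omega)
    (fun s' hF => by simp [hF.reg 13 (by decide), hF.arr aSz (by decide), hsz]) ?_ ?_
    fun _ _ _ h => h) (Nat.mul_le_mul_right _ (by omega)) fun _ h => h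
  · refine ⟨by simp, by simp [h14], fun c => (hused c).trans (Nat.le_succ _), fun c => ?_⟩
    have := hused c
    simp only [State.setR_arr]
    constructor
    · intro h; omega
    · rintro ⟨j, hj, -⟩; omega
  intro i s₁ hi hx11 hF ⟨h1, h2, h3, h4⟩
  have e10 := (hF.reg 10 (by decide)).trans hx
  have e13 := hF.reg 13 (by decide)
  have eId := hF.arr aId (by decide)
  have eFl := hF.arr aFl (by decide)
  have eOff := hF.arr aOff (by decide)
  have eCol := hF.arr aCol (by decide)
  obtain ⟨hun, hui⟩ := hu i hi
  have split : ∀ (P : ℕ → Prop), (∃ j < i + 1, P j) ↔ (∃ j < i, P j) ∨ P i := by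
    intro P
    constructor
    · rintro ⟨j, hj, h⟩
      rcases Nat.lt_succ_iff_lt_or_eq.1 hj with hj | rfl
      exacts [.inl ⟨j, hj, h⟩, .inr h]
    · rintro (⟨j, hj, h⟩ | h)
      exacts [⟨j, by omega, h⟩, ⟨i, by omega, h⟩]
  have used1 : u i < x → ∀ c, Function.update (s₁.arr aUsed) (s.arr aCol (u i)) (x + 1) c ≤ x + 1 := by
    intro _ c
    rw [Function.update_apply]
    split_ifs
    exacts [le_rfl, h3 c]
  have used2 : u i < x → ∀ c, Function.update (s₁.arr aUsed) (s.arr aCol (u i)) (x + 1) c = x + 1 ↔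
      ∃ j < i + 1, u j < x ∧ s.arr aCol (u j) = c := by
    intro hux c
    rw [split, ← h4, Function.update_apply]
    split_ifs with hc
    · simp [hux, hc]
    · simp [Ne.symm hc]
  have le_new : ∀ v, s₁.reg 14 ≤ v → (u i < x → u i ≤ v) → ∀ j < i + 1, u j < x → u j ≤ v := by
    intro v hv hi' j hj hjx
    rcases Nat.lt_succ_iff_lt_or_eq.1 hj with hj | rfl
    exacts [(h1 j hj hjx).trans hv, hi' hjx]
  have old : s₁.reg 14 = 0 ∨ ∃ j < i + 1, u j < x ∧ s₁.reg 14 = u j :=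
    h2.imp id fun ⟨j, hj, h⟩ => ⟨j, by omega, h⟩
  refine .of_vc rfl rfl ?_
  simp only [vc, eval_reg, eval_arr, eval_add, eval_sub, eval_lt, State.setR_arr, State.setR_reg,
    State.setA_arr, State.setA_reg, hx11, e10, e13, eId, eFl, eOff, eCol, hui, Nat.reduceEqDiff,
    if_true, if_false, Bd_add, Bd_sub, Bd_reg, Bd_arr, true_and, eval_ofNat, Nat.add_sub_cancel]
  refine ⟨fun hlt => ?_, fun hlt => ?_⟩
  · have hux : u i < x := by rw [ite_ne_right_iff] at hlt; omega
    refine ⟨by omega, fun h => ?_, fun h => ?_⟩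
    · rw [ite_ne_right_iff] at h
      exact ⟨le_new _ h.1.le fun _ => le_rfl, .inr ⟨i, by omega, hux, rfl⟩, used1 hux, used2 hux⟩
    · rw [ite_eq_right_iff] at h
      exact ⟨le_new _ le_rfl fun _ => by omega, old, used1 hux, used2 hux⟩
  · have hux : ¬ u i < x := by rw [ite_eq_right_iff] at hlt; omega
    refine ⟨le_new _ le_rfl fun h => (hux h).elim, old, h3, fun c => ?_⟩
    rw [h4, split]
    simp [hux]

/-- Find an unmarked slot. -/
def freeSlot : Prog :=
  setReg 16 0 ;; .for 12 (reg rK) (branch (eq (arr aUsed (reg 12)) (reg 10 + 1)) skip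
    (setReg 16 (reg 12)))

lemma freeSlot_spec {x : ℕ} (hk : s.reg rK = k) (hx : s.reg 10 = x) (hk0 : 0 < k)
    (hex : ∃ c < k, s.arr aUsed c ≠ x + 1) (hW : k ≤ W) :
    WP W freeSlot s (2 + (k + 1) * (20 + 12)) fun s' =>
      s'.reg 16 < k ∧ s.arr aUsed (s'.reg 16) ≠ x + 1 := by
  refine .seq (.of_vc rfl rfl ⟨trivial, ?_⟩)
  set s₀ := s.setR 16 (eval s 0) with hs₀
  have hk₀ : s₀.reg rK = k := by simp [hs₀, hk]
  have hx₀ : s₀.reg 10 = x := by simp [hs₀, hx]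
  have h16₀ : s₀.reg 16 = 0 := by simp [hs₀]
  have hu₀ : s₀.arr aUsed = s.arr aUsed := rfl
  clear_value s₀
  refine WP.for k (fun i s' => s'.reg 16 < k ∧
      ((∃ c < i, s.arr aUsed c ≠ x + 1) → s.arr aUsed (s'.reg 16) ≠ x + 1)) rfl hW
    (fun s' hF => by simp [hF.reg 4 (by decide), hk₀]) (by simp [h16₀, hk0]) ?_
    fun s' _ _ h => ⟨h.1, h.2 hex⟩
  intro i s₁ hi hxi hF ⟨h1, h2⟩
  have e10 := (hF.reg 10 (by decide)).trans hx₀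
  have eU := (hF.arr aUsed (by decide)).trans hu₀
  refine .of_vc rfl rfl ?_
  simp only [vc, eval_reg, eval_arr, eval_add, eval_eq, State.setR_reg, hxi, e10, eU,
    Nat.reduceEqDiff, if_true, if_false, Bd_reg, true_and, eval_ofNat]
  refine ⟨fun h => ⟨h1, ?_⟩, fun h => ⟨hi, fun _ => ?_⟩⟩
  · rintro ⟨c, hc, hc'⟩
    rcases Nat.lt_succ_iff_lt_or_eq.1 hc with hc | rfl
    · exact h2 ⟨c, hc, hc'⟩
    · rw [ite_ne_right_iff] at h; exact (hc' h.1).elim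
  · rw [ite_eq_right_iff] at h; omega

/-- Choose the slots and the parents of the vertices greedily. -/
def pickSlots : Prog :=
  .for 10 (reg rN) ((setReg 13 (arr aQ (reg rNN - 1 - arr aTau (reg 10))) ;; setReg 14 0) ;;
    scanBag ;; setArr aPar (reg 10) (reg 14) ;; freeSlot ;; setArr aCol (reg 10) (reg 16))

lemma pickSlots_spec {q off sz fl ord τ : ℕ → ℕ} (hn : s.reg rN = n) (hN : s.reg rNN = N)
    (hk : s.reg rK = k) (hq : s.arr aQ = q)
    (hoff : s.arr aOff = off) (hsz : s.arr aSz = sz) (hfl : s.arr aFl = fl)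
    (hτ : s.arr aTau = τ) (hO : IsFirstOrder n N (BagAt N q off sz fl) ord τ)
    (hid : ∀ x < n, s.arr aId (ord x) = x + 1)
    (hlt : ∀ a < N, ∀ v, BagAt N q off sz fl a v → v < n) (hk0 : 0 < k)
    (hsk : ∀ a < N, sz (q a) ≤ k) (hused : s.arr aUsed = 0) (hcol : s.arr aCol = 0)
    (hW : n + 1 ≤ W) (hWk : k ≤ W) :
    WP W pickSlots s ((n + 1) * ((20 + ((k + 1) * (50 + 12) + (3 + ((2 + (k + 1) * (20 + 12)) + 3))))
      + 12)) fun s' => (∀ x, s'.arr aCol x < k) ∧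
      ∀ x < n, (∀ y ∈ nbOf (BagAt N q off sz fl) ord τ x, s'.arr aCol x ≠ s'.arr aCol y) ∧
        ((nbOf (BagAt N q off sz fl) ord τ x = ∅ ∧ s'.arr aPar x = 0) ∨
          (s'.arr aPar x ∈ nbOf (BagAt N q off sz fl) ord τ x ∧
            ∀ y ∈ nbOf (BagAt N q off sz fl) ord τ x, y ≤ s'.arr aPar x)) := by
  set nb := nbOf (BagAt N q off sz fl) ord τ with hnb
  refine WP.for n (fun x s' => (∀ x, s'.arr aCol x < k) ∧ (∀ c, s'.arr aUsed c ≤ x) ∧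
      ∀ y < x, (∀ z ∈ nb y, s'.arr aCol y ≠ s'.arr aCol z) ∧
        ((nb y = ∅ ∧ s'.arr aPar y = 0) ∨ (s'.arr aPar y ∈ nb y ∧ ∀ z ∈ nb y, z ≤ s'.arr aPar y)))
    rfl (by omega) (fun s' hF => by simp [hF.reg 1 (by decide), hn])
    ⟨fun x => by simp [hcol, hk0], fun c => by simp [hused], by simp⟩ ?_
    fun s' _ _ h => ⟨h.1, h.2.2⟩
  intro x s₁ hx hx10 hF ⟨hI1, hI2, hI3⟩
  have N₁ := (hF.reg rNN (by decide)).trans hN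
  have k₁ := (hF.reg rK (by decide)).trans hk
  have q₁ := (hF.arr aQ (by decide)).trans hq
  have off₁ := (hF.arr aOff (by decide)).trans hoff
  have sz₁ := (hF.arr aSz (by decide)).trans hsz
  have fl₁ := (hF.arr aFl (by decide)).trans hfl
  have τ₁ := (hF.arr aTau (by decide)).trans hτ
  have id₁ := hF.arr aId (by decide)
  have hτx := hO.tau_lt x hx
  set i := q (N - 1 - τ x) with hi
  have hszk : sz i ≤ k := hsk _ (by omega)
  -- the numbers of the vertices in the bag
  have hex : ∀ j, ∃ y, j < sz i → y < n ∧ ord y = fl (off i + j) := by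
    intro j
    by_cases hj : j < sz i
    · obtain ⟨y, hy, hy'⟩ := hO.exists_ord (hlt _ hτx _ ⟨j, hj, rfl⟩)
      exact ⟨y, fun _ => ⟨hy, hy'⟩⟩
    · exact ⟨0, fun h => (hj h).elim⟩
  choose u hu using hex
  have mem_nb : ∀ y, y ∈ nb x ↔ ∃ j < sz i, u j < x ∧ y = u j := by
    intro y
    rw [hnb, mem_nbOf]
    constructor
    · rintro ⟨h1, j, h2, h3⟩
      obtain ⟨h4, h5⟩ := hu j h2
      have := hO.ord_inj _ h4 y (by omega) (h5.trans h3)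
      exact ⟨j, h2, by omega, this.symm⟩
    · rintro ⟨j, h1, h2, rfl⟩
      exact ⟨h2, j, h1, (hu j h1).2.symm⟩
  refine .seq' (Q' := fun s' => s'.reg 13 = i ∧ s'.reg 14 = 0)
    (.of_vc rfl rfl (by simp [vc, hx10, N₁, q₁, τ₁, hi])) fun s₂ ⟨h13, h14⟩ F₂ => ?_
  have h10₂ := (F₂.reg 10 (by decide)).trans hx10
  have k₂ := (F₂.reg rK (by decide)).trans k₁
  refine .seq' (scanBag_spec (u := u) (m := sz i) h10₂ hx h14
    (by rw [h13, F₂.arr aSz (by decide), sz₁]) (fun j hj => ⟨(hu j hj).1, ?_⟩)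
    (fun c => by rw [F₂.arr aUsed (by decide)]; exact hI2 c) hszk hW hWk)
    fun s₃ ⟨a1, a2, a3, a4⟩ F₃ => ?_
  · rw [h13, F₂.arr aFl (by decide), F₂.arr aOff (by decide), F₂.arr aId (by decide), fl₁, off₁,
      id₁, ← (hu j hj).2, hid _ (hu j hj).1]
  have h10₃ := (F₃.reg 10 (by decide)).trans h10₂
  have k₃ := (F₃.reg rK (by decide)).trans k₂
  have col₂ : s₂.arr aCol = s₁.arr aCol := F₂.arr aCol (by decide)
  have col₃ : s₃.arr aCol = s₁.arr aCol := (F₃.arr aCol (by decide)).trans col₂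
  have par₃ : s₃.arr aPar = s₁.arr aPar := (F₃.arr aPar (by decide)).trans (F₂.arr aPar (by decide))
  have used_iff : ∀ c, s₃.arr aUsed c = x + 1 ↔ ∃ y ∈ nb x, s₁.arr aCol y = c := by
    intro c
    rw [a4, col₂]
    simp only [mem_nb]
    constructor
    · rintro ⟨j, h1, h2, h3⟩; exact ⟨_, ⟨j, h1, h2, rfl⟩, h3⟩
    · rintro ⟨_, ⟨j, h1, h2, rfl⟩, h3⟩; exact ⟨j, h1, h2, h3⟩
  refine .seq (.of_vc rfl rfl ⟨trivial, ?_⟩)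
  set s₄ := s₃.setA aPar ((reg 10).eval s₃) ((reg 14).eval s₃) with hs₄
  have col₄ : s₄.arr aCol = s₁.arr aCol := by simp [hs₄, col₃]
  have par₄ : s₄.arr aPar = Function.update (s₁.arr aPar) x (s₃.reg 14) := by
    simp [hs₄, h10₃, par₃]
  have used₄ : s₄.arr aUsed = s₃.arr aUsed := by simp [hs₄]
  have h10₄ : s₄.reg 10 = x := by simp [hs₄, h10₃]
  have k₄ : s₄.reg rK = k := by simp [hs₄, k₃]
  clear_value s₄
  -- there are fewer than `k` earlier vertices in the bag
  have hfree : ∃ c < k, s₄.arr aUsed c ≠ x + 1 := by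
    have hcard : (insert x (nb x)).card ≤ sz i := by
      have hsub : (insert x (nb x)) ⊆ (Finset.range (sz i)).image u := by
        intro y hy
        rw [Finset.mem_image]
        rcases Finset.mem_insert.1 hy with rfl | hy
        · obtain ⟨j, h1, h2⟩ := hO.bag_tau y hx
          obtain ⟨h3, h4⟩ := hu j h1
          exact ⟨j, Finset.mem_range.2 h1, hO.ord_inj _ h3 y hx (h4.trans h2)⟩
        · obtain ⟨j, h1, h2, rfl⟩ := (mem_nb y).1 hy
          exact ⟨j, Finset.mem_range.2 h1, rfl⟩
      refine (Finset.card_le_card hsub).trans (Finset.card_image_le.trans (by simp))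
    rw [Finset.card_insert_of_notMem (fun h => by
      have := (mem_nbOf.1 h).1
      omega)] at hcard
    have h1 : ((nb x).image (s₁.arr aCol)).card < (Finset.range k).card := by
      rw [Finset.card_range]
      exact Finset.card_image_le.trans_lt (by omega)
    obtain ⟨c, hc, hc'⟩ := Finset.exists_mem_notMem_of_card_lt_card h1
    refine ⟨c, Finset.mem_range.1 hc, fun h => hc' ?_⟩
    rw [used₄, used_iff] at h
    exact Finset.mem_image.2 h
  refine .seq' (freeSlot_spec k₄ h10₄ hk0 hfree hWk) fun s₅ ⟨b1, b2⟩ F₅ => ?_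
  rw [used₄, ne_eq, used_iff] at b2
  have h10₅ := (F₅.reg 10 (by decide)).trans h10₄
  have col₅ := (F₅.arr aCol (by decide)).trans col₄
  have par₅ := (F₅.arr aPar (by decide)).trans par₄
  have used₅ := (F₅.arr aUsed (by decide)).trans used₄
  refine .of_vc rfl rfl ⟨trivial, ?_⟩
  simp only [State.setR_arr, State.setA_arr, Nat.reduceEqDiff, if_true, if_false, eval_reg, h10₅,
    col₅, par₅, used₅]
  refine ⟨fun y => ?_, a3, fun y hy => ?_⟩
  · rw [Function.update_apply]
    split_ifs
    exacts [b1, hI1 y]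
  · rcases Nat.lt_succ_iff_lt_or_eq.1 hy with hy | rfl
    · obtain ⟨h1, h2⟩ := hI3 y hy
      rw [Function.update_of_ne hy.ne, Function.update_of_ne hy.ne]
      refine ⟨fun z hz => ?_, h2⟩
      have hzy := (mem_nbOf.1 hz).1
      rw [Function.update_of_ne (by omega)]
      exact h1 z hz
    · rw [Function.update_self, Function.update_self]
      refine ⟨fun z hz => ?_, ?_⟩
      · have hzy := (mem_nbOf.1 hz).1
        rw [Function.update_of_ne hzy.ne]
        exact fun h => b2 ⟨z, hz, h.symm⟩
      · have hle : ∀ z ∈ nb y, z ≤ s₃.reg 14 := by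
          intro z hz
          obtain ⟨j, h1, h2, rfl⟩ := (mem_nb z).1 hz
          exact a1 j h1 h2
        rcases a2 with h0 | ⟨j, h1, h2, h3⟩
        · rcases (nb y).eq_empty_or_nonempty with he | ⟨z, hz⟩
          · exact .inl ⟨he, h0⟩
          · have : z = s₃.reg 14 := by have := hle z hz; omega
            exact .inr ⟨this ▸ hz, hle⟩
        · exact .inr ⟨(mem_nb _).2 ⟨j, h1, h2, h3⟩, hle⟩

/-- Enter every edge at its later vertex, at the slot of its earlier vertex. -/
def enterEdges : Prog :=
  .for 9 (reg 2) (setReg 10 (arr aId (arr 0 (reg 9))) ;; setReg 11 (arr aId (arr 1 (reg 9))) ;;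
    branch (lt (reg 10) (reg 11))
      (setArr aAdj ((reg 11 - 1) * reg rK + arr aCol (reg 10 - 1)) 1)
      (setArr aAdj ((reg 10 - 1) * reg rK + arr aCol (reg 11 - 1)) 1))

lemma enterEdges_spec {m : ℕ} {a b col : ℕ → ℕ} (hm : s.reg 2 = m) (hk : s.reg rK = k)
    (ha : ∀ e < m, s.arr aId (s.arr 0 e) = a e + 1) (hb : ∀ e < m, s.arr aId (s.arr 1 e) = b e + 1)
    (hcol : s.arr aCol = col) (hck : ∀ x, col x < k) (hA : s.arr aAdj = 0) (hW : m ≤ W) :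
    WP W enterEdges s ((m + 1) * (50 + 12)) fun s' => ∀ x, ∀ j < k, s'.arr aAdj (x * k + j) ≠ 0 ↔
      ∃ e < m, max (a e) (b e) = x ∧ col (min (a e) (b e)) = j := by
  refine WP.for m (fun i s' => ∀ x, ∀ j < k, s'.arr aAdj (x * k + j) ≠ 0 ↔
      ∃ e < i, max (a e) (b e) = x ∧ col (min (a e) (b e)) = j) rfl hW
    (fun s' hF => by simp [hF.reg 2 (by decide), hm]) (by simp [hA]) ?_ fun s' _ _ h => h
  intro i s₁ hi hx hF hI
  have k₁ := (hF.reg rK (by decide)).trans hk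
  have col₁ := (hF.arr aCol (by decide)).trans hcol
  have a₁ : s₁.arr aId (s₁.arr 0 i) = a i + 1 := by
    rw [hF.arr aId (by decide), hF.arr 0 (by decide), ha i hi]
  have b₁ : s₁.arr aId (s₁.arr 1 i) = b i + 1 := by
    rw [hF.arr aId (by decide), hF.arr 1 (by decide), hb i hi]
  have key : ∀ y z, y = max (a i) (b i) → z = min (a i) (b i) → ∀ x, ∀ j < k,
      Function.update (s₁.arr aAdj) (y * k + col z) 1 (x * k + j) ≠ 0 ↔
      ∃ e < i + 1, max (a e) (b e) = x ∧ col (min (a e) (b e)) = j := by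
    rintro _ _ rfl rfl x j hj
    have hcz := hck (min (a i) (b i))
    by_cases h : x = max (a i) (b i) ∧ j = col (min (a i) (b i))
    · obtain ⟨rfl, rfl⟩ := h
      rw [Function.update_self]
      simp only [ne_eq, one_ne_zero, not_false_eq_true, true_iff]
      exact ⟨i, by omega, rfl, rfl⟩
    · rw [Function.update_of_ne, hI x j hj]
      · constructor
        · rintro ⟨e, he, h⟩; exact ⟨e, by omega, h⟩
        · rintro ⟨e, he, h1, h2⟩
          rcases Nat.lt_succ_iff_lt_or_eq.1 he with he | rfl
          exacts [⟨e, he, h1, h2⟩, (h ⟨h1.symm, h2.symm⟩).elim]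
      · intro he
        have h1 := congrArg (· / k) he
        have h2 := congrArg (· % k) he
        have hk0 : 0 < k := by omega
        simp only [mul_comm _ k, Nat.mul_add_div hk0, Nat.mul_add_mod, Nat.div_eq_of_lt hj,
          Nat.div_eq_of_lt hcz, Nat.mod_eq_of_lt hj, Nat.mod_eq_of_lt hcz, add_zero] at h1 h2
        exact h ⟨h1, h2⟩
  refine .of_vc rfl rfl ?_
  simp only [vc, eval_reg, eval_arr, eval_add, eval_sub, eval_mul, eval_lt, State.setR_arr,
    State.setR_reg, State.setA_arr, hx, k₁, col₁, a₁, b₁, Nat.reduceEqDiff, if_true, if_false,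
    Bd_arr, Bd_ofNat, true_and, eval_ofNat, Nat.add_sub_cancel]
  refine ⟨fun h => key _ _ ?_ ?_, fun h => key _ _ ?_ ?_⟩
  all_goals first | rw [ite_ne_right_iff] at h | rw [ite_eq_right_iff] at h
  all_goals omega

end slots

section powers

variable {W r n k : ℕ} {s : State}

/-- Set up the arithmetic data. -/
def powers : Prog :=
  (setReg rB (2 * reg rR + 1) ;; setArr aPw 0 1) ;;
  .for 9 (reg rK) (setArr aPw (reg 9 + 1) (arr aPw (reg 9) * reg rB)) ;;
  (setReg rM (arr aPw (reg rK)) ;; setReg rL ((reg rK + 1) * reg rM)) ;;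
  .for 11 (reg rM) (setReg 12 (reg 11 % reg rB) ;; setArr aBs (reg 11)
    (arr aBs (reg 11 / reg rB) * reg rB + (reg 12 - reg rR * lt (reg rR) (reg 12))))

lemma powers_spec (hr : s.reg rR = r) (hn : s.reg rN = n) (hk : s.reg rK = k) (hb : s.arr aBs = 0)
    (hk0 : 0 < k) (hW : (k + 1) * (2 * r + 1) ^ k ≤ W) :
    WP W powers s (20 + ((k + 1) * (20 + 12) + (20 + ((2 * r + 1) ^ k + 1) * (30 + 12))))
      (Ctx r n k) := by
  have hM0 : 0 < (2 * r + 1) ^ k := by positivity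
  have hpow : ∀ j ≤ k, (2 * r + 1) ^ j ≤ W := fun j hj =>
    (Nat.pow_le_pow_right (by omega) hj).trans ((Nat.le_mul_of_pos_left _ (by omega)).trans hW)
  have hkW : k + 1 ≤ W := (Nat.le_mul_of_pos_right _ hM0).trans hW
  have hbW := hpow 1 hk0
  rw [pow_one] at hbW
  refine .seq' (Q' := fun s' => s'.reg rB = 2 * r + 1 ∧ s'.arr aPw 0 = 1)
    (.of_vc rfl rfl (by simp [vc, hr, hbW])) fun s₁ ⟨h5, hp0⟩ F₁ => ?_
  have hk₁ := (F₁.reg rK (by decide)).trans hk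
  refine .seq' (Q' := fun s' => ∀ j ≤ k, s'.arr aPw j = (2 * r + 1) ^ j)
    (WP.for (T := 20) k (fun i s' => ∀ j ≤ i, s'.arr aPw j = (2 * r + 1) ^ j) rfl (by omega)
      (fun s' hF => by simp [hF.reg 4 (by decide), hk₁]) ?_ ?_ fun s' _ _ h => h) fun s₂ hp F₂ => ?_
  · intro j hj
    obtain rfl : j = 0 := by omega
    simpa using hp0
  · intro i s' hi hx hF hI
    have hp := hpow (i + 1) hi
    rw [pow_succ] at hp
    refine .of_vc rfl rfl ?_
    simp only [vc, eval_reg, eval_arr, eval_add, eval_mul, State.setR_arr, State.setA_arr, hx,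
      hF.reg rB (by decide), h5, if_true, Bd_mul, eval_ofNat, hI i le_rfl]
    refine ⟨hp, fun j hj => ?_⟩
    rcases Nat.lt_or_eq_of_le hj with hj | rfl
    · rw [Function.update_of_ne (by omega), hI j (by omega)]
    · rw [Function.update_self, pow_succ]
  have hr₂ := (F₂.reg rR (by decide)).trans ((F₁.reg rR (by decide)).trans hr)
  have hn₂ := (F₂.reg rN (by decide)).trans ((F₁.reg rN (by decide)).trans hn)
  have hk₂ := (F₂.reg rK (by decide)).trans hk₁
  have h5₂ := (F₂.reg rB (by decide)).trans h5
  have hb₂ : s₂.arr aBs = 0 := (F₂.arr aBs (by decide)).trans ((F₁.arr aBs (by decide)).trans hb)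
  refine .seq' (Q' := fun s' => s'.reg rM = (2 * r + 1) ^ k ∧ s'.reg rL = (k + 1) * (2 * r + 1) ^ k)
    (.of_vc rfl rfl (by simp [vc, hk₂, hp k le_rfl, hW])) fun s₃ ⟨hM, hL⟩ F₃ => ?_
  have hr₃ := (F₃.reg rR (by decide)).trans hr₂
  have hn₃ := (F₃.reg rN (by decide)).trans hn₂
  have hk₃ := (F₃.reg rK (by decide)).trans hk₂
  have h5₃ := (F₃.reg rB (by decide)).trans h5₂
  have hp₃ : ∀ j ≤ k, s₃.arr aPw j = (2 * r + 1) ^ j := fun j hj => by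
    rw [F₃.arr aPw (by decide), hp j hj]
  have hb₃ : s₃.arr aBs = 0 := (F₃.arr aBs (by decide)).trans hb₂
  refine WP.for ((2 * r + 1) ^ k) (fun i s' => s'.arr aBs 0 = 0 ∧ ∀ σ < i, s'.arr aBs σ ≤ σ ∧
      ∀ j, dg r (s'.arr aBs σ) j = lb r σ j) rfl (hpow k le_rfl)
    (fun s' hF => by simp [hF.reg rM (by decide), hM]) (by simp [hb₃]) ?_ ?_
  · intro σ s' hσ hx hF ⟨h0, hI⟩
    have hr' := (hF.reg rR (by decide)).trans hr₃
    have h5' := (hF.reg rB (by decide)).trans h5₃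
    have hdm := Nat.div_add_mod σ (2 * r + 1)
    have hlt := Nat.mod_lt σ (show 0 < 2 * r + 1 by omega)
    -- also correct for `σ = 0`, where the cell is still `0`
    have hdiv : s'.arr aBs (σ / (2 * r + 1)) ≤ σ / (2 * r + 1) ∧
        ∀ j, dg r (s'.arr aBs (σ / (2 * r + 1))) j = lb r (σ / (2 * r + 1)) j := by
      rcases Nat.eq_zero_or_pos (σ / (2 * r + 1)) with hz | hpos
      · rw [hz, h0]; exact ⟨le_rfl, fun j => by simp [dg, lb]⟩
      · refine hI _ ?_
        have h2r : 2 ≤ 2 * r + 1 := by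
          by_contra hr0
          obtain rfl : r = 0 := by omega
          have : σ = 0 := by simpa using hσ
          simp [this] at hpos
        exact Nat.div_lt_self (Nat.pos_of_ne_zero fun h => by simp [h] at hpos) h2r
    obtain ⟨hle, hdig⟩ := hdiv
    have hlab : σ % (2 * r + 1) - r * (if r < σ % (2 * r + 1) then 1 else 0) = lb r σ 0 := by
      simp only [lb, dg, pow_zero, Nat.div_one]
      split_ifs <;> simp
    have hlab' : lb r σ 0 ≤ σ % (2 * r + 1) := by rw [← hlab]; exact Nat.sub_le _ _
    set B := s'.arr aBs (σ / (2 * r + 1)) with hB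
    have hv : B * (2 * r + 1) + lb r σ 0 ≤ σ := by
      have := Nat.mul_le_mul_right (2 * r + 1) hle
      rw [mul_comm (σ / (2 * r + 1))] at this
      omega
    have hdv : ∀ j, dg r (B * (2 * r + 1) + lb r σ 0) j = lb r σ j := by
      intro j
      have hlt' : lb r σ 0 < 2 * r + 1 := by omega
      cases j with
      | zero =>
        rw [dg, pow_zero, Nat.div_one, mul_comm, Nat.mul_add_mod, Nat.mod_eq_of_lt hlt']
      | succ j =>
        have e1 : dg r (B * (2 * r + 1) + lb r σ 0) (j + 1) = dg r B j := by
          rw [dg, pow_succ', ← Nat.div_div_eq_div_mul, mul_comm, Nat.mul_add_div (by omega),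
            Nat.div_eq_of_lt hlt', add_zero, dg]
        have e2 : dg r σ (j + 1) = dg r (σ / (2 * r + 1)) j := by
          rw [dg, pow_succ', ← Nat.div_div_eq_div_mul, dg]
        rw [e1, hdig j, lb, lb, e2]
    refine .of_vc rfl rfl ?_
    simp only [vc, eval_reg, eval_arr, eval_add, eval_sub, eval_mul, eval_div, eval_mod, eval_lt,
      State.setR_arr, State.setR_reg, State.setA_arr, hx, hr', h5', Nat.reduceEqDiff, if_true,
      if_false, Bd_add, Bd_mod, Bd_reg, true_and, OfNat.zero_ne_ofNat, hlab,
      ← hB]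
    refine ⟨hv.trans (hσ.le.trans (hpow k le_rfl)), ?_, fun τ hτ => ?_⟩
    · rw [Function.update_apply]
      split_ifs with hz
      · omega
      · exact h0
    · rcases Nat.lt_succ_iff_lt_or_eq.1 hτ with hτ | rfl
      · rw [Function.update_of_ne hτ.ne]; exact hI τ hτ
      · rw [Function.update_self]; exact ⟨hv, hdv⟩
  · rintro s' - hF ⟨-, hI⟩
    refine ⟨(hF.reg _ (by decide)).trans hr₃, (hF.reg _ (by decide)).trans hn₃,
      (hF.reg _ (by decide)).trans hk₃, (hF.reg _ (by decide)).trans h5₃,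
      (hF.reg _ (by decide)).trans hM, (hF.reg _ (by decide)).trans hL,
      fun j hj => by rw [hF.arr _ (by decide), hp₃ j hj], fun σ hσ => ?_⟩
    obtain ⟨h1, h2⟩ := hI σ hσ
    refine ⟨h1.trans_lt hσ, fun j hj => ?_⟩
    have hle := @lb_le r σ j
    have e := h2 j
    refine ⟨?_, by simp only [Flg]; omega⟩
    rw [lb, if_neg (by omega), e]

end powers

/-! ### The bags of a tree decomposition in the queue order -/

section bags

variable {n N : ℕ} {G : SimpleGraph (Fin n)} {D : TreeDecomposition G (Fin N)}
  {L : Fin N → List (Fin n)} {q off sz fl : ℕ → ℕ} {root : Fin N} {par : Fin N → Fin N}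
  {h : Fin N → ℕ}

/-- Cell `off i + j` of the concatenation of the bags holds element `j` of bag `i`. -/
lemma mem_listed_iff (hsz : sz = fun p => (List.ofFn fun i => (L i).length).getD p 0)
    (hfl : fl = fun p => ((List.ofFn L).flatten.map Fin.val).getD p 0)
    (hoff : ∀ i < N, off i = ∑ a ∈ Finset.range i, sz a) (i : Fin N) (v : ℕ) :
    (∃ j < sz i, fl (off i + j) = v) ↔ ∃ x ∈ L i, (x : ℕ) = v := by
  set l : List (List ℕ) := List.ofFn fun i => (L i).map Fin.val with hl
  have hlen : l.map List.length = List.ofFn fun i => (L i).length := by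
    simp [hl, List.map_ofFn, Function.comp_def]
  have hflat : (List.ofFn L).flatten.map Fin.val = l.flatten := by
    simp [hl, List.map_flatten, List.map_ofFn, Function.comp_def]
  have hli : l.getD i [] = (L i).map Fin.val := by
    simp [hl, List.getD_eq_getElem?_getD]
  have hszi : sz i = ((L i).map Fin.val).length := by
    simp [hsz, List.getD_eq_getElem?_getD]
  have hfj : ∀ j < sz i, fl (off i + j) = ((L i).map Fin.val).getD j 0 := by
    intro j hj
    have := getD_flatten l i j (by rw [hli, ← hszi]; exact hj)
    rw [hli, hlen] at this
    rw [hfl, hoff i i.2, hsz]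
    simp only [hflat, this]
  rw [← List.mem_map, List.mem_iff_getElem]
  refine exists_congr fun j => ⟨fun ⟨hj, e⟩ => ?_, fun ⟨hj, e⟩ => ⟨hszi ▸ hj, ?_⟩⟩
  · refine ⟨hszi ▸ hj, ?_⟩
    rwa [hfj j hj, List.getD_eq_getElem _ _ (by rwa [← hszi])] at e
  · rwa [hfj j (hszi ▸ hj), List.getD_eq_getElem _ _ hj]

lemma NodeOrder.exists_eq (hO : NodeOrder D.tree q root par h) {a : ℕ} (ha : a < N) :
    ∃ i, h i = a := by
  have : Function.Injective fun i : Fin N => (⟨h i, hO.lt i⟩ : Fin N) := fun i j hij =>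
    hO.inj (by simpa using hij)
  obtain ⟨i, hi⟩ := Finite.surjective_of_injective this ⟨a, ha⟩
  exact ⟨i, by simpa using hi⟩

lemma NodeOrder.bagAt_iff (hO : NodeOrder D.tree q root par h)
    (hL : ∀ i, ListsElements (D.bag i) (L i))
    (hsz : sz = fun p => (List.ofFn fun i => (L i).length).getD p 0)
    (hfl : fl = fun p => ((List.ofFn L).flatten.map Fin.val).getD p 0)
    (hoff : ∀ i < N, off i = ∑ a ∈ Finset.range i, sz a) (i : Fin N) (v : ℕ) :
    BagAt N q off sz fl (h i) v ↔ ∃ x ∈ D.bag i, (x : ℕ) = v := by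
  unfold BagAt
  rw [hO.queue, mem_listed_iff hsz hfl hoff]
  simp only [(hL i).2]

lemma NodeOrder.bagSeq (hO : NodeOrder D.tree q root par h)
    (hL : ∀ i, ListsElements (D.bag i) (L i))
    (hsz : sz = fun p => (List.ofFn fun i => (L i).length).getD p 0)
    (hfl : fl = fun p => ((List.ofFn L).flatten.map Fin.val).getD p 0)
    (hoff : ∀ i < N, off i = ∑ a ∈ Finset.range i, sz a) :
    BagSeq n N (fun u v => ∃ hu hv, G.Adj ⟨u, hu⟩ ⟨v, hv⟩) (BagAt N q off sz fl) := by
  have key := hO.bagAt_iff hL hsz hfl hoff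
  have hN := hO.lt root
  refine ⟨fun u v ⟨hu, hv, e⟩ => ⟨hv, hu, e.symm⟩, fun u ⟨_, _, e⟩ => e.ne rfl, ?_, ?_, ?_, ?_⟩
  · intro a v hv
    obtain ⟨i, hi⟩ := hO.exists_eq (a := min a (N - 1)) (by omega)
    have : BagAt N q off sz fl (h i) v := by
      unfold BagAt at hv ⊢
      rwa [hi, show N - 1 - min a (N - 1) = N - 1 - a by omega]
    obtain ⟨x, -, rfl⟩ := (key i v).1 this
    exact x.2
  · intro v hv
    obtain ⟨i, hi⟩ := D.exists_mem_bag ⟨v, hv⟩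
    exact ⟨h i, hO.lt i, (key i v).2 ⟨_, hi, rfl⟩⟩
  · rintro u v ⟨hu, hv, e⟩
    obtain ⟨i, h1, h2⟩ := D.exists_edge_bag _ _ e
    exact ⟨h i, hO.lt i, (key i u).2 ⟨_, h1, rfl⟩, (key i v).2 ⟨_, h2, rfl⟩⟩
  · intro a ha t ht s hs u v hau hav htv hmin hsu
    obtain ⟨i, rfl⟩ := hO.exists_eq ha
    obtain ⟨t, rfl⟩ := hO.exists_eq ht
    obtain ⟨s, rfl⟩ := hO.exists_eq (hs.trans_lt ht)
    rw [key] at hau hav htv hsu ⊢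
    obtain ⟨u, hau, rfl⟩ := hau
    obtain ⟨v, hav, rfl⟩ := hav
    obtain ⟨v', htv, e⟩ := htv
    obtain ⟨u', hsu, e'⟩ := hsu
    obtain rfl := Fin.ext e
    obtain rfl := Fin.ext e'
    refine ⟨u', mem_bag_top hO.adj hO.par_lt hO.inj D.subtree htv (fun j hj => ?_) hsu hs i hau hav,
      rfl⟩
    by_contra! hlt
    exact hmin _ hlt ((key j _).2 ⟨_, hj, rfl⟩)

lemma TreeDecomposition.sup_card (hn : 0 < n) :
    (Finset.univ.sup fun i => (D.bag i).card) = D.width + 1 := by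
  obtain ⟨i, hi⟩ := D.exists_mem_bag ⟨0, hn⟩
  have h1 : 0 < (D.bag i).card := Finset.card_pos.2 ⟨_, hi⟩
  have h2 : (D.bag i).card ≤ Finset.univ.sup fun i => (D.bag i).card :=
    Finset.le_sup (f := fun i => (D.bag i).card) (Finset.mem_univ i)
  unfold TreeDecomposition.width
  omega

lemma ListsElements.length {V : Type*} {X : Finset V} {l : List V} (h : ListsElements X l) :
    l.length = X.card := by
  classical
  rw [← List.toFinset_card_of_nodup h.1]
  congr 1
  ext v
  simp [h.2]

lemma sup_sz (hn : 0 < n) (hL : ∀ i, ListsElements (D.bag i) (L i))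
    (hsz : sz = fun p => (List.ofFn fun i => (L i).length).getD p 0) :
    (Finset.range N).sup sz = D.width + 1 := by
  have hszi : ∀ i : Fin N, sz i = (D.bag i).card := fun i => by
    simp [hsz, List.getD_eq_getElem?_getD, (hL i).length]
  rw [← D.sup_card hn]
  refine le_antisymm (Finset.sup_le fun i hi => ?_) (Finset.sup_le fun i _ => ?_)
  · have := hszi ⟨i, Finset.mem_range.1 hi⟩
    dsimp only at this
    rw [this]
    exact Finset.le_sup (f := fun i => (D.bag i).card) (Finset.mem_univ _)
  · rw [← hszi]
    exact Finset.le_sup (f := sz) (Finset.mem_range.2 i.2)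

lemma TreeDecomposition.width_lt (hn : 0 < n) : D.width + 1 ≤ n := by
  rw [← D.sup_card hn]
  exact Finset.sup_le fun i _ => (Finset.card_le_univ _).trans (by simp)

end bags

/-! ### Optimality -/

section optimal

variable {n k r : ℕ} {G : SimpleGraph (Fin n)} {E : ElimOrder n k} {ord : ℕ → ℕ}

/-- A complete trace of minimum size yields a minimum dominating set. -/
lemma isMinDominating_of_isTrace {S : Finset (Fin n)} {opt : ℕ} {cur m : ℕ → ℕ}
    (hlt : ∀ x < n, ord x < n) (hex : ∀ v < n, ∃ x < n, ord x = v)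
    (hinj : ∀ x < n, ∀ y < n, ord x = ord y → x = y)
    (hadj : ∀ x y, E.adj x y ↔ ∃ (hx : x < n) (hy : y < n),
      G.Adj ⟨ord x, hlt x hx⟩ ⟨ord y, hlt y hy⟩)
    (hopt : ∀ t ≤ n, opt ≤ t ↔ E.FeasC r (Finset.range n) (Finset.range n) 0 t)
    (ht : E.IsTrace r n opt cur m)
    (hS : ∀ x (hx : x < n), ⟨ord x, hlt x hx⟩ ∈ S ↔ lb r (cur x) (E.col x) = 0) :
    IsMinDominating G r S := by
  choose! pos hpos hord using hex
  have hpo : ∀ x < n, pos (ord x) = x := fun x hx =>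
    hinj _ (hpos _ (hlt x hx)) _ hx (hord _ (hlt x hx))
  obtain ⟨h1, h2⟩ := ht.end
  constructor
  · have hlab : IsLabelling G r fun v => lb r (cur (pos v)) (E.col (pos v)) := by
      intro v
      refine ⟨lb_le, (h1 _ (hpos v v.2)).imp id ?_⟩
      rintro ⟨u, hu, hlt'⟩
      obtain ⟨hun, hvn, ha⟩ := (hadj _ _).1 hu
      refine ⟨⟨ord u, hlt u hun⟩, ?_, ?_⟩
      · convert ha
        exact (hord v v.2).symm
      · simpa [hpo u hun] using hlt'
    convert hlab.isDominating
    ext v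
    have := hS (pos v) (hpos v v.2)
    simp only [hord v v.2] at this
    simp [this]
  · intro S' hS'
    obtain ⟨d, hd, hsub⟩ := hS'.exists_labelling
    set z := Finset.univ.filter fun v => d v = 0 with hz
    have hle : opt ≤ z.card := by
      rw [hopt _ ((Finset.card_le_univ _).trans (by simp))]
      refine ⟨fun x => if hx : x < n then d ⟨ord x, hlt x hx⟩ else 0, fun v => ?_, fun v hv => ?_,
        fun v hv => ?_, fun j _ hj => ?_, ?_⟩
      · dsimp only
        split_ifs with hv
        exacts [(hd _).1, Nat.zero_le _]
      · rw [Finset.mem_range] at hv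
        simp [hv, lb, dg]
      · rw [Finset.mem_range] at hv
        refine (hd ⟨ord v, hlt v hv⟩).2.imp (by simp [hv]) ?_
        rintro ⟨u, hu, hlt'⟩
        have hpu := hpos u u.2
        refine ⟨pos u, (hadj _ _).2 ⟨hpu, hv, ?_⟩, ?_, ?_⟩
        · convert hu
          exact hord u u.2
        · simpa [hv, hpu, hord u u.2] using hlt'
        · simp [hv, hpu]
      · simp [Flg, dg] at hj
      · refine Finset.card_le_card_of_surjOn (fun v : Fin n => pos v) fun x hx => ?_
        simp only [Finset.coe_filter, Finset.mem_range, Set.mem_ofPred_eq] at hx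
        refine ⟨⟨ord x, hlt x hx.1⟩, ?_, hpo x hx.1⟩
        simpa [hx.1, hz] using hx.2
    refine le_trans ?_ (hle.trans (Finset.card_le_card hsub))
    refine le_trans ?_ h2
    refine Finset.card_le_card_of_injOn (fun v => pos v) (fun v hv => ?_) fun u _ v _ huv => ?_
    · have := hS (pos v) (hpos v v.2)
      simp only [hord v v.2] at this
      simpa [hpos v v.2] using this.1 hv
    · have := congrArg ord huv
      rw [hord u u.2, hord v v.2] at this
      exact Fin.ext this

end optimal

/-! ### The edge list -/

section edges

variable {n k : ℕ} {G : SimpleGraph (Fin n)} {l : List (Fin n × Fin n)} {E : ElimOrder n k}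
  {ord pos a b : ℕ → ℕ}

/-- The edges of the list in terms of vertex numbers. -/
lemma ListsEdges.adj_iff (hl : ListsEdges G l) (hlt : ∀ x < n, ord x < n)
    (hpos : ∀ v < n, pos v < n) (hord : ∀ v < n, ord (pos v) = v)
    (hinj : ∀ x < n, ∀ y < n, ord x = ord y → x = y)
    (hadj : ∀ x y, E.adj x y ↔ ∃ (hx : x < n) (hy : y < n),
      G.Adj ⟨ord x, hlt x hx⟩ ⟨ord y, hlt y hy⟩)
    (ha : ∀ e (he : e < l.length), a e = pos l[e].1) (hb : ∀ e (he : e < l.length), b e = pos l[e].2)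
    (x y : ℕ) : E.adj x y ↔ ∃ e < l.length, (a e = x ∧ b e = y) ∨ (a e = y ∧ b e = x) := by
  have hpo : ∀ x < n, pos (ord x) = x := fun x hx =>
    hinj _ (hpos _ (hlt x hx)) _ hx (hord _ (hlt x hx))
  have mem : ∀ u v, G.Adj u v ↔ ∃ (e : ℕ) (he : e < l.length),
      (l[e].1 = u ∧ l[e].2 = v) ∨ (l[e].1 = v ∧ l[e].2 = u) := by
    intro u v
    rw [hl.2, List.mem_map]
    constructor
    · rintro ⟨p, hp, h⟩
      obtain ⟨e, he, rfl⟩ := List.mem_iff_getElem.1 hp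
      exact ⟨e, he, Sym2.eq_iff.1 h⟩
    · rintro ⟨e, he, h⟩
      exact ⟨l[e], List.getElem_mem he, Sym2.eq_iff.2 h⟩
  rw [hadj]
  constructor
  · rintro ⟨hx, hy, h⟩
    obtain ⟨e, he, h⟩ := (mem _ _).1 h
    refine ⟨e, he, h.imp ?_ ?_⟩
    all_goals
      rintro ⟨h1, h2⟩
      rw [ha e he, hb e he, h1, h2]
      exact ⟨hpo _ (by assumption), hpo _ (by assumption)⟩
  · rintro ⟨e, he, h⟩
    have h1 := hpos _ l[e].1.2
    have h2 := hpos _ l[e].2.2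
    have h3 : ∀ h : ord (pos l[e].1) < n, (⟨_, h⟩ : Fin n) = l[e].1 := fun h => Fin.ext (hord _ l[e].1.2)
    have h4 : ∀ h : ord (pos l[e].2) < n, (⟨_, h⟩ : Fin n) = l[e].2 := fun h => Fin.ext (hord _ l[e].2.2)
    have h5 : G.Adj l[e].1 l[e].2 := (mem _ _).2 ⟨e, he, .inl ⟨rfl, rfl⟩⟩
    rcases h with ⟨rfl, rfl⟩ | ⟨rfl, rfl⟩ <;> simp only [ha e he, hb e he, h3, h4]
    exacts [⟨h1, h2, h5⟩, ⟨h2, h1, h5.symm⟩]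

/-- Every vertex has fewer than `k` neighbours with smaller numbers, and these are in different
slots. -/
lemma ListsEdges.length_le (hl : ListsEdges G l) (hord : ∀ v < n, ord (pos v) = v)
    (ha : ∀ e (he : e < l.length), a e = pos l[e].1) (hb : ∀ e (he : e < l.length), b e = pos l[e].2)
    (hE : ∀ x y, E.adj x y ↔ ∃ e < l.length, (a e = x ∧ b e = y) ∨ (a e = y ∧ b e = x)) :
    l.length ≤ n * k := by
  have hmem : ∀ e < l.length, min (a e) (b e) ∈ E.nb (max (a e) (b e)) ∧ max (a e) (b e) < n := by
    intro e he
    have h : E.adj (min (a e) (b e)) (max (a e) (b e)) := by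
      refine (hE _ _).2 ⟨e, he, ?_⟩
      omega
    have hne : min (a e) (b e) ≠ max (a e) (b e) := fun h' => E.irrefl _ (h' ▸ h)
    exact ⟨E.mem_nb_of_adj _ _ h (by omega), E.lt_of_adj _ _ (E.symm _ _ h)⟩
  have hpinj : ∀ u v : Fin n, pos u = pos v → u = v := fun u v h => by
    have := congrArg ord h
    rw [hord _ u.2, hord _ v.2] at this
    exact Fin.ext this
  suffices h : Set.InjOn (fun e => max (a e) (b e) * k + E.col (min (a e) (b e)))
      (Finset.range l.length) by
    have := Finset.card_le_card_of_injOn (t := Finset.range (n * k)) _ (fun e he => ?_) h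
    · simpa using this
    · simp only [Finset.coe_range, Set.mem_Iio] at he ⊢
      obtain ⟨-, h2⟩ := hmem e he
      have := E.col_lt (min (a e) (b e))
      nlinarith
  intro e he e' he' h
  simp only [Finset.coe_range, Set.mem_Iio] at he he' h
  have hk := E.col_lt (min (a e) (b e))
  have hk' := E.col_lt (min (a e') (b e'))
  obtain ⟨h1, hn⟩ := hmem e he
  obtain ⟨h1', -⟩ := hmem e' he'
  have hd := congrArg (· / k) h
  have hm := congrArg (· % k) h
  simp only [mul_comm _ k, Nat.mul_add_div (by omega : 0 < k), Nat.div_eq_of_lt hk,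
    Nat.div_eq_of_lt hk', Nat.mul_add_mod, Nat.mod_eq_of_lt hk, Nat.mod_eq_of_lt hk',
    add_zero] at hd hm
  have hmin := E.col_inj _ hn _ (Finset.mem_insert_of_mem h1) _
    (Finset.mem_insert_of_mem (by rwa [hd])) hm
  have hs : s(l[e].1, l[e].2) = s(l[e'].1, l[e'].2) := by
    have : (a e = a e' ∧ b e = b e') ∨ (a e = b e' ∧ b e = a e') := by omega
    rw [ha e he, hb e he, ha e' he', hb e' he'] at this
    exact Sym2.eq_iff.2 (this.imp (fun h => ⟨hpinj _ _ h.1, hpinj _ _ h.2⟩)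
      fun h => ⟨hpinj _ _ h.1, hpinj _ _ h.2⟩)
  have := (List.Nodup.getElem_inj_iff hl.1 (i := e) (j := e') (hi := by simpa) (hj := by simpa)).1
    (by simpa using hs)
  exact this

end edges

/-- The list of the bags in the initial state is written with a coercion of lists, which is `map`. -/
lemma initState_arr_five (r : ℕ) {n N : ℕ} (E : List (Fin n × Fin n)) (F : List (Fin N × Fin N))
    (L : Fin N → List (Fin n)) : (initState r E F L).arr 5 =
      fun p => ((List.ofFn L).flatten.map Fin.val).getD p 0 := by
  funext p
  simp [initState, List.map_eq_flatMap]

/-! ### The program -/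

section main

variable {W r n N k : ℕ} {G : SimpleGraph (Fin n)} {D : TreeDecomposition G (Fin N)}
  {El : List (Fin n × Fin n)} {F : List (Fin N × Fin N)} {L : Fin N → List (Fin n)}

/-- The program: order the nodes of the decomposition and the vertices, choose slots, fill the
tables from the leaves to the root, and reconstruct a solution. -/
def dominate : Prog :=
  orderNodes ;; prefixSums ;; firstOrder ;; pickSlots ;; enterEdges ;; powers ;; initAll ;;
    eliminate ;; backtrack

/-- A bound on the running time of `dominate`. -/
def dominateTime (r n N k : ℕ) : ℕ :=
  ((N - 1 + 1) * (40 + 12) + ((2 + (N + 1) * (30 + 12)) + ((N - 1 + 1) * (60 + 12) + 10))) +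
  ((10 + (N + 1) * (30 + 12)) + ((2 + (N + 1) * (10 + (k + 1) * (40 + 12) + 12)) +
  (((n + 1) * ((20 + ((k + 1) * (50 + 12) + (3 + ((2 + (k + 1) * (20 + 12)) + 3)))) + 12)) +
  (((n * k + 1) * (50 + 12)) +
  ((20 + ((k + 1) * (20 + 12) + (20 + ((2 * r + 1) ^ k + 1) * (30 + 12)))) +
  (((n + 1) * ((10 + ((2 * r + 1) ^ k + 1) * (30 + ((k + 1) * (80 + 12) + 50) + 12)) + 12)) +
  (((n + 1) * (elimTime r k + 12)) + ((n + 1) * (backTime r k + 12)))))))))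

lemma dominate_spec (hn : 0 < n) (hE : ListsEdges G El) (hF : ListsEdges D.tree F)
    (hL : ∀ i, ListsElements (D.bag i) (L i)) (hk : D.width + 1 = k)
    (h1 : 2 * (N * N) ≤ W) (h2 : N * n ≤ W) (h3 : n * (2 * r + 1) ^ k ≤ W) (h4 : n * k ≤ W)
    (h5 : (k + 1) * ((2 * r + 1) ^ k * (2 * r + 1) ^ k) ≤ W) (h6 : 3 * n + k + 1 ≤ W) :
    WP W dominate (initState r El F L) (dominateTime r n N k)
      fun s => IsMinDominating G r (outputSet n s) := by
  have hk0 : 0 < k := by omega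
  have hM0 : 0 < (2 * r + 1) ^ k := by positivity
  have hkM : (k + 1) * (2 * r + 1) ^ k ≤ W :=
    (Nat.mul_le_mul_left _ (Nat.le_mul_of_pos_left _ hM0)).trans h5
  have hNW : N ≤ W := (Nat.le_mul_of_pos_right N hn).trans h2
  set s₀ := initState r El F L with hs₀
  obtain ⟨sz, hsz⟩ : ∃ sz, s₀.arr 4 = sz := ⟨_, rfl⟩
  obtain ⟨fl, hfl⟩ : ∃ fl, s₀.arr 5 = fl := ⟨_, rfl⟩
  have hsz' : sz = fun p => (List.ofFn fun i => (L i).length).getD p 0 := hsz.symm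
  have hfl' : fl = fun p => ((List.ofFn L).flatten.map Fin.val).getD p 0 :=
    hfl.symm.trans (initState_arr_five r El F L)
  have hsup : (Finset.range N).sup sz = k := hk ▸ sup_sz hn hL hsz'
  have hszk : ∀ i < N, sz i ≤ k := fun i hi =>
    hsup ▸ Finset.le_sup (f := sz) (Finset.mem_range.2 hi)
  have hkn : k ≤ n := hk ▸ D.width_lt hn
  -- the order of the nodes
  refine .seq' (orderNodes_spec D.isTree hF rfl rfl rfl rfl rfl h1)
    fun s₁ ⟨root, par, h, hO⟩ F₁ => ?_
  obtain ⟨q, hq⟩ : ∃ q, s₁.arr 9 = q := ⟨_, rfl⟩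
  rw [hq] at hO
  have hN₁ : s₁.reg 3 = N := F₁.reg 3 (by decide)
  have hsz₁ : s₁.arr 4 = sz := (F₁.arr 4 (by decide)).trans hsz
  -- the bags
  refine .seq' (prefixSums_spec hN₁ hsz₁ (fun i hi => (hszk i hi).trans hkn) h2 hNW)
    fun s₂ ⟨hoff, hk₂⟩ F₂ => ?_
  rw [hsup] at hk₂
  obtain ⟨off, hoff₂⟩ : ∃ off, s₂.arr 10 = off := ⟨_, rfl⟩
  rw [hoff₂] at hoff
  have hB := hO.bagSeq hL hsz' hfl' hoff
  have hszq : ∀ a < N, sz (q a) ≤ k := by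
    intro a ha
    obtain ⟨i, hi⟩ := hO.exists_eq (a := N - 1 - a) (by omega)
    have := hO.queue i
    rw [hi, show N - 1 - (N - 1 - a) = a by omega] at this
    rw [this]
    exact hszk i i.2
  have hq₂ : s₂.arr 9 = q := (F₂.arr 9 (by decide)).trans hq
  have hN₂ : s₂.reg 3 = N := (F₂.reg 3 (by decide)).trans hN₁
  have hsz₂ : s₂.arr 4 = sz := (F₂.arr 4 (by decide)).trans hsz₁
  have hfl₂ : s₂.arr 5 = fl := (F₂.arr 5 (by decide)).trans ((F₁.arr 5 (by decide)).trans hfl)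
  have hid₂ : s₂.arr 11 = 0 := (F₂.arr 11 (by decide)).trans (F₁.arr 11 (by decide))
  -- the order of the vertices
  refine .seq' (firstOrder_spec hN₂ hq₂ hoff₂ hsz₂ hfl₂ hid₂ (fun a _ => hB.lt a) hB.exists_bag
    hszq hNW (by omega) (by omega)) fun s₃ ⟨hV, hid₃⟩ F₃ => ?_
  obtain ⟨ord, hord₃⟩ : ∃ ord, s₃.arr 12 = ord := ⟨_, rfl⟩
  obtain ⟨τ, hτ₃⟩ : ∃ τ, s₃.arr 13 = τ := ⟨_, rfl⟩
  obtain ⟨id, hid₃'⟩ : ∃ id, s₃.arr 11 = id := ⟨_, rfl⟩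
  rw [hord₃, hτ₃] at hV
  rw [hord₃, hid₃'] at hid₃
  have hn₃ : s₃.reg 1 = n :=
    (F₃.reg 1 (by decide)).trans ((F₂.reg 1 (by decide)).trans (F₁.reg 1 (by decide)))
  have hr₃ : s₃.reg 0 = r :=
    (F₃.reg 0 (by decide)).trans ((F₂.reg 0 (by decide)).trans (F₁.reg 0 (by decide)))
  have hm₃ : s₃.reg 2 = El.length :=
    (F₃.reg 2 (by decide)).trans ((F₂.reg 2 (by decide)).trans (F₁.reg 2 (by decide)))
  have hk₃ : s₃.reg 4 = k := (F₃.reg 4 (by decide)).trans hk₂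
  have hA₃ : ∀ x, x ∉ orderNodes.modA → x ∉ prefixSums.modA → x ∉ firstOrder.modA →
      s₃.arr x = s₀.arr x := fun x h1 h2 h3 =>
    (F₃.arr x h3).trans ((F₂.arr x h2).trans (F₁.arr x h1))
  -- the slots
  refine .seq' (pickSlots_spec hn₃ ((F₃.reg 3 (by decide)).trans hN₂) hk₃
    ((F₃.arr 9 (by decide)).trans hq₂) ((F₃.arr 10 (by decide)).trans hoff₂)
    ((F₃.arr 4 (by decide)).trans hsz₂) ((F₃.arr 5 (by decide)).trans hfl₂) hτ₃ hV
    (fun x hx => by rw [hid₃']; exact hid₃ x hx) (fun a _ => hB.lt a) hk0 hszq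
    (hA₃ 14 (by decide) (by decide) (by decide)) (hA₃ 15 (by decide) (by decide) (by decide))
    (by omega) (by omega)) fun s₄ ⟨hcol, hcol'⟩ F₄ => ?_
  obtain ⟨col, hcol₄⟩ : ∃ col, s₄.arr 15 = col := ⟨_, rfl⟩
  obtain ⟨pr, hpr₄⟩ : ∃ pr, s₄.arr 16 = pr := ⟨_, rfl⟩
  simp only [hcol₄, hpr₄] at hcol hcol'
  let E := hB.elimOrder hV col pr hcol (fun x hx => (hcol' x hx).1) fun x hx => (hcol' x hx).2
  -- the edges
  have hpos : ∀ v < n, id v - 1 < n ∧ ord (id v - 1) = v ∧ id v = id v - 1 + 1 := by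
    intro v hv
    obtain ⟨x, hx, rfl⟩ := hV.exists_ord hv
    rw [hid₃ x hx]
    exact ⟨by omega, rfl, rfl⟩
  have hadj : ∀ x y, E.adj x y ↔ ∃ (hx : x < n) (hy : y < n),
      G.Adj ⟨ord x, hV.ord_lt x hx⟩ ⟨ord y, hV.ord_lt y hy⟩ := fun x y =>
    ⟨fun ⟨hx, hy, _, _, h⟩ => ⟨hx, hy, h⟩, fun ⟨hx, hy, h⟩ => ⟨hx, hy, _, _, h⟩⟩
  set a : ℕ → ℕ := fun e => id (s₀.arr 0 e) - 1 with ha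
  set b : ℕ → ℕ := fun e => id (s₀.arr 1 e) - 1 with hb
  have ea : ∀ e (he : e < El.length), s₀.arr 0 e = El[e].1 := fun e he => by
    simp [hs₀, initState, he]
  have eb : ∀ e (he : e < El.length), s₀.arr 1 e = El[e].2 := fun e he => by
    simp [hs₀, initState, he]
  have ha' : ∀ e (he : e < El.length), a e = id El[e].1 - 1 := fun e he => by rw [ha, ← ea e he]
  have hb' : ∀ e (he : e < El.length), b e = id El[e].2 - 1 := fun e he => by rw [hb, ← eb e he]
  have hEl := hE.adj_iff (pos := fun v => id v - 1) hV.ord_lt (fun v hv => (hpos v hv).1)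
    (fun v hv => (hpos v hv).2.1) hV.ord_inj hadj ha' hb'
  have hm := hE.length_le (pos := fun v => id v - 1) (fun v hv => (hpos v hv).2.1) ha' hb' hEl
  have hid₄ : s₄.arr 11 = id := (F₄.arr 11 (by decide)).trans hid₃'
  have hk₄ : s₄.reg 4 = k := (F₄.reg 4 (by decide)).trans hk₃
  refine .seq' ((enterEdges_spec (a := a) (b := b) ((F₄.reg 2 (by decide)).trans hm₃) hk₄
    (fun e he => ?_) (fun e he => ?_) hcol₄ hcol ((F₄.arr 17 (by decide)).trans
      (hA₃ 17 (by decide) (by decide) (by decide))) (hm.trans h4)).mono (by gcongr)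
    fun s' h => h) fun s₅ hA F₅ => ?_
  · rw [hid₄, F₄.arr 0 (by decide), hA₃ 0 (by decide) (by decide) (by decide), ea e he, ha' e he]
    exact (hpos _ El[e].1.2).2.2
  · rw [hid₄, F₄.arr 1 (by decide), hA₃ 1 (by decide) (by decide) (by decide), eb e he, hb' e he]
    exact (hpos _ El[e].2.2).2.2
  -- the tables
  refine .seq' (powers_spec ((F₅.reg 0 (by decide)).trans ((F₄.reg 0 (by decide)).trans hr₃))
    ((F₅.reg 1 (by decide)).trans ((F₄.reg 1 (by decide)).trans hn₃))
    ((F₅.reg 4 (by decide)).trans hk₄) ((F₅.arr 19 (by decide)).trans ((F₄.arr 19 (by decide)).trans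
      (hA₃ 19 (by decide) (by decide) (by decide)))) hk0 hkM) fun s₆ c₆ F₆ => ?_
  have hcol₆ : s₆.arr 15 = col := (F₆.arr 15 (by decide)).trans ((F₅.arr 15 (by decide)).trans hcol₄)
  have hpr₆ : s₆.arr 16 = pr := (F₆.arr 16 (by decide)).trans ((F₅.arr 16 (by decide)).trans hpr₄)
  have hord₆ : s₆.arr 12 = ord := (F₆.arr 12 (by decide)).trans ((F₅.arr 12 (by decide)).trans
    ((F₄.arr 12 (by decide)).trans hord₃))
  have hA₆ : ∀ x < n, ∀ j < k, s₆.arr 17 (x * k + j) ≠ 0 ↔ ∃ u < x, E.adj u x ∧ E.col u = j := by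
    intro x hx j hj
    rw [F₆.arr 17 (by decide), hA x j hj]
    constructor
    · rintro ⟨e, he, rfl, rfl⟩
      have h : E.adj (min (a e) (b e)) (max (a e) (b e)) := (hEl _ _).2 ⟨e, he, by omega⟩
      have hne : min (a e) (b e) ≠ max (a e) (b e) := fun h' => E.irrefl _ (h' ▸ h)
      exact ⟨_, by omega, h, rfl⟩
    · rintro ⟨u, hu, h, rfl⟩
      obtain ⟨e, he, h⟩ := (hEl _ _).1 h
      refine ⟨e, he, by omega, ?_⟩
      rw [show min (a e) (b e) = u by omega]
      rfl
  refine .seq' (initAll_spec (E := E) c₆ (fun x _ => congrFun hcol₆ x) hA₆ h3 h4 (by omega) hn)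
    fun s₇ hT F₇ => ?_
  have c₇ : Ctx r n k s₇ := c₆.of_frame F₇ rfl rfl
  have hcol₇ : s₇.arr 15 = col := (F₇.arr 15 (by decide)).trans hcol₆
  have hpr₇ : s₇.arr 16 = pr := (F₇.arr 16 (by decide)).trans hpr₆
  refine .seq' (eliminate_spec (E := E) c₇ (fun x _ => congrFun hcol₇ x)
    (fun x _ => congrFun hpr₇ x) hT h3 h5 h6 hn) fun s₈ hT F₈ => ?_
  have c₈ : Ctx r n k s₈ := c₇.of_frame F₈ rfl rfl
  have hord₈ : s₈.arr 12 = ord := (F₈.arr 12 (by decide)).trans ((F₇.arr 12 (by decide)).trans hord₆)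
  -- the solution
  refine (backtrack_spec (E := E) (ord := ord) c₈
    (fun x _ => congrFun ((F₈.arr 15 (by decide)).trans hcol₇) x)
    (fun x _ => congrFun ((F₈.arr 16 (by decide)).trans hpr₇) x)
    (fun x _ => congrFun hord₈ x) hV.ord_inj hT h3 (by omega) (by omega) hn).mono le_rfl
    fun s₉ ⟨opt, cur, m, hopt, htr, hout⟩ => ?_
  refine isMinDominating_of_isTrace hV.ord_lt (fun v hv => hV.exists_ord hv) hV.ord_inj hadj hopt
    htr fun x hx => ?_
  simpa [outputSet] using hout x hx

end main

/-! ### The running time -/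

section time

variable {r n N k : ℕ}

/-- With `M` codes, every monomial of the time is a multiple of `n ^ a * k ^ b * M ^ c` with `a, c ≤ 1`
and `b ≤ 2`, where `r ≤ M`, or of `k N`, which is the time to read the decomposition. -/
lemma dominateTime_le (hn : 0 < n) (hN : 0 < N) (hk : 0 < k) :
    dominateTime r n N k ≤ 10000 * ((2 * r + 1) ^ k * k ^ 2 * n + k * N) := by
  have hr : r ≤ (2 * r + 1) ^ k :=
    (by omega : r ≤ 2 * r + 1).trans (Nat.le_self_pow (by omega) _)
  have hM : 1 ≤ (2 * r + 1) ^ k := Nat.one_le_pow _ _ (by omega)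
  unfold dominateTime elimTime joinTime backTime
  rw [Nat.sub_add_cancel hN]
  generalize (2 * r + 1) ^ k = M at *
  have hk2 : k ≤ k ^ 2 := Nat.le_self_pow (by omega) _
  have hk1 : 1 ≤ k ^ 2 := (show 1 ≤ k from hk).trans hk2
  -- every monomial of the time bound is at most one of the two summands
  have key : ∀ a b c, a ≤ n → b ≤ k ^ 2 → c ≤ M → c * b * a ≤ M * k ^ 2 * n :=
    fun a b c ha hb hc => Nat.mul_le_mul (Nat.mul_le_mul hc hb) ha
  have key' : ∀ b, b ≤ k → b * N ≤ k * N := fun b hb => Nat.mul_le_mul_right _ hb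
  have m0 := key 1 1 1 hn hk1 hM
  have m1 := key 1 1 r hn hk1 hr
  have m2 := key 1 1 M hn hk1 le_rfl
  have m3 := key 1 k 1 hn hk2 hM
  have m4 := key 1 k r hn hk2 hr
  have m5 := key 1 k M hn hk2 le_rfl
  have m6 := key 1 (k ^ 2) 1 hn le_rfl hM
  have m7 := key 1 (k ^ 2) r hn le_rfl hr
  have m8 := key 1 (k ^ 2) M hn le_rfl le_rfl
  have m9 := key n 1 1 le_rfl hk1 hM
  have m10 := key n 1 r le_rfl hk1 hr
  have m11 := key n 1 M le_rfl hk1 le_rfl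
  have m12 := key n k 1 le_rfl hk2 hM
  have m13 := key n k r le_rfl hk2 hr
  have m14 := key n k M le_rfl hk2 le_rfl
  have m15 := key n (k ^ 2) 1 le_rfl le_rfl hM
  have m16 := key n (k ^ 2) r le_rfl le_rfl hr
  have p0 := key' 1 hk
  have p1 : k * 1 ≤ k * N := Nat.mul_le_mul_left _ hN
  ring_nf at *
  linarith

/-- All cells of the initial state are bounded by the number of vertices, nodes or edges, or the
radius. -/
lemma initState_bdd {W : ℕ} {G : SimpleGraph (Fin n)} {T : TreeDecomposition G (Fin N)}
    {E : List (Fin n × Fin n)} {F : List (Fin N × Fin N)} {L : Fin N → List (Fin n)}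
    (hE : ListsEdges G E) (hL : ∀ i, ListsElements (T.bag i) (L i)) (hr : r ≤ W) (hn : n ≤ W)
    (hN : N ≤ W) (hnn : n * n ≤ W) : Bdd W (initState r E F L) := by
  have getD_le : ∀ (l : List ℕ) p, (∀ x ∈ l, x ≤ W) → l.getD p 0 ≤ W := by
    intro l p hl
    rcases lt_or_ge p l.length with h | h
    · rw [List.getD_eq_getElem _ _ h]
      exact hl _ (List.getElem_mem h)
    · rw [List.getD_eq_default _ _ h]
      exact Nat.zero_le _
  have hlen : E.length ≤ n * n := by
    have := (List.Nodup.of_map _ hE.1).length_le_card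
    simpa using this
  have bd : ∀ {m : ℕ} (x : Fin m), m ≤ W → (x : ℕ) ≤ W := fun x h => x.2.le.trans h
  constructor
  · rintro (_ | _ | _ | _ | x)
    exacts [hr, hn, hlen.trans hnn, hN, Nat.zero_le _]
  · intro a p
    by_cases h5 : a = 5
    · subst h5
      rw [initState_arr_five]
      refine getD_le _ _ fun x hx => ?_
      obtain ⟨v, -, rfl⟩ := List.mem_map.1 hx
      exact bd v hn
    match a with
    | 0 | 1 =>
      refine getD_le _ _ fun x hx => ?_
      obtain ⟨e, -, rfl⟩ := List.mem_map.1 hx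
      exact bd _ hn
    | 2 | 3 =>
      refine getD_le _ _ fun x hx => ?_
      obtain ⟨e, -, rfl⟩ := List.mem_map.1 hx
      exact bd _ hN
    | 4 =>
      refine getD_le _ _ fun x hx => ?_
      obtain ⟨i, rfl⟩ := List.mem_ofFn.1 hx
      rw [(hL i).length]
      exact (Finset.card_le_univ _).trans (by simpa using hn)
    | 5 => exact absurd rfl h5
    | a + 6 => exact Nat.zero_le _

end time

end RDom

theorem theorem1 :
    ∃ (P : RDom.Prog) (C c : ℕ),
      ∀ (r n N : ℕ), 0 < n →
      ∀ (G : SimpleGraph (Fin n)) (T : RDom.TreeDecomposition G (Fin N))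
        (E : List (Fin n × Fin n)) (F : List (Fin N × Fin N)) (L : Fin N → List (Fin n)),
        RDom.ListsEdges G E → RDom.ListsEdges T.tree F →
        (∀ i, RDom.ListsElements (T.bag i) (L i)) →
        ∃ (t : ℕ) (s : RDom.State),
          RDom.Exec (((2 * r + 1) ^ (T.width + 1) * (n + N)) ^ c) P
            (RDom.initState r E F L) t s ∧
          t ≤ C * ((2 * r + 1) ^ (T.width + 1) * (T.width + 1) ^ 2 * n + (T.width + 1) * N) ∧
          RDom.IsMinDominating G r (RDom.outputSet n s) := by
  refine ⟨RDom.dominate, 10000, 192, fun r n N hn G T E F L hE hF hL => ?_⟩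
  obtain ⟨i, -⟩ := T.exists_mem_bag ⟨0, hn⟩
  have hN : 0 < N := i.pos
  have hkn := T.width_lt hn
  have hr : r ≤ (2 * r + 1) ^ (T.width + 1) :=
    (by omega : r ≤ 2 * r + 1).trans (Nat.le_self_pow (by omega) _)
  have hM : 1 ≤ (2 * r + 1) ^ (T.width + 1) := Nat.one_le_pow _ _ (by omega)
  have htime := RDom.dominateTime_le (r := r) hn hN (Nat.succ_pos T.width)
  -- all numbers that the program stores are at most the third power of the base
  set X := (2 * r + 1) ^ (T.width + 1) * (n + N) with hX
  have hnX : n + N ≤ X := Nat.le_mul_of_pos_left _ hM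
  have hMX : (2 * r + 1) ^ (T.width + 1) ≤ X := Nat.le_mul_of_pos_right _ (by omega)
  have hX2 : 2 ≤ X := by omega
  have two : ∀ {a b : ℕ}, a ≤ X → b ≤ X → a * b ≤ X ^ 3 := fun {a b} ha hb =>
    (Nat.mul_le_mul ha hb).trans
      ((sq X).symm.le.trans (Nat.pow_le_pow_right (by omega) (by omega)))
  have three : ∀ {a b c : ℕ}, a ≤ X → b ≤ X → c ≤ X → a * (b * c) ≤ X ^ 3 := fun ha hb hc =>
    (Nat.mul_le_mul ha (Nat.mul_le_mul hb hc)).trans (by rw [pow_succ', sq])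
  have one : ∀ {a : ℕ}, a ≤ X → a ≤ X ^ 3 := fun ha => ha.trans (Nat.le_self_pow (by omega) _)
  have h6 : 3 * n + (T.width + 1) + 1 ≤ X ^ 3 := by
    have := three hX2 hX2 (show n ≤ X by omega)
    have := three hX2 hX2 (show n + N ≤ X by omega)
    omega
  obtain ⟨t, s, h1, h2, -, h3⟩ := RDom.dominate_spec (W := X ^ 3) hn hE hF hL rfl
    (three hX2 (by omega) (by omega)) (two (by omega) (by omega)) (two (by omega) hMX)
    (two (by omega) (by omega)) (three (by omega) hMX hMX) h6 (X ^ 192) (hX2.trans (one le_rfl))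
    (by rw [← pow_mul])
    (RDom.initState_bdd hE hL (one (hr.trans hMX)) (one (by omega)) (one (by omega))
      (two (by omega) (by omega)))
  exact ⟨t, s, h1, h2.trans htime, h3⟩
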